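/- **Setting.** A *CQ$^\star$* has the form $Q(\vec x,\star,\vec z) \leftarrow \varphi_1,\dots,\varphi_\ell$, where each atom $\varphi_i$ is $R(v_1,\dots,v_k)$ for a relation symbol $R$ of arity $k\ge 0$ and variables $v_j$; the variables in $\vec x,\vec z$ are the *free* variables and each of them occurs in some atom; $\star$ marks the position of the annotation. $Q$ is *full* if all its variables are free, and *without self-joins* if its atoms have pairwise distinct relation symbols. $Q$ is *acyclic* if its hypergraph (with one hyperedge $\mathrm{vars}(\varphi)$ per atom $\varphi$) has a join tree, i.e. a tree on the hyperedges in which, for every variable, the hyperedges containing it are connected; $Q$ is *free-connex* if it is acyclic and remains so when the set of its free variables is added as a hyperedge. Let $(\mathbb K,\oplus,\otimes,\bar 0,\bar 1)$ be a commutative semiring with a linear order on $\mathbb K$ (no compatibility is assumed). A $\mathbb K$-database $(D,\tau)$ for $Q$ assigns to every relation symbol of $Q$ a finite relation over a countably infinite linearly ordered set of constants (here $\mathbb N$), and to every fact $f$ an annotation $\tau(f)\in\mathbb K$; $|D|$ is the number of facts. It is *$R$-annotated* if every fact outside the relation $R$ has annotation $\bar 1$. A homomorphism $h$ from $Q$ to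 $D$ maps the variables to constants so that every atom becomes a fact; put $\otimes h=\bigotimes_i\tau(h(\varphi_i))$. The result $Q(D,\tau)$ consists of the tuples $(h(\vec x),a,h(\vec z))$, for all homomorphisms $h$, where $a=\bigoplus\{\otimes h' : h'(\vec x)=h(\vec x),\ h'(\vec z)=h(\vec z)\}$ is the sum over all such homomorphisms $h'$. Answers are ordered lexicographically from left to right, with $a$ compared at the position of $\star$. *Direct access for $Q$ over $R$-annotated $\mathbb K$-databases is in $\langle\mathrm{loglinear},\log\rangle$* if there are a preprocessing algorithm that computes in time $O(|D|\log|D|)$ a data structure from an $R$-annotated $\mathbb K$-database $(D,\tau)$, and an access algorithm that, given this structure and an index $i$, returns in time $O(\log|D|)$ the $i$-th answer in $Q(D,\tau)$, or null if there are fewer answers. The query is fixed, and the machine is a RAM with $O(\log|D|)$-bit words (which hold the constants and indices) and uniform-cost word operations; elements of $\mathbb K$ are held in separate memory cells, and every instruction that handles them ($\oplus$, $\otimes$, comparison, loading $\bar 0$ or $\bar 1$, moving an element) takes time $\kappa(|D|)$. The semiring is *logarithmic-time* if $\kappa\geq 1$ is non-decreasing and grows at most like $\log n$, in the sense that $\kappa(n)/\log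 n$ is non-increasing up to a constant factor (so $\kappa(n)=O(\log n)$; constant $\kappa$ and $\kappa=\Theta(\log n)$ non-decreasing are examples). It is *$\oplus$-idempotent* if $a\oplus a=a$ for all $a\in\mathbb K$. **Statement.** Let $(\mathbb K,\oplus,\otimes,\bar 0,\bar 1)$ be a logarithmic-time $\oplus$-idempotent commutative semiring. There exists a polynomial-time algorithm that takes as input a free-connex CQ$^\star$ $Q(\vec x,\star,\vec z)$ without self-joins and a relation symbol $R$ of $Q$, and produces a full acyclic CQ$^\star$ $Q'(\vec x,\star,\vec z)$ without self-joins, with the same head sequence $(\vec x,\star,\vec z)$, and a relation symbol $R'$ of $Q'$, such that the following are equivalent: 1. Direct access for $Q$ over $R$-annotated $\mathbb K$-databases is in $\langle\mathrm{loglinear},\log\rangle$. 2. Direct access for $Q'$ over $R'$-annotated $\mathbb K$-databases is in $\langle\mathrm{loglinear},\log\rangle$. -/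

import Mathlib

/-! ## Conjunctive queries with an annotation position in the head

Variables, relation symbols and constants are natural numbers; constants carry the usual order. -/

/-- An atomic query `R(z₁, …, z_k)`; its relation symbol has arity `args.length`. -/
structure QAtom where
  rel : ℕ
  args : List ℕ

/-- A CQ⋆ with head `(pre, ⋆, post)`: an ordinary conjunctive query with free variables
`pre, post`, together with a position for the annotation in the head. -/
structure CQStar where
  body : List QAtom
  pre : List ℕ
  post : List ℕ
  head_occurs : ∀ x ∈ pre ++ post, ∃ A ∈ body, x ∈ A.args
  arity_eq : ∀ A ∈ body, ∀ B ∈ body, A.rel = B.rel → A.args.length = B.args.length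

namespace CQStar

/-- The relation symbols of the query, each listed once. -/
def symbols (Q : CQStar) : List ℕ := (Q.body.map QAtom.rel).dedup

def vars (Q : CQStar) : Finset ℕ := (Q.body.flatMap QAtom.args).toFinset

def free (Q : CQStar) : Finset ℕ := (Q.pre ++ Q.post).toFinset

def IsFull (Q : CQStar) : Prop := Q.vars = Q.free

def SelfJoinFree (Q : CQStar) : Prop := (Q.body.map QAtom.rel).Nodup

/-- The hyperedges of the hypergraph of the query. -/
def edges (Q : CQStar) : Finset (Finset ℕ) := (Q.body.map fun A => A.args.toFinset).toFinset

end CQStar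

/-- A hypergraph is (α-)acyclic if it has a join tree: a tree on its hyperedges such that, for
every vertex, the hyperedges containing it induce a connected subtree. -/
def HypergraphAcyclic (E : Finset (Finset ℕ)) : Prop :=
  ∃ T : SimpleGraph {e // e ∈ E}, T.Preconnected ∧ T.IsAcyclic ∧
    ∀ v : ℕ, (T.induce {e | v ∈ e.1}).Preconnected

namespace CQStar

def IsAcyclic (Q : CQStar) : Prop := HypergraphAcyclic Q.edges

/-- The query is acyclic and stays so when its set of free variables is added as a hyperedge. -/
def FreeConnex (Q : CQStar) : Prop :=
  HypergraphAcyclic Q.edges ∧ HypergraphAcyclic (insert Q.free Q.edges)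

end CQStar

/-! ## Annotated databases and query results -/

/-- A `K`-database: a finite relation for every relation symbol, and an annotation of its facts. -/
structure KDatabase (K : Type*) where
  rel : ℕ → Finset (List ℕ)
  ann : ℕ → List ℕ → K

namespace KDatabase

variable {K : Type*}

/-- `D` is a database over the schema of `Q`: tuples have the arity of their relation symbol. -/
def Over (D : KDatabase K) (Q : CQStar) : Prop :=
  ∀ A ∈ Q.body, ∀ t ∈ D.rel A.rel, t.length = A.args.length

/-- `|D|`, the number of facts over the relation symbols of `Q`. -/
def size (D : KDatabase K) (Q : CQStar) : ℕ := (Q.symbols.map fun R => (D.rel R).card).sum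

/-- The constants that occur in the facts over the relation symbols of `Q`. -/
def constants (D : KDatabase K) (Q : CQStar) : Finset ℕ :=
  Q.symbols.toFinset.biUnion fun R => (D.rel R).biUnion List.toFinset

/-- `D` is `R`-annotated: all facts outside the relation `R` are annotated with `1`. -/
def LocallyAnnotated [One K] (D : KDatabase K) (Q : CQStar) (R : ℕ) : Prop :=
  ∀ S ∈ Q.symbols, S ≠ R → ∀ t ∈ D.rel S, D.ann S t = 1

/-- The homomorphisms from `Q` to `D`. A map on the variables of `Q` is represented by its
extension by `0` to all of `ℕ`. -/
noncomputable def homs (D : KDatabase K) (Q : CQStar) : Finset (ℕ →₀ ℕ) :=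
  (Q.vars.finsupp fun _ => D.constants Q).filter
    fun h => ∀ A ∈ Q.body, A.args.map h ∈ D.rel A.rel

theorem mem_homs (D : KDatabase K) (Q : CQStar) (h : ℕ →₀ ℕ) :
    h ∈ D.homs Q ↔ (∀ x ∉ Q.vars, h x = 0) ∧ ∀ A ∈ Q.body, A.args.map h ∈ D.rel A.rel := by
  classical
  simp only [homs, Finset.mem_filter, Finset.mem_finsupp_iff]
  constructor
  · rintro ⟨⟨h1, -⟩, h2⟩
    refine ⟨fun x hx => ?_, h2⟩
    by_contra h0
    exact hx (h1 (Finsupp.mem_support_iff.2 h0))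
  · rintro ⟨h1, h2⟩
    refine ⟨⟨fun x hx => ?_, fun x hx => ?_⟩, h2⟩
    · by_contra h0
      exact (Finsupp.mem_support_iff.1 hx) (h1 x h0)
    · obtain ⟨A, hA, hxA⟩ := List.mem_flatMap.1 (List.mem_toFinset.1 hx)
      refine Finset.mem_biUnion.2 ⟨A.rel, ?_, Finset.mem_biUnion.2 ⟨_, h2 A hA, ?_⟩⟩
      · exact List.mem_toFinset.2 (List.mem_dedup.2 (List.mem_map_of_mem hA))
      · exact List.mem_toFinset.2 (List.mem_map_of_mem hxA)

variable [CommSemiring K]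

/-- The product of the annotations of the facts to which `h` maps the atoms of `Q`. -/
def homProd (D : KDatabase K) (Q : CQStar) (h : ℕ →₀ ℕ) : K :=
  (Q.body.map fun A => D.ann A.rel (A.args.map h)).prod

/-- The annotation of the answer `(p, q)`: the sum, over all homomorphisms that give rise to the
answer, of their products. -/
noncomputable def answerAnn (D : KDatabase K) (Q : CQStar) (p q : List ℕ) : K :=
  ∑ h ∈ (D.homs Q).filter fun h : ℕ →₀ ℕ => Q.pre.map h = p ∧ Q.post.map h = q, D.homProd Q h

end KDatabase

/-- Answers `(p, a, q)`: the values of the variables before `⋆`, the annotation, and the values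
of the variables after `⋆`, ordered lexicographically. -/
abbrev QAnswer (K : Type*) := List ℕ ×ₗ (K ×ₗ List ℕ)

namespace KDatabase

variable {K : Type*} [CommSemiring K] [LinearOrder K]

/-- The result of `Q` over the annotated database `D`. -/
noncomputable def answers (D : KDatabase K) (Q : CQStar) : Finset (QAnswer K) :=
  (D.homs Q).image fun h : ℕ →₀ ℕ =>
    toLex (Q.pre.map h, toLex (D.answerAnn Q (Q.pre.map h) (Q.post.map h), Q.post.map h))

/-- The answer number `i` in lexicographic order, counting from `0`; `none` if there are at most
`i` answers. -/
noncomputable def nthAnswer (D : KDatabase K) (Q : CQStar) (i : ℕ) : Option (QAnswer K) :=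
  ((D.answers Q).sort (· ≤ ·))[i]?

end KDatabase

/-! ## Random-access machines

Word registers and word arrays hold natural numbers below a bound `W`, the word capacity. Elements
of `K` are atomic and are kept in registers and arrays of their own. A program mentions finitely
many registers and arrays. -/

/-- The contents of the registers and of the arrays. -/
structure RamState (K : Type*) where
  reg : ℕ → ℕ
  arr : ℕ → ℕ → ℕ
  kreg : ℕ → K
  karr : ℕ → ℕ → K

namespace RamState

variable {K : Type*}

def setReg (s : RamState K) (d v : ℕ) : RamState K :=
  { s with reg := Function.update s.reg d v }

def setArr (s : RamState K) (A i v : ℕ) : RamState K :=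
  { s with arr := Function.update s.arr A (Function.update (s.arr A) i v) }

def setKreg (s : RamState K) (d : ℕ) (v : K) : RamState K :=
  { s with kreg := Function.update s.kreg d v }

def setKarr (s : RamState K) (A i : ℕ) (v : K) : RamState K :=
  { s with karr := Function.update s.karr A (Function.update (s.karr A) i v) }

end RamState

/-- Word operations; comparisons return `0` or `1`. -/
inductive WordOp
  | add | sub | mul | div | mod | eq | lt

def WordOp.eval : WordOp → ℕ → ℕ → ℕ
  | .add, a, b => a + b
  | .sub, a, b => a - b
  | .mul, a, b => a * b
  | .div, a, b => a / b
  | .mod, a, b => a % b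
  | .eq, a, b => if a = b then 1 else 0
  | .lt, a, b => if a < b then 1 else 0

/-- Programs. Letters `d a b i` are names of registers and `A` is the name of an array. -/
inductive RamProg
  | skip
  | const (d c : ℕ)
  | word (o : WordOp) (d a b : ℕ)
  | load (d A i : ℕ)
  | store (A i a : ℕ)
  | kzero (d : ℕ)
  | kone (d : ℕ)
  | kadd (d a b : ℕ)
  | kmul (d a b : ℕ)
  | kle (d a b : ℕ)
  | kload (d A i : ℕ)
  | kstore (A i a : ℕ)
  | seq (p q : RamProg)
  | cond (a : ℕ) (p q : RamProg)
  | loop (a : ℕ) (p : RamProg)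

/-- `RamExec κ W p s s' t`: started in state `s`, the program `p` halts in state `s'` after time
`t` without ever producing a word that is not below `W`. An instruction takes one time unit if it
handles words only, and `κ` time units if it handles elements of `K`. -/
inductive RamExec {K : Type*} [CommSemiring K] [LinearOrder K] (κ W : ℕ) :
    RamProg → RamState K → RamState K → ℕ → Prop
  | skip (s) : RamExec κ W .skip s s 1
  | const (s) (d c : ℕ) (h : c < W) : RamExec κ W (.const d c) s (s.setReg d c) 1
  | word (s) (o : WordOp) (d a b : ℕ) (h : o.eval (s.reg a) (s.reg b) < W) :
      RamExec κ W (.word o d a b) s (s.setReg d (o.eval (s.reg a) (s.reg b))) 1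
  | load (s) (d A i : ℕ) : RamExec κ W (.load d A i) s (s.setReg d (s.arr A (s.reg i))) 1
  | store (s) (A i a : ℕ) : RamExec κ W (.store A i a) s (s.setArr A (s.reg i) (s.reg a)) 1
  | kzero (s) (d : ℕ) : RamExec κ W (.kzero d) s (s.setKreg d 0) κ
  | kone (s) (d : ℕ) : RamExec κ W (.kone d) s (s.setKreg d 1) κ
  | kadd (s) (d a b : ℕ) :
      RamExec κ W (.kadd d a b) s (s.setKreg d (s.kreg a + s.kreg b)) κ
  | kmul (s) (d a b : ℕ) :
      RamExec κ W (.kmul d a b) s (s.setKreg d (s.kreg a * s.kreg b)) κ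
  | kle (s) (d a b : ℕ) (h : 1 < W) :
      RamExec κ W (.kle d a b) s (s.setReg d (if s.kreg a ≤ s.kreg b then 1 else 0)) κ
  | kload (s) (d A i : ℕ) : RamExec κ W (.kload d A i) s (s.setKreg d (s.karr A (s.reg i))) κ
  | kstore (s) (A i a : ℕ) : RamExec κ W (.kstore A i a) s (s.setKarr A (s.reg i) (s.kreg a)) κ
  | seq {s s' s'' p q t t'} (h : RamExec κ W p s s' t) (h' : RamExec κ W q s' s'' t') :
      RamExec κ W (.seq p q) s s'' (t + t')
  | cond_true {s s' a p q t} (ha : s.reg a ≠ 0) (h : RamExec κ W p s s' t) :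
      RamExec κ W (.cond a p q) s s' (t + 1)
  | cond_false {s s' a p q t} (ha : s.reg a = 0) (h : RamExec κ W q s s' t) :
      RamExec κ W (.cond a p q) s s' (t + 1)
  | loop_done {s a p} (ha : s.reg a = 0) : RamExec κ W (.loop a p) s s 1
  | loop_step {s s' s'' a p t t'} (ha : s.reg a ≠ 0) (h : RamExec κ W p s s' t)
      (h' : RamExec κ W (.loop a p) s' s'' t') : RamExec κ W (.loop a p) s s'' (t + t' + 1)

/-- `κ n`, the time of a semiring operation or comparison on inputs of size `n`, grows at most
logarithmically: `κ n / log n` is non-increasing up to a constant factor (in particular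
`κ n = O(log n)`). Constant time and time `log n` are instances. -/
structure LogarithmicTime (κ : ℕ → ℕ) : Prop where
  one_le : ∀ n, 1 ≤ κ n
  mono : Monotone κ
  growth : ∃ C : ℕ, ∀ m n, 2 ≤ m → m ≤ n →
    κ n * Nat.log 2 m ≤ C * (κ m * Nat.log 2 n)

/-! ## Direct access -/

section DirectAccess

variable {K : Type*} [CommSemiring K] [LinearOrder K]

/-- `L` lists the facts of every relation of `D`, in any order and without repetition. -/
def Enumerates (D : KDatabase K) (Q : CQStar) (L : ℕ → List (List ℕ)) : Prop :=
  ∀ R ∈ Q.symbols, (L R).Nodup ∧ ∀ t, t ∈ L R ↔ t ∈ D.rel R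

/-- The initial state on input `D`. For the `j`-th relation symbol of `Q`, register `j` holds the
number of facts, array `j` the facts one after the other, and `K`-array `j` their annotations. All
other registers and array cells are zero. -/
def inputState (D : KDatabase K) (Q : CQStar) (L : ℕ → List (List ℕ)) : RamState K where
  reg j := match Q.symbols[j]? with
    | some R => (L R).length
    | none => 0
  arr j i := match Q.symbols[j]? with
    | some R => (L R).flatten.getD i 0
    | none => 0
  kreg _ := 0
  karr j i := match Q.symbols[j]? with
    | some R => ((L R).map (D.ann R)).getD i 0
    | none => 0

/-- The output convention for an access: register `0` tells whether there is an answer; if so, the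
values of the free variables are at the beginning of array `0` and the annotation is in
`K`-register `0`. -/
def Returns (s : RamState K) : Option (QAnswer K) → Prop
  | none => s.reg 0 = 0
  | some r => s.reg 0 = 1 ∧ s.kreg 0 = (ofLex (ofLex r).2).1 ∧
      ∀ j x, ((ofLex r).1 ++ (ofLex (ofLex r).2).2)[j]? = some x → s.arr 0 j = x

/-- Direct access for `Q`, on the `K`-databases in the class `𝒟`, is in `⟨Tp, Ta⟩`, on machines
with `O(log |D|)`-bit words that perform a semiring operation in time `κ`.

Input words (constants and indices) are below a power of the input size whose exponent is
arbitrary but fixed, and so are all words of the computation, with an exponent chosen by the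
algorithm. The data structure is the state left by the preprocessing program `P`; the access
program `A` is started in that state, with the index in register `0`. Sizes are shifted by `2`, so
that the bounds make sense for tiny databases too. -/
def DirectAccessIn (κ : ℕ → ℕ) (Q : CQStar) (𝒟 : KDatabase K → Prop) (Tp Ta : ℕ → ℕ) : Prop :=
  ∀ k : ℕ, ∃ (P A : RamProg) (k' C : ℕ), ∀ D : KDatabase K, D.Over Q → 𝒟 D →
    ∀ N : ℕ, N = D.size Q + 2 → (∀ c ∈ D.constants Q, c < N ^ k) →
    ∀ L, Enumerates D Q L →
    ∃ s t, RamExec (κ N) (N ^ k') P (inputState D Q L) s t ∧ t ≤ C * Tp N ∧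
      ∀ i < N ^ k, ∃ s' t', RamExec (κ N) (N ^ k') A (s.setReg 0 i) s' t' ∧ t' ≤ C * Ta N ∧
        Returns s' (D.nthAnswer Q i)

/-- Direct access for `Q` over `R`-annotated `K`-databases is in `⟨loglinear, log⟩`. -/
def EfficientDirectAccess (K : Type*) [CommSemiring K] [LinearOrder K] (κ : ℕ → ℕ) (Q : CQStar)
    (R : ℕ) : Prop :=
  DirectAccessIn κ Q (fun D : KDatabase K => D.LocallyAnnotated Q R)
    (fun n => n * Nat.log 2 n) (fun n => Nat.log 2 n)

end DirectAccess

/-! ## Polynomial-time transformations of queries -/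

/-- A query and a relation symbol, written as a sequence of numbers. -/
def encodeQuery (Q : CQStar) (R : ℕ) : List ℕ :=
  R :: Q.body.length :: (Q.body.flatMap fun A => A.rel :: A.args.length :: A.args) ++
    (Q.pre.length :: Q.pre) ++ (Q.post.length :: Q.post)

/-- The number of bits of a sequence of numbers, with one separator per number. -/
def bitLength (l : List ℕ) : ℕ := (l.map fun x => Nat.size x + 1).sum

/-- The state whose register `0` and array `0` hold the length and the entries of `l`. There are no
semiring elements here, so `K` is the trivial semiring. -/
def listState (l : List ℕ) : RamState Unit where
  reg j := if j = 0 then l.length else 0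
  arr j i := if j = 0 then l.getD i 0 else 0
  kreg _ := 0
  karr _ _ := 0

/-- The sequence `l` is what register `0` and array `0` hold. -/
def HoldsList (s : RamState Unit) (l : List ℕ) : Prop :=
  s.reg 0 = l.length ∧ ∀ i x, l[i]? = some x → s.arr 0 i = x

/-- On the inputs in `dom`, the transformation `f` of queries with a distinguished relation symbol
is computed by a program in polynomial time, with words of polynomially many bits. -/
def PolyTimeOn (dom : CQStar → ℕ → Prop) (f : CQStar → ℕ → CQStar × ℕ) : Prop :=
  ∃ (P : RamProg) (c : ℕ), ∀ Q R, dom Q R →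
    ∀ n : ℕ, n = bitLength (encodeQuery Q R) →
    ∃ s t, RamExec 1 (2 ^ n ^ c) P (listState (encodeQuery Q R)) s t ∧ t ≤ n ^ c ∧
      HoldsList s (encodeQuery (f Q R).1 (f Q R).2)

/-! Let `Q'` be `Q` with every existential variable deleted from its atoms (`CQStar.fullPart`). It
stays acyclic, because its hyperedges are the traces of the old ones on the free variables. For
`R'`, consider the component of the atom of `R`: the atoms that are linked to it by chains of shared
existential variables. Since `Q` is free-connex, one atom of the component contains all free
variables that occur in the component (`Elim.exists_top`). `CQStar.top` is such an atom, and its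
symbol is `R'`.

An algorithm for `Q'` gives one for `Q` (`RelaxedAccess.eliminate`). A join tree rooted at the set
of the free variables yields an order in which the atoms can be treated one by one
(`CQStar.exists_elim`). Variables that occur in one atom only are summed out, by distributivity. If
the atom still has an existential variable, all its variables lie in a later atom `B`. The facts of
`B` are filtered by those of the atom, and multiplied by their annotations. The atom is then implied
by `B` and carries only `1`, so its existential variables can be dropped. Projections add up
annotations, and idempotence makes a sum of ones equal to `1`; so there is never more than one
annotated relation. The annotation only passes between atoms that share an existential variable.
Hence it stays in the component, and in the end it is absorbed into the top atom.

An algorithm for `Q` gives one for `Q'` (`Reduces.expand`). The facts of the top atom `T` are first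
filtered by all atoms of the component that have a reached existential variable. The facts of these
atoms are then made from the facts of `T`, with the number of the fact of `T` as value of every
existential variable of the component. By connectedness a homomorphism uses the same fact of `T`
everywhere, so the annotation of `T` may be written to the atom of `R` instead.

These reductions preserve the sequence of answers, but they may shrink the database, and then time,
word length and constants no longer fit its size. `RelaxedAccess` therefore measures everything by
an upper bound `M` of the size. That this is no restriction is `RelaxedAccess.of_directAccessIn`:
constants are replaced by their ranks, which are found in loglinear time from counts of binary
prefixes, large indices are clipped, and the growth condition on `κ` compares the costs of semiring
operations for the two sizes.

The machine programs are written in a small structured language with a verified compiler. Polynomial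
time is read off from programs without multiplication in which every loop makes as many rounds as
the input has entries. -/

/-! ## General facts about executions -/

namespace RamState

variable {K : Type*}

theorem eq_of_fields {s s' : RamState K} (h1 : s.reg = s'.reg) (h2 : s.arr = s'.arr)
    (h3 : s.kreg = s'.kreg) (h4 : s.karr = s'.karr) : s = s' := by
  cases s; cases s'; simp_all

@[simp] theorem setReg_reg (s : RamState K) (d v r : ℕ) :
    (s.setReg d v).reg r = if r = d then v else s.reg r := by
  simp [setReg, Function.update_apply]

@[simp] theorem setReg_arr (s : RamState K) (d v : ℕ) : (s.setReg d v).arr = s.arr := rfl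
@[simp] theorem setReg_kreg (s : RamState K) (d v : ℕ) : (s.setReg d v).kreg = s.kreg := rfl
@[simp] theorem setReg_karr (s : RamState K) (d v : ℕ) : (s.setReg d v).karr = s.karr := rfl

@[simp] theorem setArr_reg (s : RamState K) (A i v : ℕ) : (s.setArr A i v).reg = s.reg := rfl
@[simp] theorem setArr_arr (s : RamState K) (A i v B j : ℕ) :
    (s.setArr A i v).arr B j = if B = A ∧ j = i then v else s.arr B j := by
  unfold setArr
  by_cases h : B = A
  · subst h; by_cases h' : j = i <;> simp [h']
  · simp [h]
@[simp] theorem setArr_kreg (s : RamState K) (A i v : ℕ) : (s.setArr A i v).kreg = s.kreg := rfl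
@[simp] theorem setArr_karr (s : RamState K) (A i v : ℕ) : (s.setArr A i v).karr = s.karr := rfl

@[simp] theorem setKreg_reg (s : RamState K) (d : ℕ) (v : K) : (s.setKreg d v).reg = s.reg := rfl
@[simp] theorem setKreg_arr (s : RamState K) (d : ℕ) (v : K) : (s.setKreg d v).arr = s.arr := rfl
@[simp] theorem setKreg_kreg (s : RamState K) (d : ℕ) (v : K) (r : ℕ) :
    (s.setKreg d v).kreg r = if r = d then v else s.kreg r := by
  simp [setKreg, Function.update_apply]
@[simp] theorem setKreg_karr (s : RamState K) (d : ℕ) (v : K) :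
    (s.setKreg d v).karr = s.karr := rfl

@[simp] theorem setKarr_reg (s : RamState K) (A i : ℕ) (v : K) :
    (s.setKarr A i v).reg = s.reg := rfl
@[simp] theorem setKarr_arr (s : RamState K) (A i : ℕ) (v : K) :
    (s.setKarr A i v).arr = s.arr := rfl
@[simp] theorem setKarr_kreg (s : RamState K) (A i : ℕ) (v : K) :
    (s.setKarr A i v).kreg = s.kreg := rfl
@[simp] theorem setKarr_karr (s : RamState K) (A i : ℕ) (v : K) (B j : ℕ) :
    (s.setKarr A i v).karr B j = if B = A ∧ j = i then v else s.karr B j := by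
  unfold setKarr
  by_cases h : B = A
  · subst h; by_cases h' : j = i <;> simp [h']
  · simp [h]

/-- The part of the state with register names from `r` on and array names from `a` on. -/
def view (s : RamState K) (r a : ℕ) : RamState K where
  reg j := s.reg (j + r)
  arr j := s.arr (j + a)
  kreg j := s.kreg (j + r)
  karr j := s.karr (j + a)

theorem view_setReg (s : RamState K) (r a d v : ℕ) :
    (s.setReg (d + r) v).view r a = (s.view r a).setReg d v :=
  eq_of_fields (by ext j; simp [view]) rfl rfl rfl

theorem view_setArr (s : RamState K) (r a A i v : ℕ) :
    (s.setArr (A + a) i v).view r a = (s.view r a).setArr A i v :=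
  eq_of_fields rfl (by ext B j; simp [view]) rfl rfl

theorem view_setKreg (s : RamState K) (r a d : ℕ) (v : K) :
    (s.setKreg (d + r) v).view r a = (s.view r a).setKreg d v :=
  eq_of_fields rfl rfl (by ext j; simp [view]) rfl

theorem view_setKarr (s : RamState K) (r a A i : ℕ) (v : K) :
    (s.setKarr (A + a) i v).view r a = (s.view r a).setKarr A i v :=
  eq_of_fields rfl rfl rfl (by ext B j; simp [view])

/-- The two states have the same registers below `r` and the same arrays below `a`. -/
structure SameBelow (r a : ℕ) (s s' : RamState K) : Prop where
  reg : ∀ j < r, s'.reg j = s.reg j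
  kreg : ∀ j < r, s'.kreg j = s.kreg j
  arr : ∀ j < a, s'.arr j = s.arr j
  karr : ∀ j < a, s'.karr j = s.karr j

theorem SameBelow.refl (r a : ℕ) (s : RamState K) : SameBelow r a s s :=
  ⟨fun _ _ => rfl, fun _ _ => rfl, fun _ _ => rfl, fun _ _ => rfl⟩

theorem SameBelow.trans {r a : ℕ} {s s' s'' : RamState K} (h : SameBelow r a s s')
    (h' : SameBelow r a s' s'') : SameBelow r a s s'' :=
  ⟨fun j hj => (h'.reg j hj).trans (h.reg j hj), fun j hj => (h'.kreg j hj).trans (h.kreg j hj),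
    fun j hj => (h'.arr j hj).trans (h.arr j hj), fun j hj => (h'.karr j hj).trans (h.karr j hj)⟩

end RamState

namespace RamProg

/-- Rename registers and arrays by adding `r` and `a`. -/
def shift (r a : ℕ) : RamProg → RamProg
  | skip => skip
  | const d c => const (d + r) c
  | word o d x y => word o (d + r) (x + r) (y + r)
  | load d A i => load (d + r) (A + a) (i + r)
  | store A i x => store (A + a) (i + r) (x + r)
  | kzero d => kzero (d + r)
  | kone d => kone (d + r)
  | kadd d x y => kadd (d + r) (x + r) (y + r)
  | kmul d x y => kmul (d + r) (x + r) (y + r)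
  | kle d x y => kle (d + r) (x + r) (y + r)
  | kload d A i => kload (d + r) (A + a) (i + r)
  | kstore A i x => kstore (A + a) (i + r) (x + r)
  | seq p q => seq (p.shift r a) (q.shift r a)
  | cond x p q => cond (x + r) (p.shift r a) (q.shift r a)
  | loop x p => loop (x + r) (p.shift r a)

/-- All registers that the program writes are below this bound. -/
def regBound : RamProg → ℕ
  | skip => 0
  | const d _ => d + 1
  | word _ d _ _ => d + 1
  | load d _ _ => d + 1
  | store _ _ _ => 0
  | kzero d => d + 1
  | kone d => d + 1
  | kadd d _ _ => d + 1
  | kmul d _ _ => d + 1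
  | kle d _ _ => d + 1
  | kload d _ _ => d + 1
  | kstore _ _ _ => 0
  | seq p q => max p.regBound q.regBound
  | cond _ p q => max p.regBound q.regBound
  | loop _ p => p.regBound

end RamProg

namespace RamExec

variable {K : Type*} [CommSemiring K] [LinearOrder K] {κ W : ℕ} {p : RamProg}
  {s s' : RamState K} {t : ℕ}

theorem mono {W' : ℕ} (h : RamExec κ W p s s' t) (hW : W ≤ W') : RamExec κ W' p s s' t := by
  induction h with
  | skip => exact .skip _
  | const _ _ _ h => exact .const _ _ _ (h.trans_le hW)
  | word _ _ _ _ _ h => exact .word _ _ _ _ _ (h.trans_le hW)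
  | load | store | kzero | kone | kadd | kmul | kload | kstore => constructor
  | kle _ _ _ _ h => exact .kle _ _ _ _ (h.trans_le hW)
  | seq _ _ h1 h2 => exact .seq h1 h2
  | cond_true ha _ h => exact .cond_true ha h
  | cond_false ha _ h => exact .cond_false ha h
  | loop_done ha => exact .loop_done ha
  | loop_step ha _ _ h1 h2 => exact .loop_step ha h1 h2

/-- The hypotheses say that no instruction becomes dearer by more than the factor `b / a`. The
factor is kept as a fraction because it will be a quotient of logarithms, whose denominator cancels
against a time bound. -/
theorem change_cost {κ' a b : ℕ} (hab : a ≤ b) (hκ : κ' * a ≤ b * κ)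
    (h : RamExec κ W p s s' t) : ∃ t', RamExec κ' W p s s' t' ∧ t' * a ≤ b * t := by
  induction h with
  | skip => exact ⟨_, .skip _, by simpa using hab⟩
  | const _ _ _ h => exact ⟨_, .const _ _ _ h, by simpa using hab⟩
  | word _ _ _ _ _ h => exact ⟨_, .word _ _ _ _ _ h, by simpa using hab⟩
  | load | store => exact ⟨_, by constructor, by simpa using hab⟩
  | kzero | kone | kadd | kmul | kload | kstore => exact ⟨_, by constructor, hκ⟩
  | kle _ _ _ _ h => exact ⟨_, .kle _ _ _ _ h, hκ⟩
  | seq _ _ h1 h2 =>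
    obtain ⟨t1, e1, l1⟩ := h1
    obtain ⟨t2, e2, l2⟩ := h2
    exact ⟨_, .seq e1 e2, by rw [add_mul, mul_add]; omega⟩
  | cond_true ha _ h =>
    obtain ⟨t1, e1, l1⟩ := h
    exact ⟨_, .cond_true ha e1, by rw [add_mul, mul_add]; omega⟩
  | cond_false ha _ h =>
    obtain ⟨t1, e1, l1⟩ := h
    exact ⟨_, .cond_false ha e1, by rw [add_mul, mul_add]; omega⟩
  | loop_done ha => exact ⟨_, .loop_done ha, by simpa using hab⟩
  | loop_step ha _ _ h1 h2 =>
    obtain ⟨t1, e1, l1⟩ := h1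
    obtain ⟨t2, e2, l2⟩ := h2
    exact ⟨_, .loop_step ha e1 e2, by simp only [add_mul, mul_add]; omega⟩

/-- This guarantees that registers which a renamed subroutine expects to be zero are still zero
after the code that precedes it. -/
theorem untouched (h : RamExec κ W p s s' t) :
    ∀ r, p.regBound ≤ r → s'.reg r = s.reg r ∧ s'.kreg r = s.kreg r := by
  induction h with
  | seq _ _ h1 h2 =>
    intro r hr
    simp only [RamProg.regBound, max_le_iff] at hr
    exact ⟨((h2 r hr.2).1).trans (h1 r hr.1).1, ((h2 r hr.2).2).trans (h1 r hr.1).2⟩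
  | cond_true _ _ h =>
    intro r hr
    simp only [RamProg.regBound, max_le_iff] at hr
    exact h r hr.1
  | cond_false _ _ h =>
    intro r hr
    simp only [RamProg.regBound, max_le_iff] at hr
    exact h r hr.2
  | loop_step _ _ _ h1 h2 =>
    intro r hr
    exact ⟨((h2 r hr).1).trans (h1 r hr).1, ((h2 r hr).2).trans (h1 r hr).2⟩
  | _ =>
    intro r hr
    simp only [RamProg.regBound] at hr
    constructor <;> simp <;> omega

-- A program reaches no names but its own, so renaming commutes with execution. Thus an algorithm
-- for one query can be run as a subroutine for another one, beside data that survive below `r` and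
-- `a`.
open RamState in
theorem shift {r a : ℕ} (h : RamExec κ W p s s' t) :
    ∀ S : RamState K, S.view r a = s → ∃ S', RamExec κ W (p.shift r a) S S' t ∧
      S'.view r a = s' ∧ SameBelow r a S S' := by
  have hr : ∀ (S : RamState K) d v, SameBelow r a S (S.setReg (d + r) v) := fun S d v =>
    ⟨fun j hj => by simp; omega, fun _ _ => rfl, fun _ _ => rfl, fun _ _ => rfl⟩
  have hk : ∀ (S : RamState K) d v, SameBelow r a S (S.setKreg (d + r) v) := fun S d v =>
    ⟨fun _ _ => rfl, fun j hj => by simp; omega, fun _ _ => rfl, fun _ _ => rfl⟩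
  induction h with
  | skip => exact fun S hS => ⟨S, .skip _, hS, .refl _ _ _⟩
  | const s d c h => rintro S rfl; exact ⟨_, .const _ _ _ h, view_setReg .., hr ..⟩
  | word s o d x y h => rintro S rfl; exact ⟨_, .word _ _ _ _ _ h, view_setReg .., hr ..⟩
  | load s d A i => rintro S rfl; exact ⟨_, .load _ _ _ _, view_setReg .., hr ..⟩
  | kle s d x y h => rintro S rfl; exact ⟨_, .kle _ _ _ _ h, view_setReg .., hr ..⟩
  | kzero | kone | kadd | kmul | kload =>
    rintro S rfl; exact ⟨_, by constructor, view_setKreg .., hk ..⟩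
  | store s A i x =>
    rintro S rfl
    refine ⟨_, .store _ _ _ _, view_setArr .., fun _ _ => rfl, fun _ _ => rfl, fun j hj => ?_,
      fun _ _ => rfl⟩
    ext i; simp; omega
  | kstore s A i x =>
    rintro S rfl
    refine ⟨_, .kstore _ _ _ _, view_setKarr .., fun _ _ => rfl, fun _ _ => rfl, fun _ _ => rfl,
      fun j hj => ?_⟩
    ext i; simp; omega
  | seq _ _ h1 h2 =>
    intro S hS
    obtain ⟨S1, e1, v1, b1⟩ := h1 S hS
    obtain ⟨S2, e2, v2, b2⟩ := h2 S1 v1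
    exact ⟨S2, .seq e1 e2, v2, b1.trans b2⟩
  | cond_true ha _ h =>
    rintro S rfl
    obtain ⟨S1, e1, v1, b1⟩ := h S rfl
    exact ⟨S1, .cond_true ha e1, v1, b1⟩
  | cond_false ha _ h =>
    rintro S rfl
    obtain ⟨S1, e1, v1, b1⟩ := h S rfl
    exact ⟨S1, .cond_false ha e1, v1, b1⟩
  | loop_done ha =>
    rintro S rfl
    exact ⟨S, .loop_done ha, rfl, .refl _ _ _⟩
  | loop_step ha _ _ h1 h2 =>
    rintro S rfl
    obtain ⟨S1, e1, v1, b1⟩ := h1 S rfl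
    obtain ⟨S2, e2, v2, b2⟩ := h2 S1 v1
    exact ⟨S2, .loop_step ha e1 e2, v2, b1.trans b2⟩

end RamExec

/-! ## A small language with expressions and bounded loops -/

/-- Expressions for words. -/
inductive Ex
  | reg (r : ℕ)
  | cst (c : ℕ)
  | op (o : WordOp) (x y : Ex)
  | load (A : ℕ) (x : Ex)

/-- Expressions for elements of the semiring. -/
inductive KEx
  | reg (r : ℕ)
  | load (A : ℕ) (x : Ex)
  | zero
  | one
  | add (x y : KEx)
  | mul (x y : KEx)

/-- Statements. In `loop r e p` the register `r` runs through the numbers below the value of `e`;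
`size r e` sets `r` to the number of bits of the value of `e`. -/
inductive Stmt
  | skip
  | set (r : ℕ) (e : Ex)
  | store (A : ℕ) (i e : Ex)
  | kset (r : ℕ) (e : KEx)
  | kstore (A : ℕ) (i : Ex) (e : KEx)
  | seq (p q : Stmt)
  | cond (e : Ex) (p q : Stmt)
  | loop (r : ℕ) (e : Ex) (p : Stmt)
  | size (r : ℕ) (e : Ex)

namespace Ex

variable {K : Type*}

def eval (s : RamState K) : Ex → ℕ
  | reg r => s.reg r
  | cst c => c
  | op o x y => o.eval (x.eval s) (y.eval s)
  | load A x => s.arr A (x.eval s)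

/-- All values that occur in the evaluation are below `W`. -/
def Ok (W : ℕ) (s : RamState K) : Ex → Prop
  | reg r => s.reg r < W
  | cst c => c < W
  | op o x y => x.Ok W s ∧ y.Ok W s ∧ o.eval (x.eval s) (y.eval s) < W
  | load A x => x.Ok W s ∧ s.arr A (x.eval s) < W

def bound : Ex → ℕ
  | reg r => r + 1
  | cst _ => 0
  | op _ x y => max x.bound y.bound
  | load _ x => x.bound

def len : Ex → ℕ
  | reg _ => 2
  | cst _ => 1
  | op _ x y => x.len + y.len + 1
  | load _ x => x.len + 1

/-- The value ends up in register `d`; the registers from `d` on are scratch. The machine cannot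
move a word directly, hence the addition to zero. -/
def compile (d : ℕ) : Ex → RamProg
  | reg r => .seq (.const d 0) (.word .add d d r)
  | cst c => .const d c
  | op o x y => .seq (.seq (x.compile d) (y.compile (d + 1))) (.word o d d (d + 1))
  | load A x => .seq (x.compile d) (.load d A d)

theorem Ok.lt {W : ℕ} {s : RamState K} {e : Ex} (h : e.Ok W s) : e.eval s < W := by
  cases e <;> simp_all [Ok, eval]

end Ex

namespace KEx

variable {K : Type*} [CommSemiring K]

def eval (s : RamState K) : KEx → K
  | reg r => s.kreg r
  | load A x => s.karr A (x.eval s)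
  | zero => 0
  | one => 1
  | add x y => x.eval s + y.eval s
  | mul x y => x.eval s * y.eval s

def Ok (W : ℕ) (s : RamState K) : KEx → Prop
  | load _ x => x.Ok W s
  | add x y => x.Ok W s ∧ y.Ok W s
  | mul x y => x.Ok W s ∧ y.Ok W s
  | _ => True

/-- One bound serves for both kinds of registers, the words in the indices and the elements of `K`.
-/
def bound : KEx → ℕ
  | reg r => r + 1
  | load _ x => x.bound
  | add x y => max x.bound y.bound
  | mul x y => max x.bound y.bound
  | _ => 0

def len : KEx → ℕ
  | reg _ => 2
  | load _ x => x.len + 1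
  | add x y => x.len + y.len + 1
  | mul x y => x.len + y.len + 1
  | _ => 1

/-- Scratch words start at `d`, scratch elements at `k`. An element is copied by multiplying it with
`1`. -/
def compile (d k : ℕ) : KEx → RamProg
  | reg r => .seq (.kone k) (.kmul k k r)
  | load A x => .seq (x.compile d) (.kload k A d)
  | zero => .kzero k
  | one => .kone k
  | add x y => .seq (.seq (x.compile d k) (y.compile d (k + 1))) (.kadd k k (k + 1))
  | mul x y => .seq (.seq (x.compile d k) (y.compile d (k + 1))) (.kmul k k (k + 1))

end KEx

/-- `f 0`, …, `f (n - 1)` applied in this order. -/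
def iterSteps {α : Type*} (f : ℕ → α → α) : ℕ → α → α
  | 0, a => a
  | n + 1, a => f n (iterSteps f n a)

namespace Stmt

variable {K : Type*} [CommSemiring K]

def run : Stmt → RamState K → RamState K
  | skip, s => s
  | set r e, s => s.setReg r (e.eval s)
  | store A i e, s => s.setArr A (i.eval s) (e.eval s)
  | kset r e, s => s.setKreg r (e.eval s)
  | kstore A i e, s => s.setKarr A (i.eval s) (e.eval s)
  | seq p q, s => q.run (p.run s)
  | cond e p q, s => if e.eval s ≠ 0 then p.run s else q.run s
  | loop r e p, s => iterSteps (fun i s => p.run (s.setReg r i)) (e.eval s) s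
  | size r e, s => s.setReg r (Nat.size (e.eval s))

def Ok (W : ℕ) : Stmt → RamState K → Prop
  | skip, _ => True
  | set _ e, s => e.Ok W s
  | store _ i e, s => i.Ok W s ∧ e.Ok W s
  | kset _ e, s => e.Ok W s
  | kstore _ i e, s => i.Ok W s ∧ e.Ok W s
  | seq p q, s => p.Ok W s ∧ q.Ok W (p.run s)
  | cond e p q, s => e.Ok W s ∧ if e.eval s ≠ 0 then p.Ok W s else q.Ok W s
  | loop r e p, s => e.Ok W s ∧ ∀ i < e.eval s,
      p.Ok W ((iterSteps (fun i s => p.run (s.setReg r i)) i s).setReg r i)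
  | size _ e, s => e.Ok W s

/-- An assignment counts as one step, of time `1` or `κ`, however long its expression is. The
machine time exceeds this by at most the factor `len`, which depends on the program only. -/
def cost (κ : ℕ) : Stmt → RamState K → ℕ
  | kset _ _, _ => κ
  | kstore _ _ _, _ => κ
  | seq p q, s => p.cost κ s + q.cost κ (p.run s)
  | cond e p q, s => 1 + if e.eval s ≠ 0 then p.cost κ s else q.cost κ s
  | loop r e p, s => 1 + ∑ i ∈ Finset.range (e.eval s),
      (1 + p.cost κ ((iterSteps (fun i s => p.run (s.setReg r i)) i s).setReg r i))
  | size _ e, s => 1 + Nat.size (e.eval s)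
  | _, _ => 1

def bound : Stmt → ℕ
  | skip => 0
  | set r e => max (r + 1) e.bound
  | store _ i e => max i.bound e.bound
  | kset r e => max (r + 1) e.bound
  | kstore _ i e => max i.bound e.bound
  | seq p q => max p.bound q.bound
  | cond e p q => max e.bound (max p.bound q.bound)
  | loop r e p => max (r + 1) (max e.bound p.bound)
  | size r e => max (r + 1) e.bound

def len : Stmt → ℕ
  | skip => 1
  | set _ e => e.len + 2
  | store _ i e => i.len + e.len + 1
  | kset _ e => e.len + 2
  | kstore _ i e => i.len + e.len + 1
  | seq p q => p.len + q.len
  | cond e p q => e.len + p.len + q.len + 1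
  | loop _ e p => e.len + p.len + 10
  | size _ e => e.len + 10

/-- A loop keeps its bound in `d`, the counter in `d + 1` and the outcome of the test in `d + 2`, so
nested code gets its scratch registers from `d + 3` on. The counter is copied to `r` in every round,
so the body may overwrite `r`. For `size`, register `d` is halved until it is zero, and `d + 1`
counts the rounds. -/
def compile (d : ℕ) : Stmt → RamProg
  | skip => .skip
  | set r e => .seq (e.compile d) (.seq (.const r 0) (.word .add r r d))
  | store A i e => .seq (.seq (i.compile d) (e.compile (d + 1))) (.store A d (d + 1))
  | kset r e => .seq (e.compile d d) (.seq (.kone r) (.kmul r r d))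
  | kstore A i e => .seq (.seq (i.compile d) (e.compile (d + 1) d)) (.kstore A d d)
  | seq p q => .seq (p.compile d) (q.compile d)
  | cond e p q => .seq (e.compile d) (.cond d (p.compile d) (q.compile d))
  | loop r e p =>
    .seq (.seq (.seq (e.compile d) (.const (d + 1) 0)) (.word .lt (d + 2) (d + 1) d))
      (.loop (d + 2) (.seq (.seq (.seq (.const r 0) (.word .add r r (d + 1)))
        (p.compile (d + 3))) (.seq (.seq (.const (d + 2) 1) (.word .add (d + 1) (d + 1) (d + 2)))
        (.word .lt (d + 2) (d + 1) d))))
  | size r e =>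
    .seq (.seq (.seq (e.compile d) (.const (d + 1) 0))
      (.loop d (.seq (.seq (.const (d + 2) 1) (.word .add (d + 1) (d + 1) (d + 2)))
        (.seq (.const (d + 2) 2) (.word .div d d (d + 2))))))
      (.seq (.const r 0) (.word .add r r (d + 1)))

end Stmt

/-! ### Correctness of the compilation -/

namespace RamState

variable {K : Type*}

/-- `S` agrees with `s` on all arrays and on the registers below `b`. -/
structure Agree (b : ℕ) (S s : RamState K) : Prop where
  reg : ∀ r < b, S.reg r = s.reg r
  kreg : ∀ r < b, S.kreg r = s.kreg r
  arr : S.arr = s.arr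
  karr : S.karr = s.karr

/-- `S'` agrees with `S` on the registers from `b` on and below `d`. -/
def Keep (b d k : ℕ) (S S' : RamState K) : Prop :=
  (∀ r, b ≤ r → r < d → S'.reg r = S.reg r) ∧ ∀ r, b ≤ r → r < k → S'.kreg r = S.kreg r

theorem Keep.trans {b d k : ℕ} {S S' S'' : RamState K} (h : Keep b d k S S')
    (h' : Keep b d k S' S'') : Keep b d k S S'' :=
  ⟨fun r h1 h2 => (h'.1 r h1 h2).trans (h.1 r h1 h2),
    fun r h1 h2 => (h'.2 r h1 h2).trans (h.2 r h1 h2)⟩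

theorem Keep.mono {b d k d' k' : ℕ} {S S' : RamState K} (h : Keep b d k S S')
    (hd : d' ≤ d) (hk : k' ≤ k) : Keep b d' k' S S' :=
  ⟨fun r h1 h2 => h.1 r h1 (h2.trans_le hd), fun r h1 h2 => h.2 r h1 (h2.trans_le hk)⟩

theorem Keep.refl (b d k : ℕ) (S : RamState K) : Keep b d k S S :=
  ⟨fun _ _ _ => rfl, fun _ _ _ => rfl⟩

theorem Agree.setReg_ge {b d v : ℕ} {S s : RamState K} (h : Agree b S s) (hd : b ≤ d) :
    Agree b (S.setReg d v) s :=
  ⟨fun r hr => by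
    have : r ≠ d := by omega
    simp [this, h.reg r hr], h.kreg, h.arr, h.karr⟩

theorem keep_setReg {b d k r v : ℕ} {S : RamState K} (h : r < b ∨ d ≤ r) :
    Keep b d k S (S.setReg r v) :=
  ⟨fun r' h1 h2 => by
    have : r' ≠ r := by omega
    simp [this], fun _ _ _ => rfl⟩

end RamState

open RamState

namespace Ex

variable {K : Type*} [CommSemiring K] [LinearOrder K]

/-- The induction needs more than the value of `e`: `Agree` protects the variables of the source
program, which lie below `b`, and `Keep` protects intermediate results that wait in scratch
registers below `d`. -/
theorem compile_exec {κ W b : ℕ} (e : Ex) : ∀ {d : ℕ} {S s : RamState K}, b ≤ d → e.bound ≤ b →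
    Agree b S s → e.Ok W s → ∃ S', RamExec κ W (e.compile d) S S' e.len ∧
      S'.reg d = e.eval s ∧ Agree b S' s ∧ Keep b d 0 S S' ∧ S'.kreg = S.kreg := by
  induction e with
  | reg r =>
    intro d S s hd hb hA hok
    simp only [bound] at hb
    have hr : r ≠ d := by omega
    have hlt : s.reg r < W := hok
    refine ⟨_, .seq (.const _ _ _ (by omega)) (.word _ _ _ _ _ ?_), ?_,
      (hA.setReg_ge hd).setReg_ge hd, (keep_setReg (by omega)).trans (keep_setReg (by omega)), rfl⟩
    · simpa [WordOp.eval, hr, hA.reg r (by omega)] using hlt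
    · simp [WordOp.eval, hr, hA.reg r (by omega), eval]
  | cst c =>
    intro d S s hd hb hA hok
    exact ⟨_, .const _ _ _ hok, by simp [eval], hA.setReg_ge hd, keep_setReg (by omega), rfl⟩
  | op o x y hx hy =>
    intro d S s hd hb hA hok
    simp only [bound, max_le_iff] at hb
    obtain ⟨ho1, ho2, ho3⟩ := hok
    obtain ⟨S1, e1, v1, a1, k1, q1⟩ := hx hd hb.1 hA ho1
    obtain ⟨S2, e2, v2, a2, k2, q2⟩ := hy (d := d + 1) (by omega) hb.2 a1 ho2
    have v12 : S2.reg d = x.eval s := by rw [k2.1 d hd (by omega), v1]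
    refine ⟨_, .seq (.seq e1 e2) (.word _ _ _ _ _ ?_), ?_, a2.setReg_ge hd,
      k1.trans ((k2.mono (Nat.le_succ d) le_rfl).trans (keep_setReg (by omega))), q2.trans q1⟩
    · rw [v12, v2]; exact ho3
    · simp [v12, v2, eval]
  | load A x hx =>
    intro d S s hd hb hA hok
    obtain ⟨S1, e1, v1, a1, k1, q1⟩ := hx hd hb hA hok.1
    exact ⟨_, .seq e1 (.load _ _ _ _), by simp [v1, eval, a1.arr], a1.setReg_ge hd,
      k1.trans (keep_setReg (by omega)), q1⟩

end Ex

namespace KEx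

variable {K : Type*} [CommSemiring K] [LinearOrder K]

theorem compile_exec {κ W b : ℕ} (hκ : 1 ≤ κ) (e : KEx) : ∀ {d k : ℕ} {S s : RamState K},
    b ≤ d → b ≤ k → e.bound ≤ b → Agree b S s → e.Ok W s →
    ∃ S' t, RamExec κ W (e.compile d k) S S' t ∧ t ≤ e.len * κ ∧
      S'.kreg k = e.eval s ∧ Agree b S' s ∧ Keep b d k S S' := by
  have kκ : ∀ {n : ℕ}, n ≤ n * κ := fun {n} => Nat.le_mul_of_pos_right n hκ
  have hset : ∀ {k : ℕ} {S s : RamState K} (v : K), b ≤ k → Agree b S s →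
      Agree b (S.setKreg k v) s := fun {k S s} v hk hA =>
    ⟨fun r hr => by simp [hA.reg r hr], fun r hr => by
      have : r ≠ k := by omega
      simp [this, hA.kreg r hr], by simp [hA.arr], by simp [hA.karr]⟩
  have kset : ∀ {d k : ℕ} {S : RamState K} (v : K), Keep b d k S (S.setKreg k v) :=
    fun {d k S} v => ⟨fun r' h1 h2 => by simp, fun r' h1 h2 => by simp [h2.ne]⟩
  induction e with
  | reg r =>
    intro d k S s hd hk hb hA _
    simp only [bound] at hb
    have hr : r ≠ k := by omega
    exact ⟨_, _, .seq (.kone _ _) (.kmul _ _ _ _), by simp [len]; omega,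
      by simp [hr, hA.kreg r (by omega), eval], hset _ hk (hset _ hk hA), (kset _).trans (kset _)⟩
  | load A x =>
    intro d k S s hd hk hb hA hok
    obtain ⟨S1, e1, v1, a1, k1, q1⟩ := x.compile_exec (κ := κ) hd hb hA hok
    have := kκ (n := x.len)
    exact ⟨_, _, .seq e1 (.kload _ _ _ _), by simp [len, add_mul]; omega,
      by simp [v1, eval, a1.karr], hset _ hk a1,
      Keep.trans ⟨k1.1, fun r _ _ => by rw [q1]⟩ (kset _)⟩
  | zero =>
    intro d k S s hd hk hb hA hok
    exact ⟨_, _, .kzero _ _, by simp [len], by simp [eval], hset _ hk hA, kset _⟩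
  | one =>
    intro d k S s hd hk hb hA hok
    exact ⟨_, _, .kone _ _, by simp [len], by simp [eval], hset _ hk hA, kset _⟩
  | add x y hx hy | mul x y hx hy =>
    intro d k S s hd hk hb hA hok
    simp only [bound, max_le_iff] at hb
    obtain ⟨ho1, ho2⟩ := hok
    obtain ⟨S1, t1, e1, l1, v1, a1, k1⟩ := hx hd hk hb.1 hA ho1
    obtain ⟨S2, t2, e2, l2, v2, a2, k2⟩ := hy (k := k + 1) hd (by omega) hb.2 a1 ho2
    have v12 : S2.kreg k = x.eval s := by rw [k2.2 k hk (by omega), v1]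
    refine ⟨_, t1 + t2 + κ, .seq (.seq e1 e2) (by constructor), by simp [len, add_mul]; omega,
      by simp [v12, v2, eval], hset _ hk a2,
      k1.trans ((k2.mono le_rfl (Nat.le_succ k)).trans (kset _))⟩

end KEx

namespace Stmt

variable {K : Type*} [CommSemiring K] [LinearOrder K]

theorem mov_exec {κ W b d r v : ℕ} {S s : RamState K} (hd : b ≤ d) (hr : r < b)
    (hA : Agree b S s) (hv : S.reg d = v) (hW : v < W) :
    ∃ S', RamExec κ W (.seq (.const r 0) (.word .add r r d)) S S' 2 ∧ Agree b S' (s.setReg r v) ∧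
      ∀ d' k, Keep b d' k S S' := by
  have hne : d ≠ r := by omega
  refine ⟨_, .seq (.const _ _ _ (by omega)) (.word _ _ _ _ _ ?_), ?_, fun d' k => ?_⟩
  · simpa [WordOp.eval, hne, hv] using hW
  · refine ⟨fun r' hr' => ?_, fun r' hr' => by simp [hA.kreg r' hr'], by simp [hA.arr],
      by simp [hA.karr]⟩
    by_cases h : r' = r
    · simp [h, WordOp.eval, hne, hv]
    · simp [h, hA.reg r' hr']
  · exact (keep_setReg (.inl hr)).trans (keep_setReg (.inl hr))

/-- Halving removes one bit, so strong induction on `v` applies. A round consists of four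
instructions and the test of the loop. -/
theorem size_loop_exec {κ W b d : ℕ} (hW : 2 < W) {s : RamState K} (hd : b ≤ d) : ∀ (v n : ℕ)
    {S : RamState K}, v < W → n + Nat.size v < W → Agree b S s → S.reg d = v → S.reg (d + 1) = n →
    ∃ S', RamExec κ W (.loop d (.seq (.seq (.const (d + 2) 1) (.word .add (d + 1) (d + 1) (d + 2)))
        (.seq (.const (d + 2) 2) (.word .div d d (d + 2))))) S S' (1 + 5 * Nat.size v) ∧
      Agree b S' s ∧ S'.reg (d + 1) = n + Nat.size v ∧ Keep b d d S S' := by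
  intro v
  induction v using Nat.strong_induction_on with
  | _ v ih =>
    intro n S hv hn hA h1 h2
    rcases Nat.eq_zero_or_pos v with h0 | h0
    · subst h0
      exact ⟨S, .loop_done h1, hA, by simp [h2], .refl _ _ _ _⟩
    · have hsz : Nat.size v = Nat.size (v / 2) + 1 := by
        have h3 := Nat.size_bit (b := Nat.bodd v) (n := Nat.div2 v) (by rw [Nat.bit_bodd_div2]; omega)
        rwa [Nat.bit_bodd_div2, Nat.div2_val] at h3
      rw [hsz] at hn
      obtain ⟨S', e, a, r1, k⟩ := ih (v / 2) (by omega) (n + 1)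
        (S := (((S.setReg (d + 2) 1).setReg (d + 1) (n + 1)).setReg (d + 2) 2).setReg d (v / 2))
        (by omega) (by omega)
        ((((hA.setReg_ge (by omega)).setReg_ge (by omega)).setReg_ge (by omega)).setReg_ge hd)
        (by simp) (by simp)
      have step : RamExec κ W (.seq (.seq (.const (d + 2) 1) (.word .add (d + 1) (d + 1) (d + 2)))
          (.seq (.const (d + 2) 2) (.word .div d d (d + 2)))) S
          ((((S.setReg (d + 2) 1).setReg (d + 1) (n + 1)).setReg (d + 2) 2).setReg d (v / 2)) 4 := by
        have e1 : RamExec κ W _ S _ _ := .const S (d + 2) 1 (by omega)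
        have e2 := RamExec.word (κ := κ) (W := W) (S.setReg (d + 2) 1) .add (d + 1) (d + 1) (d + 2)
          (by simp [WordOp.eval, h2]; omega)
        have e3 := RamExec.const (κ := κ) (W := W) ((S.setReg (d + 2) 1).setReg (d + 1) (n + 1))
          (d + 2) 2 (by omega)
        have e4 := RamExec.word (κ := κ) (W := W)
          (((S.setReg (d + 2) 1).setReg (d + 1) (n + 1)).setReg (d + 2) 2) .div d d (d + 2)
          (by simp [WordOp.eval, h1]; omega)
        simp only [setReg_reg, WordOp.eval] at e2 e4
        simp only [show d + 1 ≠ d + 2 by omega, show d ≠ d + 2 by omega, show d ≠ d + 1 by omega,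
          if_true, if_false, h1, h2] at e2 e4
        exact .seq (.seq e1 e2) (.seq e3 e4)
      refine ⟨S', ?_, a, by rw [r1, hsz]; ring, ?_⟩
      · have := RamExec.loop_step (by rw [h1]; omega) step e
        rw [hsz]
        convert this using 1
        ring
      · exact (((keep_setReg (by omega)).trans (keep_setReg (by omega))).trans
          ((keep_setReg (by omega)).trans (keep_setReg (by omega)))).trans k

/-- The compiled code writes the constants `1` and `2`, whence `2 < W`. Because of `1 ≤ κ`, the word
instructions that accompany a semiring step are paid for by its cost. -/
theorem compile_exec {κ W b : ℕ} (hκ : 1 ≤ κ) (hW : 2 < W) (p : Stmt) :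
    ∀ {d : ℕ} {S s : RamState K}, b ≤ d → p.bound ≤ b → Agree b S s → p.Ok W s →
    ∃ S' t, RamExec κ W (p.compile d) S S' t ∧ t ≤ p.len * p.cost κ s ∧
      Agree b S' (p.run s) ∧ Keep b d d S S' := by
  induction p with
  | skip =>
    intro d S s hd hb hA hok
    exact ⟨S, _, .skip _, by simp [len, cost], hA, .refl _ _ _ _⟩
  | set r e =>
    intro d S s hd hb hA hok
    simp only [bound, max_le_iff] at hb
    obtain ⟨S1, e1, v1, a1, k1, q1⟩ := e.compile_exec (κ := κ) hd hb.2 hA hok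
    obtain ⟨S2, e2, a2, k2⟩ := mov_exec (κ := κ) (W := W) (r := r) hd (by omega) a1 v1 hok.lt
    exact ⟨S2, _, .seq e1 e2, by simp [len, cost], a2,
      Keep.trans ⟨k1.1, fun r _ _ => by rw [q1]⟩ (k2 _ _)⟩
  | store A i e =>
    intro d S s hd hb hA hok
    simp only [bound, max_le_iff] at hb
    obtain ⟨S1, e1, v1, a1, k1, q1⟩ := i.compile_exec (κ := κ) hd hb.1 hA hok.1
    obtain ⟨S2, e2, v2, a2, k2, q2⟩ := e.compile_exec (κ := κ) (d := d + 1) (by omega) hb.2 a1 hok.2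
    have v12 : S2.reg d = i.eval s := by rw [k2.1 d hd (by omega), v1]
    refine ⟨_, _, .seq (.seq e1 e2) (.store _ _ _ _), by simp [len, cost],
      ⟨a2.reg, a2.kreg, ?_, a2.karr⟩, ?_⟩
    · ext B j; simp [run, v12, v2, a2.arr]
    · exact ⟨fun r h1 h2 => by simp [k2.1 r h1 (by omega), k1.1 r h1 h2],
        fun r h1 h2 => by simp [q1, q2]⟩
  | kset r e =>
    intro d S s hd hb hA hok
    simp only [bound, max_le_iff] at hb
    obtain ⟨S1, t1, e1, l1, v1, a1, k1⟩ := e.compile_exec hκ hd hd hb.2 hA hok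
    have hr : d ≠ r := by omega
    refine ⟨_, _, .seq e1 (.seq (.kone _ _) (.kmul _ _ _ _)), ?_, ⟨?_, ?_, ?_, ?_⟩,
      k1.trans ⟨fun r h1 h2 => by simp, fun r' h1 h2 => ?_⟩⟩
    · simp only [len, cost, add_mul]; omega
    · intro r' hr'; simp [run, a1.reg r' hr']
    · intro r' hr'
      by_cases h : r' = r
      · simp [run, h, hr, v1]
      · simp [run, h, a1.kreg r' hr']
    · simp [run, a1.arr]
    · simp [run, a1.karr]
    · have : r' ≠ r := by omega
      simp [this]
  | kstore A i e =>
    intro d S s hd hb hA hok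
    simp only [bound, max_le_iff] at hb
    obtain ⟨S1, e1, v1, a1, k1, q1⟩ := i.compile_exec (κ := κ) hd hb.1 hA hok.1
    obtain ⟨S2, t2, e2, l2, v2, a2, k2⟩ := e.compile_exec hκ (d := d + 1) (k := d) (by omega) hd hb.2
      a1 hok.2
    have v12 : S2.reg d = i.eval s := by rw [k2.1 d hd (by omega), v1]
    refine ⟨_, _, .seq (.seq e1 e2) (.kstore _ _ _ _), ?_, ⟨a2.reg, a2.kreg, a2.arr, ?_⟩, ?_⟩
    · simp only [len, cost, add_mul]
      have := Nat.le_mul_of_pos_right i.len hκ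
      omega
    · ext B j; simp [run, v12, v2, a2.karr]
    · exact ⟨fun r h1 h2 => by simp [k2.1 r h1 (by omega), k1.1 r h1 h2],
        fun r h1 h2 => by simp [q1, k2.2 r h1 h2]⟩
  | seq p q hp hq =>
    intro d S s hd hb hA hok
    simp only [bound, max_le_iff] at hb
    obtain ⟨S1, t1, e1, l1, a1, k1⟩ := hp hd hb.1 hA hok.1
    obtain ⟨S2, t2, e2, l2, a2, k2⟩ := hq hd hb.2 a1 hok.2
    refine ⟨S2, _, .seq e1 e2, ?_, a2, k1.trans k2⟩
    simp only [len, cost]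
    nlinarith [Nat.zero_le (p.len * q.cost κ (p.run s)), Nat.zero_le (q.len * p.cost κ s)]
  | cond e p q hp hq =>
    intro d S s hd hb hA hok
    simp only [bound, max_le_iff] at hb
    obtain ⟨S1, e1, v1, a1, k1, q1⟩ := e.compile_exec (κ := κ) hd hb.1 hA hok.1
    have k1' : Keep b d d S S1 := ⟨k1.1, fun r _ _ => by rw [q1]⟩
    have hok2 := hok.2
    by_cases h : e.eval s ≠ 0
    · rw [if_pos h] at hok2
      obtain ⟨S2, t2, e2, l2, a2, k2⟩ := hp hd hb.2.1 a1 hok2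
      refine ⟨S2, _, .seq e1 (.cond_true (by rwa [v1]) e2), ?_, ?_, k1'.trans k2⟩
      · simp only [len, cost, if_pos h]
        nlinarith [Nat.zero_le (e.len * p.cost κ s), Nat.zero_le (q.len * p.cost κ s)]
      · simpa only [run, if_pos h] using a2
    · rw [if_neg h] at hok2
      obtain ⟨S2, t2, e2, l2, a2, k2⟩ := hq hd hb.2.2 a1 hok2
      refine ⟨S2, _, .seq e1 (.cond_false (by rw [v1]; exact not_not.1 h) e2), ?_, ?_,
        k1'.trans k2⟩
      · simp only [len, cost, if_neg h]
        nlinarith [Nat.zero_le (e.len * q.cost κ s), Nat.zero_le (p.len * q.cost κ s)]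
      · simpa only [run, if_neg h] using a2
  | size r e =>
    intro d S s hd hb hA hok
    simp only [bound, max_le_iff] at hb
    obtain ⟨S1, e1, v1, a1, k1, q1⟩ := e.compile_exec (κ := κ) hd hb.2 hA hok
    have hlt : e.eval s < W := Ex.Ok.lt hok
    have hsz : Nat.size (e.eval s) < W :=
      (Nat.size_le.2 (Nat.lt_two_pow_self (n := e.eval s))).trans_lt hlt
    obtain ⟨S2, e2, a2, v2, k2⟩ := size_loop_exec (κ := κ) hW hd (e.eval s) 0
      (S := S1.setReg (d + 1) 0) hlt (by omega) (a1.setReg_ge (by omega))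
      (by simp [v1]) (by simp)
    obtain ⟨S3, e3, a3, k3⟩ := mov_exec (κ := κ) (W := W) (r := r) (d := d + 1) (by omega) (by omega)
      a2 v2 (by omega)
    refine ⟨S3, _, .seq (.seq (.seq e1 (.const _ _ _ (by omega))) e2) e3, ?_, ?_, ?_⟩
    · simp only [len, cost]; nlinarith [Nat.zero_le (e.len * Nat.size (e.eval s))]
    · simpa only [run, zero_add] using a3
    · exact Keep.trans ⟨k1.1, fun r _ _ => by rw [q1]⟩
        ((keep_setReg (by omega)).trans (k2.trans (k3 _ _)))
  | loop r e p hp =>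
    intro d S s hd hb hA hok
    simp only [bound, max_le_iff] at hb
    obtain ⟨hok1, hok2⟩ := hok
    obtain ⟨S1, e1, v1, a1, k1, q1⟩ := e.compile_exec (κ := κ) hd hb.2.1 hA hok1
    set n := e.eval s with hn
    set f : ℕ → RamState K → RamState K := fun i s => p.run (s.setReg r i) with hf
    have hlt : n < W := Ex.Ok.lt hok1
    -- Induction on the number `m` of rounds that are left. Each costs `6` beyond the body: two for
    -- copying the counter, two for increasing it, one for the comparison and one for the test.
    have key : ∀ m i, i + m = n → ∀ T : RamState K, T.reg d = n → T.reg (d + 1) = i →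
        T.reg (d + 2) = (if i < n then 1 else 0) → Agree b T (iterSteps f i s) →
        ∃ T' t, RamExec κ W (.loop (d + 2) (.seq (.seq (.seq (.const r 0)
            (.word .add r r (d + 1))) (p.compile (d + 3))) (.seq (.seq (.const (d + 2) 1)
            (.word .add (d + 1) (d + 1) (d + 2))) (.word .lt (d + 2) (d + 1) d)))) T T' t ∧
          t ≤ 1 + ∑ j ∈ Finset.Ico i n, (6 + p.len * p.cost κ ((iterSteps f j s).setReg r j)) ∧
          Agree b T' (iterSteps f n s) ∧ Keep b d d T T' := by
      intro m
      induction m with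
      | zero =>
        intro i hi T h1 h2 h3 hA
        obtain rfl : i = n := by omega
        exact ⟨T, _, .loop_done (by simpa using h3), by simp, hA, .refl _ _ _ _⟩
      | succ m ih =>
        intro i hi T h1 h2 h3 hA
        have hi' : i < n := by omega
        obtain ⟨T1, x1, b1, l1⟩ := mov_exec (κ := κ) (W := W) (r := r) (d := d + 1) (by omega)
          (by omega) hA h2 (by omega)
        obtain ⟨T2, t2, x2, c2, b2, l2⟩ := hp (d := d + 3) (by omega) hb.2.2 b1 (hok2 i hi')
        have r1 : T2.reg d = n := by
          rw [l2.1 d hd (by omega), (l1 (d + 1) 0).1 d hd (by omega), h1]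
        have r2 : T2.reg (d + 1) = i := by
          rw [l2.1 (d + 1) (by omega) (by omega), (l1 (d + 2) 0).1 (d + 1) (by omega) (by omega), h2]
        have e1 := RamExec.const (κ := κ) (W := W) T2 (d + 2) 1 (by omega)
        have e2 := RamExec.word (κ := κ) (W := W) (T2.setReg (d + 2) 1) .add (d + 1) (d + 1) (d + 2)
          (by simp [WordOp.eval, r2]; omega)
        simp only [setReg_reg, WordOp.eval] at e2
        simp only [show d + 1 ≠ d + 2 by omega, if_true, if_false, r2] at e2
        have e3 := RamExec.word (κ := κ) (W := W) ((T2.setReg (d + 2) 1).setReg (d + 1) (i + 1))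
          .lt (d + 2) (d + 1) d (by simp [WordOp.eval, r1]; split <;> omega)
        simp only [setReg_reg, WordOp.eval] at e3
        simp only [show d ≠ d + 2 by omega, show d ≠ d + 1 by omega, if_true, if_false, r1] at e3
        obtain ⟨T3, t3, x3, c3, b3, l3⟩ := ih (i + 1) (by omega)
          (((T2.setReg (d + 2) 1).setReg (d + 1) (i + 1)).setReg (d + 2)
            (if i + 1 < n then 1 else 0)) (by simp [r1]) (by simp) (by simp)
          (((b2.setReg_ge (by omega)).setReg_ge (by omega)).setReg_ge (by omega))
        refine ⟨T3, _, .loop_step (by simp [h3, hi']) (.seq (.seq x1 x2) (.seq (.seq e1 e2) e3)) x3,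
          ?_, b3, ?_⟩
        · rw [Finset.sum_eq_sum_Ico_succ_bot hi']
          change t2 ≤ p.len * p.cost κ ((iterSteps f i s).setReg r i) at c2
          omega
        · exact ((l1 _ _).trans (l2.mono (by omega) (by omega))).trans
            (((keep_setReg (by omega)).trans ((keep_setReg (by omega)).trans
              (keep_setReg (by omega)))).trans l3)
    have e3 := RamExec.word (κ := κ) (W := W) (S1.setReg (d + 1) 0)
      .lt (d + 2) (d + 1) d (by simp [WordOp.eval, v1]; split <;> omega)
    simp only [setReg_reg, WordOp.eval] at e3
    simp only [show d ≠ d + 1 by omega, if_true, if_false, v1] at e3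
    obtain ⟨T', t, x, c, a, l⟩ := key n 0 (by omega)
      ((S1.setReg (d + 1) 0).setReg (d + 2) (if 0 < n then 1 else 0)) (by simp [v1]) (by simp)
      (by simp) ((a1.setReg_ge (by omega)).setReg_ge (by omega))
    refine ⟨T', _, .seq (.seq (.seq e1 (.const _ _ _ (by omega))) e3) x, ?_, a, ?_⟩
    · simp only [len, cost, ← hn]
      change _ ≤ (e.len + p.len + 10) * (1 + ∑ i ∈ Finset.range n,
        (1 + p.cost κ ((iterSteps f i s).setReg r i)))
      rw [← Finset.range_eq_Ico] at c
      have h1 : ∑ j ∈ Finset.range n, (6 + p.len * p.cost κ ((iterSteps f j s).setReg r j)) ≤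
          (e.len + p.len + 10) * ∑ i ∈ Finset.range n,
            (1 + p.cost κ ((iterSteps f i s).setReg r i)) := by
        rw [Finset.mul_sum]
        refine Finset.sum_le_sum fun j _ => ?_
        nlinarith [Nat.zero_le ((e.len + 10) * p.cost κ ((iterSteps f j s).setReg r j))]
      rw [mul_add, mul_one]
      omega
    · exact Keep.trans ⟨k1.1, fun r _ _ => by rw [q1]⟩
        ((keep_setReg (by omega)).trans ((keep_setReg (by omega)).trans l))

end Stmt

/-! ## Specifications of statements -/

section Spec

variable {K : Type*} [CommSemiring K] {κ W T T' : ℕ} {p q : Stmt} {s : RamState K}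
  {Q Q' : RamState K → Prop}

/-- From the state `s` the statement `p` runs safely, at a cost of at most `T`, to a state that
satisfies `Q`. -/
def Sp (κ W : ℕ) (p : Stmt) (s : RamState K) (T : ℕ) (Q : RamState K → Prop) : Prop :=
  p.Ok W s ∧ p.cost κ s ≤ T ∧ Q (p.run s)

theorem Sp.conseq (h : Sp κ W p s T Q) (hT : T ≤ T') (hQ : ∀ s, Q s → Q' s) :
    Sp κ W p s T' Q' :=
  ⟨h.1, h.2.1.trans hT, hQ _ h.2.2⟩

theorem Sp.mono (h : Sp κ W p s T Q) (hT : T ≤ T') : Sp κ W p s T' Q := h.conseq hT fun _ h => h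

theorem Sp.skip (h : Q s) : Sp κ W .skip s 1 Q := ⟨trivial, le_rfl, h⟩

theorem Sp.set {r : ℕ} {e : Ex} (h : e.Ok W s) (hQ : Q (s.setReg r (e.eval s))) :
    Sp κ W (.set r e) s 1 Q := ⟨h, le_rfl, hQ⟩

theorem Sp.store {A : ℕ} {i e : Ex} (h : i.Ok W s) (h' : e.Ok W s)
    (hQ : Q (s.setArr A (i.eval s) (e.eval s))) : Sp κ W (.store A i e) s 1 Q :=
  ⟨⟨h, h'⟩, le_rfl, hQ⟩

theorem Sp.kset {r : ℕ} {e : KEx} (h : e.Ok W s) (hQ : Q (s.setKreg r (e.eval s))) :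
    Sp κ W (.kset r e) s κ Q := ⟨h, le_rfl, hQ⟩

theorem Sp.kstore {A : ℕ} {i : Ex} {e : KEx} (h : i.Ok W s) (h' : e.Ok W s)
    (hQ : Q (s.setKarr A (i.eval s) (e.eval s))) : Sp κ W (.kstore A i e) s κ Q :=
  ⟨⟨h, h'⟩, le_rfl, hQ⟩

theorem Sp.size {r : ℕ} {e : Ex} (h : e.Ok W s) (hQ : Q (s.setReg r (Nat.size (e.eval s)))) :
    Sp κ W (.size r e) s (1 + Nat.size (e.eval s)) Q := ⟨h, le_rfl, hQ⟩

theorem Sp.seq (h : Sp κ W p s T Q) (h' : ∀ s', Q s' → Sp κ W q s' T' Q') :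
    Sp κ W (.seq p q) s (T + T') Q' := by
  obtain ⟨o1, c1, q1⟩ := h
  obtain ⟨o2, c2, q2⟩ := h' _ q1
  exact ⟨⟨o1, o2⟩, by simp only [Stmt.cost]; omega, q2⟩

theorem Sp.cond {e : Ex} (he : e.Ok W s) (h : e.eval s ≠ 0 → Sp κ W p s T Q)
    (h' : e.eval s = 0 → Sp κ W q s T Q) : Sp κ W (.cond e p q) s (1 + T) Q := by
  by_cases h0 : e.eval s = 0
  · obtain ⟨o, c, r⟩ := h' h0
    exact ⟨⟨he, by simpa [h0] using o⟩, by simp [Stmt.cost, h0]; omega,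
      by simpa [Stmt.run, h0] using r⟩
  · obtain ⟨o, c, r⟩ := h h0
    exact ⟨⟨he, by simpa [h0] using o⟩, by simp [Stmt.cost, h0]; omega,
      by simpa [Stmt.run, h0] using r⟩

/-- The invariant `I i` speaks of the state before round `i`, when `r` has not yet been set to `i`.
-/
theorem Sp.loop {e : Ex} {r n : ℕ} (I : ℕ → RamState K → Prop) (he : e.Ok W s)
    (hn : e.eval s = n) (h0 : I 0 s)
    (h : ∀ i < n, ∀ s', I i s' → Sp κ W p (s'.setReg r i) T (I (i + 1))) :
    Sp κ W (.loop r e p) s (1 + n * (1 + T)) (I n) := by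
  have key : ∀ i ≤ n, I i (iterSteps (fun i s => p.run (s.setReg r i)) i s) := by
    intro i
    induction i with
    | zero => exact fun _ => h0
    | succ i ih => exact fun hi => (h i (by omega) _ (ih (by omega))).2.2
  refine ⟨⟨he, fun i hi => ?_⟩, ?_, ?_⟩
  · rw [hn] at hi
    exact (h i hi _ (key i hi.le)).1
  · simp only [Stmt.cost, hn]
    gcongr
    calc _ ≤ ∑ i ∈ Finset.range n, (1 + T) := Finset.sum_le_sum fun i hi => by
            gcongr
            exact (h i (Finset.mem_range.1 hi) _ (key i (Finset.mem_range.1 hi).le)).2.1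
      _ = _ := by simp
  · simp only [Stmt.run, hn]
    exact key n le_rfl

end Spec

/-! ## Subroutines for another query -/

namespace RamProg

/-- Move the contents of the `n` registers from `l` on to those from `r` on. -/
def movs (r l : ℕ) : ℕ → RamProg
  | 0 => skip
  | n + 1 => seq (movs r l n) (seq (const (n + r) 0) (word .add (n + r) (n + r) (l + n)))

end RamProg

section Subroutine

variable {K : Type*} [CommSemiring K] [LinearOrder K]

open RamState

theorem movs_exec {κ W r l : ℕ} (S : RamState K) (hW : 0 < W) : ∀ n, l + n ≤ r →
    (∀ j < n, S.reg (l + j) < W) → ∃ S', RamExec κ W (RamProg.movs r l n) S S' (1 + 2 * n) ∧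
      (∀ j < n, S'.reg (j + r) = S.reg (l + j)) ∧ (∀ j, j < r ∨ r + n ≤ j → S'.reg j = S.reg j) ∧
      S'.arr = S.arr ∧ S'.kreg = S.kreg ∧ S'.karr = S.karr
  | 0 => fun _ _ => ⟨S, .skip _, by simp, by simp, rfl, rfl, rfl⟩
  | n + 1 => fun hl hv => by
    obtain ⟨S1, e1, v1, u1, h1, h2, h3⟩ := movs_exec (κ := κ) (r := r) S hW n (by omega)
      fun j hj => hv j (by omega)
    have hv' : S1.reg (l + n) = S.reg (l + n) := u1 _ (by omega)
    have e2 := RamExec.word (κ := κ) (W := W) (S1.setReg (n + r) 0) .add (n + r) (n + r) (l + n)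
      (by simpa [WordOp.eval, show l + n ≠ n + r by omega, hv'] using hv n (by omega))
    have e3 := RamExec.seq e1 (.seq (.const _ _ _ hW) e2)
    refine ⟨_, e3, fun j hj => ?_, fun j hj => ?_, by simp only [setReg_arr, h1],
      by simp only [setReg_kreg, h2], by simp only [setReg_karr, h3]⟩
    · by_cases h : j = n
      · subst h
        simp [WordOp.eval, show l + j ≠ j + r by omega, hv']
      · simp [h, v1 j (by omega)]
    · simp [show j ≠ n + r by omega, u1 j (by omega)]

/-- Run `G`, which prepares the input of `P`, and then `P` on renamed registers and arrays. -/
theorem exec_prepare (G : Stmt) (P : RamProg) (l ao n r₀ : ℕ) : ∃ (r : ℕ) (P' : RamProg) (c : ℕ),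
    r₀ ≤ r ∧ ∀ (κ W T t : ℕ) (S₀ s₀ s : RamState K), 1 ≤ κ → 2 < W →
    (∀ j ≥ r₀, S₀.reg j = 0 ∧ S₀.kreg j = 0) →
    (∀ j ≥ n, s₀.reg j = 0) → (∀ j, s₀.kreg j = 0) →
    Sp κ W G S₀ T (fun s' => (∀ j, s'.arr (j + ao) = s₀.arr j) ∧
      (∀ j, s'.karr (j + ao) = s₀.karr j) ∧ ∀ j < n, s'.reg (l + j) = s₀.reg j ∧ s₀.reg j < W) →
    RamExec κ W P s₀ s t →
    ∃ S t', RamExec κ W P' S₀ S t' ∧ t' ≤ c * (T + 1) + t ∧ S.view r ao = s ∧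
      SameBelow r₀ ao (G.run S₀) S := by
  set b := max (max G.bound (l + n)) r₀ with hb
  -- The renamed program lives above everything that the compiled `G` writes. So, apart from the `n`
  -- registers that are moved there, its registers are still zero, as in a genuine initial state.
  set r := max b (G.compile b).regBound with hr
  refine ⟨r, .seq (G.compile b) (.seq (.movs r l n) (P.shift r ao)), G.len + 1 + 2 * n,
    by omega, ?_⟩
  intro κ W T t S₀ s₀ s hκ hW hS h0 hk0 ⟨ok, hT, q1, q2, q3⟩ hP
  obtain ⟨S1, t1, e1, l1, a1, -⟩ := G.compile_exec (b := b) (d := b) hκ hW le_rfl (by omega)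
    (S := S₀) (s := S₀) ⟨fun _ _ => rfl, fun _ _ => rfl, rfl, rfl⟩ ok
  obtain ⟨S2, e2, v2, u2, h1, h2, h3⟩ := movs_exec (κ := κ) (W := W) (r := r) (l := l) S1 (by omega)
    n (by omega) fun j hj => by rw [a1.reg _ (by omega), (q3 j hj).1]; exact (q3 j hj).2
  have hv : S2.view r ao = s₀ := by
    refine eq_of_fields ?_ ?_ ?_ ?_
    · ext j
      simp only [view]
      by_cases hj : j < n
      · rw [v2 j hj, a1.reg _ (by omega), (q3 j hj).1]
      · rw [u2 _ (by omega), (e1.untouched _ (by omega)).1, h0 j (by omega)]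
        exact (hS _ (by omega)).1
    · ext j; simp [view, h1, a1.arr, q1]
    · ext j; simp only [view]; rw [h2, (e1.untouched _ (by omega)).2, hk0]
      exact (hS _ (by omega)).2
    · ext j; simp [view, h3, a1.karr, q2]
  obtain ⟨S3, e3, v3, b3⟩ := hP.shift S2 hv
  refine ⟨S3, _, .seq e1 (.seq e2 e3), ?_, v3, ?_⟩
  · have : t1 ≤ G.len * T := l1.trans (Nat.mul_le_mul_left _ hT)
    nlinarith [Nat.zero_le ((1 + 2 * n) * T)]
  · refine SameBelow.trans ⟨fun j hj => ?_, fun j hj => ?_, fun j hj => ?_, fun j hj => ?_⟩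
      ⟨fun j hj => b3.reg j (by omega), fun j hj => b3.kreg j (by omega), b3.arr, b3.karr⟩
    · rw [u2 j (by omega), a1.reg j (by omega)]
    · rw [h2, a1.kreg j (by omega)]
    · rw [h1, a1.arr]
    · rw [h3, a1.karr]

/-- Adjust the index by `G`, run `A` on renamed registers and arrays, and edit the output
by `H`. -/
theorem exec_access (G H : Stmt) (A : RamProg) (r₀ ao : ℕ)
    (hG : (G.compile (max G.bound 1)).regBound ≤ r₀) (hGr : max G.bound 1 ≤ r₀) :
    ∃ (A' : RamProg) (c : ℕ), ∀ (κ W T T' t i : ℕ) (S s s' : RamState K) (Q : RamState K → Prop),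
    1 ≤ κ → 2 < W → S.view r₀ ao = s →
    -- `Q` may depend only on what the output convention reads, since the compiled `H` leaves
    -- arbitrary values in its scratch registers.
    (∀ S S' : RamState K, S.reg 0 = S'.reg 0 → S.kreg 0 = S'.kreg 0 → S.arr = S'.arr →
      Q S → Q S') →
    Sp κ W G S T (fun S' => S'.reg 0 = i ∧ S'.arr = S.arr ∧ S'.karr = S.karr) → i < W →
    RamExec κ W A (s.setReg 0 i) s' t →
    (∀ S', S'.view r₀ ao = s' → SameBelow 0 ao S S' → Sp κ W H S' T' Q) →
    ∃ S' t', RamExec κ W A' S S' t' ∧ t' ≤ c * (T + T' + 1) + t ∧ Q S' := by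
  set b := max H.bound 1 with hb
  set d := max G.bound 1 with hd
  refine ⟨.seq (G.compile d) (.seq (.movs r₀ 0 1) (.seq (A.shift r₀ ao) (H.compile b))),
      G.len + H.len + 3, ?_⟩
  intro κ W T T' t i S s s' Q hκ hW hS hQ ⟨ok, hT, q1, q2, q3⟩ hi hA hH
  obtain ⟨S1, t1, e1, l1, a1, -⟩ := G.compile_exec (b := d) (d := d) hκ hW le_rfl (by omega)
    (S := S) (s := S) ⟨fun _ _ => rfl, fun _ _ => rfl, rfl, rfl⟩ ok
  obtain ⟨S2, e2, v2, u2, h1, h2, h3⟩ := movs_exec (κ := κ) (W := W) (r := r₀) (l := 0) S1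
    (by omega) 1 (by omega) fun j hj => by
      obtain rfl : j = 0 := by omega
      rw [a1.reg _ (by omega)]; simpa [q1] using hi
  have hv : S2.view r₀ ao = s.setReg 0 i := by
    rw [← hS]
    refine eq_of_fields ?_ ?_ ?_ ?_
    · ext j
      simp only [view, setReg_reg]
      by_cases hj : j = 0
      · subst hj
        rw [v2 0 (by omega), a1.reg _ (by omega)]; simpa using q1
      · rw [u2 _ (by omega), (e1.untouched _ (by omega)).1, if_neg hj]
    · ext j; simp [view, h1, a1.arr, q2]
    · ext j; simp only [view, setReg_kreg]; rw [h2, (e1.untouched _ (by omega)).2]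
    · ext j; simp [view, h3, a1.karr, q3]
  obtain ⟨S3, e3, v3, b3⟩ := hA.shift S2 hv
  obtain ⟨ok4, hT4, q4⟩ := hH S3 v3 ⟨by simp, by simp,
    fun j hj => by rw [b3.arr j hj, h1, a1.arr, q2],
    fun j hj => by rw [b3.karr j hj, h3, a1.karr, q3]⟩
  obtain ⟨S4, t4, e4, l4, a4, -⟩ := H.compile_exec (b := b) (d := b) hκ hW le_rfl (by omega)
    (S := S3) (s := S3) ⟨fun _ _ => rfl, fun _ _ => rfl, rfl, rfl⟩ ok4
  refine ⟨S4, _, .seq e1 (.seq e2 (.seq e3 e4)), ?_,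
    hQ _ _ (a4.reg 0 (by omega)).symm (a4.kreg 0 (by omega)).symm a4.arr.symm q4⟩
  have x1 : t1 ≤ G.len * T := l1.trans (Nat.mul_le_mul_left _ hT)
  have x2 : t4 ≤ H.len * T' := l4.trans (Nat.mul_le_mul_left _ hT4)
  nlinarith [Nat.zero_le (G.len * T'), Nat.zero_le (H.len * T)]
end Subroutine

open RamState

/-! ## Loops over the facts of a relation -/

section Rows

variable {K : Type*}

/-- Array `A` holds the rows one after the other, `K`-array `A` their annotations, and register
`l` their number. -/
structure Holds [Zero K] (s : RamState K) (A l : ℕ) (rows : List (List ℕ × K)) : Prop where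
  reg : s.reg l = rows.length
  arr : ∀ p, s.arr A p = (rows.map Prod.fst).flatten.getD p 0
  karr : ∀ p, s.karr A p = (rows.map Prod.snd).getD p 0

theorem Holds.congr [Zero K] {s s' : RamState K} {A l : ℕ} {rows : List (List ℕ × K)}
    (h : Holds s A l rows) (h1 : s'.reg l = s.reg l) (h2 : s'.arr A = s.arr A)
    (h3 : s'.karr A = s.karr A) : Holds s' A l rows :=
  ⟨h1.trans h.reg, fun p => by rw [h2, h.arr], fun p => by rw [h3, h.karr]⟩

theorem List.flatten_getD_uniform {ar : ℕ} : ∀ (rows : List (List ℕ)), (∀ t ∈ rows, t.length = ar) →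
    ∀ i p, p < ar → rows.flatten.getD (i * ar + p) 0 = (rows.getD i []).getD p 0
  | [], _, i, p, hp => by simp
  | t :: rows, h, i, p, hp => by
    have ht : t.length = ar := h t (by simp)
    cases i with
    | zero =>
      rw [List.flatten_cons, List.getD_append _ _ _ _ (by omega)]
      simp
    | succ i =>
      rw [List.flatten_cons, List.getD_append_right _ _ _ _ (by rw [ht, Nat.succ_mul]; omega)]
      rw [show (i + 1) * ar + p - t.length = i * ar + p by rw [ht, Nat.succ_mul]; omega]
      rw [List.flatten_getD_uniform rows (fun t' h' => h t' (by simp [h'])) i p hp]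
      simp

theorem List.length_flatten_uniform {ar : ℕ} (rows : List (List ℕ))
    (h : ∀ t ∈ rows, t.length = ar) : rows.flatten.length = rows.length * ar := by
  induction rows with
  | nil => simp
  | cons t rows ih =>
    rw [List.flatten_cons, List.length_append, ih fun t' h' => h t' (by simp [h']), h t (by simp),
      List.length_cons, Nat.succ_mul, add_comm]

end Rows

/-! ### Writing tuples to arrays -/

section Store

variable {K : Type*} [CommSemiring K]

/-- Store the values of the expressions in array `A` from position `i + p` on. -/
def storeList (A : ℕ) (i : Ex) : ℕ → List Ex → Stmt
  | _, [] => .skip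
  | p, e :: es => .seq (.store A (.op .add i (.cst p)) e) (storeList A i (p + 1) es)

/-- `s'` differs from `s` at most in the array `A`. -/
structure SameExcept (A : ℕ) (s s' : RamState K) : Prop where
  reg : s'.reg = s.reg
  kreg : s'.kreg = s.kreg
  karr : s'.karr = s.karr
  arr : ∀ B ≠ A, s'.arr B = s.arr B

/-- The later expressions are evaluated after earlier stores to `A`. Their values are therefore
prescribed in all states that differ from `s` in the array `A` only. -/
theorem storeList_spec {κ W A v : ℕ} {i : Ex} : ∀ (es : List Ex) (xs : List ℕ) (p : ℕ)
    (s : RamState K),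
    (∀ s', SameExcept A s s' → i.Ok W s' ∧ i.eval s' = v) →
    (∀ s', SameExcept A s s' → List.Forall₂ (fun e x => e.Ok W s' ∧ e.eval s' = x) es xs) →
    v + p + es.length < W →
    Sp κ W (storeList A i p es) s (es.length + 1) fun s' => SameExcept A s s' ∧
      ∀ j, s'.arr A j = if v + p ≤ j ∧ j < v + p + xs.length then xs.getD (j - (v + p)) 0
        else s.arr A j
  | [], xs, p, s, _, h, _ => by
    have := h s ⟨rfl, rfl, rfl, fun _ _ => rfl⟩
    rw [List.forall₂_nil_left_iff] at this
    subst this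
    exact (Sp.skip ⟨⟨rfl, rfl, rfl, fun _ _ => rfl⟩, fun j => by
      rw [if_neg]; simp⟩).mono (by simp)
  | e :: es, xs, p, s, hi, h, hW => by
    have h0 := h s ⟨rfl, rfl, rfl, fun _ _ => rfl⟩
    have hi0 := hi s ⟨rfl, rfl, rfl, fun _ _ => rfl⟩
    rw [List.forall₂_cons_left_iff] at h0
    obtain ⟨x, ys, hx, -, rfl⟩ := h0
    rw [List.length_cons] at hW ⊢
    refine (Sp.seq (T := 1) (T' := es.length + 1)
      (Q := fun s' => s' = s.setArr A (v + p) x) (Sp.store ?_ hx.1 ?_) ?_).mono (by omega)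
    · exact ⟨hi0.1, by simp only [Ex.Ok]; omega, by
        simp only [WordOp.eval, Ex.eval, hi0.2]; omega⟩
    · simp [Ex.eval, WordOp.eval, hi0.2, hx.2]
    · rintro s' rfl
      have hs : ∀ s', SameExcept A (s.setArr A (v + p) x) s' → SameExcept A s s' := fun s' h' =>
        ⟨h'.reg, h'.kreg, h'.karr, fun B hB => by
          rw [h'.arr B hB]; ext j; simp [hB]⟩
      refine (storeList_spec es ys (p + 1) _ (fun s' h' => hi s' (hs s' h'))
        (fun s' h' => (List.forall₂_cons.1 (h s' (hs s' h'))).2) (by omega)).conseq le_rfl ?_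
      rintro s' ⟨h1, h2⟩
      refine ⟨hs s' h1, fun j => ?_⟩
      rw [h2 j, List.length_cons]
      by_cases hj : j = v + p
      · subst hj
        rw [if_neg (by omega), if_pos (by omega)]
        simp
      · by_cases hj2 : v + p ≤ j ∧ j < v + p + (ys.length + 1)
        · rw [if_pos (by omega), if_pos hj2]
          obtain ⟨m, rfl⟩ : ∃ m, j = v + p + (m + 1) := ⟨j - (v + p) - 1, by omega⟩
          rw [show v + p + (m + 1) - (v + (p + 1)) = m by omega,
            show v + p + (m + 1) - (v + p) = m + 1 by omega, List.getD_cons_succ]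
        · rw [if_neg (by omega), if_neg hj2]
          simp [hj]

end Store

/-! ### Computing new relations row by row -/

section Transduce

variable {K : Type*}

/-- For each row of a relation whose number of rows is in register `src`: if the condition holds,
output a row with the given fields and the given annotation. -/
structure RowSpec where
  src : ℕ
  test : Ex
  fields : List Ex
  val : KEx

/-- Append a row to the rows held by `A` and `l`. -/
def appendRow (A l : ℕ) (es : List Ex) (v : KEx) : Stmt :=
  .seq (storeList A (.op .mul (.reg l) (.cst es.length)) 0 es)
    (.seq (.kstore A (.reg l) v) (.set l (.op .add (.reg l) (.cst 1))))

def RowSpec.prog (ρ : RowSpec) (c A l : ℕ) : Stmt :=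
  .loop c (.reg ρ.src) (.cond ρ.test (appendRow A l ρ.fields ρ.val) .skip)

/-- `s'` differs from `s` at most in the arrays `A` and the registers `c` and `l`. -/
structure Frame (c A l : ℕ) (s s' : RamState K) : Prop where
  reg : ∀ r, r ≠ c → r ≠ l → s'.reg r = s.reg r
  kreg : s'.kreg = s.kreg
  arr : ∀ B ≠ A, s'.arr B = s.arr B
  karr : ∀ B ≠ A, s'.karr B = s.karr B

/-- In the state `s` the expressions evaluate to the row. -/
structure EvalsTo [CommSemiring K] (W : ℕ) (s : RamState K) (es : List Ex) (v : KEx) (row : List ℕ × K) : Prop where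
  fields : List.Forall₂ (fun e x => e.Ok W s ∧ e.eval s = x) es row.1
  val_ok : v.Ok W s
  val : v.eval s = row.2

/-- In the state `s` the specification yields the given result for the current row. -/
def RowSpec.Yields [CommSemiring K] (ρ : RowSpec) (W : ℕ) (s : RamState K) (o : Option (List ℕ × K)) : Prop :=
  ρ.test.Ok W s ∧ (o = none → ρ.test.eval s = 0) ∧
    ∀ row, o = some row → ρ.test.eval s ≠ 0 ∧ EvalsTo W s ρ.fields ρ.val row

theorem appendRow_spec [CommSemiring K] {κ W c A l : ℕ} {es : List Ex} {v : KEx} {row : List ℕ × K}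
    {rows : List (List ℕ × K)} {s : RamState K} (hH : Holds s A l rows)
    (hrows : ∀ r ∈ rows, r.1.length = es.length)
    (hev : ∀ s', Frame c A l s s' → s'.reg c = s.reg c → EvalsTo W s' es v row)
    (hW : (rows.length + 1) * (es.length + 1) < W) :
    Sp κ W (appendRow A l es v) s (es.length + 2 + κ) fun s' =>
      Frame c A l s s' ∧ Holds s' A l (rows ++ [row]) := by
  have e1 : rows.length * es.length + es.length + rows.length + 1 < W := by
    calc _ = (rows.length + 1) * (es.length + 1) := by ring
      _ < W := hW
  have hlen : row.1.length = es.length :=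
    ((hev s ⟨fun _ _ _ => rfl, rfl, fun _ _ => rfl, fun _ _ => rfl⟩ rfl).fields.length_eq).symm
  have hfr : ∀ s', SameExcept A s s' → Frame c A l s s' := fun s' h =>
    ⟨fun r _ _ => by rw [h.reg], h.kreg, h.arr, fun B _ => by rw [h.karr]⟩
  refine (Sp.seq (T := es.length + 1) (T' := κ + 1) (storeList_spec (v := rows.length * es.length)
    es row.1 0 s (fun s' h => ?_) (fun s' h => (hev s' (hfr s' h) (by rw [h.reg])).fields)
    (by omega)) ?_).mono (by omega)
  · have : s'.reg l = rows.length := by rw [h.reg, hH.reg]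
    simp only [Ex.Ok, Ex.eval, WordOp.eval, this]
    refine ⟨⟨by omega, ?_, by omega⟩, trivial⟩
    nlinarith
  · rintro s1 ⟨f1, a1⟩
    have hl1 : s1.reg l = rows.length := by rw [f1.reg, hH.reg]
    refine Sp.seq (Q := fun s2 => s2 = s1.setKarr A rows.length row.2) (Sp.kstore ?_ ?_ ?_) ?_
    · simp only [Ex.Ok, hl1]; omega
    · exact (hev s1 (hfr s1 f1) (by rw [f1.reg])).val_ok
    · simp only [Ex.eval, hl1, (hev s1 (hfr s1 f1) (by rw [f1.reg])).val]
    · rintro s2 rfl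
      refine Sp.set ?_ ?_
      · simp only [Ex.Ok, Ex.eval, setKarr_reg, hl1, WordOp.eval]; omega
      · refine ⟨⟨fun r h1 h2 => ?_, ?_, fun B hB => ?_, fun B hB => ?_⟩, ?_, fun p => ?_, fun p => ?_⟩
        · simp [h2, f1.reg]
        · simp [f1.kreg]
        · simp [f1.arr B hB]
        · ext j; simp [hB, f1.karr]
        · simp [Ex.eval, WordOp.eval, hl1]
        · have hfl : (rows.map Prod.fst).flatten.length = rows.length * es.length := by
            rw [List.length_flatten_uniform (ar := es.length)]
            · simp
            · intro t ht
              obtain ⟨r, hr, rfl⟩ := List.mem_map.1 ht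
              exact hrows r hr
          simp only [setReg_arr, setKarr_arr, a1 p, add_zero, hlen]
          rw [List.map_append, List.flatten_append]
          by_cases h1 : p < rows.length * es.length
          · rw [if_neg (by omega), hH.arr, List.getD_append _ _ _ _ (by omega)]
          · rw [List.getD_append_right _ _ _ _ (by omega), hfl]
            by_cases h2 : p < rows.length * es.length + es.length
            · rw [if_pos (by omega)]; simp
            · rw [if_neg (by omega), hH.arr, List.getD_eq_default _ _ (by omega),
                List.getD_eq_default _ _ (by simp; omega)]
        · simp only [setReg_karr, setKarr_karr, f1.karr, true_and, hH.karr]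
          rw [List.map_append]
          by_cases h1 : p < rows.length
          · rw [if_neg (by omega), List.getD_append _ _ _ _ (by simpa)]
          · rw [List.getD_append_right _ _ _ _ (by simp; omega)]
            by_cases h2 : p = rows.length
            · simp [h2]
            · rw [if_neg h2, List.getD_eq_default _ _ (by simp; omega),
                List.getD_eq_default _ _ (by simp; omega)]

theorem Frame.trans {c A l : ℕ} {s s' s'' : RamState K} (h : Frame c A l s s')
    (h' : Frame c A l s' s'') : Frame c A l s s'' :=
  ⟨fun r h1 h2 => (h'.reg r h1 h2).trans (h.reg r h1 h2), h'.kreg.trans h.kreg,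
    fun B hB => (h'.arr B hB).trans (h.arr B hB), fun B hB => (h'.karr B hB).trans (h.karr B hB)⟩

/-- `g i` is the row, if any, that arises from row `i` of the source. It is prescribed for all
states that the loop can reach, that is, up to changes of the output and the counter. -/
theorem RowSpec.prog_spec [CommSemiring K] {κ W c A l N : ℕ} (hκ : 1 ≤ κ) (ρ : RowSpec) {s : RamState K}
    (hcl : c ≠ l) (hN : s.reg ρ.src = N) (g : ℕ → Option (List ℕ × K))
    (hg : ∀ i < N, ∀ s', Frame c A l s s' → s'.reg c = i → ρ.Yields W s' (g i))
    (h0 : Holds s A l []) (hW : (N + 1) * (ρ.fields.length + 1) < W) :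
    Sp κ W (ρ.prog c A l) s (1 + N * ((ρ.fields.length + 5) * κ)) fun s' =>
      Frame c A l s s' ∧ Holds s' A l ((List.range N).filterMap g) := by
  have hNW : N < W := by nlinarith
  refine (Sp.loop (e := .reg ρ.src) (T := 1 + (ρ.fields.length + 2 + κ)) (n := N)
    (fun i s' => Frame c A l s s' ∧ Holds s' A l ((List.range i).filterMap g)) ?_ hN ?_ ?_).mono ?_
  · simpa [Ex.Ok, hN] using hNW
  · exact ⟨⟨fun _ _ _ => rfl, rfl, fun _ _ => rfl, fun _ _ => rfl⟩, by simpa using h0⟩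
  · rintro i hi s1 ⟨f1, H1⟩
    have f2 : Frame c A l s (s1.setReg c i) := f1.trans
      ⟨fun r h1 h2 => by simp [h1], rfl, fun _ _ => rfl, fun _ _ => rfl⟩
    have H2 : Holds (s1.setReg c i) A l ((List.range i).filterMap g) :=
      H1.congr (by simp [hcl.symm]) rfl rfl
    have hy := hg i hi _ f2 (by simp)
    rw [List.range_succ, List.filterMap_append]
    refine Sp.cond hy.1 (fun hne => ?_) (fun he => ?_)
    · obtain ⟨row, hrow⟩ : ∃ row, g i = some row := by
        cases hgi : g i with
        | none => exact absurd (hy.2.1 hgi) hne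
        | some row => exact ⟨row, rfl⟩
      refine (appendRow_spec (c := c) H2 ?_ (row := row) ?_ ?_).conseq le_rfl ?_
      · intro r hr
        obtain ⟨j, hj, hjr⟩ := List.mem_filterMap.1 hr
        rw [List.mem_range] at hj
        have := (hg j (by omega) ((s1.setReg c j)) (f1.trans
          ⟨fun r h1 h2 => by simp [h1], rfl, fun _ _ => rfl, fun _ _ => rfl⟩) (by simp)).2.2 r hjr
        exact this.2.fields.length_eq.symm
      · intro s' h1 h2
        exact ((hg i hi s' (f2.trans h1) (by rw [h2]; simp)).2.2 row hrow).2
      · have : ((List.range i).filterMap g).length ≤ i :=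
          (List.length_filterMap_le _ _).trans (by simp)
        calc _ ≤ (N + 1) * (ρ.fields.length + 1) := Nat.mul_le_mul_right _ (by omega)
          _ < W := hW
      · rintro s' ⟨h1, h2⟩
        refine ⟨f2.trans h1, ?_⟩
        simpa [hrow] using h2
    · have : g i = none := by
        cases hgi : g i with
        | none => rfl
        | some row => exact absurd he (hy.2.2 row hgi).1
      refine (Sp.skip ⟨f2, ?_⟩).mono (by omega)
      simpa [this] using H2
  · gcongr
    nlinarith

/-- Run the specifications one after the other, with consecutive output arrays and registers. -/
def transduceAll (c : ℕ) : ℕ → ℕ → List RowSpec → Stmt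
  | _, _, [] => .skip
  | A, l, ρ :: ρs => .seq (ρ.prog c A l) (transduceAll c (A + 1) (l + 1) ρs)

/-- `s'` agrees with `s` on the registers below `l` except `c`, and on the arrays below `A`. -/
structure Below (c A l : ℕ) (s s' : RamState K) : Prop where
  reg : ∀ r < l, r ≠ c → s'.reg r = s.reg r
  kreg : s'.kreg = s.kreg
  arr : ∀ B < A, s'.arr B = s.arr B
  karr : ∀ B < A, s'.karr B = s.karr B

theorem Below.trans {c A l : ℕ} {s s' s'' : RamState K} (h : Below c A l s s')
    (h' : Below c A l s' s'') : Below c A l s s'' :=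
  ⟨fun r h1 h2 => (h'.reg r h1 h2).trans (h.reg r h1 h2), h'.kreg.trans h.kreg,
    fun B hB => (h'.arr B hB).trans (h.arr B hB), fun B hB => (h'.karr B hB).trans (h.karr B hB)⟩

/-- All results refer to one state `s₀`: outputs are placed from `A₀` and `l₀` on, and what a
specification yields is the same in all states that agree with `s₀` below. Hence the new relations
are computed independently of each other. -/
theorem transduceAll_spec [CommSemiring K] {κ W c A₀ l₀ X ar : ℕ} (hκ : 1 ≤ κ) (hcl : c < l₀) {s₀ : RamState K}
    (hX : (X + 1) * (ar + 1) < W) : ∀ (ρs : List RowSpec) (gs : List (ℕ → Option (List ℕ × K)))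
    (A l : ℕ) (s : RamState K), A₀ ≤ A → l₀ ≤ l →
    List.Forall₂ (fun (ρ : RowSpec) (g : ℕ → Option (List ℕ × K)) =>
      ρ.src < l₀ ∧ ρ.src ≠ c ∧ s₀.reg ρ.src ≤ X ∧ ρ.fields.length ≤ ar ∧
      ∀ i < s₀.reg ρ.src, ∀ s', Below c A₀ l₀ s₀ s' → s'.reg c = i → ρ.Yields W s' (g i)) ρs gs →
    Below c A₀ l₀ s₀ s → (∀ B ≥ A, ∀ i, s.arr B i = 0 ∧ s.karr B i = 0) →
    (∀ r ≥ l, s.reg r = 0) →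
    Sp κ W (transduceAll c A l ρs) s (1 + ρs.length * (1 + X * ((ar + 5) * κ))) fun s' =>
      Below c A l s s' ∧
      (∀ j ρ g, ρs[j]? = some ρ → gs[j]? = some g →
        Holds s' (A + j) (l + j) ((List.range (s₀.reg ρ.src)).filterMap g)) ∧
      (∀ B ≥ A + ρs.length, ∀ i, s'.arr B i = 0 ∧ s'.karr B i = 0) ∧
      ∀ r ≥ l + ρs.length, s'.reg r = 0
  | [], gs, A, l, s, _, _, _, _, h0, h0' =>
    (Sp.skip ⟨⟨fun _ _ _ => rfl, rfl, fun _ _ => rfl, fun _ _ => rfl⟩, by simp, by simpa using h0,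
      by simpa using h0'⟩).mono (by simp)
  | ρ :: ρs, gs, A, l, s, hA, hl, hF, hs, h0, h0' => by
    rw [List.forall₂_cons_left_iff] at hF
    obtain ⟨g, gs, ⟨c1, c2, c3, c4, c5⟩, hF, rfl⟩ := hF
    have hreg : s.reg ρ.src = s₀.reg ρ.src := hs.reg _ c1 c2
    refine (Sp.seq (RowSpec.prog_spec (c := c) (A := A) (l := l) hκ ρ (by omega) hreg g
      (fun i hi s' hf hc => c5 i hi s' (hs.trans ⟨fun r h1 h2 => hf.reg r h2 (by omega), hf.kreg,
        fun B hB => hf.arr B (by omega), fun B hB => hf.karr B (by omega)⟩) hc)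
      ⟨by simpa using h0' l le_rfl, fun p => by simpa using (h0 A le_rfl p).1,
        fun p => by simpa using (h0 A le_rfl p).2⟩ ?_)
      (T' := 1 + ρs.length * (1 + X * ((ar + 5) * κ))) (Q' := ?_) ?_).mono ?_
    · refine lt_of_le_of_lt ?_ hX
      gcongr
    · rintro s1 ⟨f1, H1⟩
      have b1 : Below c A l s s1 := ⟨fun r h1 h2 => f1.reg r h2 (by omega), f1.kreg,
        fun B hB => f1.arr B (by omega), fun B hB => f1.karr B (by omega)⟩
      refine (transduceAll_spec hκ hcl hX ρs gs (A + 1) (l + 1) s1 (by omega) (by omega) hF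
        (hs.trans ⟨fun r h1 h2 => b1.reg r (by omega) h2, b1.kreg,
          fun B hB => b1.arr B (by omega), fun B hB => b1.karr B (by omega)⟩)
        (fun B hB i => ?_) (fun r hr => ?_)).conseq le_rfl ?_
      · rw [f1.arr B (by omega), f1.karr B (by omega)]; exact h0 B (by omega) i
      · rw [f1.reg r (by omega) (by omega)]; exact h0' r (by omega)
      · rintro s2 ⟨b2, H2, z2, z2'⟩
        refine ⟨b1.trans ⟨fun r h1 h2 => b2.reg r (by omega) h2, b2.kreg,
          fun B hB => b2.arr B (by omega), fun B hB => b2.karr B (by omega)⟩, ?_, ?_, ?_⟩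
        · intro j ρ' g' h1 h2
          cases j with
          | zero =>
            simp only [List.getElem?_cons_zero, Option.some.injEq] at h1 h2
            subst h1 h2
            exact H1.congr (b2.reg _ (by omega) (by omega)) (b2.arr _ (by omega))
              (b2.karr _ (by omega))
          | succ j =>
            have := H2 j ρ' g' (by simpa using h1) (by simpa using h2)
            rwa [show A + 1 + j = A + (j + 1) by omega, show l + 1 + j = l + (j + 1) by omega]
              at this
        · intro B hB; exact z2 B (by rw [List.length_cons] at hB; omega)
        · intro r hr; exact z2' r (by rw [List.length_cons] at hr; omega)
    · have : s₀.reg ρ.src * ((ρ.fields.length + 5) * κ) ≤ X * ((ar + 5) * κ) := by gcongr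
      rw [List.length_cons, Nat.succ_mul]
      linarith

end Transduce

/-! ## Codes of tuples and access to the fields of a row -/

theorem Ex.Ok.mono {K : Type*} {W W' : ℕ} (hW : W ≤ W') {s : RamState K} {e : Ex}
    (h : e.Ok W s) : e.Ok W' s := by
  induction e with
  | reg r => exact lt_of_lt_of_le (show s.reg r < W from h) hW
  | cst c => exact lt_of_lt_of_le (show c < W from h) hW
  | op o x y hx hy => exact ⟨hx h.1, hy h.2.1, h.2.2.trans_le hW⟩
  | load A x hx => exact ⟨hx h.1, h.2.trans_le hW⟩

theorem KEx.Ok.mono {K : Type*} {W W' : ℕ} (hW : W ≤ W') {s : RamState K}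
    {e : KEx} (h : e.Ok W s) : e.Ok W' s := by
  induction e with
  | load A x => exact Ex.Ok.mono hW h
  | add x y hx hy => exact ⟨hx h.1, hy h.2⟩
  | mul x y hx hy => exact ⟨hx h.1, hy h.2⟩
  | _ => trivial

theorem Stmt.Ok.mono {K : Type*} [CommSemiring K] {W W' : ℕ} (hW : W ≤ W') {p : Stmt} :
    ∀ {s : RamState K}, p.Ok W s → p.Ok W' s := by
  induction p with
  | skip => exact fun h => h
  | set r e => exact fun h => Ex.Ok.mono hW h
  | store A i e => exact fun h => ⟨h.1.mono hW, h.2.mono hW⟩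
  | kset r e => exact fun h => KEx.Ok.mono hW h
  | kstore A i e => exact fun h => ⟨h.1.mono hW, h.2.mono hW⟩
  | seq p q hp hq => exact fun h => ⟨hp h.1, hq h.2⟩
  | cond e p q hp hq =>
    intro s h
    refine ⟨h.1.mono hW, ?_⟩
    have := h.2
    split_ifs with h0
    · rw [if_pos h0] at this; exact hp this
    · rw [if_neg h0] at this; exact hq this
  | loop r e p hp => exact fun h => ⟨h.1.mono hW, fun i hi => hp (h.2 i hi)⟩
  | size r e => exact fun h => Ex.Ok.mono hW h

theorem Sp.mono_word {K : Type*} [CommSemiring K] {κ W W' T : ℕ} (hW : W ≤ W') {p : Stmt}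
    {s : RamState K} {Q : RamState K → Prop} (h : Sp κ W p s T Q) : Sp κ W' p s T Q :=
  ⟨h.1.mono hW, h.2⟩

/-- Since `(a + b)² ≤ pairCode a b < (a + b + 1)²`, the code determines `a + b`, and then `b`.
Unlike for triangular numbers, no division is needed. -/
def pairCode (a b : ℕ) : ℕ := (a + b) * (a + b) + b

theorem pairCode_inj {a b a' b' : ℕ} (h : pairCode a b = pairCode a' b') : a = a' ∧ b = b' := by
  unfold pairCode at h
  have key : ∀ {a b a' b' : ℕ}, (a + b) * (a + b) + b = (a' + b') * (a' + b') + b' →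
      ¬ a + b < a' + b' := by
    intro a b a' b' h hlt
    have : (a + b + 1) * (a + b + 1) ≤ (a' + b') * (a' + b') := Nat.mul_le_mul hlt hlt
    nlinarith
  have h1 := key h
  have h2 := key h.symm
  have h3 : a + b = a' + b' := by omega
  rw [h3] at h
  omega

theorem pairCode_lt {M k k' a b : ℕ} (hM : 2 ≤ M) (ha : a < M ^ k) (hb : b < M ^ k') :
    pairCode a b < M ^ (2 * (k + k' + 1) + 1) := by
  have h1 : M ^ k ≤ M ^ (k + k') := Nat.pow_le_pow_right (by omega) (by omega)
  have h2 : M ^ k' ≤ M ^ (k + k') := Nat.pow_le_pow_right (by omega) (by omega)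
  have h3 : a + b < M ^ (k + k' + 1) := by rw [pow_succ]; nlinarith
  have h4 : pairCode a b < 2 * (M ^ (k + k' + 1) * M ^ (k + k' + 1)) := by
    unfold pairCode; nlinarith
  calc _ < 2 * (M ^ (k + k' + 1) * M ^ (k + k' + 1)) := h4
    _ ≤ M * (M ^ (k + k' + 1) * M ^ (k + k' + 1)) := Nat.mul_le_mul_right _ hM
    _ = _ := by ring

/-- Injective on lists of equal length only; for instance, `[]` and `[0]` both have the code `0`. -/
def listCode : List ℕ → ℕ
  | [] => 0
  | x :: xs => pairCode x (listCode xs)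

theorem listCode_inj : ∀ {xs ys : List ℕ}, xs.length = ys.length → listCode xs = listCode ys →
    xs = ys
  | [], [], _, _ => rfl
  | x :: xs, y :: ys, h, h' => by
    obtain ⟨h1, h2⟩ := pairCode_inj h'
    rw [h1, listCode_inj (by simpa using h) h2]

/-- An exponent for the codes of lists of length `r` with entries below `M ^ k`. -/
def codeExp (k : ℕ) : ℕ → ℕ
  | 0 => 1
  | r + 1 => 2 * (k + codeExp k r + 1) + 1

theorem listCode_lt {M k : ℕ} (hM : 2 ≤ M) : ∀ {xs : List ℕ}, (∀ x ∈ xs, x < M ^ k) →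
    listCode xs < M ^ codeExp k xs.length
  | [], _ => by simp [listCode, codeExp]; omega
  | x :: xs, h => pairCode_lt hM (h x (by simp)) (listCode_lt hM fun y hy => h y (by simp [hy]))

namespace Ex

def pair (x y : Ex) : Ex := .op .add (.op .mul (.op .add x y) (.op .add x y)) y

theorem pair_ok {K : Type*} {W : ℕ} {s : RamState K} {x y : Ex} (hx : x.Ok W s) (hy : y.Ok W s)
    (h : pairCode (x.eval s) (y.eval s) < W) :
    (x.pair y).Ok W s ∧ (x.pair y).eval s = pairCode (x.eval s) (y.eval s) := by
  refine ⟨?_, rfl⟩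
  unfold pairCode at h
  have h2 : x.eval s + y.eval s ≤ (x.eval s + y.eval s) * (x.eval s + y.eval s) :=
    Nat.le_mul_self _
  simp only [pair, Ok, eval, WordOp.eval]
  refine ⟨⟨⟨hx, hy, by omega⟩, ⟨hx, hy, by omega⟩, by omega⟩, hy, h⟩

def code : List Ex → Ex
  | [] => .cst 0
  | e :: es => e.pair (code es)

theorem code_ok {K : Type*} {W : ℕ} {s : RamState K} : ∀ {es : List Ex} {xs : List ℕ},
    List.Forall₂ (fun e x => e.Ok W s ∧ e.eval s = x) es xs → listCode xs < W →
    (code es).Ok W s ∧ (code es).eval s = listCode xs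
  | [], _, .nil, h => ⟨h, rfl⟩
  | e :: es, _, .cons (b := x) (l₂ := xs) h hs, hlt => by
    have hle : listCode xs ≤ listCode (x :: xs) := by
      simp only [listCode, pairCode]; omega
    obtain ⟨h1, h2⟩ := code_ok hs (hle.trans_lt hlt)
    have := pair_ok h.1 h1 (by rw [h.2, h2]; exact hlt)
    rw [h.2, h2] at this
    exact this

/-- The field `p` of the row, of arity `ar`, whose number is in register `c`. -/
def field (j ar c p : ℕ) : Ex := .load j (.op .add (.op .mul (.reg c) (.cst ar)) (.cst p))

theorem field_ok {K : Type*} [Zero K] {W j l ar c p i : ℕ} {s : RamState K}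
    {rows : List (List ℕ × K)} (h : Holds s j l rows) (hc : s.reg c = i) (hi : i < rows.length)
    (har : ∀ r ∈ rows, r.1.length = ar) (hp : p < ar) (hW : (rows.length + 1) * (ar + 1) < W)
    (hx : ∀ r ∈ rows, ∀ x ∈ r.1, x < W) :
    (field j ar c p).Ok W s ∧ (field j ar c p).eval s = (rows[i]'hi).1.getD p 0 := by
  have hev : (field j ar c p).eval s = (rows[i]'hi).1.getD p 0 := by
    simp only [field, eval, WordOp.eval, hc, h.arr]
    rw [List.flatten_getD_uniform _ (by
      intro t ht
      obtain ⟨r, hr, rfl⟩ := List.mem_map.1 ht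
      exact har r hr) i p hp]
    simp [List.getD_eq_getElem?_getD, hi]
  refine ⟨?_, hev⟩
  have h1 : i * ar + ar + i + 1 ≤ (rows.length + 1) * (ar + 1) := by
    have : (i + 1) * (ar + 1) ≤ (rows.length + 1) * (ar + 1) :=
      Nat.mul_le_mul_right _ (by omega)
    nlinarith
  refine ⟨⟨⟨?_, ?_, ?_⟩, ?_, ?_⟩, ?_⟩
  · simp only [Ok, hc]; omega
  · simp only [Ok]; omega
  · simp only [eval, hc, WordOp.eval]; omega
  · simp only [Ok]; omega
  · simp only [eval, hc, WordOp.eval]; omega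
  · change (field j ar c p).eval s < W
    rw [hev]
    have hl := har _ (List.getElem_mem hi)
    rw [List.getD_eq_getElem _ _ (by omega)]
    exact hx _ (List.getElem_mem hi) _ (List.getElem_mem _)

theorem fields_ok {K : Type*} [Zero K] {W j l ar c i : ℕ} {s : RamState K}
    {rows : List (List ℕ × K)} (h : Holds s j l rows) (hc : s.reg c = i) (hi : i < rows.length)
    (har : ∀ r ∈ rows, r.1.length = ar) (hW : (rows.length + 1) * (ar + 1) < W)
    (hx : ∀ r ∈ rows, ∀ x ∈ r.1, x < W) {ps : List ℕ} (hps : ∀ p ∈ ps, p < ar) :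
    List.Forall₂ (fun e x => e.Ok W s ∧ e.eval s = x) (ps.map (field j ar c))
      (ps.map fun p => (rows[i]'hi).1.getD p 0) := by
  rw [List.forall₂_map_left_iff, List.forall₂_map_right_iff, List.forall₂_same]
  exact fun p hp => field_ok h hc hi har (hps p hp) hW hx

end Ex

theorem KEx.row_val {K : Type*} [CommSemiring K] {j l c i : ℕ} {s : RamState K}
    {rows : List (List ℕ × K)} (h : Holds s j l rows) (hc : s.reg c = i) (hi : i < rows.length) :
    (KEx.load j (.reg c)).eval s = (rows[i]'hi).2 := by
  simp [KEx.eval, Ex.eval, hc, h.karr, List.getD_eq_getElem?_getD, hi]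

/-! ## Marking codes -/

/-- For each row `i` of a relation that passes the test, store `i + 1` at the code of the row in
array `m`, and add its value to the entry at the code in the `K`-array `m`. -/
def markLoop (c m src : ℕ) (test code : Ex) (v : KEx) : Stmt :=
  .loop c (.reg src) (.cond test (.seq (.store m code (.op .add (.reg c) (.cst 1)))
    (.kstore m code (.add (.load m code) v))) .skip)

/-- Storing `i + 1` leaves `0` for codes that do not occur. Rows with the same code overwrite each
other in the word array, so one representative is remembered, while their values add up in the
`K`-array. -/
theorem markLoop_spec {K : Type*} [CommSemiring K] {κ W c m src N : ℕ} (hκ : 1 ≤ κ)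
    {test code : Ex} {v : KEx} {s : RamState K} (hN : s.reg src = N) (hW : N + 1 < W)
    (P : ℕ → Prop) [DecidablePred P] (cd : ℕ → ℕ) (w : ℕ → K)
    (hs : ∀ i < N, ∀ s', Frame c m c s s' → s'.reg c = i → test.Ok W s' ∧
      (test.eval s' ≠ 0 ↔ P i) ∧ (P i → (code.Ok W s' ∧ code.eval s' = cd i) ∧
      v.Ok W s' ∧ v.eval s' = w i))
    (h0 : ∀ x, s.arr m x = 0 ∧ s.karr m x = 0) :
    Sp κ W (markLoop c m src test code v) s (1 + N * (4 * κ)) fun s' => Frame c m c s s' ∧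
      ∀ x, s'.karr m x = ∑ i ∈ (Finset.range N).filter (fun i => P i ∧ cd i = x), w i ∧
        ((s'.arr m x = 0 ∧ ∀ i < N, P i → cd i ≠ x) ∨
          ∃ i < N, P i ∧ cd i = x ∧ s'.arr m x = i + 1) := by
  refine (Sp.loop (e := .reg src) (n := N) (T := 1 + (1 + κ)) (fun n s' => Frame c m c s s' ∧
      ∀ x, s'.karr m x = ∑ i ∈ (Finset.range n).filter (fun i => P i ∧ cd i = x), w i ∧
        ((s'.arr m x = 0 ∧ ∀ i < n, P i → cd i ≠ x) ∨
          ∃ i < n, P i ∧ cd i = x ∧ s'.arr m x = i + 1)) ?_ hN ?_ ?_).mono ?_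
  · simp only [Ex.Ok, hN]; omega
  · exact ⟨⟨fun _ _ _ => rfl, rfl, fun _ _ => rfl, fun _ _ => rfl⟩, fun x => by simp [h0 x]⟩
  · rintro n hn s1 ⟨f1, q1⟩
    have f2 : Frame c m c s (s1.setReg c n) := f1.trans
      ⟨fun r h1 h2 => by simp [h1], rfl, fun _ _ => rfl, fun _ _ => rfl⟩
    obtain ⟨t1, t2, t3⟩ := hs n hn _ f2 (by simp)
    refine Sp.cond t1 (fun hne => ?_) (fun he => ?_)
    · have hP := t2.1 hne
      obtain ⟨⟨t4, t5⟩, -⟩ := t3 hP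
      refine Sp.seq (Q := fun s' => s' = (s1.setReg c n).setArr m (cd n) (n + 1))
        (Sp.store t4 ?_ ?_) ?_
      · simp only [Ex.Ok, Ex.eval, WordOp.eval, setReg_reg, if_true]; omega
      · rw [t5]; simp [Ex.eval, WordOp.eval]
      · rintro s2 rfl
        have f3 : Frame c m c s ((s1.setReg c n).setArr m (cd n) (n + 1)) := f2.trans
          ⟨fun r h1 h2 => by simp, by simp, fun B hB => by ext j; simp [hB], fun B hB => by simp⟩
        obtain ⟨t4', t5', t6'⟩ := hs n hn _ f3 (by simp)
        obtain ⟨⟨t4', t5'⟩, t6', t7'⟩ := t6' hP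
        refine Sp.kstore t4' ⟨t4', t6'⟩ ⟨f3.trans ⟨fun r h1 h2 => by simp, by simp,
          fun B hB => by simp, fun B hB => by ext j; simp [hB]⟩, fun x => ⟨?_, ?_⟩⟩
        · simp only [setKarr_karr, KEx.eval, t5', t7', true_and, Finset.range_add_one,
            Finset.filter_insert, hP, setArr_karr, setReg_karr, (q1 _).1]
          by_cases hx : x = cd n
          · subst hx
            rw [if_pos rfl, if_pos rfl, Finset.sum_insert (by simp), add_comm]
          · rw [if_neg hx, if_neg (Ne.symm hx)]
        · by_cases hx : x = cd n
          · subst hx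
            exact Or.inr ⟨n, by omega, hP, rfl, by simp⟩
          · simp only [setKarr_arr, setArr_arr, hx, and_false, if_false, setReg_arr]
            rcases (q1 x).2 with ⟨h1, h2⟩ | ⟨i, h1, h2, h3, h4⟩
            · refine Or.inl ⟨h1, fun i hi hPi => ?_⟩
              rcases Nat.lt_succ_iff_lt_or_eq.1 hi with h | rfl
              · exact h2 i h hPi
              · exact Ne.symm hx
            · exact Or.inr ⟨i, by omega, h2, h3, h4⟩
    · have hP : ¬ P n := fun h => t2.2 h he
      refine (Sp.skip ⟨f2, fun x => ⟨?_, ?_⟩⟩).mono (by omega)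
      · simp [Finset.range_add_one, Finset.filter_insert, hP, (q1 x).1]
      · rcases (q1 x).2 with ⟨h1, h2⟩ | ⟨i, h1, h2, h3, h4⟩
        · refine Or.inl ⟨h1, fun i hi hPi => ?_⟩
          rcases Nat.lt_succ_iff_lt_or_eq.1 hi with h | rfl
          · exact h2 i h hPi
          · exact absurd hPi hP
        · exact Or.inr ⟨i, by omega, h2, h3, h4⟩
  · gcongr
    omega

/-! ## Direct access relative to an upper bound on the input size -/

namespace LogarithmicTime

variable {κ : ℕ → ℕ}

/-- This is the growth condition at `m = 2`, where the logarithm is `1`. -/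
theorem exists_le_log (hκ : LogarithmicTime κ) : ∃ C, ∀ n, 2 ≤ n → κ n ≤ C * Nat.log 2 n := by
  obtain ⟨C, hC⟩ := hκ.growth
  refine ⟨C * κ 2, fun n hn => ?_⟩
  have := hC 2 n le_rfl hn
  rwa [show Nat.log 2 2 = 1 from Nat.log_pow (b := 2) (by norm_num) 1, mul_one, ← mul_assoc] at this

end LogarithmicTime

section Relaxed

variable {K : Type*}

theorem KDatabase.hom_mem_constants {D : KDatabase K} {Q : CQStar} {h : ℕ →₀ ℕ}
    (hh : h ∈ D.homs Q) {x : ℕ} (hx : x ∈ Q.vars) : h x ∈ D.constants Q := by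
  obtain ⟨A, hA, hxA⟩ := List.mem_flatMap.1 (List.mem_toFinset.1 hx)
  refine Finset.mem_biUnion.2 ⟨A.rel, ?_, Finset.mem_biUnion.2
    ⟨_, ((D.mem_homs Q h).1 hh).2 A hA, ?_⟩⟩
  · exact List.mem_toFinset.2 (List.mem_dedup.2 (List.mem_map_of_mem hA))
  · exact List.mem_toFinset.2 (List.mem_map_of_mem hxA)

theorem CQStar.mem_vars_of_mem_head {Q : CQStar} {x : ℕ} (hx : x ∈ Q.pre ++ Q.post) :
    x ∈ Q.vars := by
  obtain ⟨A, hA, hxA⟩ := Q.head_occurs x hx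
  exact List.mem_toFinset.2 (List.mem_flatMap.2 ⟨A, hA, hxA⟩)

theorem Enumerates.card {D : KDatabase K} {Q : CQStar} {L : ℕ → List (List ℕ)}
    (hL : Enumerates D Q L) {R : ℕ} (hR : R ∈ Q.symbols) : (L R).length = (D.rel R).card := by
  classical
  rw [← List.toFinset_card_of_nodup (hL R hR).1]
  congr 1
  ext t
  simp [(hL R hR).2]

theorem KDatabase.card_le_size (D : KDatabase K) {Q : CQStar} {R : ℕ} (hR : R ∈ Q.symbols) :
    (D.rel R).card ≤ D.size Q :=
  List.single_le_sum (by simp) _ (List.mem_map_of_mem hR)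

variable [CommSemiring K] [LinearOrder K]

theorem KDatabase.nthAnswer_eq_some {D : KDatabase K} {Q : CQStar} {i : ℕ} {r : QAnswer K}
    (h : D.nthAnswer Q i = some r) :
    ((ofLex r).1 ++ (ofLex (ofLex r).2).2).length = (Q.pre ++ Q.post).length ∧
      ∀ x ∈ (ofLex r).1 ++ (ofLex (ofLex r).2).2, x ∈ D.constants Q := by
  have hr : r ∈ D.answers Q := (Finset.mem_sort (· ≤ ·)).1 (List.mem_of_getElem? h)
  obtain ⟨g, hg, rfl⟩ := Finset.mem_image.1 hr
  refine ⟨by simp, fun x hx => ?_⟩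
  simp only [ofLex_toLex, ← List.map_append] at hx
  obtain ⟨y, hy, rfl⟩ := List.mem_map.1 hx
  exact hom_mem_constants hg (CQStar.mem_vars_of_mem_head hy)

/-- Direct access in `⟨loglinear, log⟩`, where time and words are measured by an upper bound `M` on
the order of the size of the database, and not by the size itself. -/
def RelaxedAccess (κ : ℕ → ℕ) (Q : CQStar) (𝒟 : KDatabase K → Prop) : Prop :=
  ∀ k : ℕ, ∃ (P A : RamProg) (k' C : ℕ), ∀ D : KDatabase K, D.Over Q → 𝒟 D →
    -- `M` may exceed the size by far. This is what reductions need: they can shrink a database,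
    -- while the time and the words that are allowed are still those of the original input.
    ∀ M : ℕ, 2 ≤ M → D.size Q ≤ k * M → (∀ c ∈ D.constants Q, c < M ^ k) →
    ∀ L, Enumerates D Q L →
    ∃ s t, RamExec (κ M) (M ^ k') P (inputState D Q L) s t ∧ t ≤ C * (M * Nat.log 2 M) ∧
      ∀ i < M ^ k, ∃ s' t', RamExec (κ M) (M ^ k') A (s.setReg 0 i) s' t' ∧
        t' ≤ C * Nat.log 2 M ∧ Returns s' (D.nthAnswer Q i)

theorem RelaxedAccess.directAccessIn {κ : ℕ → ℕ} {Q : CQStar} {𝒟 : KDatabase K → Prop}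
    (h : RelaxedAccess κ Q 𝒟) :
    DirectAccessIn κ Q 𝒟 (fun n => n * Nat.log 2 n) (fun n => Nat.log 2 n) := by
  intro k
  -- With `k` itself the requirement on the size would fail for `k = 0`.
  obtain ⟨P, A, k', C, H⟩ := h (k + 1)
  refine ⟨P, A, k', C, fun D hD h𝒟 N hN hc L hL => ?_⟩
  have hpow : N ^ k ≤ N ^ (k + 1) := Nat.pow_le_pow_right (by omega) (by omega)
  obtain ⟨s, t, e, ht, ha⟩ := H D hD h𝒟 N (by omega) (by nlinarith)
    (fun c hcc => (hc c hcc).trans_le hpow) L hL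
  exact ⟨s, t, e, ht, fun i hi => ha i (hi.trans_le hpow)⟩

/-- Register `0` tells whether there is an output; if so, copy it to its place. -/
def emit (r : ℕ) (es : List Ex) : Stmt :=
  .cond (.reg r) (.seq (storeList 0 (.cst 0) 0 es)
    (.seq (.kset 0 (.reg r)) (.set 0 (.reg r)))) (.set 0 (.cst 0))

/-- `o` is what the subroutine has returned and `o'` what is to be returned. They may differ in the
constants, which `es` translates; the annotation is taken over. The expressions must not be
disturbed by the output itself, which goes to array `0`. -/
theorem emit_spec {κ W r ao : ℕ} (hκ : 1 ≤ κ) {es : List Ex} {S s : RamState K}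
    {o o' : Option (QAnswer K)} (hv : S.view r ao = s) (ho : Returns s o)
    (hW : es.length + 1 < W) (h0 : o = none → o' = none)
    (h1 : ∀ a, o = some a → ∃ a', o' = some a' ∧
      (ofLex (ofLex a').2).1 = (ofLex (ofLex a).2).1 ∧
      ∀ s', SameExcept 0 S s' → List.Forall₂ (fun e x => e.Ok W s' ∧ e.eval s' = x) es
        ((ofLex a').1 ++ (ofLex (ofLex a').2).2)) :
    Sp κ W (emit r es) S ((es.length + 4) * κ) fun s' => Returns s' o' := by
  have hreg : S.reg r = s.reg 0 := by rw [← hv]; simp [view]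
  have hkreg : S.kreg r = s.kreg 0 := by rw [← hv]; simp [view]
  cases o with
  | none =>
    rw [h0 rfl]
    have hz : S.reg r = 0 := by rw [hreg]; exact ho
    refine (Sp.cond (T := 1) (by simp only [Ex.Ok]; omega) (fun h => absurd hz (by simpa [Ex.eval] using h)) fun _ => ?_).mono
      (by nlinarith)
    exact Sp.set (by simp only [Ex.Ok]; omega) (by simp [Returns, Ex.eval])
  | some a =>
    obtain ⟨a', ha', hk, hev⟩ := h1 a rfl
    obtain ⟨o1, o2, -⟩ := ho
    have hz : S.reg r = 1 := by rw [hreg]; exact o1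
    subst ha'
    have hT : 1 + (es.length + 1 + (κ + 1)) ≤ (es.length + 4) * κ := by nlinarith
    refine (Sp.cond (T := es.length + 1 + (κ + 1)) (by simp only [Ex.Ok]; omega) (fun _ => ?_)
      fun h => absurd h (by simp [Ex.eval, hz])).mono hT
    refine Sp.seq (storeList_spec (v := 0) es _ 0 S (fun s' _ => ⟨by simp only [Ex.Ok]; omega, rfl⟩)
      hev (by omega)) ?_
    rintro s1 ⟨f1, a1⟩
    refine Sp.seq (Q := fun s2 => s2 = s1.setKreg 0 (s1.kreg r)) (Sp.kset trivial rfl) ?_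
    rintro s2 rfl
    refine Sp.set ?_ ⟨?_, ?_, fun j x hj => ?_⟩
    · simp only [Ex.Ok, setKreg_reg, f1.reg]; omega
    · simp [Ex.eval, f1.reg, hz]
    · simp [f1.kreg, hkreg, o2, hk]
    · have hlt := (List.getElem?_eq_some_iff.1 hj).1
      simp only [setReg_arr, setKreg_arr, a1]
      rw [if_pos (by omega), List.getD_eq_getElem?_getD]
      simp [hj]

/-- A reduction from direct access for `Q₁` to direct access for `Q₂`: a statement that transforms
every database for `Q₁` in linear time into a database for `Q₂` with the same answers. -/
def Reduces (κ : ℕ → ℕ) (Q₁ : CQStar) (𝒟₁ : KDatabase K → Prop) (Q₂ : CQStar)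
    (𝒟₂ : KDatabase K → Prop) : Prop :=
  ∀ k : ℕ, ∃ (G : Stmt) (l ao k₂ C : ℕ), 0 < ao ∧ ∀ D : KDatabase K, D.Over Q₁ → 𝒟₁ D →
    ∀ M : ℕ, 2 ≤ M → D.size Q₁ ≤ k * M → (∀ c ∈ D.constants Q₁, c < M ^ k) →
    ∀ L, Enumerates D Q₁ L → ∃ (D' : KDatabase K) (L' : ℕ → List (List ℕ)),
      D'.Over Q₂ ∧ 𝒟₂ D' ∧ D'.size Q₂ ≤ k₂ * M ∧ (∀ c ∈ D'.constants Q₂, c < M ^ k₂) ∧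
      Enumerates D' Q₂ L' ∧ (∀ i, D'.nthAnswer Q₂ i = D.nthAnswer Q₁ i) ∧
      Sp (κ M) (M ^ k₂) G (inputState D Q₁ L) (C * (M * κ M)) fun s =>
        (∀ j, s.arr (j + ao) = (inputState D' Q₂ L').arr j) ∧
        (∀ j, s.karr (j + ao) = (inputState D' Q₂ L').karr j) ∧
        ∀ j < Q₂.symbols.length, s.reg (l + j) = (inputState D' Q₂ L').reg j

theorem inputState_reg_le {D : KDatabase K} {Q : CQStar} {L : ℕ → List (List ℕ)}
    (hL : Enumerates D Q L) (j : ℕ) : (inputState D Q L).reg j ≤ D.size Q := by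
  simp only [inputState]
  split
  · next R hR =>
    have := List.mem_of_getElem? hR
    rw [hL.card this]
    exact D.card_le_size this
  · exact Nat.zero_le _

theorem inputState_reg_of_le {D : KDatabase K} {Q : CQStar} {L : ℕ → List (List ℕ)} {j : ℕ}
    (hj : Q.symbols.length ≤ j) : (inputState D Q L).reg j = 0 := by
  simp [inputState, List.getElem?_eq_none hj]

/-- Preprocessing computes the new database and runs the preprocessing for `Q₂` on it, with renamed
registers and arrays. As the two databases have the same answers at every index, an access only has
to copy the output of the subroutine. -/
theorem RelaxedAccess.of_reduces {κ : ℕ → ℕ} (hκ : LogarithmicTime κ) {Q₁ Q₂ : CQStar}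
    {𝒟₁ 𝒟₂ : KDatabase K → Prop} (hred : Reduces κ Q₁ 𝒟₁ Q₂ 𝒟₂) (h : RelaxedAccess κ Q₂ 𝒟₂) :
    RelaxedAccess κ Q₁ 𝒟₁ := by
  intro k
  obtain ⟨Cκ, hCκ⟩ := hκ.exists_le_log
  obtain ⟨G, l, ao, k₂, C, hao, HG⟩ := hred k
  -- `k` is needed for the range of the indices, `k₂` for the size and the constants of the new
  -- database.
  obtain ⟨P, A, k', C', HP⟩ := h (max k k₂)
  obtain ⟨r, P', c, hr, Hprep⟩ := exec_prepare (K := K) G P l ao Q₂.symbols.length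
    (max Q₁.symbols.length 1)
  set m := (Q₂.pre ++ Q₂.post).length with hm
  -- Array `0` of the subroutine, which holds its answer, is array `ao` here.
  set es : List Ex := (List.range m).map fun j => .load ao (.cst j) with hes
  have hesl : es.length = m := by simp [hes]
  obtain ⟨A', c', Hacc⟩ := exec_access (K := K) .skip (emit r es) A r ao
    (by simp [Stmt.compile, RamProg.regBound]) (by simp [Stmt.bound]; omega)
  set k₃ := max k k₂ + k' + k₂ + m + 2 with hk₃
  refine ⟨P', A', k₃, c * (C * Cκ + 1) + C' + c' * ((m + 4) * Cκ + 2), ?_⟩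
  intro D hD h𝒟 M hM hsz hc L hL
  have hpow : ∀ {a b : ℕ}, a ≤ b → M ^ a ≤ M ^ b := fun h => Nat.pow_le_pow_right (by omega) h
  have hself : ∀ a : ℕ, a < M ^ a := fun a =>
    Nat.lt_two_pow_self.trans_le (Nat.pow_le_pow_left hM a)
  obtain ⟨D', L', hD', h𝒟', hsz', hc', hL', hans, hG⟩ := HG D hD h𝒟 M hM hsz hc L hL
  obtain ⟨s, t, e, ht, ha⟩ := HP D' hD' h𝒟' M hM
    (hsz'.trans (Nat.mul_le_mul_right _ (le_max_right _ _)))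
    (fun c hcc => (hc' c hcc).trans_le (hpow (le_max_right _ _))) L' hL'
  have h1κ : 1 ≤ κ M := hκ.one_le M
  have hW2 : 2 < M ^ k₃ := (hself 2).trans_le (hpow (by omega))
  have hlog : 1 ≤ Nat.log 2 M := Nat.log_pos (by norm_num) hM
  have hκM := hCκ M hM
  obtain ⟨S, t', eS, ht', hv, -⟩ := Hprep (κ M) (M ^ k₃) (C * (M * κ M)) t (inputState D Q₁ L)
    (inputState D' Q₂ L') s h1κ hW2
    (fun j hj => ⟨inputState_reg_of_le (by omega), rfl⟩)
    (fun j hj => inputState_reg_of_le hj) (fun j => rfl)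
    ((hG.mono_word (hpow (show k₂ ≤ k₃ by omega))).conseq le_rfl fun s' hs' =>
      ⟨hs'.1, hs'.2.1, fun j hj => ⟨hs'.2.2 j hj, by
        calc _ ≤ k₂ * M := (inputState_reg_le hL' j).trans hsz'
          _ < M ^ k₂ * M := Nat.mul_lt_mul_of_pos_right (hself k₂) (by omega)
          _ = M ^ (k₂ + 1) := by ring
          _ ≤ M ^ k₃ := hpow (by omega)⟩⟩) (e.mono (hpow (by omega)))
  refine ⟨S, t', eS, ?_, fun i hi => ?_⟩
  · have h1 : 1 ≤ M * Nat.log 2 M := Nat.mul_pos (by omega) (by omega)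
    have h2 : C * (M * κ M) ≤ C * Cκ * (M * Nat.log 2 M) := by
      calc _ ≤ C * (M * (Cκ * Nat.log 2 M)) := by gcongr
        _ = _ := by ring
    calc t' ≤ c * (C * (M * κ M) + 1) + t := ht'
      _ ≤ c * (C * Cκ * (M * Nat.log 2 M) + 1 * (M * Nat.log 2 M)) + C' * (M * Nat.log 2 M) := by
          gcongr; omega
      _ = (c * (C * Cκ + 1) + C') * (M * Nat.log 2 M) := by ring
      _ ≤ _ := Nat.mul_le_mul_right _ (by omega)
  · obtain ⟨s', t2, e2, ht2, hret⟩ := ha i (hi.trans_le (hpow (le_max_left _ _)))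
    rw [hans] at hret
    obtain ⟨S', t3, e3, ht3, hfin⟩ := Hacc (κ M) (M ^ k₃) 1 ((es.length + 4) * κ M) t2 i
      (S.setReg 0 i) s s' (fun S' => Returns S' (D.nthAnswer Q₁ i)) h1κ hW2
      (by rw [← hv]; exact eq_of_fields (by ext j; simp [view]; omega) rfl rfl rfl)
      (fun S S' h1 h2 h3 => by
        intro h
        cases hn : D.nthAnswer Q₁ i with
        | none => rw [hn] at h; exact h1.symm.trans h
        | some a =>
          rw [hn] at h
          exact ⟨h1.symm.trans h.1, h2.symm.trans h.2.1, by rw [← h3]; exact h.2.2⟩)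
      (Sp.skip ⟨by simp, rfl, rfl⟩) (hi.trans_le (hpow (by omega))) (e2.mono (hpow (by omega)))
      (fun S2 hS2 _ => emit_spec h1κ hS2 hret
        (by rw [hesl]; exact (hself (m + 1)).trans_le (hpow (by omega))) (fun h => h)
        fun a hn => ⟨a, hn, rfl, fun S3 hS3 => by
          rw [← hans] at hn
          obtain ⟨hl, hcon⟩ := KDatabase.nthAnswer_eq_some hn
          rw [hans] at hn
          rw [hn] at hret
          obtain ⟨-, -, hr3⟩ := hret
          rw [List.forall₂_iff_get]
          refine ⟨by rw [hl, hesl], fun j h1 h2 => ?_⟩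
          have hj : j < m := by rwa [hesl] at h1
          have hval : S3.arr ao j = ((ofLex a).1 ++ (ofLex (ofLex a).2).2)[j] := by
            rw [hS3.arr ao (by omega)]
            have := hr3 j _ (List.getElem?_eq_getElem h2)
            rw [← this, ← hS2]
            simp [view]
          have hlt : ((ofLex a).1 ++ (ofLex (ofLex a).2).2)[j] < M ^ k₃ :=
            (hc' _ (hcon _ (List.getElem_mem h2))).trans_le (hpow (by omega))
          simp only [hes, List.get_eq_getElem, List.getElem_map, List.getElem_range, Ex.Ok, Ex.eval,
            hval]
          exact ⟨⟨(hj.trans (hself m)).trans_le (hpow (by omega)), hlt⟩, trivial⟩⟩)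
    refine ⟨S', t3, e3, ht3.trans ?_, hfin⟩
    rw [hesl]
    calc _ ≤ c' * (1 * Nat.log 2 M + (m + 4) * (Cκ * Nat.log 2 M) + 1 * Nat.log 2 M) +
          C' * Nat.log 2 M := by gcongr <;> omega
      _ = (c' * ((m + 4) * Cκ + 2) + C') * Nat.log 2 M := by ring
      _ ≤ _ := Nat.mul_le_mul_right _ (by omega)

end Relaxed

/-! ## Inputs of queries without self-joins -/

section Input

variable {K : Type*}

theorem CQStar.SelfJoinFree.symbols_eq {Q : CQStar} (h : Q.SelfJoinFree) :
    Q.symbols = Q.body.map QAtom.rel := List.dedup_eq_self.2 h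

theorem CQStar.SelfJoinFree.eq_of_rel {Q : CQStar} (h : Q.SelfJoinFree) {A B : QAtom}
    (hA : A ∈ Q.body) (hB : B ∈ Q.body) (hr : A.rel = B.rel) : A = B :=
  List.inj_on_of_nodup_map h hA hB hr

theorem CQStar.mem_symbols {Q : CQStar} {R : ℕ} : R ∈ Q.symbols ↔ ∃ A ∈ Q.body, A.rel = R := by
  simp [CQStar.symbols]

theorem CQStar.rel_mem_symbols {Q : CQStar} {A : QAtom} (hA : A ∈ Q.body) : A.rel ∈ Q.symbols :=
  CQStar.mem_symbols.2 ⟨A, hA, rfl⟩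

/-- The listed facts of a relation with their annotations. -/
def factRows (D : KDatabase K) (L : ℕ → List (List ℕ)) (R : ℕ) : List (List ℕ × K) :=
  (L R).map fun t => (t, D.ann R t)

theorem factRows_length (D : KDatabase K) (L : ℕ → List (List ℕ)) (R : ℕ) :
    (factRows D L R).length = (L R).length := by simp [factRows]

theorem mem_constants_of_mem {D : KDatabase K} {Q : CQStar} {A : QAtom} (hA : A ∈ Q.body)
    {t : List ℕ} (ht : t ∈ D.rel A.rel) {x : ℕ} (hx : x ∈ t) : x ∈ D.constants Q :=
  Finset.mem_biUnion.2 ⟨A.rel, List.mem_toFinset.2 (CQStar.rel_mem_symbols hA),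
    Finset.mem_biUnion.2 ⟨t, ht, List.mem_toFinset.2 hx⟩⟩

theorem mem_constants {D : KDatabase K} {Q : CQStar} {x : ℕ} :
    x ∈ D.constants Q ↔ ∃ A ∈ Q.body, ∃ t ∈ D.rel A.rel, x ∈ t := by
  constructor
  · intro h
    obtain ⟨R, hR, h1⟩ := Finset.mem_biUnion.1 h
    obtain ⟨t, ht, h2⟩ := Finset.mem_biUnion.1 h1
    obtain ⟨A, hA, rfl⟩ := CQStar.mem_symbols.1 (List.mem_toFinset.1 hR)
    exact ⟨A, hA, t, ht, List.mem_toFinset.1 h2⟩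
  · rintro ⟨A, hA, t, ht, hx⟩
    exact mem_constants_of_mem hA ht hx

theorem Enumerates.row {D : KDatabase K} {Q : CQStar} {L : ℕ → List (List ℕ)}
    (hL : Enumerates D Q L) (hD : D.Over Q) {A : QAtom} (hA : A ∈ Q.body) {r : List ℕ × K}
    (hr : r ∈ factRows D L A.rel) : r.1.length = A.args.length ∧ r.1 ∈ D.rel A.rel ∧
      r.2 = D.ann A.rel r.1 ∧ ∀ x ∈ r.1, x ∈ D.constants Q := by
  obtain ⟨t, ht, rfl⟩ := List.mem_map.1 hr
  have ht' := ((hL A.rel (CQStar.rel_mem_symbols hA)).2 t).1 ht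
  exact ⟨hD A hA t ht', ht', rfl, fun x hx => mem_constants_of_mem hA ht' hx⟩

theorem Enumerates.rows_length_le {D : KDatabase K} {Q : CQStar} {L : ℕ → List (List ℕ)}
    (hL : Enumerates D Q L) {A : QAtom} (hA : A ∈ Q.body) :
    (factRows D L A.rel).length ≤ D.size Q := by
  rw [factRows_length, hL.card (CQStar.rel_mem_symbols hA)]
  exact D.card_le_size (CQStar.rel_mem_symbols hA)

theorem inputState_holds [CommSemiring K] {D : KDatabase K} {Q : CQStar}
    {L : ℕ → List (List ℕ)} (hQ : Q.SelfJoinFree) {j : ℕ} {A : QAtom} (hj : Q.body[j]? = some A) :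
    Holds (inputState D Q L) j j (factRows D L A.rel) := by
  have hs : Q.symbols[j]? = some A.rel := by rw [hQ.symbols_eq]; simp [hj]
  refine ⟨by simp [inputState, hs, factRows], fun p => ?_, fun p => ?_⟩
  · simp [inputState, hs, factRows, Function.comp_def]
  · simp [inputState, hs, factRows, Function.comp_def]

/-- What the outputs of the loops over the facts have to be in order that they form the input state
of a database for another query. -/
theorem inputState_of_holds [CommSemiring K] {D : KDatabase K} {Q : CQStar}
    {L : ℕ → List (List ℕ)} (hQ : Q.SelfJoinFree) {s : RamState K} {ao l : ℕ}
    (h : ∀ j A, Q.body[j]? = some A → Holds s (ao + j) (l + j) (factRows D L A.rel))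
    (h0 : ∀ B ≥ ao + Q.body.length, ∀ i, s.arr B i = 0 ∧ s.karr B i = 0) :
    (∀ j, s.arr (j + ao) = (inputState D Q L).arr j) ∧
      (∀ j, s.karr (j + ao) = (inputState D Q L).karr j) ∧
      ∀ j < Q.symbols.length, s.reg (l + j) = (inputState D Q L).reg j := by
  have key : ∀ j, (s.arr (j + ao) = (inputState D Q L).arr j) ∧
      (s.karr (j + ao) = (inputState D Q L).karr j) := by
    intro j
    cases hj : Q.body[j]? with
    | some A =>
      have h1 := h j A hj
      have h2 := inputState_holds (D := D) (L := L) hQ hj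
      rw [add_comm j]
      exact ⟨funext fun i => (h1.arr i).trans (h2.arr i).symm,
        funext fun i => (h1.karr i).trans (h2.karr i).symm⟩
    | none =>
      have hs : Q.symbols[j]? = none := by rw [hQ.symbols_eq]; simpa using hj
      have hle : Q.body.length ≤ j := List.getElem?_eq_none_iff.1 hj
      exact ⟨funext fun i => by simp [inputState, hs, h0 (j + ao) (by omega) i],
        funext fun i => by simp [inputState, hs, h0 (j + ao) (by omega) i]⟩
  refine ⟨fun j => (key j).1, fun j => (key j).2, fun j hj => ?_⟩
  rw [hQ.symbols_eq, List.length_map] at hj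
  have hj' := List.getElem?_eq_getElem hj
  exact (h j _ hj').reg.trans (inputState_holds (D := D) (L := L) hQ hj').reg.symm

end Input

/-! ## Comparing the answers over two databases -/

section Answers

variable {K : Type*} [CommSemiring K] [LinearOrder K]

/-- Apply a map to the constants of an answer. -/
def QAnswer.mapConst (ρ : ℕ → ℕ) (r : QAnswer K) : QAnswer K :=
  toLex ((ofLex r).1.map ρ, toLex ((ofLex (ofLex r).2).1, (ofLex (ofLex r).2).2.map ρ))

/-- The sum for an answer over `D₁` is grouped by the fibres of `π`, and each fibre contributes the
product of its image. Injectivity of `ρ` on the constants ensures that homomorphisms whose images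
agree on the head agree there themselves. -/
theorem answers_eq_image {D₁ D₂ : KDatabase K} {Q₁ Q₂ : CQStar} (ρ : ℕ → ℕ)
    (π : (ℕ →₀ ℕ) → (ℕ →₀ ℕ)) (hmap : ∀ h ∈ D₁.homs Q₁, π h ∈ D₂.homs Q₂)
    (hsurj : ∀ h₂ ∈ D₂.homs Q₂, ∃ h ∈ D₁.homs Q₁, π h = h₂)
    (hpre : ∀ h ∈ D₁.homs Q₁, Q₂.pre.map (π h) = (Q₁.pre.map h).map ρ)
    (hpost : ∀ h ∈ D₁.homs Q₁, Q₂.post.map (π h) = (Q₁.post.map h).map ρ)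
    (hinj : Set.InjOn ρ (D₁.constants Q₁))
    (hprod : ∀ h₂ ∈ D₂.homs Q₂,
      D₂.homProd Q₂ h₂ = ∑ h ∈ (D₁.homs Q₁).filter (fun h => π h = h₂), D₁.homProd Q₁ h) :
    D₂.answers Q₂ = (D₁.answers Q₁).image (QAnswer.mapConst ρ) := by
  have hinj' : ∀ l : List ℕ, (∀ x ∈ l, x ∈ Q₁.vars) → ∀ h ∈ D₁.homs Q₁, ∀ h' ∈ D₁.homs Q₁,
      (l.map h).map ρ = (l.map h').map ρ → l.map h = l.map h' := by
    intro l hl h hh h' hh' he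
    rw [List.map_map, List.map_map, List.map_inj_left] at he
    rw [List.map_inj_left]
    exact fun x hx => hinj (KDatabase.hom_mem_constants hh (hl x hx))
      (KDatabase.hom_mem_constants hh' (hl x hx)) (he x hx)
  have hann : ∀ h ∈ D₁.homs Q₁, D₂.answerAnn Q₂ (Q₂.pre.map (π h)) (Q₂.post.map (π h)) =
      D₁.answerAnn Q₁ (Q₁.pre.map h) (Q₁.post.map h) := by
    intro h hh
    unfold KDatabase.answerAnn
    symm
    rw [← Finset.sum_fiberwise_of_maps_to (g := π) (t := (D₂.homs Q₂).filter fun h₂ : ℕ →₀ ℕ =>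
      Q₂.pre.map h₂ = Q₂.pre.map (π h) ∧ Q₂.post.map h₂ = Q₂.post.map (π h))]
    · refine Finset.sum_congr rfl fun h₂ hh₂ => ?_
      rw [Finset.mem_filter] at hh₂
      rw [hprod h₂ hh₂.1, Finset.filter_filter]
      refine Finset.sum_congr ?_ fun _ _ => rfl
      refine Finset.filter_congr fun h' hh' => ⟨fun hx => hx.2, fun hx => ⟨⟨?_, ?_⟩, hx⟩⟩
      · apply hinj' _ (fun x hx => CQStar.mem_vars_of_mem_head (by simp [hx])) _ hh' _ hh
        rw [← hpre _ hh', ← hpre _ hh, hx]; exact hh₂.2.1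
      · apply hinj' _ (fun x hx => CQStar.mem_vars_of_mem_head (by simp [hx])) _ hh' _ hh
        rw [← hpost _ hh', ← hpost _ hh, hx]; exact hh₂.2.2
    · intro h' hh'
      rw [Finset.mem_filter] at hh' ⊢
      exact ⟨hmap _ hh'.1, by rw [hpre _ hh'.1, hpre _ hh, hh'.2.1],
        by rw [hpost _ hh'.1, hpost _ hh, hh'.2.2]⟩
  unfold KDatabase.answers
  ext r
  simp only [Finset.mem_image]
  constructor
  · rintro ⟨h₂, hh₂, rfl⟩
    obtain ⟨h, hh, rfl⟩ := hsurj _ hh₂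
    refine ⟨_, ⟨h, hh, rfl⟩, ?_⟩
    rw [hann _ hh, hpre _ hh, hpost _ hh]
    rfl
  · rintro ⟨_, ⟨h, hh, rfl⟩, rfl⟩
    refine ⟨π h, hmap _ hh, ?_⟩
    rw [hann _ hh, hpre _ hh, hpost _ hh]
    rfl

theorem QAnswer.mapConst_id (r : QAnswer K) : r.mapConst (fun x => x) = r := by
  simp [QAnswer.mapConst]

/-- The form used for reductions between queries: constants stay as they are, so equal sets of
answers are listed in the same order. -/
theorem nthAnswer_congr {D₁ D₂ : KDatabase K} {Q₁ Q₂ : CQStar} (hp : Q₂.pre = Q₁.pre)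
    (hq : Q₂.post = Q₁.post)
    (π : (ℕ →₀ ℕ) → (ℕ →₀ ℕ)) (hmap : ∀ h ∈ D₁.homs Q₁, π h ∈ D₂.homs Q₂)
    (hsurj : ∀ h₂ ∈ D₂.homs Q₂, ∃ h ∈ D₁.homs Q₁, π h = h₂)
    (hhead : ∀ h ∈ D₁.homs Q₁, ∀ x ∈ Q₁.free, π h x = h x)
    (hprod : ∀ h₂ ∈ D₂.homs Q₂,
      D₂.homProd Q₂ h₂ = ∑ h ∈ (D₁.homs Q₁).filter (fun h => π h = h₂), D₁.homProd Q₁ h) (i : ℕ) :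
    D₂.nthAnswer Q₂ i = D₁.nthAnswer Q₁ i := by
  have : D₂.answers Q₂ = D₁.answers Q₁ := by
    rw [answers_eq_image (fun x => x) π hmap hsurj ?_ ?_ (Set.injOn_id _) hprod]
    · rw [show QAnswer.mapConst (K := K) (fun x => x) = id from funext QAnswer.mapConst_id,
        Finset.image_id]
    · intro h hh
      rw [hp, List.map_id', List.map_inj_left]
      exact fun x hx => hhead h hh x (by simp [CQStar.free, hx])
    · intro h hh
      rw [hq, List.map_id', List.map_inj_left]
      exact fun x hx => hhead h hh x (by simp [CQStar.free, hx])
  unfold KDatabase.nthAnswer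
  rw [this]

/-- A homomorphism is determined by the facts to which it maps the atoms. -/
theorem card_answers_le (D : KDatabase K) (Q : CQStar) {N : ℕ} (hN : D.size Q ≤ N) :
    (D.answers Q).card ≤ N ^ Q.body.length := by
  classical
  refine Finset.card_image_le.trans ?_
  have h1 : (D.homs Q).card ≤
      (Fintype.piFinset fun j : Fin Q.body.length => D.rel (Q.body[j]).rel).card := by
    refine Finset.card_le_card_of_injOn
      (fun h j => (Q.body[j]).args.map h) (fun h hh => ?_) (fun h hh h' hh' he => ?_)
    · rw [Finset.mem_coe, Fintype.mem_piFinset]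
      exact fun j => ((D.mem_homs Q h).1 hh).2 _ (List.getElem_mem _)
    · ext x
      by_cases hx : x ∈ Q.vars
      · obtain ⟨A, hA, hxA⟩ := List.mem_flatMap.1 (List.mem_toFinset.1 hx)
        obtain ⟨j, hj, rfl⟩ := List.mem_iff_getElem.1 hA
        exact (List.map_inj_left.1 (congrFun he ⟨j, hj⟩)) x hxA
      · rw [((D.mem_homs Q h).1 hh).1 x hx, ((D.mem_homs Q h').1 hh').1 x hx]
  refine h1.trans ?_
  rw [Fintype.card_piFinset]
  refine (Finset.prod_le_pow_card _ _ N fun j _ => ?_).trans (by simp)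
  exact (D.card_le_size (CQStar.rel_mem_symbols (List.getElem_mem _))).trans hN

end Answers

/-! ## Renaming the constants of a database -/

/-- The map `g` on the variables in `V`, extended by `0`. -/
noncomputable def assignOn (V : Finset ℕ) (g : ℕ → ℕ) : ℕ →₀ ℕ :=
  Finsupp.onFinset V (fun x => if x ∈ V then g x else 0) fun x hx => by
    by_contra h; simp [h] at hx

theorem assignOn_apply (V : Finset ℕ) (g : ℕ → ℕ) (x : ℕ) :
    assignOn V g x = if x ∈ V then g x else 0 := rfl

theorem assignOn_of_mem {V : Finset ℕ} (g : ℕ → ℕ) {x : ℕ} (hx : x ∈ V) : assignOn V g x = g x :=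
  if_pos hx

theorem CQStar.mem_vars {Q : CQStar} {x : ℕ} : x ∈ Q.vars ↔ ∃ A ∈ Q.body, x ∈ A.args := by
  simp [CQStar.vars]

theorem List.map_strictMonoOn {ρ : ℕ → ℕ} {C : Set ℕ} (hρ : StrictMonoOn ρ C) :
    ∀ {l l' : List ℕ}, (∀ x ∈ l, x ∈ C) → (∀ x ∈ l', x ∈ C) → l < l' → l.map ρ < l'.map ρ
  | [], [], _, _, h => absurd h (lt_irrefl _)
  | [], b :: l', _, _, _ => List.nil_lt_cons _ _
  | a :: l, [], _, _, h => absurd h (List.not_lt_nil _)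
  | a :: l, b :: l', h1, h2, h => by
    rw [List.cons_lt_cons_iff] at h
    rw [List.map_cons, List.map_cons, List.cons_lt_cons_iff]
    rcases h with h | ⟨rfl, h⟩
    · exact Or.inl (hρ (h1 a (by simp)) (h2 b (by simp)) h)
    · exact Or.inr ⟨rfl, List.map_strictMonoOn hρ (fun x hx => h1 x (by simp [hx]))
        (fun x hx => h2 x (by simp [hx])) h⟩

section Rename

variable {K : Type*}

namespace KDatabase

/-- `ι` is to invert `ρ` on the constants of `D`; it recovers the fact whose annotation is wanted.
-/
def rename (D : KDatabase K) (ρ ι : ℕ → ℕ) : KDatabase K where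
  rel S := (D.rel S).image (List.map ρ)
  ann S t := D.ann S (t.map ι)

variable {D : KDatabase K} {Q : CQStar} {ρ ι : ℕ → ℕ}

theorem map_map_of_constants (hι : ∀ c ∈ D.constants Q, ι (ρ c) = c) {t : List ℕ}
    (ht : ∀ x ∈ t, x ∈ D.constants Q) : (t.map ρ).map ι = t := by
  rw [List.map_map]
  exact (List.map_congr_left (g := id) fun x hx => hι x (ht x hx)).trans (List.map_id t)

theorem rename_over (h : D.Over Q) : (D.rename ρ ι).Over Q := by
  intro A hA t ht
  obtain ⟨t', ht', rfl⟩ := Finset.mem_image.1 ht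
  simpa using h A hA t' ht'

theorem mem_constants_of_symbols {R x : ℕ} {t : List ℕ} (hR : R ∈ Q.symbols) (ht : t ∈ D.rel R)
    (hx : x ∈ t) : x ∈ D.constants Q := by
  obtain ⟨A, hA, rfl⟩ := CQStar.mem_symbols.1 hR
  exact mem_constants_of_mem hA ht hx

theorem rename_inj (hι : ∀ c ∈ D.constants Q, ι (ρ c) = c) {R : ℕ} (hR : R ∈ Q.symbols) :
    Set.InjOn (List.map ρ) (D.rel R) := by
  intro t ht t' ht' h
  rw [← map_map_of_constants hι fun x hx => mem_constants_of_symbols hR ht hx, h,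
    map_map_of_constants hι fun x hx => mem_constants_of_symbols hR ht' hx]

theorem rename_size (hι : ∀ c ∈ D.constants Q, ι (ρ c) = c) :
    (D.rename ρ ι).size Q = D.size Q := by
  unfold size
  congr 1
  rw [List.map_inj_left]
  exact fun R hR => Finset.card_image_of_injOn (rename_inj hι hR)

theorem mem_rename_constants {y : ℕ} :
    y ∈ (D.rename ρ ι).constants Q ↔ ∃ x ∈ D.constants Q, ρ x = y := by
  rw [mem_constants]
  constructor
  · rintro ⟨A, hA, t, ht, hy⟩
    obtain ⟨t', ht', rfl⟩ := Finset.mem_image.1 ht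
    obtain ⟨x, hx, rfl⟩ := List.mem_map.1 hy
    exact ⟨x, mem_constants_of_mem hA ht' hx, rfl⟩
  · rintro ⟨x, hx, rfl⟩
    obtain ⟨A, hA, t, ht, hx⟩ := mem_constants.1 hx
    exact ⟨A, hA, _, Finset.mem_image_of_mem _ ht, List.mem_map_of_mem hx⟩

theorem rename_locallyAnnotated [One K] (hι : ∀ c ∈ D.constants Q, ι (ρ c) = c) {R : ℕ}
    (h : D.LocallyAnnotated Q R) : (D.rename ρ ι).LocallyAnnotated Q R := by
  intro S hS hne t ht
  obtain ⟨t', ht', rfl⟩ := Finset.mem_image.1 ht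
  change D.ann S _ = 1
  rw [map_map_of_constants hι fun x hx => mem_constants_of_symbols hS ht' hx]
  exact h S hS hne t' ht'

theorem rename_enumerates (hι : ∀ c ∈ D.constants Q, ι (ρ c) = c) {L : ℕ → List (List ℕ)}
    (hL : Enumerates D Q L) :
    Enumerates (D.rename ρ ι) Q (fun S => (L S).map (List.map ρ)) := by
  intro R hR
  obtain ⟨h1, h2⟩ := hL R hR
  refine ⟨h1.map_on fun t ht t' ht' he => rename_inj hι hR ((h2 t).1 ht) ((h2 t').1 ht') he,
    fun t => ?_⟩
  simp [rename, h2]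

variable [CommSemiring K] [LinearOrder K]

theorem rename_answers (hι : ∀ c ∈ D.constants Q, ι (ρ c) = c) :
    (D.rename ρ ι).answers Q = (D.answers Q).image (QAnswer.mapConst ρ) := by
  have hinj : Set.InjOn ρ (D.constants Q) := fun x hx y hy h => by
    rw [← hι x hx, h, hι y hy]
  have hval : ∀ h : ℕ →₀ ℕ, ∀ l : List ℕ, (∀ x ∈ l, x ∈ Q.vars) →
      l.map (assignOn Q.vars fun x => ρ (h x)) = (l.map h).map ρ := by
    intro h l hl
    rw [List.map_map]
    exact List.map_congr_left fun x hx => assignOn_of_mem _ (hl x hx)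
  have hargs : ∀ A ∈ Q.body, ∀ x ∈ A.args, x ∈ Q.vars := fun A hA x hx =>
    CQStar.mem_vars.2 ⟨A, hA, hx⟩
  have hπinj : ∀ h ∈ D.homs Q, ∀ h' ∈ D.homs Q, (assignOn Q.vars fun x => ρ (h x)) =
      (assignOn Q.vars fun x => ρ (h' x)) → h = h' := by
    intro h hh h' hh' he
    ext x
    by_cases hx : x ∈ Q.vars
    · have := DFunLike.congr_fun he x
      rw [assignOn_of_mem _ hx, assignOn_of_mem _ hx] at this
      exact hinj (hom_mem_constants hh hx) (hom_mem_constants hh' hx) this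
    · rw [((D.mem_homs Q h).1 hh).1 x hx, ((D.mem_homs Q h').1 hh').1 x hx]
  have hprod1 : ∀ h ∈ D.homs Q,
      (D.rename ρ ι).homProd Q (assignOn Q.vars fun x => ρ (h x)) = D.homProd Q h := by
    intro h hh
    unfold homProd
    congr 1
    rw [List.map_inj_left]
    intro A hA
    rw [hval h _ (hargs A hA)]
    change D.ann _ _ = _
    rw [map_map_of_constants hι]
    exact fun x hx => mem_constants_of_mem hA (((D.mem_homs Q h).1 hh).2 A hA) hx
  have hsurj : ∀ h₂ ∈ (D.rename ρ ι).homs Q,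
      ∃ h ∈ D.homs Q, (assignOn Q.vars fun x => ρ (h x)) = h₂ := by
    intro h₂ hh₂
    have hcon : ∀ x ∈ Q.vars, ∃ c ∈ D.constants Q, ρ c = h₂ x := fun x hx =>
      mem_rename_constants.1 (hom_mem_constants hh₂ hx)
    rw [mem_homs] at hh₂
    refine ⟨assignOn Q.vars fun x => ι (h₂ x), ?_, ?_⟩
    · rw [mem_homs]
      refine ⟨fun x hx => by rw [assignOn_apply, if_neg hx], fun A hA => ?_⟩
      obtain ⟨t, ht, he⟩ := Finset.mem_image.1 (hh₂.2 A hA)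
      have : A.args.map (assignOn Q.vars fun x => ι (h₂ x)) = (A.args.map h₂).map ι := by
        rw [List.map_map]
        exact List.map_congr_left fun x hx => assignOn_of_mem _ (hargs A hA x hx)
      rw [this, ← he, map_map_of_constants hι fun x hx => mem_constants_of_mem hA ht hx]
      exact ht
    · ext x
      by_cases hx : x ∈ Q.vars
      · obtain ⟨c, hc, he⟩ := hcon x hx
        rw [assignOn_of_mem _ hx, assignOn_of_mem _ hx, ← he, hι c hc]
      · rw [assignOn_apply, if_neg hx, hh₂.1 x hx]
  refine answers_eq_image ρ (fun h => assignOn Q.vars fun x => ρ (h x)) (fun h hh => ?_) hsurj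
    (fun h _ => hval h _ fun x hx => CQStar.mem_vars_of_mem_head (by simp [hx]))
    (fun h _ => hval h _ fun x hx => CQStar.mem_vars_of_mem_head (by simp [hx])) hinj
    (fun h₂ hh₂ => ?_)
  · rw [mem_homs]
    refine ⟨fun x hx => by rw [assignOn_apply, if_neg hx], fun A hA => ?_⟩
    rw [hval h _ (hargs A hA)]
    exact Finset.mem_image_of_mem _ (((D.mem_homs Q h).1 hh).2 A hA)
  · obtain ⟨h, hh, rfl⟩ := hsurj h₂ hh₂
    rw [hprod1 h hh, Finset.sum_eq_single_of_mem h (by simp [hh])]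
    intro h' hh' hne
    rw [Finset.mem_filter] at hh'
    exact absurd (hπinj h' hh'.1 h hh hh'.2) hne

/-- A strictly monotone renaming preserves the lexicographic order. The renamed list of answers is
therefore sorted, and a finite set has only one sorted list. -/
theorem rename_nthAnswer (hρ : StrictMonoOn ρ (D.constants Q))
    (hι : ∀ c ∈ D.constants Q, ι (ρ c) = c) (i : ℕ) :
    (D.rename ρ ι).nthAnswer Q i = (D.nthAnswer Q i).map (QAnswer.mapConst ρ) := by
  have hmono : ∀ r ∈ D.answers Q, ∀ r' ∈ D.answers Q, r < r' →
      QAnswer.mapConst ρ r < QAnswer.mapConst ρ r' := by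
    intro r hr r' hr' hlt
    have hcon : ∀ r ∈ D.answers Q, (∀ x ∈ (ofLex r).1, x ∈ (D.constants Q : Set ℕ)) ∧
        ∀ x ∈ (ofLex (ofLex r).2).2, x ∈ (D.constants Q : Set ℕ) := by
      intro r hr
      obtain ⟨h, hh, rfl⟩ := Finset.mem_image.1 hr
      refine ⟨fun x hx => ?_, fun x hx => ?_⟩ <;>
      · obtain ⟨y, hy, rfl⟩ := List.mem_map.1 hx
        exact hom_mem_constants hh (CQStar.mem_vars_of_mem_head (by simp [hy]))
    rw [Prod.Lex.lt_iff] at hlt ⊢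
    rcases hlt with h | ⟨h, h'⟩
    · exact Or.inl (List.map_strictMonoOn hρ (hcon r hr).1 (hcon r' hr').1 h)
    · refine Or.inr ⟨congrArg (List.map ρ) h, ?_⟩
      change toLex _ < toLex _
      rw [Prod.Lex.lt_iff] at h' ⊢
      rcases h' with h1 | ⟨h1, h2⟩
      · exact Or.inl h1
      · exact Or.inr ⟨h1, List.map_strictMonoOn hρ (hcon r hr).2 (hcon r' hr').2 h2⟩
  unfold nthAnswer
  rw [← List.getElem?_map, rename_answers hι]
  congr 1
  refine List.Perm.eq_of_sortedLE (Finset.sortedLT_sort _).sortedLE ?_ ?_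
  · rw [List.sortedLE_iff_pairwise, List.pairwise_map]
    refine (Finset.sortedLT_sort (D.answers Q)).pairwise.imp_of_mem fun ha hb hab => ?_
    exact (hmono _ ((Finset.mem_sort _).1 ha) _ ((Finset.mem_sort _).1 hb) hab).le
  · refine (List.perm_ext_iff_of_nodup (Finset.sort_nodup _ _) ?_).2 fun r => by simp
    rw [List.nodup_iff_pairwise_ne, List.pairwise_map]
    refine (Finset.sortedLT_sort (D.answers Q)).pairwise.imp_of_mem fun ha hb hab => ?_
    exact (hmono _ ((Finset.mem_sort _).1 ha) _ ((Finset.mem_sort _).1 hb) hab).ne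

end KDatabase

end Rename

/-! ## Ranks of constants -/

def rankIn (C : Finset ℕ) (x : ℕ) : ℕ := (C.filter (· < x)).card

theorem rankIn_strictMonoOn (C : Finset ℕ) : StrictMonoOn (rankIn C) C := by
  intro x hx y _ hxy
  refine Finset.card_lt_card ⟨fun z hz => ?_, fun h => ?_⟩
  · rw [Finset.mem_filter] at hz ⊢
    exact ⟨hz.1, hz.2.trans hxy⟩
  · have := h (Finset.mem_filter.2 ⟨hx, hxy⟩)
    exact absurd (Finset.mem_filter.1 this).2 (lt_irrefl _)

theorem rankIn_lt {C : Finset ℕ} {x : ℕ} (hx : x ∈ C) : rankIn C x < C.card := by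
  refine Finset.card_lt_card ⟨Finset.filter_subset _ _, fun h => ?_⟩
  exact absurd (Finset.mem_filter.1 (h hx)).2 (lt_irrefl _)

/-- The number of elements of `C` whose bits from the position `d` on form the number `v`. -/
def prefixCount (C : Finset ℕ) (d v : ℕ) : ℕ := (C.filter fun y => y / 2 ^ d = v).card

/-- A smaller prefix from bit `d` on is either smaller already from `d + 1` on, or it agrees there
and has a `0` at position `d` where `x` has a `1`. Iterated over all positions, this gives the rank
of `x` from one look-up per bit. -/
theorem card_prefix_step (C : Finset ℕ) (x d : ℕ) :
    (C.filter fun y => y / 2 ^ d < x / 2 ^ d).card =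
      (C.filter fun y => y / 2 ^ (d + 1) < x / 2 ^ (d + 1)).card +
        if x / 2 ^ d % 2 ≠ 0 then prefixCount C d (x / 2 ^ d - 1) else 0 := by
  have hd : ∀ y, y / 2 ^ (d + 1) = y / 2 ^ d / 2 := fun y => by
    rw [pow_succ, Nat.div_div_eq_div_mul]
  simp only [hd]
  split_ifs with h
  · rw [prefixCount, ← Finset.card_union_of_disjoint, ← Finset.filter_or]
    · congr 1
      refine Finset.filter_congr fun y _ => ?_
      generalize y / 2 ^ d = a at *
      generalize x / 2 ^ d = b at *
      omega
    · refine Finset.disjoint_filter.2 fun y _ h1 h2 => ?_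
      generalize y / 2 ^ d = a at *
      generalize x / 2 ^ d = b at *
      omega
  · rw [add_zero]
    congr 1
    refine Finset.filter_congr fun y _ => ?_
    generalize y / 2 ^ d = a at *
    generalize x / 2 ^ d = b at *
    omega

/-! ## Loops over all constants of the input -/

section Columns

variable {K : Type*}

/-- Execute the body for each entry of the given columns, where `(j, ar, p)` stands for the column
`p` of the relation `j` of arity `ar`. -/
def forColumns (c x : ℕ) (body : Stmt) : List (ℕ × ℕ × ℕ) → Stmt
  | [] => .skip
  | (j, ar, p) :: cs =>
    .seq (.loop c (.reg j) (.seq (.set x (.field j ar c p)) body)) (forColumns c x body cs)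

def columnValues (rows : ℕ → List (List ℕ × K)) : List (ℕ × ℕ × ℕ) → Finset ℕ
  | [] => ∅
  | (j, _, p) :: cs => ((rows j).map fun r => r.1.getD p 0).toFinset ∪ columnValues rows cs

theorem mem_columnValues {rows : ℕ → List (List ℕ × K)} {v : ℕ} : ∀ {cs : List (ℕ × ℕ × ℕ)},
    v ∈ columnValues rows cs ↔ ∃ q ∈ cs, ∃ r ∈ rows q.1, r.1.getD q.2.2 0 = v
  | [] => by simp [columnValues]
  | (j, ar, p) :: cs => by
    rw [columnValues, Finset.mem_union, mem_columnValues]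
    simp

/-- In `J S s`, the set `S` consists of the constants treated so far. A constant may occur many
times, so the body also has to cope with a `v` that is in `S` already. -/
theorem forColumns_spec [CommSemiring K] {κ W c x X T : ℕ} {C : Finset ℕ} {body : Stmt}
    {rows : ℕ → List (List ℕ × K)} (J : Finset ℕ → RamState K → Prop) :
    ∀ (cs : List (ℕ × ℕ × ℕ)),
    (∀ q ∈ cs, q.2.2 < q.2.1 ∧ (∀ r ∈ rows q.1, r.1.length = q.2.1) ∧ (rows q.1).length ≤ X ∧
      (∀ r ∈ rows q.1, ∀ y ∈ r.1, y < W ∧ y ∈ C) ∧ (X + 1) * (q.2.1 + 1) < W) →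
    (∀ S s, J S s → ∀ q ∈ cs, Holds s q.1 q.1 (rows q.1)) →
    (∀ q ∈ cs, q.1 ≠ c) →
    (∀ S s v, J S s → J S (s.setReg c v)) →
    (∀ S s v, J S s → v ∈ C → Sp κ W body (s.setReg x v) T (J (insert v S))) →
    ∀ S s, J S s →
    Sp κ W (forColumns c x body cs) s (1 + cs.length * (1 + X * (2 + T)))
      (J (S ∪ columnValues rows cs))
  | [], _, _, _, _, _, S, s, h => (Sp.skip (by simpa [columnValues] using h)).mono (by simp)
  | (j, ar, p) :: cs, hq, hH, hc, hset, hbody, S, s, h => by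
    obtain ⟨q1, q2, q3, q4, q5⟩ := hq (j, ar, p) (by simp)
    simp only at q1 q2 q3 q4 q5
    have hW1 : ((rows j).length + 1) * (ar + 1) < W :=
      (Nat.mul_le_mul_right _ (by omega)).trans_lt q5
    have hj := hH S s h (j, ar, p) (by simp)
    refine (Sp.seq (Sp.loop (e := .reg j) (n := (rows j).length) (T := 1 + T) (fun i s' =>
      J (S ∪ (((rows j).take i).map fun r => r.1.getD p 0).toFinset) s') ?_ hj.reg (by simpa using h)
      ?_) (fun s' h' => forColumns_spec J cs (fun q hq' => hq q (by simp [hq']))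
        (fun S s h q hq' => hH S s h q (by simp [hq'])) (fun q hq' => hc q (by simp [hq']))
        hset hbody _ s' h')).conseq ?_ ?_
    · have : (rows j).length < W := by nlinarith
      simpa [Ex.Ok, hj.reg] using this
    · intro i hi s1 h1
      have h2 := hset _ _ i h1
      have hj2 := hH _ _ h2 (j, ar, p) (by simp)
      obtain ⟨f1, f2⟩ := Ex.field_ok (p := p) hj2 (c := c) (i := i) (by simp) hi q2 q1 hW1
        (fun r hr y hy => (q4 r hr y hy).1)
      refine Sp.seq (Q := fun s' => s' = (s1.setReg c i).setReg x ((rows j)[i].1.getD p 0))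
        (Sp.set f1 (by rw [f2])) ?_
      rintro s2 rfl
      refine (hbody _ _ _ h2 ?_).conseq le_rfl fun s' h' => ?_
      · have hl := q2 _ (List.getElem_mem hi)
        rw [List.getD_eq_getElem _ _ (by omega)]
        exact (q4 _ (List.getElem_mem hi) _ (List.getElem_mem _)).2
      · convert h' using 1
        rw [List.take_add_one, List.map_append, List.toFinset_append, ← Finset.union_assoc]
        ext y
        simp [List.getElem?_eq_getElem hi]
    · have : (rows j).length * (1 + (1 + T)) ≤ X * (2 + T) := by
        rw [show 1 + (1 + T) = 2 + T by ring]; exact Nat.mul_le_mul_right _ q3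
      rw [List.length_cons, Nat.succ_mul]
      linarith
    · intro s' h'
      simpa [columnValues, Finset.union_assoc] using h'

end Columns

/-! ## The program that computes ranks -/

section RankProgram

variable {K : Type*}

/-- The states differ at most in the registers `n, …, n + 7` and the arrays `n, …, n + 3`. -/
structure OnlyWork (n : ℕ) (s s' : RamState K) : Prop where
  reg : ∀ r, r < n ∨ n + 8 ≤ r → s'.reg r = s.reg r
  kreg : s'.kreg = s.kreg
  karr : s'.karr = s.karr
  arr : ∀ B, B < n ∨ n + 4 ≤ B → s'.arr B = s.arr B

theorem OnlyWork.setReg {n r v : ℕ} {s s' : RamState K} (h : OnlyWork n s s')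
    (h1 : n ≤ r) (h2 : r < n + 8) : OnlyWork n s (s'.setReg r v) :=
  ⟨fun r' hr' => by
    have : r' ≠ r := by omega
    simp [this, h.reg r' hr'], h.kreg, h.karr, h.arr⟩

theorem OnlyWork.setArr {n A i v : ℕ} {s s' : RamState K} (h : OnlyWork n s s')
    (h1 : n ≤ A) (h2 : A < n + 4) : OnlyWork n s (s'.setArr A i v) :=
  ⟨h.reg, h.kreg, h.karr, fun B hB => by
    have : B ≠ A := by omega
    ext j; simp [this, h.arr B hB]⟩

/-- Use of the work space: register `n` is the row, `n + 1` the largest constant so far, `n + 2` its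
number of bits in the end, `n + 3` the current constant, `n + 4` that constant shifted to the right,
`n + 5` the bit position, `n + 6` a partial rank, and `n + 7` a bound on the number of answers.
Array `n` marks the constants seen, `n + 1` counts prefixes, `n + 2` maps ranks to constants and `n
+ 3` constants to ranks. -/
def maxBody (n : ℕ) : Stmt :=
  .cond (.op .lt (.reg (n + 1)) (.reg (n + 3))) (.set (n + 1) (.reg (n + 3))) .skip

theorem maxBody_spec [CommSemiring K] {κ W n v : ℕ} {s₀ s : RamState K} {S : Finset ℕ} {Y : ℕ} (hW : 1 < W)
    (hYW : Y ≤ W) (h : (OnlyWork n s₀ s ∧ s.arr = s₀.arr) ∧ (∀ x ∈ S, x ≤ s.reg (n + 1)) ∧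
      s.reg (n + 1) < Y)
    (hv : v < Y) : Sp κ W (maxBody n) (s.setReg (n + 3) v) 2 fun s' =>
      (OnlyWork n s₀ s' ∧ s'.arr = s₀.arr) ∧ (∀ x ∈ insert v S, x ≤ s'.reg (n + 1)) ∧
      s'.reg (n + 1) < Y := by
  obtain ⟨⟨h1, h4⟩, h2, h3⟩ := h
  refine Sp.cond (T := 1) ⟨?_, ?_, ?_⟩ (fun hlt => Sp.set ?_ ⟨⟨?_, by simpa using h4⟩, ?_, ?_⟩)
    (fun hge => Sp.skip ⟨⟨?_, by simpa using h4⟩, ?_, ?_⟩)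
  · simp [Ex.Ok]; omega
  · simp [Ex.Ok]; omega
  · simp only [WordOp.eval]; split <;> omega
  · simp [Ex.Ok]; omega
  · exact (h1.setReg (by omega) (by omega)).setReg (by omega) (by omega)
  · simp [Ex.eval, WordOp.eval] at hlt
    intro x hx
    rcases Finset.mem_insert.1 hx with rfl | hx
    · simp [Ex.eval]
    · have := h2 x hx
      simp [Ex.eval]; omega
  · simpa [Ex.eval] using hv
  · exact h1.setReg (by omega) (by omega)
  · simp [Ex.eval, WordOp.eval] at hge
    intro x hx
    rcases Finset.mem_insert.1 hx with rfl | hx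
    · simpa using hge
    · simpa using h2 x hx
  · simpa using h3

/-- The mark in array `n` makes every constant count once, however often it occurs. A new constant
increases the count of each of its prefixes. -/
def insertBody (n : ℕ) : Stmt :=
  .cond (.load n (.reg (n + 3))) .skip (.seq (.store n (.reg (n + 3)) (.cst 1))
    (.seq (.set (n + 4) (.reg (n + 3))) (.loop (n + 5) (.reg (n + 2))
      (.seq (.store (n + 1) (.pair (.reg (n + 5)) (.reg (n + 4)))
        (.op .add (.load (n + 1) (.pair (.reg (n + 5)) (.reg (n + 4)))) (.cst 1)))
        (.set (n + 4) (.op .div (.reg (n + 4)) (.cst 2)))))))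

theorem pair_reg_ok {W a b : ℕ} {s : RamState K} (h : pairCode (s.reg a) (s.reg b) < W) :
    (Ex.pair (.reg a) (.reg b)).Ok W s ∧
      (Ex.pair (.reg a) (.reg b)).eval s = pairCode (s.reg a) (s.reg b) := by
  have h2 : s.reg a + s.reg b ≤ (s.reg a + s.reg b) * (s.reg a + s.reg b) := Nat.le_mul_self _
  have h3 := h
  unfold pairCode at h3
  exact Ex.pair_ok (by simp only [Ex.Ok]; omega) (by simp only [Ex.Ok]; omega) h

theorem insertBody_spec [CommSemiring K] {κ W n v B Y : ℕ} {s₀ s : RamState K} {S C : Finset ℕ} (hW : 2 < W)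
    (hYW : Y ≤ W) (hB : B < W) (hpair : ∀ d < B, ∀ v < Y, pairCode d v < W) (hC : C.card < W)
    (hSC : S ⊆ C) (hvC : v ∈ C)
    (h : OnlyWork n s₀ s ∧ s.reg (n + 2) = B ∧ (∀ x, s.arr n x = if x ∈ S then 1 else 0) ∧
      ∀ d < B, ∀ u, s.arr (n + 1) (pairCode d u) = prefixCount S d u)
    (hv : v < Y) : Sp κ W (insertBody n) (s.setReg (n + 3) v) (4 + B * 3) fun s' =>
      OnlyWork n s₀ s' ∧ s'.reg (n + 2) = B ∧ (∀ x, s'.arr n x = if x ∈ insert v S then 1 else 0) ∧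
      ∀ d < B, ∀ u, s'.arr (n + 1) (pairCode d u) = prefixCount (insert v S) d u := by
  obtain ⟨h1, h2, h3, h4⟩ := h
  have h1' : OnlyWork n s₀ (s.setReg (n + 3) v) := h1.setReg (by omega) (by omega)
  refine (Sp.cond (e := .load n (.reg (n + 3))) (T := 3 + B * 3) (show _ ∧ _ from ⟨?_, ?_⟩)
    (fun hne => (Sp.skip ?_).mono (by omega)) (fun he => ?_)).mono (by omega)
  · simp [Ex.Ok]; omega
  · simp [Ex.eval, h3]; split <;> omega
  · have hvS : v ∈ S := by
      by_contra hvS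
      simp [Ex.eval, h3, hvS] at hne
    rw [Finset.insert_eq_self.2 hvS]
    exact ⟨h1', by simpa using h2, by simpa using h3, by simpa using h4⟩
  · have hvS : v ∉ S := by
      intro hvS
      simp [Ex.eval, h3, hvS] at he
    refine (Sp.seq (T := 1) (T' := 1 + (1 + B * (1 + 2)))
      (Q := fun s' => s' = (s.setReg (n + 3) v).setArr n v 1)
      (Sp.store ?_ ?_ ?_) ?_).mono (by omega)
    · simp [Ex.Ok]; omega
    · simp only [Ex.Ok]; omega
    · simp [Ex.eval]
    rintro s1 rfl
    refine Sp.seq (Q := fun s' => s' = ((s.setReg (n + 3) v).setArr n v 1).setReg (n + 4) v)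
      (Sp.set ?_ ?_) ?_
    · simp [Ex.Ok]; omega
    · simp [Ex.eval]
    rintro s1 rfl
    refine (Sp.loop (e := .reg (n + 2)) (n := B) (T := 2) (fun d s' => OnlyWork n s₀ s' ∧
      s'.reg (n + 2) = B ∧ (∀ x, s'.arr n x = if x ∈ insert v S then 1 else 0) ∧
      s'.reg (n + 4) = v / 2 ^ d ∧
      ∀ d' < B, ∀ u, s'.arr (n + 1) (pairCode d' u) =
        prefixCount S d' u + if d' < d ∧ v / 2 ^ d' = u then 1 else 0) ?_ ?_ ?_ ?_).conseq le_rfl ?_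
    · simp [Ex.Ok, h2]; omega
    · simp [Ex.eval, h2]
    · refine ⟨(h1'.setArr (by omega) (by omega)).setReg (by omega) (by omega), by simp [h2],
        fun x => ?_, by simp, fun d' hd' u => by simp [h4 d' hd']⟩
      by_cases hx : x = v
      · simp [hx]
      · simp [hx, h3]
    · rintro d hd s2 ⟨a1, a2, a3, a4, a5⟩
      have hu : v / 2 ^ d < Y := (Nat.div_le_self _ _).trans_lt hv
      have hcode := hpair d hd _ hu
      have hcode' : pairCode ((s2.setReg (n + 5) d).reg (n + 5)) ((s2.setReg (n + 5) d).reg (n + 4))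
          < W := by simpa [a4] using hcode
      obtain ⟨p1, p2⟩ := pair_reg_ok hcode'
      have p3 : pairCode ((s2.setReg (n + 5) d).reg (n + 5)) ((s2.setReg (n + 5) d).reg (n + 4)) =
          pairCode d (v / 2 ^ d) := by simp [a4]
      rw [p3] at p2
      -- `v` itself is not counted yet, so there is room for one more and the increased count is
      -- still a word.
      have hcnt : prefixCount S d (v / 2 ^ d) + 1 ≤ C.card := by
        have : (S.filter fun y => y / 2 ^ d = v / 2 ^ d) ⊂ C :=
          ⟨(Finset.filter_subset _ _).trans hSC, fun hh =>
            hvS (Finset.mem_filter.1 (hh hvC)).1⟩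
        exact Finset.card_lt_card this
      have hval : (s2.setReg (n + 5) d).arr (n + 1) (pairCode d (v / 2 ^ d)) =
          prefixCount S d (v / 2 ^ d) := by simp [a5 d hd]
      refine Sp.seq (T := 1) (T' := 1) (Q := fun s' => s' = (s2.setReg (n + 5) d).setArr (n + 1)
        (pairCode d (v / 2 ^ d)) (prefixCount S d (v / 2 ^ d) + 1)) (Sp.store p1 ?_ ?_) ?_
      · simp only [Ex.Ok, Ex.eval, p2, hval, WordOp.eval]
        exact ⟨⟨p1, by omega⟩, by omega, by omega⟩
      · simp only [Ex.eval, p2, hval, WordOp.eval]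
      rintro s3 rfl
      refine Sp.set ⟨?_, ?_, ?_⟩ ⟨?_, ?_, ?_, ?_, ?_⟩
      · simp [Ex.Ok, a4]; omega
      · simp only [Ex.Ok]; omega
      · simp [Ex.eval, WordOp.eval, a4]
        exact (Nat.div_le_self _ _).trans_lt (by omega)
      · exact ((a1.setReg (by omega) (by omega)).setArr (by omega) (by omega)).setReg
          (by omega) (by omega)
      · simp [a2]
      · intro x; simp [a3]
      · simp [Ex.eval, WordOp.eval, a4, pow_succ, Nat.div_div_eq_div_mul]
      · intro d' hd' u
        simp only [setReg_arr, setArr_arr, true_and, a5 d' hd']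
        by_cases hp : pairCode d' u = pairCode d (v / 2 ^ d)
        · obtain ⟨rfl, rfl⟩ := pairCode_inj hp
          simp
        · rw [if_neg hp]
          have : ¬ (d' = d ∧ v / 2 ^ d' = u) := by
            rintro ⟨rfl, rfl⟩; exact hp rfl
          congr 1
          by_cases hlt : d' < d
          · simp [hlt, hlt.trans (Nat.lt_succ_self d)]
          · by_cases hd2 : d' = d
            · subst hd2
              simp at this
              simp [this]
            · rw [if_neg (by omega), if_neg (by omega)]
    · rintro s' ⟨a1, a2, a3, a4, a5⟩
      refine ⟨a1, a2, a3, fun d hd u => ?_⟩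
      rw [a5 d hd, prefixCount, prefixCount, Finset.filter_insert]
      by_cases hu : v / 2 ^ d = u
      · rw [if_pos ⟨hd, hu⟩, if_pos hu, Finset.card_insert_of_notMem (by simp [hvS])]
      · rw [if_neg (by tauto), if_neg hu, add_zero]

/-- Where the constant has bit `1`, the prefix minus one is the prefix with bit `0` there and the
same bits above; its count is the summand in `card_prefix_step`. -/
def rankBody (n : ℕ) : Stmt :=
  .seq (.set (n + 4) (.reg (n + 3))) (.seq (.set (n + 6) (.cst 0)) (.seq
    (.loop (n + 5) (.reg (n + 2)) (.seq (.cond (.op .mod (.reg (n + 4)) (.cst 2))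
      (.set (n + 6) (.op .add (.reg (n + 6))
        (.load (n + 1) (.pair (.reg (n + 5)) (.op .sub (.reg (n + 4)) (.cst 1)))))) .skip)
      (.set (n + 4) (.op .div (.reg (n + 4)) (.cst 2)))))
    (.seq (.store (n + 3) (.reg (n + 3)) (.reg (n + 6)))
      (.store (n + 2) (.reg (n + 6)) (.reg (n + 3))))))

theorem rankBody_spec [CommSemiring K] {κ W n v B Y : ℕ} {s₀ s : RamState K} {S C : Finset ℕ} (hW : 2 < W)
    (hYW : Y ≤ W) (hB : B < W) (hpair : ∀ d < B, ∀ v < Y, pairCode d v < W) (hC : C.card < W)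
    (hSC : S ⊆ C) (hvC : v ∈ C) (hCB : ∀ x ∈ C, x < 2 ^ B)
    (h : OnlyWork n s₀ s ∧ s.reg (n + 2) = B ∧
      (∀ d < B, ∀ u, s.arr (n + 1) (pairCode d u) = prefixCount C d u) ∧
      ∀ x ∈ S, s.arr (n + 3) x = rankIn C x ∧ s.arr (n + 2) (rankIn C x) = x)
    (hv : v < Y) : Sp κ W (rankBody n) (s.setReg (n + 3) v) (5 + B * 4) fun s' =>
      OnlyWork n s₀ s' ∧ s'.reg (n + 2) = B ∧
      (∀ d < B, ∀ u, s'.arr (n + 1) (pairCode d u) = prefixCount C d u) ∧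
      ∀ x ∈ insert v S, s'.arr (n + 3) x = rankIn C x ∧ s'.arr (n + 2) (rankIn C x) = x := by
  obtain ⟨h1, h2, h3, h4⟩ := h
  have hcnt : ∀ x, rankIn C x ≤ C.card := fun x => Finset.card_filter_le _ _
  refine (Sp.seq (T := 1) (Q := fun s' => s' = (s.setReg (n + 3) v).setReg (n + 4) v)
    (Sp.set ?_ ?_) ?_).mono (show 1 + (1 + ((1 + B * (1 + 3)) + (1 + 1))) ≤ 5 + B * 4 by omega)
  · simp [Ex.Ok]; omega
  · simp [Ex.eval]
  rintro s1 rfl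
  refine Sp.seq (Q := fun s' => s' = ((s.setReg (n + 3) v).setReg (n + 4) v).setReg (n + 6) 0)
    (Sp.set ?_ ?_) ?_
  · simp only [Ex.Ok]; omega
  · simp [Ex.eval]
  rintro s1 rfl
  -- Invariant: the partial sum together with the number of constants that have a smaller prefix
  -- from `d` on is the rank. At `d = 0` the sum is empty; at `d = B` all prefixes are zero, and the
  -- sum is the rank.
  refine Sp.seq (Sp.loop (e := .reg (n + 2)) (n := B) (T := 3) (fun d s' => OnlyWork n s₀ s' ∧
      s'.reg (n + 2) = B ∧ s'.reg (n + 3) = v ∧ s'.reg (n + 4) = v / 2 ^ d ∧ s'.arr = s.arr ∧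
      s'.reg (n + 6) + (C.filter fun y => y / 2 ^ d < v / 2 ^ d).card = rankIn C v) ?_ ?_ ?_ ?_) ?_
  · simp [Ex.Ok, h2]; omega
  · simp [Ex.eval, h2]
  · exact ⟨((h1.setReg (by omega) (by omega)).setReg (by omega) (by omega)).setReg (by omega)
      (by omega), by simp [h2], by simp, by simp, by simp, by simp [rankIn]⟩
  · rintro d hd s2 ⟨a1, a2, a3, a4, a5, a6⟩
    have hu : v / 2 ^ d < Y := (Nat.div_le_self _ _).trans_lt hv
    have hstep := card_prefix_step C v d
    have hrv := hcnt v
    refine (Sp.seq (T := 2) (T' := 1) (Sp.cond (T := 1) ⟨?_, ?_, ?_⟩ (Q := fun s' =>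
      OnlyWork n s₀ s' ∧
      s'.reg (n + 2) = B ∧ s'.reg (n + 3) = v ∧ s'.reg (n + 4) = v / 2 ^ d ∧ s'.arr = s.arr ∧
      s'.reg (n + 6) + (C.filter fun y => y / 2 ^ (d + 1) < v / 2 ^ (d + 1)).card = rankIn C v)
      (fun hodd => ?_) (fun heven => ?_)) ?_)
    · simp [Ex.Ok, a4]; omega
    · simp only [Ex.Ok]; omega
    · simp only [Ex.eval, WordOp.eval]; omega
    · simp only [Ex.eval, WordOp.eval, setReg_reg, a4, show n + 4 ≠ n + 5 by omega, if_false]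
        at hodd
      rw [if_pos hodd] at hstep
      have hcode := hpair d hd (v / 2 ^ d - 1) (by omega)
      obtain ⟨p1, p2⟩ := Ex.pair_ok (W := W) (s := s2.setReg (n + 5) d) (x := .reg (n + 5))
        (y := .op .sub (.reg (n + 4)) (.cst 1)) (by simp [Ex.Ok]; omega)
        (by simp [Ex.Ok, Ex.eval, WordOp.eval, a4]; omega)
        (by simpa [Ex.eval, WordOp.eval, a4] using hcode)
      have p3 : pairCode ((Ex.reg (n + 5)).eval (s2.setReg (n + 5) d))
          ((Ex.op .sub (.reg (n + 4)) (.cst 1)).eval (s2.setReg (n + 5) d)) =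
          pairCode d (v / 2 ^ d - 1) := by simp [Ex.eval, WordOp.eval, a4]
      rw [p3] at p2
      have hval : (s2.setReg (n + 5) d).arr (n + 1) (pairCode d (v / 2 ^ d - 1)) =
          prefixCount C d (v / 2 ^ d - 1) := by simp [a5, h3 d hd]
      refine Sp.set ⟨?_, ⟨p1, ?_⟩, ?_⟩ ⟨?_, ?_, ?_, ?_, ?_, ?_⟩
      · simp [Ex.Ok]; omega
      · rw [p2, hval]; omega
      · simp only [Ex.eval, WordOp.eval, p2, hval]; simp; omega
      · exact (a1.setReg (by omega) (by omega)).setReg (by omega) (by omega)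
      · simp [a2]
      · simp [a3]
      · simp [a4]
      · simp [a5]
      · simp only [Ex.eval, WordOp.eval, p2, hval]; simp; omega
    · simp only [Ex.eval, WordOp.eval, setReg_reg, a4, show n + 4 ≠ n + 5 by omega, if_false]
        at heven
      rw [if_neg (by omega)] at hstep
      exact Sp.skip ⟨a1.setReg (by omega) (by omega), by simp [a2], by simp [a3], by simp [a4],
        by simp [a5], by simp; omega⟩
    · rintro s3 ⟨b1, b2, b3, b4, b5, b6⟩
      refine Sp.set ⟨?_, ?_, ?_⟩ ⟨b1.setReg (by omega) (by omega), by simp [b2], by simp [b3],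
        ?_, by simp [b5], by simpa using b6⟩
      · simp [Ex.Ok, b4]; omega
      · simp only [Ex.Ok]; omega
      · simp [Ex.eval, WordOp.eval, b4]
        exact (Nat.div_le_self _ _).trans_lt (by omega)
      · simp [Ex.eval, WordOp.eval, b4, pow_succ, Nat.div_div_eq_div_mul]
  · rintro s2 ⟨a1, a2, a3, -, a5, a6⟩
    have hr : s2.reg (n + 6) = rankIn C v := by
      rw [← a6]
      simp [Nat.div_eq_of_lt (hCB v hvC)]
    have hrv := hcnt v
    refine Sp.seq (Q := fun s' => s' = s2.setArr (n + 3) v (rankIn C v)) (Sp.store ?_ ?_ ?_) ?_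
    · simp [Ex.Ok]; omega
    · simp [Ex.Ok]; omega
    · simp [Ex.eval, hr, a3]
    rintro s3 rfl
    refine Sp.store ?_ ?_ ⟨?_, ?_, fun d hd u => ?_, fun x hx => ?_⟩
    · simp [Ex.Ok]; omega
    · simp [Ex.Ok]; omega
    · exact (a1.setArr (by omega) (by omega)).setArr (by omega) (by omega)
    · simp [a2]
    · simp [a5, h3 d hd]
    · simp only [Ex.eval, setArr_reg, setArr_arr, hr, a3, a5, true_and]
      have hxC : x ∈ C := by
        rcases Finset.mem_insert.1 hx with rfl | hx
        · exact hvC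
        · exact hSC hx
      by_cases hxv : x = v
      · simp [hxv]
      · have hxS : x ∈ S := (Finset.mem_insert.1 hx).resolve_left hxv
        -- Distinct constants have distinct ranks, so the entries of earlier constants are not
        -- overwritten.
        have hne : rankIn C x ≠ rankIn C v := fun he =>
          hxv ((rankIn_strictMonoOn C).injOn hxC hvC he)
        simpa [hxv, hne] using h4 x hxS

end RankProgram

/-! ## From direct access to relaxed direct access -/

theorem log_le_of_le_mul {k M N : ℕ} (hM : 2 ≤ M) (hN : N ≤ (k + 1) * M) :
    Nat.log 2 N ≤ (k + 1) * Nat.log 2 M := by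
  have h1 : 1 ≤ Nat.log 2 M := Nat.log_pos (by norm_num) hM
  rcases Nat.eq_zero_or_pos N with rfl | h0
  · simp
  have h2 : N < 2 ^ (k + (Nat.log 2 M + 1)) := by
    have h3 : k + 1 ≤ 2 ^ k := Nat.lt_two_pow_self
    have h4 : M < 2 ^ (Nat.log 2 M + 1) := Nat.lt_pow_succ_log_self (by norm_num) M
    calc N ≤ (k + 1) * M := hN
      _ ≤ 2 ^ k * M := Nat.mul_le_mul_right _ h3
      _ < 2 ^ k * 2 ^ (Nat.log 2 M + 1) := Nat.mul_lt_mul_of_pos_left h4 (by positivity)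
      _ = _ := (pow_add _ _ _).symm
  have h5 := Nat.log_lt_of_lt_pow (by omega) h2
  nlinarith

theorem size_le_log {k M x : ℕ} (hM : 2 ≤ M) (hx : x < M ^ k) :
    Nat.size x ≤ 2 * k * Nat.log 2 M := by
  have h1 : 1 ≤ Nat.log 2 M := Nat.log_pos (by norm_num) hM
  have h2 : M < 2 ^ (Nat.log 2 M + 1) := Nat.lt_pow_succ_log_self (by norm_num) M
  have h3 : x < 2 ^ ((Nat.log 2 M + 1) * k) := by
    rw [pow_mul]
    exact hx.trans_le (Nat.pow_le_pow_left h2.le k)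
  refine (Nat.size_le.2 h3).trans ?_
  nlinarith

/-- If `N ≤ M`, the growth condition bounds `κ M` by a multiple of `κ N * log M / log N`, and this
factor is harmless for word instructions too. If `M ≤ N`, then `κ M ≤ κ N` by monotonicity, and `log
N` is at most a multiple of `log M`. -/
theorem LogarithmicTime.transfer {K : Type*} [CommSemiring K] [LinearOrder K] {κ : ℕ → ℕ}
    (hκ : LogarithmicTime κ) (k : ℕ) : ∃ c, ∀ {M N W t : ℕ} {p : RamProg} {s s' : RamState K},
    2 ≤ M → 2 ≤ N → N ≤ (k + 1) * M → RamExec (κ N) W p s s' t →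
    ∃ t', RamExec (κ M) W p s s' t' ∧ t' * Nat.log 2 N ≤ c * Nat.log 2 M * t := by
  obtain ⟨C, hC⟩ := hκ.growth
  refine ⟨C + 1 + (k + 1), fun {M N W t p s s'} hM hN hNM h => ?_⟩
  rcases le_total N M with hle | hle
  · have h1 : Nat.log 2 N ≤ Nat.log 2 M := Nat.log_mono_right hle
    obtain ⟨t', e, ht⟩ := h.change_cost (κ' := κ M) (a := Nat.log 2 N)
      (b := (C + 1) * Nat.log 2 M) (by nlinarith) (by
        calc κ M * Nat.log 2 N ≤ C * (κ N * Nat.log 2 M) := hC N M hN hle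
          _ = C * Nat.log 2 M * κ N := by ring
          _ ≤ (C + 1) * Nat.log 2 M * κ N := by gcongr; omega)
    refine ⟨t', e, ht.trans ?_⟩
    exact Nat.mul_le_mul_right _ (Nat.mul_le_mul_right _ (by omega))
  · obtain ⟨t', e, ht⟩ := h.change_cost (κ' := κ M) (a := Nat.log 2 N)
      (b := Nat.log 2 N) le_rfl (by rw [mul_comm]; gcongr; exact hκ.mono hle)
    refine ⟨t', e, ht.trans ?_⟩
    have := log_le_of_le_mul hM hNM
    gcongr
    nlinarith

theorem List.filterMap_getElem?_range {α β : Type*} (g : α → Option β) : ∀ l : List α,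
    (List.range l.length).filterMap (fun i => l[i]?.bind g) = l.filterMap g
  | [] => rfl
  | a :: l => by
    rw [List.length_cons, List.range_succ_eq_map, List.filterMap_cons, List.filterMap_cons,
      List.filterMap_map, ← List.filterMap_getElem?_range g l]
    simp

/-! ### Replacing all constants of a database by their ranks -/

section Ranks

variable {K : Type*}

def CQStar.columns (Q : CQStar) : List (ℕ × ℕ × ℕ) :=
  Q.body.zipIdx.flatMap fun q => (List.range q.1.args.length).map fun p =>
    (q.2, q.1.args.length, p)

theorem CQStar.mem_columns {Q : CQStar} {j ar p : ℕ} : (j, ar, p) ∈ Q.columns ↔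
    ∃ A, Q.body[j]? = some A ∧ ar = A.args.length ∧ p < ar := by
  simp only [CQStar.columns, List.mem_flatMap, List.mem_map, List.mem_range, Prod.exists,
    Prod.mk.injEq, List.mem_zipIdx_iff_getElem?]
  constructor
  · rintro ⟨A, i, h1, q, h2, rfl, rfl, rfl⟩
    exact ⟨A, h1, rfl, h2⟩
  · rintro ⟨A, h1, rfl, h2⟩
    exact ⟨A, j, h1, p, h2, rfl, rfl, rfl⟩

def CQStar.maxArity (Q : CQStar) : ℕ := (Q.body.map fun A => A.args.length).sum

theorem CQStar.le_maxArity {Q : CQStar} {A : QAtom} (hA : A ∈ Q.body) :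
    A.args.length ≤ Q.maxArity :=
  List.single_le_sum (by simp) _ (List.mem_map.2 ⟨A, hA, rfl⟩)

/-- The annotated facts of the `j`-th atom. -/
def atomRows (D : KDatabase K) (L : ℕ → List (List ℕ)) (Q : CQStar) (j : ℕ) :
    List (List ℕ × K) :=
  match Q.body[j]? with
  | some A => factRows D L A.rel
  | none => []

theorem atomRows_eq {D : KDatabase K} {L : ℕ → List (List ℕ)} {Q : CQStar} {j : ℕ} {A : QAtom}
    (h : Q.body[j]? = some A) : atomRows D L Q j = factRows D L A.rel := by
  simp [atomRows, h]

theorem columnValues_eq_constants {D : KDatabase K} {L : ℕ → List (List ℕ)} {Q : CQStar}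
    (hD : D.Over Q) (hL : Enumerates D Q L) :
    columnValues (atomRows D L Q) Q.columns = D.constants Q := by
  ext v
  rw [mem_columnValues, mem_constants]
  constructor
  · rintro ⟨⟨j, ar, p⟩, hq, r, hr, rfl⟩
    obtain ⟨A, hA, rfl, hp⟩ := CQStar.mem_columns.1 hq
    have hA' := List.mem_of_getElem? hA
    rw [atomRows_eq hA] at hr
    obtain ⟨h1, h2, -⟩ := hL.row hD hA' hr
    refine ⟨A, hA', r.1, h2, ?_⟩
    rw [List.getD_eq_getElem _ _ (by simp only; omega)]
    exact List.getElem_mem _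
  · rintro ⟨A, hA, t, ht, hv⟩
    obtain ⟨j, hj, rfl⟩ := List.mem_iff_getElem.1 hA
    obtain ⟨p, hp, rfl⟩ := List.mem_iff_getElem.1 hv
    refine ⟨(j, (Q.body[j]).args.length, p), CQStar.mem_columns.2 ⟨Q.body[j],
      List.getElem?_eq_getElem hj, rfl, by rwa [← hD _ hA t ht]⟩, (t, D.ann (Q.body[j]).rel t), ?_, ?_⟩
    · rw [atomRows_eq (List.getElem?_eq_getElem hj)]
      exact List.mem_map.2 ⟨t, ((hL _ (CQStar.rel_mem_symbols hA)).2 t).2 ht, rfl⟩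
    · simp [hp]

theorem card_constants_le {D : KDatabase K} {Q : CQStar} (hD : D.Over Q) :
    (D.constants Q).card ≤ D.size Q * Q.maxArity := by
  unfold KDatabase.constants KDatabase.size
  refine Finset.card_biUnion_le.trans ?_
  have hsum : (Q.symbols.map fun R => (D.rel R).card).sum =
      ∑ R ∈ Q.symbols.toFinset, (D.rel R).card :=
    (List.sum_toFinset _ (List.nodup_dedup (Q.body.map QAtom.rel))).symm
  rw [hsum, Finset.sum_mul]
  refine Finset.sum_le_sum fun R hR => Finset.card_biUnion_le.trans ?_
  obtain ⟨A, hA, rfl⟩ := CQStar.mem_symbols.1 (List.mem_toFinset.1 hR)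
  rw [← smul_eq_mul]
  refine Finset.sum_le_card_nsmul _ _ _ fun t ht => (List.toFinset_card_le t).trans ?_
  rw [hD A hA t ht]
  exact CQStar.le_maxArity hA

/-- Starting from `2`, the sum of the numbers of facts is the shifted input size. -/
def Ex.sumRegs : ℕ → Ex
  | 0 => .cst 2
  | n + 1 => .op .add (Ex.sumRegs n) (.reg n)

theorem Ex.sumRegs_ok {W : ℕ} {s : RamState K} : ∀ n, ∑ j ∈ Finset.range n, s.reg j + 2 < W →
    (Ex.sumRegs n).Ok W s ∧ (Ex.sumRegs n).eval s = ∑ j ∈ Finset.range n, s.reg j + 2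
  | 0, h => ⟨by simpa [Ex.sumRegs, Ex.Ok] using h, by simp [Ex.sumRegs, Ex.eval]⟩
  | n + 1, h => by
    rw [Finset.sum_range_succ] at h ⊢
    obtain ⟨h1, h2⟩ := Ex.sumRegs_ok n (s := s) (W := W) (by omega)
    simp only [Ex.sumRegs, Ex.Ok, Ex.eval, WordOp.eval, h2]
    exact ⟨⟨h1, by omega, by omega⟩, by omega⟩

def Ex.pow (e : Ex) : ℕ → Ex
  | 0 => .cst 1
  | n + 1 => .op .mul (e.pow n) e

theorem Ex.pow_ok {W : ℕ} {s : RamState K} {e : Ex} (h : e.Ok W s) (h0 : 0 < e.eval s) : ∀ n,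
    e.eval s ^ n < W → (e.pow n).Ok W s ∧ (e.pow n).eval s = e.eval s ^ n
  | 0, hW => ⟨by simpa [Ex.pow, Ex.Ok] using hW, by simp [Ex.pow, Ex.eval]⟩
  | n + 1, hW => by
    have hle : e.eval s ^ n ≤ e.eval s ^ (n + 1) := Nat.pow_le_pow_right h0 (by omega)
    obtain ⟨h1, h2⟩ := Ex.pow_ok h h0 n (hle.trans_lt hW)
    simp only [Ex.pow, Ex.Ok, Ex.eval, WordOp.eval, h2]
    exact ⟨⟨h1, h, by rwa [← pow_succ]⟩, by rw [pow_succ]⟩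

theorem sum_inputState_reg [CommSemiring K] {D : KDatabase K} {Q : CQStar}
    {L : ℕ → List (List ℕ)} (hQ : Q.SelfJoinFree) (hL : Enumerates D Q L) :
    ∑ j ∈ Finset.range Q.body.length, (inputState D Q L).reg j = D.size Q := by
  rw [KDatabase.size, hQ.symbols_eq, List.map_map, Finset.sum_range, ← List.sum_ofFn]
  congr 1
  refine List.ext_getElem (by simp) fun j h1 h2 => ?_
  have hj : j < Q.body.length := by simpa using h1
  have h3 := inputState_holds (D := D) (L := L) hQ (List.getElem?_eq_getElem hj)
  simp only [List.getElem_ofFn, List.getElem_map, Function.comp_apply, h3.reg, factRows_length]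
  exact hL.card (CQStar.rel_mem_symbols (List.getElem_mem hj))

/-- For each atom, output its facts with ranks in place of constants. -/
def rankSpecs (Q : CQStar) : List RowSpec :=
  let n := Q.body.length
  Q.body.zipIdx.map fun q =>
    { src := q.2
      test := .cst 1
      fields := (List.range q.1.args.length).map fun p =>
        .load (n + 3) (.field q.2 q.1.args.length n p)
      val := .load q.2 (.reg n) }

/-- Replace the constants of the input by their ranks. -/
def rankProgram (Q : CQStar) : Stmt :=
  let n := Q.body.length
  .seq (forColumns n (n + 3) (maxBody n) Q.columns) (.seq (.size (n + 2) (.reg (n + 1)))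
    (.seq (forColumns n (n + 3) (insertBody n) Q.columns)
    (.seq (forColumns n (n + 3) (rankBody n) Q.columns)
    (.seq (.set (n + 7) ((Ex.sumRegs n).pow n)) (transduceAll n (n + 4) (n + 8) (rankSpecs Q))))))

/-- `B` is the number of bits of the largest constant, which is only found during the run. The power
in register `n + 7` bounds the number of answers, by `card_answers_le`, and is used later to clip
indices; the table from ranks back to constants is kept for the output. -/
theorem rankProgram_spec [CommSemiring K] {κ W Y : ℕ} (hκ : 1 ≤ κ) {D : KDatabase K} {Q : CQStar}
    {L : ℕ → List (List ℕ)} (hQ : Q.SelfJoinFree) (hD : D.Over Q) (hL : Enumerates D Q L)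
    (hW : 2 < W) (hYW : Y ≤ W) (hY : 0 < Y) (hc : ∀ c ∈ D.constants Q, c < Y)
    (hpair : ∀ d < Y, ∀ v < Y, pairCode d v < W) (hC : (D.constants Q).card < W)
    (hX : (D.size Q + 1) * (Q.maxArity + 1) < W) (hN : (D.size Q + 2) ^ Q.body.length < W)
    (hN' : D.size Q + 2 < W) {ι : ℕ → ℕ} (hι : ∀ c ∈ D.constants Q, ι (rankIn (D.constants Q) c) = c) :
    ∃ B, (∃ x < Y, B = Nat.size x) ∧ Sp κ W (rankProgram Q) (inputState D Q L)
      ((1 + Q.columns.length * (1 + D.size Q * (2 + 2))) + ((1 + B) +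
        ((1 + Q.columns.length * (1 + D.size Q * (2 + (4 + B * 3)))) +
        ((1 + Q.columns.length * (1 + D.size Q * (2 + (5 + B * 4)))) + (1 +
        (1 + Q.body.length * (1 + D.size Q * ((Q.maxArity + 5) * κ)))))))) fun s =>
      ((∀ j, s.arr (j + (Q.body.length + 4)) = (inputState (D.rename (rankIn (D.constants Q)) ι) Q
          (fun S => (L S).map (List.map (rankIn (D.constants Q))))).arr j) ∧
        (∀ j, s.karr (j + (Q.body.length + 4)) = (inputState (D.rename (rankIn (D.constants Q)) ι) Q
          (fun S => (L S).map (List.map (rankIn (D.constants Q))))).karr j) ∧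
        ∀ j < Q.symbols.length, s.reg (Q.body.length + 8 + j) =
          (inputState (D.rename (rankIn (D.constants Q)) ι) Q
          (fun S => (L S).map (List.map (rankIn (D.constants Q))))).reg j) ∧
      s.reg (Q.body.length + 7) = (D.size Q + 2) ^ Q.body.length ∧
      ∀ x ∈ D.constants Q, s.arr (Q.body.length + 2) (rankIn (D.constants Q) x) = x := by
  classical
  set n := Q.body.length with hn
  set C := D.constants Q with hCdef
  set s₀ := inputState D Q L with hs₀
  have hsym : Q.symbols.length = n := by rw [hQ.symbols_eq, List.length_map]
  have hz : ∀ r ≥ n, s₀.reg r = 0 := fun r hr => by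
    have : Q.symbols[r]? = none := List.getElem?_eq_none (by omega)
    simp [hs₀, inputState, this]
  have hza : ∀ B ≥ n, ∀ i, s₀.arr B i = 0 ∧ s₀.karr B i = 0 := by
    intro B hB i
    have : Q.symbols[B]? = none := List.getElem?_eq_none (by omega)
    simp [hs₀, inputState, this]
  have hH : ∀ s, OnlyWork n s₀ s → ∀ j A, Q.body[j]? = some A →
      Holds s j j (factRows D L A.rel) := by
    intro s hs j A hj
    have hjn : j < n := (List.getElem?_eq_some_iff.1 hj).1
    exact (inputState_holds hQ hj).congr (hs.reg j (by omega)) (hs.arr j (by omega))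
      (by rw [hs.karr])
  have hcol : ∀ q ∈ Q.columns, q.2.2 < q.2.1 ∧ (∀ r ∈ atomRows D L Q q.1, r.1.length = q.2.1) ∧
      (atomRows D L Q q.1).length ≤ D.size Q ∧
      (∀ r ∈ atomRows D L Q q.1, ∀ y ∈ r.1, y < W ∧ y ∈ C) ∧
      (D.size Q + 1) * (q.2.1 + 1) < W := by
    rintro ⟨j, ar, p⟩ hq
    obtain ⟨A, hA, rfl, hp⟩ := CQStar.mem_columns.1 hq
    have hA' := List.mem_of_getElem? hA
    simp only [atomRows_eq hA]
    refine ⟨hp, fun r hr => (hL.row hD hA' hr).1, hL.rows_length_le hA', fun r hr y hy => ?_,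
      (Nat.mul_le_mul_left _ (Nat.succ_le_succ (CQStar.le_maxArity hA'))).trans_lt hX⟩
    have := (hL.row hD hA' hr).2.2.2 y hy
    exact ⟨(hc y this).trans_le hYW, this⟩
  have hcolH : ∀ s, OnlyWork n s₀ s → ∀ q ∈ Q.columns,
      Holds s q.1 q.1 (atomRows D L Q q.1) := by
    rintro s hs ⟨j, ar, p⟩ hq
    obtain ⟨A, hA, -⟩ := CQStar.mem_columns.1 hq
    simpa only [atomRows_eq hA] using hH s hs j A hA
  have hcoln : ∀ q ∈ Q.columns, q.1 ≠ n := by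
    rintro ⟨j, ar, p⟩ hq
    obtain ⟨A, hA, -⟩ := CQStar.mem_columns.1 hq
    have : j < n := (List.getElem?_eq_some_iff.1 hA).1
    simp only; omega
  have hval := columnValues_eq_constants hD hL
  have hs₀s₀ : OnlyWork n s₀ s₀ := ⟨fun _ _ => rfl, rfl, rfl, fun _ _ => rfl⟩
  have h1 := forColumns_spec (κ := κ) (W := W) (c := n) (x := n + 3) (C := C)
    (fun (S : Finset ℕ) s => (OnlyWork n s₀ s ∧ s.arr = s₀.arr) ∧ (∀ x ∈ S, x ≤ s.reg (n + 1)) ∧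
      s.reg (n + 1) < Y) Q.columns hcol (fun S s h => hcolH s h.1.1) hcoln
    (fun S s v h => ⟨⟨h.1.1.setReg le_rfl (by omega), by simpa using h.1.2⟩, by simpa using h.2.1,
      by simpa using h.2.2⟩)
    (fun S s v h hv => maxBody_spec (by omega) hYW h (hc v hv)) ∅ s₀
    ⟨⟨hs₀s₀, rfl⟩, by simp, by rw [hz _ (by omega)]; exact hY⟩
  rw [hval, Finset.empty_union] at h1
  set s₁ := (forColumns n (n + 3) (maxBody n) Q.columns).run s₀ with hs₁
  obtain ⟨h1a, h1b, ⟨w1, a1⟩, m1, b1⟩ := h1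
  refine ⟨Nat.size (s₁.reg (n + 1)), ⟨_, b1, rfl⟩, ?_⟩
  set B := Nat.size (s₁.reg (n + 1)) with hB
  have hBY : B ≤ s₁.reg (n + 1) := Nat.size_le.2 Nat.lt_two_pow_self
  have hBW : B < W := by change s₁.reg (n + 1) < Y at b1; omega
  have hCB : ∀ x ∈ C, x < 2 ^ B := fun x hx => (m1 x hx).trans_lt (Nat.lt_size_self _)
  have hpair' : ∀ d < B, ∀ v < Y, pairCode d v < W := fun d hd v hv =>
    hpair d (by change s₁.reg (n + 1) < Y at b1; omega) v hv
  refine Sp.seq (Q := fun s => s = s₁) ⟨h1a, h1b, rfl⟩ ?_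
  rintro _ rfl
  refine Sp.seq (Q := fun s => s = s₁.setReg (n + 2) B)
    (Sp.size (e := .reg (n + 1)) (by change s₁.reg (n + 1) < Y at b1; simp only [Ex.Ok]; omega) rfl) ?_
  rintro _ rfl
  refine Sp.seq (forColumns_spec (C := C) (fun (S : Finset ℕ) s => S ⊆ C ∧ OnlyWork n s₀ s ∧ s.reg (n + 2) = B ∧
      (∀ x, s.arr n x = if x ∈ S then 1 else 0) ∧
      ∀ d < B, ∀ u, s.arr (n + 1) (pairCode d u) = prefixCount S d u)
    Q.columns hcol (fun S s h => hcolH s h.2.1) hcoln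
    (fun S s v h => ⟨h.1, h.2.1.setReg le_rfl (by omega), by simpa using h.2.2.1,
      by simpa using h.2.2.2.1, by simpa using h.2.2.2.2⟩)
    (fun S s v h hv => (insertBody_spec hW hYW hBW hpair' hC h.1 hv h.2 (hc v hv)).conseq le_rfl
      fun s' h' => ⟨Finset.insert_subset hv h.1, h'⟩) ∅ _
    ⟨by simp, w1.setReg (by omega) (by omega), by simp, ?_, ?_⟩) ?_
  · intro x
    change s₁.arr n x = _
    rw [a1, (hza n le_rfl x).1]
    simp
  · intro d _ u
    change s₁.arr (n + 1) _ = _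
    rw [a1, (hza (n + 1) (by omega) _).1]
    simp [prefixCount]
  rintro s₂ ⟨-, w2, r2, -, c2⟩
  rw [hval, Finset.empty_union] at c2
  refine Sp.seq (forColumns_spec (C := C) (fun (S : Finset ℕ) s => S ⊆ C ∧ OnlyWork n s₀ s ∧ s.reg (n + 2) = B ∧
      (∀ d < B, ∀ u, s.arr (n + 1) (pairCode d u) = prefixCount C d u) ∧
      ∀ x ∈ S, s.arr (n + 3) x = rankIn C x ∧ s.arr (n + 2) (rankIn C x) = x)
    Q.columns hcol (fun S s h => hcolH s h.2.1) hcoln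
    (fun S s v h => ⟨h.1, h.2.1.setReg le_rfl (by omega), by simpa using h.2.2.1,
      by simpa using h.2.2.2.1, by simpa using h.2.2.2.2⟩)
    (fun S s v h hv => (rankBody_spec hW hYW hBW hpair' hC h.1 hv hCB h.2 (hc v hv)).conseq le_rfl
      fun s' h' => ⟨Finset.insert_subset hv h.1, h'⟩) ∅ _
    ⟨by simp, w2, r2, c2, by simp⟩) ?_
  rintro s₃ ⟨-, w3, r3, -, k3⟩
  rw [hval, Finset.empty_union] at k3
  have hsum : ∑ j ∈ Finset.range n, s₃.reg j = D.size Q := by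
    rw [← sum_inputState_reg hQ hL]
    exact Finset.sum_congr rfl fun j hj => w3.reg j (by have := Finset.mem_range.1 hj; omega)
  obtain ⟨e1, e2⟩ := Ex.sumRegs_ok (W := W) (s := s₃) n (by omega)
  obtain ⟨e3, e4⟩ := Ex.pow_ok e1 (by omega) n (by rw [e2, hsum]; exact hN)
  rw [e2, hsum] at e4
  refine Sp.seq (Q := fun s => s = s₃.setReg (n + 7) ((D.size Q + 2) ^ n)) (Sp.set e3 (by rw [e4])) ?_
  rintro _ rfl
  set s₄ := s₃.setReg (n + 7) ((D.size Q + 2) ^ n) with hs₄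
  have w4 : OnlyWork n s₀ s₄ := w3.setReg (by omega) (by omega)
  have k4 : ∀ x ∈ C, s₄.arr (n + 3) x = rankIn C x ∧ s₄.arr (n + 2) (rankIn C x) = x := by
    simpa [hs₄] using k3
  set gs : List (ℕ → Option (List ℕ × K)) := (List.range n).map fun j i =>
    (atomRows D L Q j)[i]?.bind fun r => some (r.1.map (rankIn C), r.2) with hgs
  have hsp : ∀ j A, Q.body[j]? = some A → (rankSpecs Q)[j]? = some
      (RowSpec.mk j (.cst 1) ((List.range A.args.length).map fun p =>
          .load (n + 3) (.field j A.args.length n p)) (.load j (.reg n))) := by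
    intro j A hj
    simp [rankSpecs, hj, hn]
  have hsl : (rankSpecs Q).length = n := by simp [rankSpecs, hn]
  have hg : ∀ j < n, gs[j]? = some fun i =>
      (atomRows D L Q j)[i]?.bind fun r => some (r.1.map (rankIn C), r.2) := by
    intro j hj
    simp [hgs, hj]
  refine (transduceAll_spec hκ (X := D.size Q) (ar := Q.maxArity) (s₀ := s₄) (A₀ := n + 4)
    (l₀ := n + 8) (by omega) hX (rankSpecs Q) gs (n + 4) (n + 8) s₄ le_rfl le_rfl ?_
    ⟨fun _ _ _ => rfl, rfl, fun _ _ => rfl, fun _ _ => rfl⟩ ?_ ?_).conseq (by rw [hsl]) ?_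
  · rw [List.forall₂_iff_get]
    refine ⟨by simp [hsl, hgs], fun j hj1 hj2 => ?_⟩
    have hj : j < n := by omega
    have hbj := List.getElem?_eq_getElem (l := Q.body) (i := j) (by omega)
    set A := Q.body[j] with hAdef
    have hA' : A ∈ Q.body := List.mem_of_getElem? hbj
    have hs1 := hsp j A hbj
    have hs2 := hg j hj
    rw [List.getElem?_eq_getElem hj1, Option.some_inj] at hs1
    rw [List.getElem?_eq_getElem hj2, Option.some_inj] at hs2
    simp only [List.get_eq_getElem, hs1, hs2, atomRows_eq hbj]
    have hHj := hH s₄ w4 j A hbj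
    refine ⟨by omega, by omega, ?_, by simpa using CQStar.le_maxArity hA', ?_⟩
    · rw [hHj.reg]; exact hL.rows_length_le hA'
    · intro i hi s hs hsc
      rw [hHj.reg] at hi
      have hHs : Holds s j j (factRows D L A.rel) :=
        hHj.congr (hs.reg j (by omega) (by omega)) (hs.arr j (by omega)) (hs.karr j (by omega))
      have hrow := hL.row hD hA' (List.getElem_mem hi)
      have hlt : (factRows D L A.rel).length < W := by
        have := hL.rows_length_le hA'; omega
      have hin : n < W := by
        have : n < 2 ^ n := Nat.lt_two_pow_self
        have : 2 ^ n ≤ (D.size Q + 2) ^ n := Nat.pow_le_pow_left (by omega) n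
        omega
      refine ⟨by simp only [Ex.Ok]; omega, by simp [hi], fun row hr => ⟨by simp [Ex.eval], ?_, ?_, ?_⟩⟩
      · simp only [List.getElem?_eq_getElem hi, Option.bind_some, Option.some_inj] at hr
        subst hr
        rw [List.forall₂_iff_get]
        refine ⟨by simp [hrow.1], fun p hp1 hp2 => ?_⟩
        have hp : p < A.args.length := by simpa using hp1
        obtain ⟨f1, f2⟩ := Ex.field_ok (W := W) (p := p) hHs hsc hi (fun r hr => (hL.row hD hA' hr).1) hp
          (((Nat.mul_le_mul (by have := hL.rows_length_le hA'; omega)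
            (Nat.succ_le_succ (CQStar.le_maxArity hA'))).trans_lt hX))
          (fun r hr y hy => (hc y ((hL.row hD hA' hr).2.2.2 y hy)).trans_le hYW)
        have hx : (factRows D L A.rel)[i].1[p]'(by omega) ∈ C := hrow.2.2.2 _ (List.getElem_mem _)
        have hk : s.arr (n + 3) ((factRows D L A.rel)[i].1[p]'(by omega)) =
            rankIn C ((factRows D L A.rel)[i].1[p]'(by omega)) := by
          rw [hs.arr _ (by omega)]; exact (k4 _ hx).1
        have hf : (Ex.field j A.args.length n p).eval s = (factRows D L A.rel)[i].1[p]'(by omega) := by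
          rw [f2, List.getD_eq_getElem]
        simp only [List.get_eq_getElem, List.getElem_map, List.getElem_range, Ex.Ok, Ex.eval, hf, hk]
        refine ⟨⟨f1, (rankIn_lt hx).trans hC⟩, trivial⟩
      · change s.reg n < W
        change s.reg n = i at hsc
        omega
      · simp only [List.getElem?_eq_getElem hi, Option.bind_some, Option.some_inj] at hr
        subst hr
        exact KEx.row_val hHs hsc hi
  · intro B hB i
    rw [w4.arr B (by omega), w4.karr]
    exact hza B (by omega) i
  · intro r hr
    rw [w4.reg r (by omega)]
    exact hz r (by omega)
  · rintro s ⟨b1, b2, b3, -⟩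
    refine ⟨inputState_of_holds hQ (fun j A hj => ?_) (by simpa [hsl] using b3), ?_, fun x hx => ?_⟩
    · have hjn : j < n := (List.getElem?_eq_some_iff.1 hj).1
      have hA' := List.mem_of_getElem? hj
      have := b2 j _ _ (hsp j A hj) (hg j hjn)
      simp only [(hH s₄ w4 j A hj).reg, atomRows_eq hj] at this
      rw [List.filterMap_getElem?_range] at this
      convert this using 1
      simp only [factRows, List.filterMap_eq_map', List.map_map]
      refine List.map_congr_left fun t ht => ?_
      have ht' := ((hL _ (CQStar.rel_mem_symbols hA')).2 t).1 ht
      simp only [Function.comp_apply, KDatabase.rename]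
      rw [KDatabase.map_map_of_constants hι fun x hx => mem_constants_of_mem hA' ht' hx]
    · rw [b1.reg _ (by omega) (by omega)]; simp [hs₄]
    · rw [b1.arr _ (by omega)]; exact (k4 x hx).2

end Ranks

section Relaxing

variable {K : Type*} [CommSemiring K] [LinearOrder K]

/-- Both `B` and the cost of a semiring operation are `O(log M)`, and every phase spends such a cost
for each fact and column. -/
theorem rank_cost_le {k M S B p n a κ Cκ : ℕ} (hS : S ≤ k * M) (hM : 1 ≤ M)
    (hl : 1 ≤ Nat.log 2 M) (hB : B ≤ 2 * k * Nat.log 2 M) (hκ : κ ≤ Cκ * Nat.log 2 M) :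
    (1 + p * (1 + S * (2 + 2))) + ((1 + B) + ((1 + p * (1 + S * (2 + (4 + B * 3)))) +
      ((1 + p * (1 + S * (2 + (5 + B * 4)))) + (1 + (1 + n * (1 + S * ((a + 5) * κ))))))) ≤
    (6 + 3 * p + n + 17 * p * k + 14 * p * k * k + 2 * k + n * (a + 5) * k * Cκ) *
      (M * Nat.log 2 M) := by
  generalize Nat.log 2 M = l at *
  have h1 : 1 ≤ M * l := Nat.mul_pos hM hl
  have h2 : S ≤ k * (M * l) := hS.trans (Nat.mul_le_mul_left _ (by nlinarith))
  have h3 : S * B ≤ 2 * k * k * (M * l) := by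
    calc _ ≤ (k * M) * (2 * k * l) := Nat.mul_le_mul hS hB
      _ = _ := by ring
  have h4 : S * κ ≤ k * Cκ * (M * l) := by
    calc _ ≤ (k * M) * (Cκ * l) := Nat.mul_le_mul hS hκ
      _ = _ := by ring
  have h5 : B ≤ 2 * k * (M * l) := hB.trans (Nat.mul_le_mul_left _ (by nlinarith))
  calc _ = (6 + 3 * p + n) * 1 + 17 * p * S + 7 * p * (S * B) + B + n * (a + 5) * (S * κ) := by ring
    _ ≤ (6 + 3 * p + n) * (M * l) + 17 * p * (k * (M * l)) + 7 * p * (2 * k * k * (M * l)) +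
        2 * k * (M * l) + n * (a + 5) * (k * Cκ * (M * l)) := by gcongr
    _ = _ := by ring

/-- All indices from the number of answers on are equivalent, so a large index may be replaced by
one within the range that an algorithm accepts. -/
theorem KDatabase.nthAnswer_min {D : KDatabase K} {Q : CQStar} {N i : ℕ}
    (h : (D.answers Q).card ≤ N) : D.nthAnswer Q (if i < N then i else N) = D.nthAnswer Q i := by
  split_ifs with hi
  · rfl
  · unfold KDatabase.nthAnswer
    rw [List.getElem?_eq_none (by simpa using h), List.getElem?_eq_none (by simp; omega)]

/-- Three things separate the bound `M` from the shifted size `N`. Constants below a power of `M`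
need not be below a power of `N`: they are replaced by ranks, and the answer is translated back.
Indices are clipped at `N ^ n`, which no answer reaches. Semiring operations take time `κ M` and not
`κ N`, which is settled by `LogarithmicTime.transfer`. -/
theorem RelaxedAccess.of_directAccessIn {κ : ℕ → ℕ} (hκ : LogarithmicTime κ) {Q : CQStar}
    (hQ : Q.SelfJoinFree) {R : ℕ}
    (h : DirectAccessIn (K := K) κ Q (fun D => D.LocallyAnnotated Q R)
      (fun n => n * Nat.log 2 n) (fun n => Nat.log 2 n)) :
    RelaxedAccess (K := K) κ Q (fun D => D.LocallyAnnotated Q R) := by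
  intro k
  obtain ⟨Cκ, hCκ⟩ := hκ.exists_le_log
  obtain ⟨n, hn⟩ : ∃ n, n = Q.body.length := ⟨_, rfl⟩
  -- The ranks are below `N * Q.maxArity`, hence below `N ^ (Q.maxArity + 1)`; the clipped index is
  -- at most `N ^ n`, hence below `N ^ (n + 1)`.
  obtain ⟨k₂, hk₂, hk₂'⟩ : ∃ k₂, Q.maxArity + 1 ≤ k₂ ∧ n + 1 ≤ k₂ :=
    ⟨_, le_max_left _ _, le_max_right _ _⟩
  obtain ⟨P, A, k', C', HP⟩ := h k₂
  obtain ⟨cT, hT⟩ := hκ.transfer (K := K) (k + 1)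
  have hsym : Q.symbols.length = n := by rw [hQ.symbols_eq, List.length_map, hn]
  -- Before an access, `G'` clips the index at the bound that is stored in register `n + 7`.
  obtain ⟨G', hG'⟩ : ∃ G' : Stmt, G' = .cond (.op .lt (.reg 0) (.reg (n + 7))) .skip
    (.set 0 (.reg (n + 7))) := ⟨_, rfl⟩
  obtain ⟨r₀, hr1, hr2, hr3⟩ : ∃ r₀, (G'.compile (max G'.bound 1)).regBound ≤ r₀ ∧
    max G'.bound 1 ≤ r₀ ∧ n + 8 ≤ r₀ := ⟨max (max _ _) _, (le_max_left _ _).trans (le_max_left _ _),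
      (le_max_right _ _).trans (le_max_left _ _), le_max_right _ _⟩
  obtain ⟨r, P', c, hr, Hprep⟩ := exec_prepare (K := K) (rankProgram Q) P (n + 8) (n + 4) n r₀
  obtain ⟨m, hm⟩ : ∃ m, m = (Q.pre ++ Q.post).length := ⟨_, rfl⟩
  -- The subroutine leaves ranks in array `n + 4`; array `n + 2` turns them into constants.
  obtain ⟨es, hes⟩ : ∃ es : List Ex, es = (List.range m).map fun j =>
    .load (n + 2) (.load (n + 4) (.cst j)) := ⟨_, rfl⟩
  have hesl : es.length = m := by simp [hes]
  obtain ⟨A', c', Hacc⟩ := exec_access (K := K) G' (emit r es) A r (n + 4)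
    (by omega) (by omega)
  obtain ⟨Z, z1, z2, z3, z4, z5⟩ : ∃ Z, 2 * (k + k + 1) + 1 ≤ Z ∧ (k + 2) + (Q.maxArity + 1) ≤ Z ∧
    (k + 2) * n + 1 ≤ Z ∧ (k + 2) * k' ≤ Z ∧ m + 1 ≤ Z :=
    ⟨(2 * (k + k + 1) + 1) + ((k + 2) + (Q.maxArity + 1)) + ((k + 2) * n + 1) + (k + 2) * k' +
      (m + 1), by omega, by omega, by omega, by omega, by omega⟩
  obtain ⟨cG, hcG⟩ : ∃ cG, cG = 6 + 3 * Q.columns.length + n + 17 * Q.columns.length * k +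
    14 * Q.columns.length * k * k + 2 * k + n * (Q.maxArity + 5) * k * Cκ := ⟨_, rfl⟩
  refine ⟨P', A', Z, c * (cG + 1) + cT * C' * (k + 2) + (c' * ((m + 4) * Cκ + 3) + cT * C'), ?_⟩
  intro D hD h𝒟 M hM hsz hc L hL
  obtain ⟨N, hN⟩ : ∃ N, N = D.size Q + 2 := ⟨_, rfl⟩
  have hpow : ∀ {a b : ℕ}, a ≤ b → M ^ a ≤ M ^ b := fun h => Nat.pow_le_pow_right (by omega) h
  have hself : ∀ a : ℕ, a < M ^ a := fun a =>
    Nat.lt_two_pow_self.trans_le (Nat.pow_le_pow_left hM a)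
  have hNM : N ≤ (k + 1) * M := by rw [hN]; nlinarith
  have hNM' : N ≤ (k + 1 + 1) * M := by nlinarith
  have hNpow : N < M ^ (k + 2) := by
    calc N ≤ (k + 1) * M := hNM
      _ < M ^ (k + 1) * M := Nat.mul_lt_mul_of_pos_right (hself (k + 1)) (by omega)
      _ = M ^ (k + 2) := by ring
  have hN2 : 2 ≤ N := by omega
  have hCN := card_constants_le hD
  have hcard : ∀ i, D.nthAnswer Q (if i < N ^ n then i else N ^ n) = D.nthAnswer Q i := fun i =>
    KDatabase.nthAnswer_min (by rw [hn]; exact card_answers_le D Q (by omega))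
  obtain ⟨Cs, hCs⟩ : ∃ Cs, Cs = D.constants Q := ⟨_, rfl⟩
  rw [← hCs] at hCN
  obtain ⟨ι, hι⟩ : ∃ ι : ℕ → ℕ, ∀ c ∈ Cs, ι (rankIn Cs c) = c :=
    ⟨Function.invFunOn (rankIn Cs) Cs, fun c hc =>
      Set.InjOn.leftInvOn_invFunOn (rankIn_strictMonoOn Cs).injOn hc⟩
  have hpowN : ∀ a, N ^ a ≤ M ^ ((k + 2) * a) := fun a => by
    rw [pow_mul]; exact Nat.pow_le_pow_left hNpow.le a
  have hNself : ∀ a : ℕ, a < N ^ a := fun a =>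
    Nat.lt_two_pow_self.trans_le (Nat.pow_le_pow_left hN2 a)
  have hW2 : 2 < M ^ Z := (hself 2).trans_le (hpow (by omega))
  have hX : (D.size Q + 1) * (Q.maxArity + 1) < M ^ Z := by
    calc _ ≤ N * (Q.maxArity + 1) := Nat.mul_le_mul_right _ (by omega)
      _ ≤ M ^ (k + 2) * (Q.maxArity + 1) := Nat.mul_le_mul_right _ hNpow.le
      _ < M ^ (k + 2) * M ^ (Q.maxArity + 1) :=
        Nat.mul_lt_mul_of_pos_left (hself _) (by positivity)
      _ = M ^ ((k + 2) + (Q.maxArity + 1)) := (pow_add _ _ _).symm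
      _ ≤ M ^ Z := hpow z2
  have hNn : N ^ n < M ^ Z := by
    calc _ ≤ M ^ ((k + 2) * n) := hpowN n
      _ < M ^ ((k + 2) * n + 1) := Nat.pow_lt_pow_right (by omega) (by omega)
      _ ≤ _ := hpow z3
  have hNW : N < M ^ Z := hNpow.trans_le (hpow (by omega))
  have hCW : Cs.card < M ^ Z := by nlinarith
  obtain ⟨B, ⟨x, hx, hB⟩, hprog⟩ := rankProgram_spec (κ := κ M) (W := M ^ Z) (Y := M ^ k)
    (hκ.one_le M) hQ hD hL hW2 (hpow (by omega)) (by positivity) hc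
    (fun d hd v hv => (pairCode_lt hM hd hv).trans_le (hpow z1)) (by rw [← hCs]; exact hCW) hX
    (by rw [← hn, ← hN]; exact hNn) (by omega) (by rw [← hCs]; exact hι)
  rw [← hCs, ← hn] at hprog
  have hlog : 1 ≤ Nat.log 2 M := Nat.log_pos (by norm_num) hM
  have hlogN : 1 ≤ Nat.log 2 N := Nat.log_pos (by norm_num) hN2
  have hκM := hCκ M hM
  have hBl : B ≤ 2 * k * Nat.log 2 M := by rw [hB]; exact size_le_log hM hx
  replace hprog := hprog.mono (rank_cost_le (p := Q.columns.length) (n := n) (a := Q.maxArity)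
    hsz (by omega) hlog hBl hκM)
  rw [← hcG] at hprog
  rw [hCs] at hι
  have hsize : (D.rename (rankIn Cs) ι).size Q = D.size Q := KDatabase.rename_size (by rw [hCs]; exact hι)
  have hrank : ∀ x ∈ Cs, rankIn Cs x < N ^ k₂ := fun x hx => by
    calc _ < Cs.card := rankIn_lt hx
      _ ≤ D.size Q * Q.maxArity := hCN
      _ ≤ N * N ^ Q.maxArity := Nat.mul_le_mul (by omega) (hNself _).le
      _ = N ^ (Q.maxArity + 1) := by ring
      _ ≤ N ^ k₂ := Nat.pow_le_pow_right (by omega) hk₂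
  have hL' := KDatabase.rename_enumerates (ρ := rankIn Cs) (by rw [hCs]; exact hι) hL
  obtain ⟨s, t, e, ht, ha⟩ := HP (D.rename (rankIn Cs) ι) (KDatabase.rename_over hD)
    (KDatabase.rename_locallyAnnotated (by rw [hCs]; exact hι) h𝒟) N (by rw [hsize, hN])
    (fun y hy => by
      obtain ⟨x, hx, rfl⟩ := KDatabase.mem_rename_constants.1 hy
      exact hrank x (hCs ▸ hx)) _ hL'
  obtain ⟨t1, e1, ht1⟩ := hT hM hN2 hNM' e
  obtain ⟨S, t', eS, ht', hv, hbelow⟩ := Hprep (κ M) (M ^ Z) _ t1 (inputState D Q L)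
    (inputState (D.rename (rankIn Cs) ι) Q _) s (hκ.one_le M) hW2
    (fun j hj => ⟨inputState_reg_of_le (by omega), rfl⟩)
    (fun j hj => inputState_reg_of_le (by omega)) (fun j => rfl)
    (hprog.conseq le_rfl fun s' hs' => ⟨hs'.1.1, hs'.1.2.1, fun j hj =>
      ⟨hs'.1.2.2 j (by omega), by
        have := (inputState_reg_le hL' j).trans hsize.le
        omega⟩⟩) (e1.mono ((hpowN k').trans (hpow z4)))
  obtain ⟨-, -, -, hreg, harr⟩ := hprog
  -- The bound `N * log N` for the time, multiplied by the exchange rate `log M / log N`, gives `N *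
  -- log M`, and `N` is at most a multiple of `M`.
  have ht1' : t1 ≤ cT * C' * (k + 2) * (M * Nat.log 2 M) := by
    have h1 : t1 * Nat.log 2 N ≤ (cT * C' * (k + 2) * (M * Nat.log 2 M)) * Nat.log 2 N := by
      calc _ ≤ cT * Nat.log 2 M * t := ht1
        _ ≤ cT * Nat.log 2 M * (C' * (((k + 2) * M) * Nat.log 2 N)) := by
          gcongr; exact ht.trans (Nat.mul_le_mul_left _ (Nat.mul_le_mul_right _ hNM'))
        _ = _ := by ring
    exact Nat.le_of_mul_le_mul_right h1 (by omega)
  have h1 : 1 ≤ M * Nat.log 2 M := Nat.mul_pos (by omega) (by omega)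
  refine ⟨S, t', eS, ?_, fun i hi => ?_⟩
  · calc t' ≤ c * (cG * (M * Nat.log 2 M) + 1) + t1 := ht'
      _ ≤ c * (cG * (M * Nat.log 2 M) + 1 * (M * Nat.log 2 M)) +
          cT * C' * (k + 2) * (M * Nat.log 2 M) := by gcongr; omega
      _ = (c * (cG + 1) + cT * C' * (k + 2)) * (M * Nat.log 2 M) := by ring
      _ ≤ _ := Nat.mul_le_mul_right _ (by omega)
  · have hi' : (if i < N ^ n then i else N ^ n) < N ^ k₂ := by
      have : N ^ n < N ^ k₂ := Nat.pow_lt_pow_right (by omega) (by omega)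
      split_ifs <;> omega
    have hiW : i < M ^ Z := hi.trans_le (hpow (by omega))
    obtain ⟨s', t2, e2, ht2, hret⟩ := ha _ hi'
    rw [KDatabase.rename_nthAnswer (by rw [hCs]; exact rankIn_strictMonoOn _) (by rw [hCs]; exact hι),
      hcard] at hret
    obtain ⟨t2', e2', ht2'⟩ := hT hM hN2 hNM' e2
    have ht2'' : t2' ≤ cT * C' * Nat.log 2 M := by
      have h1 : t2' * Nat.log 2 N ≤ (cT * C' * Nat.log 2 M) * Nat.log 2 N := by
        calc _ ≤ cT * Nat.log 2 M * t2 := ht2'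
          _ ≤ cT * Nat.log 2 M * (C' * Nat.log 2 N) := by gcongr
          _ = _ := by ring
      exact Nat.le_of_mul_le_mul_right h1 (by omega)
    have hSreg : S.reg (n + 7) = N ^ n := by
      rw [hbelow.reg _ (by omega), hreg, ← hN]
    obtain ⟨S', t3, e3, ht3, hfin⟩ := Hacc (κ M) (M ^ Z) 2 ((es.length + 4) * κ M) t2'
      (if i < N ^ n then i else N ^ n)
      (S.setReg 0 i) s s' (fun S' => Returns S' (D.nthAnswer Q i)) (hκ.one_le M) hW2
      (by rw [← hv]; exact eq_of_fields (by ext j; simp [view]; omega) rfl rfl rfl)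
      (fun S S' h1 h2 h3 => by
        intro h
        cases hn : D.nthAnswer Q i with
        | none => rw [hn] at h; exact h1.symm.trans h
        | some a =>
          rw [hn] at h
          exact ⟨h1.symm.trans h.1, h2.symm.trans h.2.1, by rw [← h3]; exact h.2.2⟩)
      (by
        rw [hG']
        refine Sp.cond (T := 1) ⟨?_, ?_, ?_⟩ (fun hlt => Sp.skip ⟨?_, rfl, rfl⟩)
          (fun hge => Sp.set ?_ ⟨?_, rfl, rfl⟩)
        · simpa [Ex.Ok] using hiW
        · simpa [Ex.Ok, hSreg] using hNn
        · simp only [WordOp.eval]; split <;> omega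
        · simp [Ex.eval, WordOp.eval, hSreg] at hlt
          simp [hlt]
        · simpa [Ex.Ok, hSreg] using hNn
        · simp [Ex.eval, WordOp.eval, hSreg] at hge
          simp [Ex.eval, hSreg, hge.not_gt])
      (by split_ifs <;> omega) (e2'.mono ((hpowN k').trans (hpow z4)))
      (fun S2 hS2 hbelow2 => emit_spec (hκ.one_le M) hS2 hret
        (by rw [hesl]; exact (hself (m + 1)).trans_le (hpow (by omega))) (fun h => by simpa using h)
        fun a hna => by
          obtain ⟨a', ha', rfl⟩ := Option.map_eq_some_iff.1 hna
          refine ⟨a', ha', rfl, fun S3 hS3 => ?_⟩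
          obtain ⟨hl, hcon⟩ := KDatabase.nthAnswer_eq_some ha'
          rw [ha'] at hret
          obtain ⟨-, -, hr3⟩ := hret
          rw [List.forall₂_iff_get]
          refine ⟨by rw [hl, hesl, hm], fun j h1 h2 => ?_⟩
          have hj : j < m := by rwa [hesl] at h1
          have hxC := hcon _ (List.getElem_mem h2)
          have hval : S3.arr (n + 4) j =
              rankIn Cs (((ofLex a').1 ++ (ofLex (ofLex a').2).2)[j]) := by
            rw [hS3.arr _ (by omega)]
            have := hr3 j (rankIn Cs (((ofLex a').1 ++ (ofLex (ofLex a').2).2)[j])) (by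
              simp only [QAnswer.mapConst, ofLex_toLex, ← List.map_append, List.getElem?_map,
                List.getElem?_eq_getElem h2, Option.map_some])
            rw [← this, ← hS2]
            simp [view]
          have hval2 : S3.arr (n + 2)
              (rankIn Cs (((ofLex a').1 ++ (ofLex (ofLex a').2).2)[j])) =
              ((ofLex a').1 ++ (ofLex (ofLex a').2).2)[j] := by
            rw [hS3.arr _ (by omega), hbelow2.arr _ (by omega)]
            simp only [setReg_arr]
            rw [hbelow.arr _ (by omega)]
            exact harr _ (hCs ▸ hxC)
          have hlt : ((ofLex a').1 ++ (ofLex (ofLex a').2).2)[j] < M ^ Z :=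
            (hc _ hxC).trans_le (hpow (by omega))
          simp only [hes, List.get_eq_getElem, List.getElem_map, List.getElem_range, Ex.Ok, Ex.eval,
            hval, hval2]
          exact ⟨⟨⟨(hj.trans (hself m)).trans_le (hpow (by omega)),
            (rankIn_lt (hCs ▸ hxC)).trans hCW⟩, hlt⟩, trivial⟩)
    refine ⟨S', t3, e3, ht3.trans ?_, hfin⟩
    rw [hesl]
    calc _ ≤ c' * (2 * Nat.log 2 M + (m + 4) * (Cκ * Nat.log 2 M) + 1 * Nat.log 2 M) +
          cT * C' * Nat.log 2 M := by gcongr <;> omega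
      _ = (c' * ((m + 4) * Cκ + 3) + cT * C') * Nat.log 2 M := by ring
      _ ≤ _ := Nat.mul_le_mul_right _ (by omega)

end Relaxing

/-! ## Reductions by one marking phase and one pass over the facts -/

section OfSpecs

variable {K : Type*} [CommSemiring K] [LinearOrder K]

/-- The statement `P` may use the register and the arrays with the number `n`, where `n` is the
number of atoms; then each relation of the new database is computed by a loop over the facts of one
of the given relations. -/
theorem Reduces.of_specs {κ : ℕ → ℕ} (hκ : ∀ n, 1 ≤ κ n) {Q₁ Q₂ : CQStar}
    {𝒟₁ 𝒟₂ : KDatabase K → Prop} (hQ₁ : Q₁.SelfJoinFree) (hQ₂ : Q₂.SelfJoinFree) {n : ℕ}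
    (hn : n = Q₁.body.length) (P : Stmt) (ρs : List RowSpec) (hlen : ρs.length = Q₂.body.length)
    (hsrc : ∀ ρ ∈ ρs, ρ.src < n)
    (H : ∀ k, ∃ e c, ∀ D : KDatabase K, D.Over Q₁ → 𝒟₁ D → ∀ L, Enumerates D Q₁ L →
      ∀ κ M W, 1 ≤ κ → 2 ≤ M → D.size Q₁ ≤ k * M → (∀ x ∈ D.constants Q₁, x < M ^ k) → M ^ e ≤ W →
      ∃ (D' : KDatabase K) (L' : ℕ → List (List ℕ)), D'.Over Q₂ ∧ 𝒟₂ D' ∧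
        -- The second alternative admits numbers of rows as fresh constants.
        (∀ x ∈ D'.constants Q₂, x ∈ D.constants Q₁ ∨ x ≤ D.size Q₁) ∧ Enumerates D' Q₂ L' ∧
        (∀ i, D'.nthAnswer Q₂ i = D.nthAnswer Q₁ i) ∧
        Sp κ W P (inputState D Q₁ L) (c * ((D.size Q₁ + 1) * κ))
          (Frame n n n (inputState D Q₁ L)) ∧
        ∀ (j : ℕ) (A : QAtom), Q₂.body[j]? = some A → ∃ (ρ : RowSpec) (g : ℕ → Option (List ℕ × K)),
          ρs[j]? = some ρ ∧
          factRows D' L' A.rel = (List.range ((inputState D Q₁ L).reg ρ.src)).filterMap g ∧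
          ∀ i < (inputState D Q₁ L).reg ρ.src, ∀ s,
            Below n (n + 1) (n + 1) (P.run (inputState D Q₁ L)) s → s.reg n = i →
            ρ.Yields W s (g i)) :
    Reduces κ Q₁ 𝒟₁ Q₂ 𝒟₂ := by
  intro k
  obtain ⟨e, c, H⟩ := H k
  obtain ⟨ar, har⟩ : ∃ ar, ar = (ρs.map fun ρ => ρ.fields.length).sum := ⟨_, rfl⟩
  refine ⟨.seq P (transduceAll n (n + 1) (n + 1) ρs), n + 1, n + 1,
    e + (k + ar + 3) + Q₂.body.length * k,
    c * (k + 1) + (1 + ρs.length * (1 + k * (ar + 5))), by omega, ?_⟩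
  intro D hD h𝒟 M hM hsz hc L hL
  have hpow : ∀ {a b : ℕ}, a ≤ b → M ^ a ≤ M ^ b := fun h => Nat.pow_le_pow_right (by omega) h
  have hself : ∀ a : ℕ, a < M ^ a := fun a =>
    Nat.lt_two_pow_self.trans_le (Nat.pow_le_pow_left hM a)
  obtain ⟨k₂, hk₂⟩ : ∃ k₂, k₂ = e + (k + ar + 3) + Q₂.body.length * k := ⟨_, rfl⟩
  rw [← hk₂]
  have hsz' : D.size Q₁ + 1 ≤ (k + 1) * M := by nlinarith
  have hX : (D.size Q₁ + 1) * (ar + 1) < M ^ k₂ := by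
    calc _ ≤ ((k + 1) * M) * (ar + 1) := Nat.mul_le_mul_right _ hsz'
      _ = ((k + 1) * (ar + 1)) * M := by ring
      _ < (M ^ (k + 1) * M ^ (ar + 1)) * M :=
        Nat.mul_lt_mul_of_pos_right (Nat.mul_lt_mul'' (hself _) (hself _)) (by omega)
      _ = M ^ (k + ar + 3) := by ring
      _ ≤ M ^ k₂ := hpow (by omega)
  obtain ⟨D', L', hD', h𝒟', hcon, hL', hans, hP, hspec⟩ := H D hD h𝒟 L hL (κ M) M (M ^ k₂) (hκ M) hM
    hsz hc (hpow (by omega))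
  have hsym : Q₁.symbols.length = n := by rw [hQ₁.symbols_eq, List.length_map, hn]
  -- A loop emits at most one fact for each fact of its source, so the database grows at most by a
  -- factor that depends on `Q₂`.
  have hrows : ∀ A ∈ Q₂.body, (D'.rel A.rel).card ≤ D.size Q₁ := by
    intro A hA
    obtain ⟨j, hj⟩ := List.mem_iff_getElem?.1 hA
    obtain ⟨ρ, g, -, hg, -⟩ := hspec j A hj
    rw [← hL'.card (CQStar.rel_mem_symbols hA), ← factRows_length, hg]
    refine (List.length_filterMap_le _ _).trans ?_
    rw [List.length_range]
    exact inputState_reg_le hL _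
  have hsize : D'.size Q₂ ≤ Q₂.body.length * D.size Q₁ := by
    unfold KDatabase.size
    rw [hQ₂.symbols_eq, List.map_map]
    refine (List.sum_le_card_nsmul _ (D.size Q₁) fun x hx => ?_).trans (by simp [KDatabase.size])
    obtain ⟨A, hA, rfl⟩ := List.mem_map.1 hx
    exact hrows A hA
  refine ⟨D', L', hD', h𝒟', ?_, fun x hx => ?_, hL', hans, ?_⟩
  · calc _ ≤ Q₂.body.length * D.size Q₁ := hsize
      _ ≤ Q₂.body.length * (k * M) := Nat.mul_le_mul_left _ hsz
      _ = Q₂.body.length * k * M := by ring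
      _ ≤ k₂ * M := Nat.mul_le_mul_right _ (by omega)
  · rcases hcon x hx with h | h
    · exact (hc x h).trans_le (hpow (by omega))
    · calc x < D.size Q₁ + 1 := by omega
        _ ≤ (D.size Q₁ + 1) * (ar + 1) := Nat.le_mul_of_pos_right _ (by omega)
        _ < _ := hX
  · have h0 : ∀ B ≥ n, ∀ i, (inputState D Q₁ L).arr B i = 0 ∧ (inputState D Q₁ L).karr B i = 0 := by
      intro B hB i
      have : Q₁.symbols[B]? = none := List.getElem?_eq_none (by omega)
      simp [inputState, this]
    obtain ⟨s₁, hs₁⟩ : ∃ s₁, s₁ = P.run (inputState D Q₁ L) := ⟨_, rfl⟩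
    rw [← hs₁] at hspec
    have hfr : Frame n n n (inputState D Q₁ L) s₁ := hs₁ ▸ hP.2.2
    have : Nonempty RowSpec := ⟨⟨0, .cst 0, [], .zero⟩⟩
    choose! ρ g hρ hg hy using hspec
    have hcost : c * ((D.size Q₁ + 1) * κ M) + (1 + ρs.length * (1 + D.size Q₁ * ((ar + 5) * κ M))) ≤
        (c * (k + 1) + (1 + ρs.length * (1 + k * (ar + 5)))) * (M * κ M) := by
      have h1 : 1 ≤ M * κ M := Nat.mul_pos (by omega) (hκ M)
      calc _ ≤ c * (((k + 1) * M) * κ M) +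
            (M * κ M + ρs.length * (M * κ M + (k * M) * ((ar + 5) * κ M))) := by gcongr
        _ = _ := by ring
    refine (Sp.seq (Q := fun s => s = s₁) ⟨hP.1, hP.2.1, hs₁.symm⟩ ?_).conseq hcost (fun _ h => h)
    intro s hs
    rw [hs]
    obtain ⟨B, hB⟩ : ∃ B : ℕ → QAtom, ∀ j < ρs.length, Q₂.body[j]? = some (B j) :=
      ⟨fun j => Q₂.body.getD j ⟨0, []⟩, fun j hj => by
        simp [List.getD_eq_getElem?_getD, List.getElem?_eq_getElem (show j < Q₂.body.length by omega)]⟩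
    have hregs : ∀ ρ ∈ ρs, s₁.reg ρ.src = (inputState D Q₁ L).reg ρ.src := fun ρ hρ' => by
      have := hsrc ρ hρ'
      exact hfr.reg _ (by omega) (by omega)
    have hga : ∀ j, j < ρs.length →
        ((List.range ρs.length).map fun j => g j (B j))[j]? = some (g j (B j)) := by
      intro j hj
      simp [hj]
    refine (transduceAll_spec (hκ M) (X := D.size Q₁) (ar := ar) (s₀ := s₁) (A₀ := n + 1)
      (l₀ := n + 1) (by omega) hX ρs ((List.range ρs.length).map fun j => g j (B j))
      (n + 1) (n + 1) s₁ le_rfl le_rfl ?_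
      ⟨fun _ _ _ => rfl, rfl, fun _ _ => rfl, fun _ _ => rfl⟩ ?_ ?_).conseq le_rfl ?_
    · rw [List.forall₂_iff_get]
      refine ⟨by simp, fun j h1 h2 => ?_⟩
      have e1 := hρ j (B j) (hB j h1)
      have e2 := hga j h1
      rw [List.getElem?_eq_getElem h1, Option.some_inj] at e1
      rw [List.getElem?_eq_getElem h2, Option.some_inj] at e2
      simp only [List.get_eq_getElem, e2]
      have hmem : ρs[j] ∈ ρs := List.getElem_mem h1
      have h3 := hsrc _ hmem
      rw [hregs _ hmem]
      refine ⟨by omega, by omega, inputState_reg_le hL _, ?_, ?_⟩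
      · rw [har]
        exact List.single_le_sum (by simp) _ (List.mem_map_of_mem hmem)
      · intro i hi s hs hsi
        rw [e1] at hi ⊢
        exact hy j (B j) (hB j h1) i hi s hs hsi
    · intro A hA i
      rw [hfr.arr A (by omega), hfr.karr A (by omega)]
      exact h0 A (by omega) i
    · intro r hr
      rw [hfr.reg r (by omega) (by omega)]
      exact inputState_reg_of_le (by omega)
    · rintro s ⟨-, b2, b3, -⟩
      refine inputState_of_holds hQ₂ (fun j A hj => ?_) (by simpa [hlen] using b3)
      have hjl : j < ρs.length := by rw [hlen]; exact (List.getElem?_eq_some_iff.1 hj).1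
      have hAB : A = B j := Option.some_inj.1 (hj.symm.trans (hB j hjl))
      subst hAB
      have e1 := hρ j (B j) hj
      have := b2 j _ _ e1 (hga j hjl)
      rwa [hregs _ (List.mem_of_getElem? e1), ← hg j (B j) hj] at this

end OfSpecs

/-! ## Access to the input facts -/

/-- The tuple of the values of `as` that is determined by a tuple `u` of values of `bs`. -/
def reindex (bs as u : List ℕ) : List ℕ := as.map fun x => u.getD (bs.idxOf x) 0

/-- `idxOf` finds the first occurrence of a variable. For the image of an atom this does no harm, as
equal variables have equal values there; other tuples are detected by `reindex bs bs u ≠ u`. -/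
theorem reindex_map {bs as : List ℕ} (h : as ⊆ bs) (f : ℕ → ℕ) :
    reindex bs as (bs.map f) = as.map f := by
  refine List.map_congr_left fun x hx => ?_
  have hlt : bs.idxOf x < bs.length := List.idxOf_lt_length_iff.2 (h hx)
  rw [List.getD_eq_getElem _ _ (by simpa using hlt), List.getElem_map, List.getElem_idxOf hlt]

theorem reindex_mem {bs as u : List ℕ} (h : as ⊆ bs) (hu : u.length = bs.length) {y : ℕ}
    (hy : y ∈ reindex bs as u) : y ∈ u := by
  obtain ⟨x, hx, rfl⟩ := List.mem_map.1 hy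
  have hlt : bs.idxOf x < bs.length := List.idxOf_lt_length_iff.2 (h hx)
  rw [List.getD_eq_getElem _ _ (by omega)]
  exact List.getElem_mem _

theorem length_reindex (bs as u : List ℕ) : (reindex bs as u).length = as.length := by
  simp [reindex]

section InputRows

variable {K : Type*}

/-- A database with the words bounded as needed in loops over its facts. -/
structure InputRows (Q : CQStar) (D : KDatabase K) (L : ℕ → List (List ℕ)) (n W : ℕ) : Prop where
  selfJoinFree : Q.SelfJoinFree
  length_eq : n = Q.body.length
  isOver : D.Over Q
  enum : Enumerates D Q L
  rows : ∀ A ∈ Q.body, ((factRows D L A.rel).length + 1) * (A.args.length + 1) < W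
  lt : ∀ x ∈ D.constants Q, x < W

theorem InputRows.of_le {Q : CQStar} {D : KDatabase K} {L : ℕ → List (List ℕ)} {M W k e : ℕ}
    (hQ : Q.SelfJoinFree) (hD : D.Over Q) (hL : Enumerates D Q L) (hM : 2 ≤ M)
    (hsz : D.size Q ≤ k * M) (hc : ∀ x ∈ D.constants Q, x < M ^ k)
    (he : k + Q.maxArity + 3 ≤ e) (hW : M ^ e ≤ W) : InputRows Q D L Q.body.length W := by
  have hpow : ∀ {a b : ℕ}, a ≤ b → M ^ a ≤ M ^ b := fun h => Nat.pow_le_pow_right (by omega) h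
  have hself : ∀ a : ℕ, a < M ^ a := fun a =>
    Nat.lt_two_pow_self.trans_le (Nat.pow_le_pow_left hM a)
  refine ⟨hQ, rfl, hD, hL, fun A hA => ?_, fun x hx => (hc x hx).trans_le
    ((hpow (by omega)).trans hW)⟩
  have h1 := hL.rows_length_le hA
  calc _ ≤ ((k + 1) * M) * (Q.maxArity + 1) :=
        Nat.mul_le_mul (by nlinarith) (Nat.succ_le_succ (CQStar.le_maxArity hA))
    _ = ((k + 1) * (Q.maxArity + 1)) * M := by ring
    _ < (M ^ (k + 1) * M ^ (Q.maxArity + 1)) * M :=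
        Nat.mul_lt_mul_of_pos_right (Nat.mul_lt_mul'' (hself _) (hself _)) (by omega)
    _ = M ^ (k + Q.maxArity + 3) := by ring
    _ ≤ W := (hpow he).trans hW

variable {Q : CQStar} {D : KDatabase K} {L : ℕ → List (List ℕ)} {n W : ℕ}

theorem InputRows.length_lt (h : InputRows Q D L n W) {A : QAtom} (hA : A ∈ Q.body) :
    (factRows D L A.rel).length + 1 < W := by
  have := h.rows A hA
  nlinarith

/-- Expressions for the values of `as` in the current row of the relation `j` with columns `bs`. -/
def reindexFields (n j : ℕ) (bs as : List ℕ) : List Ex :=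
  as.map fun x => Ex.field j bs.length n (bs.idxOf x)

def rowFields (n j ar : ℕ) : List Ex := (List.range ar).map (Ex.field j ar n)

theorem reindexFields_ok [Zero K] (h : InputRows Q D L n W) {j i : ℕ} {A : QAtom} (hA : A ∈ Q.body)
    {s : RamState K} (hs : Holds s j j (factRows D L A.rel)) (hc : s.reg n = i)
    (hi : i < (factRows D L A.rel).length) {as : List ℕ} (has : as ⊆ A.args) :
    List.Forall₂ (fun e x => e.Ok W s ∧ e.eval s = x) (reindexFields n j A.args as)
      (reindex A.args as ((factRows D L A.rel)[i].1)) := by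
  have := Ex.fields_ok (W := W) hs hc hi (fun r hr => (h.enum.row h.isOver hA hr).1) (h.rows A hA)
    (fun r hr x hx => h.lt x ((h.enum.row h.isOver hA hr).2.2.2 x hx))
    (ps := as.map A.args.idxOf) (fun p hp => by
      obtain ⟨x, hx, rfl⟩ := List.mem_map.1 hp
      exact List.idxOf_lt_length_iff.2 (has hx))
  simpa only [reindexFields, reindex, List.map_map, Function.comp_def] using this

theorem rowFields_ok [Zero K] (h : InputRows Q D L n W) {j i : ℕ} {A : QAtom} (hA : A ∈ Q.body)
    {s : RamState K} (hs : Holds s j j (factRows D L A.rel)) (hc : s.reg n = i)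
    (hi : i < (factRows D L A.rel).length) :
    List.Forall₂ (fun e x => e.Ok W s ∧ e.eval s = x) (rowFields n j A.args.length)
      ((factRows D L A.rel)[i].1) := by
  have := Ex.fields_ok (W := W) hs hc hi (fun r hr => (h.enum.row h.isOver hA hr).1) (h.rows A hA)
    (fun r hr x hx => h.lt x ((h.enum.row h.isOver hA hr).2.2.2 x hx))
    (ps := List.range A.args.length) (fun p hp => List.mem_range.1 hp)
  convert this using 1
  · rfl
  have hl := (h.enum.row h.isOver hA (List.getElem_mem hi)).1
  refine List.ext_getElem (by simp [hl]) fun p h1 h2 => ?_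
  simp [h1]

theorem InputRows.holds [CommSemiring K] (h : InputRows Q D L n W) {j : ℕ} {A : QAtom}
    (hj : Q.body[j]? = some A) {s₁ s : RamState K} (h1 : Frame n n n (inputState D Q L) s₁)
    (h2 : Below n (n + 1) (n + 1) s₁ s) : Holds s j j (factRows D L A.rel) := by
  have hjn : j < n := h.length_eq ▸ (List.getElem?_eq_some_iff.1 hj).1
  refine (inputState_holds h.selfJoinFree hj).congr ?_ ?_ ?_
  · rw [h2.reg _ (by omega) (by omega), h1.reg _ (by omega) (by omega)]
  · rw [h2.arr _ (by omega), h1.arr _ (by omega)]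
  · rw [h2.karr _ (by omega), h1.karr _ (by omega)]

/-- Copy the current row of the relation `j` of arity `ar`, with a new value. -/
def copySpec (n j ar : ℕ) (v : KEx) : RowSpec := ⟨j, .cst 1, rowFields n j ar, v⟩

theorem copySpec_yields [CommSemiring K] (h : InputRows Q D L n W) {j i ar : ℕ} {A : QAtom}
    (hj : Q.body[j]? = some A) (har : ar = A.args.length)
    {s : RamState K} (hs : Holds s j j (factRows D L A.rel)) (hc : s.reg n = i)
    (hi : i < (factRows D L A.rel).length) {v : KEx} (hv : v.Ok W s) :
    (copySpec n j ar v).Yields W s ((factRows D L A.rel)[i]?.bind fun r => some (r.1, v.eval s)) := by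
  have hA := List.mem_of_getElem? hj
  have hW := h.length_lt hA
  refine ⟨by simp only [copySpec, Ex.Ok]; omega, by simp [hi], fun row hr => ?_⟩
  simp only [List.getElem?_eq_getElem hi, Option.bind_some, Option.some_inj] at hr
  subst hr
  exact ⟨by simp [copySpec, Ex.eval], har ▸ rowFields_ok h hA hs hc hi, hv, rfl⟩

theorem getElem?_zipIdx_map {α β : Type*} (l : List α) (f : α × ℕ → β) (j : ℕ) {a : α}
    (h : l[j]? = some a) : (l.zipIdx.map f)[j]? = some (f (a, j)) := by
  simp [h]

theorem CQStar.SelfJoinFree.exists_perm (hQ : Q.SelfJoinFree) {A B : QAtom} (hA : A ∈ Q.body)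
    (hB : B ∈ Q.body) (hne : A.rel ≠ B.rel) : ∃ l, Q.body.Perm (A :: B :: l) ∧
      ∀ C ∈ l, C.rel ≠ A.rel ∧ C.rel ≠ B.rel := by
  classical
  have h1 := List.perm_cons_erase hA
  have hB' : B ∈ Q.body.erase A := (List.mem_erase_of_ne (fun h => hne (by rw [h]))).2 hB
  have h2 := h1.trans ((List.perm_cons_erase hB').cons A)
  have hnd := (h2.map QAtom.rel).nodup_iff.1 hQ
  simp only [List.map_cons, List.nodup_cons, List.mem_cons, List.mem_map, not_or, not_exists,
    not_and] at hnd
  exact ⟨_, h2, fun C hC => ⟨fun h => hnd.1.2 C hC h, fun h => hnd.2.1 C hC h⟩⟩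

end InputRows

/-! ## Absorbing the annotations of an atom into those of a larger atom -/

section Absorb

variable {K : Type*} [CommSemiring K]

/-- Every fact of `B` determines a fact of `A`. -/
def Contained (D : KDatabase K) (A B : QAtom) : Prop :=
  ∀ u ∈ D.rel B.rel, reindex B.args A.args u ∈ D.rel A.rel

namespace KDatabase

/-- Filter the facts of `B` by those of `A`, and move the annotations of `A` to `B`. -/
def absorb (D : KDatabase K) (A B : QAtom) : KDatabase K where
  rel r := if r = B.rel then (D.rel r).filter (fun u => reindex B.args A.args u ∈ D.rel A.rel)
    else D.rel r
  ann r t := if r = B.rel then D.ann r t * D.ann A.rel (reindex B.args A.args t)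
    else if r = A.rel then 1 else D.ann r t

variable {D : KDatabase K} {Q : CQStar} {A B : QAtom}

theorem absorb_rel_subset (r : ℕ) : (D.absorb A B).rel r ⊆ D.rel r := by
  simp only [absorb]
  split
  · exact Finset.filter_subset _ _
  · exact subset_rfl

theorem absorb_rel_of_ne {r : ℕ} (h : r ≠ B.rel) : (D.absorb A B).rel r = D.rel r := if_neg h

theorem mem_absorb {t : List ℕ} : t ∈ (D.absorb A B).rel B.rel ↔
    t ∈ D.rel B.rel ∧ reindex B.args A.args t ∈ D.rel A.rel := by
  simp [absorb]

theorem absorb_over (h : D.Over Q) : (D.absorb A B).Over Q :=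
  fun C hC t ht => h C hC t (absorb_rel_subset _ ht)

theorem absorb_constants {x : ℕ} (hx : x ∈ (D.absorb A B).constants Q) : x ∈ D.constants Q := by
  obtain ⟨C, hC, t, ht, hxt⟩ := mem_constants.1 hx
  exact mem_constants_of_mem hC (absorb_rel_subset _ ht) hxt

theorem absorb_contained (hne : A.rel ≠ B.rel) : Contained (D.absorb A B) A B := by
  intro u hu
  rw [absorb_rel_of_ne hne]
  exact (mem_absorb.1 hu).2

theorem absorb_contained_of {C : QAtom} (hC : C.rel ≠ B.rel) (h : Contained D C B) :
    Contained (D.absorb A B) C B := by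
  intro u hu
  rw [absorb_rel_of_ne hC]
  exact h u (absorb_rel_subset _ hu)

/-- If `A` was the annotated atom, its annotation has gone to `B` and `1` is left behind. Otherwise
the factors contributed by `A` are `1`, and the same relation stays annotated. -/
theorem absorb_locallyAnnotated {R : ℕ} (h : D.LocallyAnnotated Q R) (hA : A ∈ Q.body) :
    (D.absorb A B).LocallyAnnotated Q (if R = A.rel then B.rel else R) := by
  intro S hS hSR t ht
  by_cases hSB : S = B.rel
  · subst hSB
    rw [mem_absorb] at ht
    have hRA : R ≠ A.rel := fun hh => hSR (by rw [if_pos hh])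
    rw [if_neg hRA] at hSR
    simp only [absorb, if_true]
    rw [h _ hS hSR t ht.1, h _ (CQStar.rel_mem_symbols hA) (Ne.symm hRA) _ ht.2, one_mul]
  · rw [absorb_rel_of_ne hSB] at ht
    simp only [absorb, if_neg hSB]
    split_ifs with hSA
    · rfl
    · refine h S hS ?_ t ht
      rintro rfl
      rw [if_neg hSA] at hSR
      exact hSR rfl

theorem absorb_enumerates {L : ℕ → List (List ℕ)} (hL : Enumerates D Q L) :
    Enumerates (D.absorb A B) Q (fun r => if r = B.rel then
      (L r).filter (fun u => reindex B.args A.args u ∈ D.rel A.rel) else L r) := by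
  intro R hR
  obtain ⟨h1, h2⟩ := hL R hR
  by_cases hRB : R = B.rel
  · subst hRB
    simp only [if_true]
    exact ⟨h1.filter _, fun t => by rw [mem_absorb, List.mem_filter, h2]; simp⟩
  · simp only [if_neg hRB, absorb_rel_of_ne hRB]
    exact ⟨h1, h2⟩

/-- A homomorphism maps `A` to the restriction of the image of `B`. So the facts of `B` that are
filtered out are not used by any homomorphism. -/
theorem absorb_homs (hA : A ∈ Q.body) (hB : B ∈ Q.body) (hQ : Q.SelfJoinFree)
    (hAB : A.args ⊆ B.args) : (D.absorb A B).homs Q = D.homs Q := by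
  ext h
  rw [mem_homs, mem_homs]
  refine and_congr_right fun _ => ⟨fun hh C hC => absorb_rel_subset _ (hh C hC), fun hh C hC => ?_⟩
  by_cases hCB : C.rel = B.rel
  · obtain rfl := hQ.eq_of_rel hC hB hCB
    rw [mem_absorb, reindex_map hAB]
    exact ⟨hh _ hC, hh _ hA⟩
  · rw [absorb_rel_of_ne hCB]
    exact hh C hC

theorem absorb_homProd (hA : A ∈ Q.body) (hB : B ∈ Q.body) (hQ : Q.SelfJoinFree)
    (hAB : A.args ⊆ B.args) (hne : A.rel ≠ B.rel) (h : ℕ →₀ ℕ) :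
    (D.absorb A B).homProd Q h = D.homProd Q h := by
  obtain ⟨l, hl, hl'⟩ := hQ.exists_perm hA hB hne
  unfold homProd
  rw [(hl.map _).prod_eq, (hl.map _).prod_eq]
  simp only [List.map_cons, List.prod_cons]
  have : (l.map fun C => (D.absorb A B).ann C.rel (C.args.map h)) =
      l.map fun C => D.ann C.rel (C.args.map h) :=
    List.map_congr_left fun C hC => by simp [absorb, hl' C hC]
  rw [this]
  simp only [absorb, hne, if_false, if_true, reindex_map hAB]
  ring

theorem absorb_nthAnswer [LinearOrder K] (hA : A ∈ Q.body) (hB : B ∈ Q.body) (hQ : Q.SelfJoinFree)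
    (hAB : A.args ⊆ B.args) (hne : A.rel ≠ B.rel) (i : ℕ) :
    (D.absorb A B).nthAnswer Q i = D.nthAnswer Q i := by
  unfold nthAnswer answers answerAnn
  simp only [absorb_homs hA hB hQ hAB, absorb_homProd hA hB hQ hAB hne]

end KDatabase

/-- What a marking loop over all facts of an atom leaves behind. -/
theorem markRows_spec {κ W n a : ℕ} {Q : CQStar} {D : KDatabase K} {L : ℕ → List (List ℕ)}
    {A : QAtom} (hκ : 1 ≤ κ) (h : InputRows Q D L n W) (ha : Q.body[a]? = some A) {test code : Ex}
    {P : List ℕ → Prop} {cd : List ℕ → ℕ} [DecidablePred P]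
    (hs : ∀ i (hi : i < (factRows D L A.rel).length), ∀ s, Holds s a a (factRows D L A.rel) →
      s.reg n = i → test.Ok W s ∧ (test.eval s ≠ 0 ↔ P (factRows D L A.rel)[i].1) ∧
      (P (factRows D L A.rel)[i].1 → code.Ok W s ∧ code.eval s = cd (factRows D L A.rel)[i].1)) :
    Sp κ W (markLoop n n a test code (.load a (.reg n))) (inputState D Q L)
      (5 * ((D.size Q + 1) * κ)) fun s' => Frame n n n (inputState D Q L) s' ∧
      ∀ x, s'.karr n x = ∑ t ∈ (D.rel A.rel).filter (fun t => P t ∧ cd t = x), D.ann A.rel t ∧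
        ((s'.arr n x = 0 ∧ ∀ t ∈ D.rel A.rel, P t → cd t ≠ x) ∨
          ∃ i, ∃ hi : i < (factRows D L A.rel).length, P (factRows D L A.rel)[i].1 ∧
            cd (factRows D L A.rel)[i].1 = x ∧ s'.arr n x = i + 1) := by
  classical
  have hA := List.mem_of_getElem? ha
  have hna : a < n := h.length_eq ▸ (List.getElem?_eq_some_iff.1 ha).1
  have hH := inputState_holds (D := D) (L := L) h.selfJoinFree ha
  obtain ⟨N, hN⟩ : ∃ N, N = (factRows D L A.rel).length := ⟨_, rfl⟩
  have hNs : N ≤ D.size Q := hN ▸ h.enum.rows_length_le hA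
  obtain ⟨row, hrow⟩ : ∃ row : ℕ → List ℕ × K, ∀ i (hi : i < N),
      row i = (factRows D L A.rel)[i]'(hN ▸ hi) :=
    ⟨fun i => (factRows D L A.rel).getD i ([], 0), fun i hi => List.getD_eq_getElem _ _ _⟩
  have hL := h.enum A.rel (CQStar.rel_mem_symbols hA)
  have hmem : ∀ t, t ∈ D.rel A.rel ↔ ∃ i < N, (row i).1 = t := by
    intro t
    rw [← hL.2]
    constructor
    · intro ht
      have : (t, D.ann A.rel t) ∈ factRows D L A.rel := List.mem_map_of_mem ht
      obtain ⟨i, hi, he⟩ := List.mem_iff_getElem.1 this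
      exact ⟨i, hN ▸ hi, by rw [hrow i (hN ▸ hi), he]⟩
    · rintro ⟨i, hi, rfl⟩
      rw [hrow i hi, hL.2]
      exact (h.enum.row h.isOver hA (List.getElem_mem _)).2.1
  have hann : ∀ i < N, (row i).2 = D.ann A.rel (row i).1 := fun i hi => by
    rw [hrow i hi]; exact (h.enum.row h.isOver hA (List.getElem_mem _)).2.2.1
  have hinj : ∀ i < N, ∀ j < N, (row i).1 = (row j).1 → i = j := by
    intro i hi j hj he
    have hN' : N = (L A.rel).length := hN.trans (factRows_length D L A.rel)
    rw [hrow i hi, hrow j hj] at he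
    simp only [factRows, List.getElem_map] at he
    exact (hL.1.getElem_inj_iff).1 he
  refine (markLoop_spec (κ := κ) (W := W) (c := n) (m := n) (src := a) (N := N) hκ
    (by rw [hH.reg, hN]) (hN ▸ h.length_lt hA) (fun i => P (row i).1) (fun i => cd (row i).1)
    (fun i => (row i).2) (fun i hi s' hf hc => ?_) (fun x => ?_)).conseq ?_ ?_
  · have hHs : Holds s' a a (factRows D L A.rel) :=
      hH.congr (hf.reg a (by omega) (by omega)) (hf.arr a (by omega)) (hf.karr a (by omega))
    obtain ⟨t1, t2, t3⟩ := hs i (hN ▸ hi) s' hHs hc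
    rw [← hrow i hi] at t2 t3
    refine ⟨t1, t2, fun hP => ⟨t3 hP, ?_, ?_⟩⟩
    · have := h.length_lt hA
      change s'.reg n < W
      omega
    · rw [hrow i hi]; exact KEx.row_val hHs hc (hN ▸ hi)
  · have : Q.symbols[n]? = none := List.getElem?_eq_none (by
      rw [h.selfJoinFree.symbols_eq, List.length_map, h.length_eq])
    simp [inputState, this]
  · nlinarith
  · rintro s' ⟨f1, f2⟩
    refine ⟨f1, fun x => ⟨?_, ?_⟩⟩
    · rw [(f2 x).1]
      refine Finset.sum_bij (fun i _ => (row i).1) (fun i hi => ?_) (fun i hi j hj he => ?_)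
        (fun t ht => ?_) (fun i hi => ?_)
      · simp only [Finset.mem_filter, Finset.mem_range] at hi ⊢
        exact ⟨(hmem _).2 ⟨i, hi.1, rfl⟩, hi.2⟩
      · simp only [Finset.mem_filter, Finset.mem_range] at hi hj
        exact hinj i hi.1 j hj.1 he
      · simp only [Finset.mem_filter] at ht
        obtain ⟨i, hi, rfl⟩ := (hmem t).1 ht.1
        exact ⟨i, by simp [hi, ht.2], rfl⟩
      · simp only [Finset.mem_filter, Finset.mem_range] at hi
        exact hann i hi.1
    · rcases (f2 x).2 with ⟨h1, h2⟩ | ⟨i, hi, h1, h2, h3⟩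
      · refine Or.inl ⟨h1, fun t ht hP => ?_⟩
        obtain ⟨i, hi, rfl⟩ := (hmem t).1 ht
        exact h2 i hi hP
      · rw [hrow i hi] at h1 h2
        exact Or.inr ⟨i, hN ▸ hi, h1, h2, h3⟩

end Absorb

/-! ### Absorption as a reduction -/

section AbsorbReduction

variable {K : Type*} [CommSemiring K] [LinearOrder K]

theorem factRows_getElem_fst {K : Type*} {D : KDatabase K} {L : ℕ → List (List ℕ)} {R i : ℕ}
    (hi : i < (factRows D L R).length) : (factRows D L R)[i] =
      ((factRows D L R)[i].1, D.ann R (factRows D L R)[i].1) := by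
  simp [factRows]

/-- The rows of a relation that is copied with new annotations. -/
theorem factRows_copy {K : Type*} {D D' : KDatabase K} {L L' : ℕ → List (List ℕ)} {R : ℕ} (h : L' R = L R)
    (v : ℕ → K) (hv : ∀ i (hi : i < (factRows D L R).length),
      v i = D'.ann R (factRows D L R)[i].1) :
    factRows D' L' R = (List.range (factRows D L R).length).filterMap fun i =>
      (factRows D L R)[i]?.bind fun r => some (r.1, v i) := by
  have h1 : ∀ i ∈ List.range (factRows D L R).length, ((factRows D L R)[i]?.bind fun r =>
      some (r.1, v i)) = (factRows D L R)[i]?.bind fun r => some (r.1, D'.ann R r.1) := by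
    intro i hi
    have hi' := List.mem_range.1 hi
    rw [List.getElem?_eq_getElem hi', Option.bind_some, Option.bind_some, hv i hi']
  rw [List.filterMap_congr h1, List.filterMap_getElem?_range]
  simp [factRows, h]

/-- The reduction that moves the annotations of `A` to `B`. -/
theorem Reduces.absorb {κ : ℕ → ℕ} (hκ : ∀ n, 1 ≤ κ n) {Q : CQStar} (hQ : Q.SelfJoinFree)
    {A B : QAtom} (hA : A ∈ Q.body) (hB : B ∈ Q.body) (hne : A.rel ≠ B.rel)
    (hAB : A.args ⊆ B.args) {𝒟₁ 𝒟₂ : KDatabase K → Prop}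
    (h𝒟 : ∀ D : KDatabase K, D.Over Q → 𝒟₁ D → 𝒟₂ (D.absorb A B)) : Reduces κ Q 𝒟₁ Q 𝒟₂ := by
  obtain ⟨n, hn⟩ : ∃ n, n = Q.body.length := ⟨_, rfl⟩
  obtain ⟨a, ha⟩ := List.mem_iff_getElem?.1 hA
  obtain ⟨b, hb⟩ := List.mem_iff_getElem?.1 hB
  have han : a < n := hn ▸ (List.getElem?_eq_some_iff.1 ha).1
  have hbn : b < n := hn ▸ (List.getElem?_eq_some_iff.1 hb).1
  obtain ⟨code, hcode⟩ : ∃ code, code = Ex.code (reindexFields n b B.args A.args) := ⟨_, rfl⟩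
  -- At the code of the restricted tuple, the word array `n` tells whether the fact of `A` exists,
  -- and the `K`-array `n` holds its annotation.
  obtain ⟨spec, hspec⟩ : ∃ spec : QAtom × ℕ → RowSpec, spec = fun q =>
    if q.1.rel = B.rel then ⟨q.2, .load n code, rowFields n b B.args.length,
      .mul (.load b (.reg n)) (.load n code)⟩
    else copySpec n q.2 q.1.args.length (if q.1.rel = A.rel then .one else .load q.2 (.reg n)) :=
      ⟨_, rfl⟩
  have hsrcj : ∀ q, (spec q).src = q.2 := fun q => by
    rw [hspec]; simp only; split_ifs <;> rfl
  refine Reduces.of_specs hκ hQ hQ hn (markLoop n n a (.cst 1)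
    (.code (rowFields n a A.args.length)) (.load a (.reg n))) (Q.body.zipIdx.map spec)
    (by simp) (fun ρ hρ => ?_) ?_
  · obtain ⟨⟨C, j⟩, hq, rfl⟩ := List.mem_map.1 hρ
    rw [hsrcj, hn]
    exact (List.getElem?_eq_some_iff.1 (List.mem_zipIdx_iff_getElem?.1 hq)).1
  intro k
  refine ⟨(k + Q.maxArity + 3) + codeExp k A.args.length, 5, ?_⟩
  intro D hD hD𝒟 L hL κ M W hκ1 hM hsz hc hW
  have hpow : ∀ {a b : ℕ}, a ≤ b → M ^ a ≤ M ^ b := fun h => Nat.pow_le_pow_right (by omega) h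
  have hin : InputRows Q D L n W := hn ▸ InputRows.of_le hQ hD hL hM hsz hc (by omega) hW
  have hcodeW : ∀ t : List ℕ, t.length = A.args.length → (∀ x ∈ t, x ∈ D.constants Q) →
      listCode t < W := by
    intro t ht hx
    refine (listCode_lt hM fun x hxt => hc x (hx x hxt)).trans_le ((hpow ?_).trans hW)
    rw [ht]; omega
  have hmark := markRows_spec (κ := κ) (P := fun _ => True) (cd := listCode) (test := .cst 1)
    (code := .code (rowFields n a A.args.length)) hκ1 hin ha (fun i hi s hs hsi => ⟨by
      have := hin.length_lt hA
      simp only [Ex.Ok]; omega, by simp [Ex.eval], fun _ => by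
      have hr := hL.row hD hA (List.getElem_mem hi)
      exact Ex.code_ok (rowFields_ok hin hA hs hsi hi) (hcodeW _ hr.1 hr.2.2.2)⟩)
  obtain ⟨s₁, hs₁⟩ : ∃ s₁, s₁ = (markLoop n n a (.cst 1) (.code (rowFields n a A.args.length))
    (.load a (.reg n))).run (inputState D Q L) := ⟨_, rfl⟩
  refine ⟨D.absorb A B, _, KDatabase.absorb_over hD, h𝒟 D hD hD𝒟,
    fun x hx => Or.inl (KDatabase.absorb_constants hx), KDatabase.absorb_enumerates hL,
    fun i => KDatabase.absorb_nthAnswer hA hB hQ hAB hne i,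
    hmark.conseq le_rfl fun s h => h.1, fun j C hj => ?_⟩
  obtain ⟨-, -, hfr, hm⟩ := hmark
  rw [← hs₁] at hfr hm ⊢
  have hC := List.mem_of_getElem? hj
  have hCH := inputState_holds (D := D) (L := L) hQ hj
  refine ⟨spec (C, j), ?_⟩
  simp only [hsrcj]
  rw [hCH.reg]
  by_cases hCB : C.rel = B.rel
  · obtain rfl := hQ.eq_of_rel hC hB hCB
    have hjb : j = b := by
      have hnd : Q.body.Nodup := List.Nodup.of_map _ hQ
      exact (List.getElem?_inj (List.getElem?_eq_some_iff.1 hj).1 hnd).1 (hj.trans hb.symm)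
    subst hjb
    refine ⟨fun i => (factRows D L C.rel)[i]?.bind fun r =>
      if reindex C.args A.args r.1 ∈ D.rel A.rel then
        some (r.1, r.2 * D.ann A.rel (reindex C.args A.args r.1)) else none,
      getElem?_zipIdx_map _ _ _ hj, ?_, fun i hi s hs hsi => ?_⟩
    · rw [List.filterMap_getElem?_range]
      simp only [factRows, if_true, List.filterMap_map]
      rw [← List.filterMap_eq_map, ← List.filterMap_eq_filter, List.filterMap_filterMap]
      refine List.filterMap_congr fun t ht => ?_
      simp only [Function.comp_apply, Option.guard]
      by_cases ht' : reindex C.args A.args t ∈ D.rel A.rel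
      · simp [ht', KDatabase.absorb]
      · simp [ht']
    · have hHs := hin.holds hj hfr hs
      have hr := hL.row hD hC (List.getElem_mem hi)
      have hf := reindexFields_ok hin hC hHs hsi hi hAB
      obtain ⟨c1, c2⟩ := Ex.code_ok hf (hcodeW _ (length_reindex _ _ _) fun x hx =>
        hr.2.2.2 x (reindex_mem hAB hr.1 hx))
      rw [← hcode] at c1 c2
      have hm' := hm (listCode (reindex C.args A.args (factRows D L C.rel)[i].1))
      have harr : s.arr n = s₁.arr n := hs.arr n (by omega)
      have hkarr : s.karr n = s₁.karr n := hs.karr n (by omega)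
      have hload : (Ex.load n code).eval s =
          s₁.arr n (listCode (reindex C.args A.args (factRows D L C.rel)[i].1)) := by
        simp only [Ex.eval, c2, harr]
      have hAlt := hin.length_lt hA
      have hClt := hin.length_lt hC
      have hok : (Ex.load n code).Ok W s := by
        refine ⟨c1, ?_⟩
        rw [c2, harr]
        rcases hm'.2 with ⟨h1, -⟩ | ⟨i', hi', -, -, h1⟩ <;> rw [h1] <;> omega
      have hiff : s₁.arr n (listCode (reindex C.args A.args (factRows D L C.rel)[i].1)) ≠ 0 ↔
          reindex C.args A.args (factRows D L C.rel)[i].1 ∈ D.rel A.rel := by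
        constructor
        · intro hne0
          rcases hm'.2 with ⟨h1, -⟩ | ⟨i', hi', -, h1, -⟩
          · exact absurd h1 hne0
          · have hr' := hL.row hD hA (List.getElem_mem hi')
            rw [← listCode_inj (by rw [hr'.1, length_reindex]) h1]
            exact hr'.2.1
        · intro hmem h0
          rcases hm'.2 with ⟨-, h1⟩ | ⟨i', hi', -, -, h1⟩
          · exact h1 _ hmem trivial rfl
          · omega
      rw [hspec]
      simp only [if_true]
      simp only [List.getElem?_eq_getElem hi, Option.bind_some]
      refine ⟨hok, fun hnone => ?_, fun row hrow => ?_⟩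
      · change (Ex.load n code).eval s = 0
        rw [hload]
        by_contra h0
        rw [if_pos (hiff.1 h0)] at hnone
        exact absurd hnone (by simp)
      · by_cases hmem : reindex C.args A.args (factRows D L C.rel)[i].1 ∈ D.rel A.rel
        · rw [if_pos hmem, Option.some_inj] at hrow
          subst hrow
          refine ⟨?_, rowFields_ok hin hC hHs hsi hi, ⟨?_, c1⟩, ?_⟩
          · change (Ex.load n code).eval s ≠ 0
            rw [hload]
            exact hiff.2 hmem
          · change s.reg n < W
            omega
          · simp only [KEx.eval, c2, hkarr, (hm').1]
            congr 1
            · exact KEx.row_val hHs hsi hi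
            -- Codes are injective on tuples of this length, so a single fact of `A` has contributed
            -- to the entry.
            · rw [Finset.sum_eq_single (reindex C.args A.args (factRows D L C.rel)[i].1)]
              · intro t ht hne'
                simp only [true_and, Finset.mem_filter] at ht
                exact absurd (listCode_inj (by rw [hD A hA t ht.1, length_reindex]) ht.2) hne'
              · intro h
                simp [hmem] at h
        · rw [if_neg hmem] at hrow
          exact absurd hrow (by simp)
  · refine ⟨fun i => (factRows D L C.rel)[i]?.bind fun r => some (r.1,
      if C.rel = A.rel then 1 else D.ann C.rel ((factRows D L C.rel).getD i ([], 0)).1),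
      getElem?_zipIdx_map _ _ _ hj, ?_, fun i hi s hs hsi => ?_⟩
    · refine factRows_copy (by simp [hCB]) _ fun i hi => ?_
      simp only [KDatabase.absorb, if_neg hCB, List.getD_eq_getElem _ _ hi]
    · have hHs := hin.holds hj hfr hs
      have hClt := hin.length_lt hC
      rw [hspec]
      simp only [if_neg hCB]
      have hval : (if C.rel = A.rel then KEx.one else KEx.load j (.reg n)).eval s =
          if C.rel = A.rel then 1 else D.ann C.rel ((factRows D L C.rel).getD i ([], 0)).1 := by
        split_ifs
        · rfl
        · rw [KEx.row_val hHs hsi hi, List.getD_eq_getElem _ _ hi, factRows_getElem_fst hi]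
      rw [← hval]
      refine copySpec_yields hin hj rfl hHs hsi hi ?_
      split_ifs
      · trivial
      · change s.reg n < W
        omega

end AbsorbReduction

/-! ## Projecting the facts of an atom -/

section Project

variable {K : Type*} [CommSemiring K]

/-- The only use of idempotence: when facts outside `R` are projected and their annotations added
up, the result is `1` again, and no second annotated relation arises. -/
theorem nsmul_one_of_idem (hidem : ∀ a : K, a + a = a) : ∀ n : ℕ, n ≠ 0 → n • (1 : K) = 1
  | 0, h => absurd rfl h
  | 1, _ => one_nsmul _
  | n + 2, _ => by rw [succ_nsmul, nsmul_one_of_idem hidem (n + 1) (by omega), hidem]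

/-- `Q₂` arises from `Q₁` by dropping the variables outside `V` from the atom `A`. -/
structure Projects (Q₁ Q₂ : CQStar) (A : QAtom) (V : Finset ℕ) : Prop where
  selfJoinFree : Q₁.SelfJoinFree
  mem : A ∈ Q₁.body
  body : Q₂.body = Q₁.body.map fun C =>
    if C.rel = A.rel then ⟨C.rel, C.args.filter (· ∈ V)⟩ else C
  pre : Q₂.pre = Q₁.pre
  post : Q₂.post = Q₁.post

namespace Projects

variable {Q₁ Q₂ : CQStar} {A : QAtom} {V : Finset ℕ}

theorem map_rel (h : Projects Q₁ Q₂ A V) : Q₂.body.map QAtom.rel = Q₁.body.map QAtom.rel := by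
  rw [h.body, List.map_map]
  refine List.map_congr_left fun C _ => ?_
  simp only [Function.comp_apply]
  split_ifs <;> rfl

theorem symbols_eq (h : Projects Q₁ Q₂ A V) : Q₂.symbols = Q₁.symbols := by
  unfold CQStar.symbols
  rw [h.map_rel]

theorem selfJoinFree_right (h : Projects Q₁ Q₂ A V) : Q₂.SelfJoinFree := by
  unfold CQStar.SelfJoinFree
  rw [h.map_rel]
  exact h.selfJoinFree

theorem free_eq (h : Projects Q₁ Q₂ A V) : Q₂.free = Q₁.free := by
  unfold CQStar.free
  rw [h.pre, h.post]

theorem forall_body (h : Projects Q₁ Q₂ A V) {P : QAtom → Prop} :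
    (∀ C ∈ Q₂.body, P C) ↔ P ⟨A.rel, A.args.filter (· ∈ V)⟩ ∧
      ∀ C ∈ Q₁.body, C.rel ≠ A.rel → P C := by
  rw [h.body]
  simp only [List.forall_mem_map]
  constructor
  · intro hh
    refine ⟨by simpa using hh A h.mem, fun C hC hne => by simpa [hne] using hh C hC⟩
  · rintro ⟨h1, h2⟩ C hC
    split_ifs with hr
    · obtain rfl := h.selfJoinFree.eq_of_rel hC h.mem hr
      exact h1
    · exact h2 C hC hr

theorem mem_vars (h : Projects Q₁ Q₂ A V) {x : ℕ} : x ∈ Q₂.vars ↔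
    x ∈ A.args ∧ x ∈ V ∨ ∃ C ∈ Q₁.body, C.rel ≠ A.rel ∧ x ∈ C.args := by
  have := h.forall_body (P := fun C => x ∉ C.args)
  rw [← not_iff_not, CQStar.mem_vars]
  push Not
  rw [this]
  simp

theorem mem_vars_left (h : Projects Q₁ Q₂ A V) {x : ℕ} : x ∈ Q₁.vars ↔
    x ∈ A.args ∨ ∃ C ∈ Q₁.body, C.rel ≠ A.rel ∧ x ∈ C.args := by
  rw [CQStar.mem_vars]
  constructor
  · rintro ⟨C, hC, hx⟩
    by_cases hr : C.rel = A.rel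
    · obtain rfl := h.selfJoinFree.eq_of_rel hC h.mem hr
      exact Or.inl hx
    · exact Or.inr ⟨C, hC, hr, hx⟩
  · rintro (hx | ⟨C, hC, -, hx⟩)
    · exact ⟨A, h.mem, hx⟩
    · exact ⟨C, hC, hx⟩

end Projects

namespace KDatabase

/-- Project the facts of `A` in which equal variables have equal values to the variables `vs`, and
add up their annotations. -/
def project (D : KDatabase K) (A : QAtom) (vs : List ℕ) : KDatabase K where
  rel r := if r = A.rel then ((D.rel r).filter fun t => reindex A.args A.args t = t).image
    (reindex A.args vs) else D.rel r
  ann r u := if r = A.rel then ∑ t ∈ (D.rel r).filter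
    (fun t => reindex A.args A.args t = t ∧ reindex A.args vs t = u), D.ann r t else D.ann r u

variable {D : KDatabase K} {Q₁ Q₂ : CQStar} {A B : QAtom} {V : Finset ℕ}

theorem project_rel_of_ne {vs : List ℕ} {r : ℕ} (h : r ≠ A.rel) :
    (D.project A vs).rel r = D.rel r := if_neg h

theorem mem_project {vs u : List ℕ} : u ∈ (D.project A vs).rel A.rel ↔
    ∃ t ∈ D.rel A.rel, reindex A.args A.args t = t ∧ reindex A.args vs t = u := by
  simp [project, and_assoc]

theorem project_over (hP : Projects Q₁ Q₂ A V) (hD : D.Over Q₁) :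
    (D.project A (A.args.filter (· ∈ V))).Over Q₂ := by
  refine hP.forall_body.2 ⟨fun u hu => ?_, fun C hC hne t ht => ?_⟩
  · obtain ⟨t, -, -, rfl⟩ := mem_project.1 hu
    exact length_reindex _ _ _
  · rw [project_rel_of_ne hne] at ht
    exact hD C hC t ht

theorem project_constants (hP : Projects Q₁ Q₂ A V) (hD : D.Over Q₁) {x : ℕ}
    (hx : x ∈ (D.project A (A.args.filter (· ∈ V))).constants Q₂) : x ∈ D.constants Q₁ := by
  obtain ⟨C, hC, u, hu, hxu⟩ := mem_constants.1 hx
  revert u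
  revert C
  refine hP.forall_body.2 ⟨fun u hu hxu => ?_, fun C hC hne t ht hxt => ?_⟩
  · obtain ⟨t, ht, -, rfl⟩ := mem_project.1 hu
    exact mem_constants_of_mem hP.mem ht
      (reindex_mem (List.filter_subset_self _) (hD A hP.mem t ht) hxu)
  · rw [project_rel_of_ne hne] at ht
    exact mem_constants_of_mem hC ht hxt

theorem project_locallyAnnotated (hidem : ∀ a : K, a + a = a) (hP : Projects Q₁ Q₂ A V) {R : ℕ}
    (h : D.LocallyAnnotated Q₁ R) :
    (D.project A (A.args.filter (· ∈ V))).LocallyAnnotated Q₂ R := by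
  intro S hS hne t ht
  rw [hP.symbols_eq] at hS
  by_cases hSA : S = A.rel
  · subst hSA
    obtain ⟨t', ht', h1, h2⟩ := mem_project.1 ht
    simp only [project, if_true]
    rw [Finset.sum_congr rfl fun u hu => h _ hS hne u (Finset.mem_filter.1 hu).1,
      Finset.sum_const]
    refine nsmul_one_of_idem hidem _ (Finset.card_ne_zero_of_mem (a := t') ?_)
    exact Finset.mem_filter.2 ⟨ht', h1, h2⟩
  · rw [project_rel_of_ne hSA] at ht
    simp only [project, if_neg hSA]
    exact h S hS hne t ht

theorem mem_homs_project (hP : Projects Q₁ Q₂ A V) (h : ℕ →₀ ℕ) :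
    h ∈ (D.project A (A.args.filter (· ∈ V))).homs Q₂ ↔ (∀ x ∉ Q₂.vars, h x = 0) ∧
      (∃ t ∈ D.rel A.rel, reindex A.args A.args t = t ∧
        reindex A.args (A.args.filter (· ∈ V)) t = (A.args.filter (· ∈ V)).map h) ∧
      ∀ C ∈ Q₁.body, C.rel ≠ A.rel → C.args.map h ∈ D.rel C.rel := by
  rw [mem_homs, hP.forall_body, mem_project]
  refine and_congr_right fun _ => and_congr_right fun _ => ?_
  refine forall_congr' fun C => forall_congr' fun _ => forall_congr' fun hne => ?_
  rw [project_rel_of_ne hne]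

/-- Isolates the factor of the one atom that a projection or an expansion treats specially. -/
theorem homProd_cons {D : KDatabase K} {Q : CQStar} {A : QAtom} (hA : A ∈ Q.body)
    (hQ : Q.SelfJoinFree) (h : ℕ →₀ ℕ) : D.homProd Q h = D.ann A.rel (A.args.map h) *
      ((Q.body.filter fun C => C.rel ≠ A.rel).map fun C => D.ann C.rel (C.args.map h)).prod := by
  have hnd : Q.body.Nodup := List.Nodup.of_map _ hQ
  have h1 : Q.body.Perm (A :: Q.body.filter fun C => C.rel ≠ A.rel) := by
    refine (List.perm_ext_iff_of_nodup hnd (List.nodup_cons.2 ⟨by simp, hnd.filter _⟩)).2 fun C => ?_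
    simp only [List.mem_cons, List.mem_filter, decide_eq_true_eq]
    constructor
    · intro hC
      by_cases hr : C.rel = A.rel
      · exact Or.inl (hQ.eq_of_rel hC hA hr)
      · exact Or.inr ⟨hC, hr⟩
    · rintro (rfl | hC)
      · exact hA
      · exact hC.1
  unfold homProd
  rw [(h1.map _).prod_eq, List.map_cons, List.prod_cons]

theorem homProd_project (hP : Projects Q₁ Q₂ A V) (h : ℕ →₀ ℕ) :
    (D.project A (A.args.filter (· ∈ V))).homProd Q₂ h =
      (∑ t ∈ (D.rel A.rel).filter (fun t => reindex A.args A.args t = t ∧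
        reindex A.args (A.args.filter (· ∈ V)) t = (A.args.filter (· ∈ V)).map h), D.ann A.rel t) *
      ((Q₁.body.filter fun C => C.rel ≠ A.rel).map fun C => D.ann C.rel (C.args.map h)).prod := by
  have hmem : (⟨A.rel, A.args.filter (· ∈ V)⟩ : QAtom) ∈ Q₂.body := by
    rw [hP.body]
    exact List.mem_map.2 ⟨A, hP.mem, by simp⟩
  rw [homProd_cons hmem hP.selfJoinFree_right]
  congr 1
  · simp [project]
  · have hf : (Q₂.body.filter fun C => C.rel ≠ A.rel) =
        Q₁.body.filter fun C => C.rel ≠ A.rel := by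
      rw [hP.body, List.filter_map]
      have h1 : (Q₁.body.filter ((fun C : QAtom => decide (C.rel ≠ A.rel)) ∘ fun C =>
          if C.rel = A.rel then ⟨C.rel, C.args.filter (· ∈ V)⟩ else C)) =
          Q₁.body.filter fun C => C.rel ≠ A.rel := by
        refine List.filter_congr fun C _ => ?_
        simp only [Function.comp_apply]
        split_ifs <;> simp_all
      rw [h1]
      refine (List.map_congr_left fun C hC => ?_).trans (List.map_id _)
      have := (List.mem_filter.1 hC).2
      rw [if_neg (by simpa using this), id]
    rw [hf]
    congr 1
    refine List.map_congr_left fun C hC => ?_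
    have := (List.mem_filter.1 hC).2
    simp only [project, if_neg (show C.rel ≠ A.rel by simpa using this)]

/-- Variables that occur in no other atom may be projected away. -/
theorem project_nthAnswer_of_private [LinearOrder K] (hP : Projects Q₁ Q₂ A V)
    (hpriv : ∀ x ∈ A.args, x ∉ V → ∀ C ∈ Q₁.body, C.rel ≠ A.rel → x ∉ C.args) (i : ℕ) :
    (D.project A (A.args.filter (· ∈ V))).nthAnswer Q₂ i = D.nthAnswer Q₁ i := by
  classical
  obtain ⟨vs, hvs⟩ : ∃ vs, vs = A.args.filter (· ∈ V) := ⟨_, rfl⟩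
  have hvs' : vs ⊆ A.args := hvs ▸ List.filter_subset_self _
  have hA := hP.mem
  have hrest : ∀ C ∈ Q₁.body, C.rel ≠ A.rel → ∀ x ∈ C.args, x ∈ Q₂.vars := fun C hC hne x hx =>
    hP.mem_vars.2 (Or.inr ⟨C, hC, hne, hx⟩)
  have hvsV : ∀ x ∈ vs, x ∈ Q₂.vars := fun x hx => by
    rw [hvs, List.mem_filter] at hx
    exact hP.mem_vars.2 (Or.inl ⟨hx.1, by simpa using hx.2⟩)
  have hAvs : ∀ x ∈ A.args, x ∈ Q₂.vars → x ∈ vs := fun x hx h2 => by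
    rw [hvs, List.mem_filter]
    refine ⟨hx, ?_⟩
    rcases hP.mem_vars.1 h2 with h3 | ⟨C, hC, hne, hxC⟩
    · simpa using h3.2
    · by_contra hV
      exact hpriv x hx (by simpa using hV) C hC hne hxC
  have hsub : ∀ x ∈ Q₂.vars, x ∈ Q₁.vars := fun x hx => hP.mem_vars_left.2 (by
    rcases hP.mem_vars.1 hx with h | h
    · exact Or.inl h.1
    · exact Or.inr h)
  have hcons : ∀ h : ℕ →₀ ℕ, reindex A.args A.args (A.args.map h) = A.args.map h :=
    fun h => reindex_map (List.Subset.refl _) h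
  have hval : ∀ (h : ℕ →₀ ℕ) (l : List ℕ), (∀ x ∈ l, x ∈ Q₂.vars) →
      l.map (assignOn Q₂.vars h) = l.map h := fun h l hl =>
    List.map_congr_left fun x hx => assignOn_of_mem _ (hl x hx)
  -- the extension of a homomorphism by a fact of `A`
  have hext : ∀ h₂ ∈ (D.project A vs).homs Q₂, ∀ t ∈ D.rel A.rel, reindex A.args A.args t = t →
      reindex A.args vs t = vs.map h₂ → ∃ h ∈ D.homs Q₁, assignOn Q₂.vars h = h₂ ∧
        A.args.map h = t := by
    intro h₂ hh₂ t ht ht1 ht2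
    rw [hvs, mem_homs_project hP, ← hvs] at hh₂
    obtain ⟨z, -, hh₂⟩ := hh₂
    have hA1 : ∀ x ∈ A.args, x ∈ Q₂.vars → t.getD (A.args.idxOf x) 0 = h₂ x := by
      intro x hx h2
      have := List.map_inj_left.1 (show vs.map (fun x => t.getD (A.args.idxOf x) 0) = vs.map h₂
        from ht2)
      exact this x (hAvs x hx h2)
    obtain ⟨h, hh⟩ : ∃ h, h = assignOn Q₁.vars (fun x =>
      if x ∈ A.args then t.getD (A.args.idxOf x) 0 else h₂ x) := ⟨_, rfl⟩
    have hhA : ∀ x ∈ A.args, h x = t.getD (A.args.idxOf x) 0 := fun x hx => by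
      rw [hh, assignOn_of_mem _ (hP.mem_vars_left.2 (Or.inl hx)), if_pos hx]
    have hh2 : ∀ x ∈ Q₂.vars, h x = h₂ x := fun x hx => by
      by_cases hxA : x ∈ A.args
      · rw [hhA x hxA, hA1 x hxA hx]
      · rw [hh, assignOn_of_mem _ (hsub x hx), if_neg hxA]
    have hAt : A.args.map h = t := by
      rw [← ht1]
      exact List.map_congr_left hhA
    refine ⟨h, (mem_homs _ _ _).2 ⟨fun x hx => by rw [hh, assignOn_apply, if_neg hx],
      fun C hC => ?_⟩, ?_, hAt⟩
    · by_cases hr : C.rel = A.rel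
      · obtain rfl := hP.selfJoinFree.eq_of_rel hC hA hr
        rw [hAt]; exact ht
      · rw [show C.args.map h = C.args.map h₂ from
          List.map_congr_left fun x hx => hh2 x (hrest C hC hr x hx)]
        exact hh₂ C hC hr
    · ext x
      rw [assignOn_apply]
      split_ifs with hx
      · exact hh2 x hx
      · exact (z x hx).symm
  rw [← hvs]
  refine nthAnswer_congr hP.pre hP.post (assignOn Q₂.vars ·) (fun h hh => ?_) (fun h₂ hh₂ => ?_)
    (fun h hh x hx => ?_) (fun h₂ hh₂ => ?_) i
  · rw [hvs, mem_homs_project hP, ← hvs]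
    have hh' := (mem_homs _ _ _).1 hh
    refine ⟨fun x hx => if_neg hx, ⟨_, hh'.2 A hA, hcons h, ?_⟩, fun C hC hne => ?_⟩
    · rw [reindex_map hvs', hval h vs hvsV]
    · rw [hval h _ (hrest C hC hne)]
      exact hh'.2 C hC
  · have hh₂' := hh₂
    rw [hvs, mem_homs_project hP, ← hvs] at hh₂'
    obtain ⟨-, ⟨t, ht, ht1, ht2⟩, -⟩ := hh₂'
    obtain ⟨h, h1, h2, -⟩ := hext h₂ hh₂ t ht ht1 ht2
    exact ⟨h, h1, h2⟩
  · refine assignOn_of_mem _ ?_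
    have h1 : x ∈ Q₂.pre ++ Q₂.post := by
      rw [hP.pre, hP.post]
      simpa [CQStar.free] using hx
    exact CQStar.mem_vars_of_mem_head h1
  -- Distributivity: the homomorphisms above `h₂` correspond to the consistent facts of `A` that
  -- project to its values, and the other factors are the same for all of them.
  · rw [hvs, homProd_project hP, ← hvs, Finset.sum_mul]
    symm
    refine Finset.sum_bij (fun h _ => A.args.map h) (fun h hh => ?_) (fun h hh h' hh' he => ?_)
      (fun t ht => ?_) (fun h hh => ?_)
    · obtain ⟨hh1, rfl⟩ := Finset.mem_filter.1 hh
      refine Finset.mem_filter.2 ⟨((mem_homs _ _ _).1 hh1).2 A hA, hcons h, ?_⟩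
      rw [reindex_map hvs', hval h vs hvsV]
    · obtain ⟨hh1, rfl⟩ := Finset.mem_filter.1 hh
      obtain ⟨hh2, hπ⟩ := Finset.mem_filter.1 hh'
      ext x
      by_cases hx : x ∈ Q₁.vars
      · by_cases hxA : x ∈ A.args
        · exact List.map_inj_left.1 he x hxA
        · have hx2 : x ∈ Q₂.vars := by
            rcases hP.mem_vars_left.1 hx with h1 | ⟨C, hC, hne, hxC⟩
            · exact absurd h1 hxA
            · exact hrest C hC hne x hxC
          have := DFunLike.congr_fun hπ x
          simpa only [assignOn_of_mem _ hx2] using this.symm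
      · rw [((mem_homs _ _ _).1 hh1).1 x hx, ((mem_homs _ _ _).1 hh2).1 x hx]
    · have ht' := Finset.mem_filter.1 ht
      obtain ⟨h, h1, h2, h3⟩ := hext h₂ hh₂ t ht'.1 ht'.2.1 ht'.2.2
      exact ⟨h, Finset.mem_filter.2 ⟨h1, h2⟩, h3⟩
    · have hh1 := Finset.mem_filter.1 hh
      rw [homProd_cons hA hP.selfJoinFree]
      congr 2
      refine List.map_congr_left fun C hC => ?_
      have hC' := List.mem_filter.1 hC
      rw [← hh1.2, hval h _ (hrest C hC'.1 (by simpa using hC'.2))]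

/-- If every fact of `B` determines a fact of `A`, variables of `A` may be projected away. -/
theorem project_nthAnswer_of_contained [LinearOrder K] (hidem : ∀ a : K, a + a = a)
    (hP : Projects Q₁ Q₂ A V) (hB : B ∈ Q₁.body) (hne : B.rel ≠ A.rel) (hAB : A.args ⊆ B.args)
    (hc : Contained D A B) (h1 : ∀ t ∈ D.rel A.rel, D.ann A.rel t = 1) (i : ℕ) :
    (D.project A (A.args.filter (· ∈ V))).nthAnswer Q₂ i = D.nthAnswer Q₁ i := by
  classical
  have hA := hP.mem
  have hvars : Q₂.vars = Q₁.vars := by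
    ext x
    rw [hP.mem_vars, hP.mem_vars_left]
    exact ⟨fun h => h.imp_left And.left, fun h => Or.inr (h.elim (fun h => ⟨B, hB, hne, hAB h⟩) id)⟩
  have hproj : ∀ h ∈ D.homs Q₁, A.args.map h ∈ (D.rel A.rel).filter (fun t =>
      reindex A.args A.args t = t ∧
        reindex A.args (A.args.filter (· ∈ V)) t = (A.args.filter (· ∈ V)).map h) := fun h hh =>
    Finset.mem_filter.2 ⟨((mem_homs _ _ _).1 hh).2 A hA, reindex_map (List.Subset.refl _) h,
      reindex_map (List.filter_subset_self _) h⟩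
  -- Every fact of `B` determines a fact of `A`, so weakening the atom `A` admits no new
  -- homomorphisms.
  have hhoms : (D.project A (A.args.filter (· ∈ V))).homs Q₂ = D.homs Q₁ := by
    ext h
    constructor
    · intro hh
      rw [mem_homs_project hP, hvars] at hh
      refine (mem_homs _ _ _).2 ⟨hh.1, fun C hC => ?_⟩
      by_cases hr : C.rel = A.rel
      · obtain rfl := hP.selfJoinFree.eq_of_rel hC hA hr
        have := hc _ (hh.2.2 B hB hne)
        rwa [reindex_map hAB] at this
      · exact hh.2.2 C hC hr
    · intro hh
      have h2 := Finset.mem_filter.1 (hproj h hh)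
      have hh' := (mem_homs _ _ _).1 hh
      rw [mem_homs_project hP, hvars]
      exact ⟨hh'.1, ⟨_, h2⟩, fun C hC _ => hh'.2 C hC⟩
  refine nthAnswer_congr hP.pre hP.post id (fun h hh => by rw [hhoms]; exact hh)
    (fun h hh => ⟨h, by rwa [hhoms] at hh, rfl⟩) (fun h hh x hx => rfl) (fun h hh => ?_) i
  rw [hhoms] at hh
  have h2 := Finset.mem_filter.1 (hproj h hh)
  rw [homProd_project hP, Finset.sum_congr rfl fun u hu => h1 u (Finset.mem_filter.1 hu).1,
    Finset.sum_const, nsmul_one_of_idem hidem _ (Finset.card_ne_zero_of_mem (hproj h hh))]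
  have h3 : (D.homs Q₁).filter (fun h' => id h' = h) = {h} := by
    ext h'
    simp only [id, Finset.mem_filter, Finset.mem_singleton]
    exact ⟨fun h => h.2, fun h => ⟨h ▸ hh, h⟩⟩
  rw [h3, Finset.sum_singleton, homProd_cons hA hP.selfJoinFree, h1 _ h2.1]

end KDatabase

end Project

/-! ### Projection as a reduction -/

/-- Whether the values of two lists of expressions coincide. -/
def Ex.allEq : List Ex → List Ex → Ex
  | e :: es, f :: fs => .op .mul (.op .eq e f) (allEq es fs)
  | _, _ => .cst 1

theorem Ex.allEq_ok {K : Type*} {W : ℕ} {s : RamState K} (hW : 1 < W) : ∀ {es fs : List Ex}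
    {xs ys : List ℕ}, List.Forall₂ (fun e x => e.Ok W s ∧ e.eval s = x) es xs →
    List.Forall₂ (fun e x => e.Ok W s ∧ e.eval s = x) fs ys → xs.length = ys.length →
    (Ex.allEq es fs).Ok W s ∧ (Ex.allEq es fs).eval s = if xs = ys then 1 else 0
  | [], _, _, [], .nil, _, _ => by simp only [allEq, Ok, eval]; exact ⟨hW, rfl⟩
  | e :: es, f :: fs, _, _, .cons (b := x) (l₂ := xs) h1 h2, .cons (b := y) (l₂ := ys) h3 h4, hl => by
    obtain ⟨a1, a2⟩ := Ex.allEq_ok hW h2 h4 (by simpa using hl)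
    simp only [allEq, Ok, eval, WordOp.eval, a2, h1.2, h3.2, List.cons.injEq]
    refine ⟨⟨⟨h1.1, h3.1, by split <;> omega⟩, a1, ?_⟩, ?_⟩
    · split <;> split <;> omega
    · by_cases hx : x = y <;> by_cases hxs : xs = ys <;> simp [hx, hxs]
  | [], _, _, _ :: _, .nil, .cons _ _, hl => by simp at hl
  | _ :: _, [], _, _, .cons _ _, .nil, hl => by simp at hl

theorem indicator_and (p q : Prop) [Decidable p] [Decidable q] :
    ((if p then 1 else 0) * if q then 1 else 0) = if p ∧ q then 1 else (0 : ℕ) := by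
  by_cases hp : p <;> by_cases hq : q <;> simp [hp, hq]

section ProjectReduction

variable {K : Type*} [CommSemiring K] [LinearOrder K]

/-- An expression for whether equal variables have equal values in the current row. -/
def consistent (n a : ℕ) (as : List ℕ) : Ex :=
  .allEq (reindexFields n a as as) (rowFields n a as.length)

theorem consistent_ok {K : Type*} [Zero K] {Q : CQStar} {D : KDatabase K} {L : ℕ → List (List ℕ)}
    {n W : ℕ} (h : InputRows Q D L n W) {j i : ℕ} {A : QAtom} (hA : A ∈ Q.body)
    {s : RamState K} (hs : Holds s j j (factRows D L A.rel)) (hc : s.reg n = i)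
    (hi : i < (factRows D L A.rel).length) :
    (consistent n j A.args).Ok W s ∧ (consistent n j A.args).eval s =
      if reindex A.args A.args (factRows D L A.rel)[i].1 = (factRows D L A.rel)[i].1
      then 1 else 0 := by
  have := h.length_lt hA
  exact Ex.allEq_ok (by omega) (reindexFields_ok h hA hs hc hi (List.Subset.refl _))
    (rowFields_ok h hA hs hc hi)
    (by rw [length_reindex, (h.enum.row h.isOver hA (List.getElem_mem hi)).1])

set_option maxHeartbeats 400000 in
/-- The reduction that projects the facts of `A`. -/
theorem Reduces.project {κ : ℕ → ℕ} (hκ : ∀ n, 1 ≤ κ n) {Q₁ Q₂ : CQStar} {A : QAtom}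
    {V : Finset ℕ} (hP : Projects Q₁ Q₂ A V) {𝒟₁ 𝒟₂ : KDatabase K → Prop}
    (h𝒟 : ∀ D : KDatabase K, D.Over Q₁ → 𝒟₁ D → 𝒟₂ (D.project A (A.args.filter (· ∈ V))))
    (hans : ∀ D : KDatabase K, D.Over Q₁ → 𝒟₁ D → ∀ i,
      (D.project A (A.args.filter (· ∈ V))).nthAnswer Q₂ i = D.nthAnswer Q₁ i) :
    Reduces κ Q₁ 𝒟₁ Q₂ 𝒟₂ := by
  obtain ⟨n, hn⟩ : ∃ n, n = Q₁.body.length := ⟨_, rfl⟩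
  obtain ⟨vs, hvs⟩ : ∃ vs, vs = A.args.filter (· ∈ V) := ⟨_, rfl⟩
  have hvs' : vs ⊆ A.args := hvs ▸ List.filter_subset_self _
  rw [← hvs] at h𝒟 hans
  have hA := hP.mem
  have hQ := hP.selfJoinFree
  obtain ⟨a, ha⟩ := List.mem_iff_getElem?.1 hA
  have han : a < n := hn ▸ (List.getElem?_eq_some_iff.1 ha).1
  obtain ⟨code, hcode⟩ : ∃ code, code = Ex.code (reindexFields n a A.args vs) := ⟨_, rfl⟩
  -- Many facts of `A` may have the same projection. Only the one whose number is recorded in array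
  -- `n` emits it, together with the sum collected in the `K`-array.
  obtain ⟨spec, hspec⟩ : ∃ spec : QAtom × ℕ → RowSpec, spec = fun q =>
    if q.1.rel = A.rel then ⟨q.2, .op .mul (consistent n a A.args)
      (.op .eq (.load n code) (.op .add (.reg n) (.cst 1))), reindexFields n a A.args vs,
      .load n code⟩
    else copySpec n q.2 q.1.args.length (.load q.2 (.reg n)) := ⟨_, rfl⟩
  have hsrcj : ∀ q, (spec q).src = q.2 := fun q => by
    rw [hspec]; simp only; split_ifs <;> rfl
  refine Reduces.of_specs hκ hQ hP.selfJoinFree_right hn (markLoop n n a (consistent n a A.args)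
    code (.load a (.reg n))) (Q₁.body.zipIdx.map spec)
    (by simp [hP.body]) (fun ρ hρ => ?_) ?_
  · obtain ⟨⟨C, j⟩, hq, rfl⟩ := List.mem_map.1 hρ
    rw [hsrcj, hn]
    exact (List.getElem?_eq_some_iff.1 (List.mem_zipIdx_iff_getElem?.1 hq)).1
  intro k
  refine ⟨(k + Q₁.maxArity + 3) + codeExp k vs.length, 5, ?_⟩
  intro D hD hD𝒟 L hL κ M W hκ1 hM hsz hc hW
  have hpow : ∀ {a b : ℕ}, a ≤ b → M ^ a ≤ M ^ b := fun h => Nat.pow_le_pow_right (by omega) h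
  have hin : InputRows Q₁ D L n W := hn ▸ InputRows.of_le hQ hD hL hM hsz hc (by omega) hW
  have hcodeW : ∀ t ∈ D.rel A.rel, listCode (reindex A.args vs t) < W := by
    intro t ht
    refine (listCode_lt hM fun x hxt => hc x (mem_constants_of_mem hA ht
      (reindex_mem hvs' (hD A hA t ht) hxt))).trans_le ((hpow ?_).trans hW)
    rw [length_reindex]; omega
  have hAlt := hin.length_lt hA
  have hcodeok : ∀ i (hi : i < (factRows D L A.rel).length), ∀ s,
      Holds s a a (factRows D L A.rel) → s.reg n = i →
      code.Ok W s ∧ code.eval s = listCode (reindex A.args vs (factRows D L A.rel)[i].1) := by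
    intro i hi s hs hsi
    have hr := hL.row hD hA (List.getElem_mem hi)
    rw [hcode]
    exact Ex.code_ok (reindexFields_ok hin hA hs hsi hi hvs') (hcodeW _ hr.2.1)
  have hmark := markRows_spec (κ := κ) (P := fun t => reindex A.args A.args t = t)
    (cd := fun t => listCode (reindex A.args vs t)) (test := consistent n a A.args)
    (code := code) hκ1 hin ha (fun i hi s hs hsi => by
      obtain ⟨c1, c2⟩ := consistent_ok hin hA hs hsi hi
      refine ⟨c1, by rw [c2]; simp, fun _ => hcodeok i hi s hs hsi⟩)
  obtain ⟨s₁, hs₁⟩ : ∃ s₁, s₁ = (markLoop n n a (consistent n a A.args) code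
    (.load a (.reg n))).run (inputState D Q₁ L) := ⟨_, rfl⟩
  have hmark' := hmark
  obtain ⟨-, -, hfr, hm⟩ := hmark'
  rw [← hs₁] at hfr hm
  obtain ⟨L', hL'⟩ : ∃ L' : ℕ → List (List ℕ), L' = fun r => if r = A.rel then
    (List.range (L r).length).filterMap fun i => (L r)[i]?.bind fun t =>
      if reindex A.args A.args t = t ∧ s₁.arr n (listCode (reindex A.args vs t)) = i + 1 then
        some (reindex A.args vs t) else none
    else L r := ⟨_, rfl⟩
  have hLA := hL A.rel (CQStar.rel_mem_symbols hA)
  have hmemL' : ∀ u i, ((L A.rel)[i]?.bind fun t =>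
      if reindex A.args A.args t = t ∧ s₁.arr n (listCode (reindex A.args vs t)) = i + 1 then
        some (reindex A.args vs t) else none) = some u → (∃ t ∈ D.rel A.rel,
        reindex A.args A.args t = t ∧ reindex A.args vs t = u) ∧ s₁.arr n (listCode u) = i + 1 := by
    intro u i he
    have hi : i < (L A.rel).length := by
      by_contra hi
      rw [List.getElem?_eq_none (by omega)] at he
      exact absurd he (by simp)
    rw [List.getElem?_eq_getElem hi, Option.bind_some] at he
    split_ifs at he with hh
    rw [Option.some_inj] at he
    subst he
    exact ⟨⟨_, (hLA.2 _).1 (List.getElem_mem hi), hh.1, rfl⟩, hh.2⟩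
  have henum : Enumerates (D.project A vs) Q₂ L' := by
    intro R hR
    by_cases hRA : R = A.rel
    · subst hRA
      rw [hL']
      simp only [if_true]
      refine ⟨?_, fun u => ?_⟩
      -- The entry at the code of `u` names the row that emits `u`, so `u` comes from one row only.
      · refine List.Nodup.filterMap (fun i i' u h h' => ?_) List.nodup_range
        have h1 := (hmemL' u i h).2
        have h2 := (hmemL' u i' h').2
        omega
      · rw [KDatabase.mem_project, List.mem_filterMap]
        constructor
        · rintro ⟨i, hi, he⟩
          exact (hmemL' u i he).1
        · rintro ⟨t, ht, h1, rfl⟩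
          rcases (hm (listCode (reindex A.args vs t))).2 with ⟨-, h2⟩ | ⟨i, hi, h2, h3, h4⟩
          · exact absurd rfl (h2 t ht h1)
          · have hi' : i < (L A.rel).length := by rwa [factRows_length] at hi
            have hrow : (factRows D L A.rel)[i].1 = (L A.rel)[i] := by simp [factRows]
            rw [hrow] at h2 h3
            have h3' := listCode_inj (by rw [length_reindex, length_reindex]) h3
            refine ⟨i, List.mem_range.2 hi', ?_⟩
            rw [List.getElem?_eq_getElem hi', Option.bind_some, if_pos ⟨h2, by rw [h3, h4]⟩, h3']
    · rw [hL']
      simp only [if_neg hRA]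
      rw [KDatabase.project_rel_of_ne hRA]
      exact hL R (hP.symbols_eq ▸ hR)
  refine ⟨D.project A vs, L', hvs ▸ KDatabase.project_over hP hD, h𝒟 D hD hD𝒟,
    fun x hx => Or.inl (KDatabase.project_constants hP hD (hvs ▸ hx)), henum,
    hans D hD hD𝒟, hmark.conseq le_rfl fun s h => h.1, fun j C' hj' => ?_⟩
  rw [← hs₁]
  obtain ⟨C, hj, rfl⟩ : ∃ C, Q₁.body[j]? = some C ∧
      (if C.rel = A.rel then ⟨C.rel, C.args.filter (· ∈ V)⟩ else C) = C' := by
    rw [hP.body, List.getElem?_map] at hj'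
    exact Option.map_eq_some_iff.1 hj'
  have hC := List.mem_of_getElem? hj
  have hCH := inputState_holds (D := D) (L := L) hQ hj
  refine ⟨spec (C, j), ?_⟩
  simp only [hsrcj]
  rw [hCH.reg]
  have hClt := hin.length_lt hC
  by_cases hCA : C.rel = A.rel
  · obtain rfl := hQ.eq_of_rel hC hA hCA
    have hja : j = a := by
      have hnd : Q₁.body.Nodup := List.Nodup.of_map _ hQ
      exact (List.getElem?_inj (List.getElem?_eq_some_iff.1 hj).1 hnd).1 (hj.trans ha.symm)
    subst hja
    refine ⟨fun i => (factRows D L C.rel)[i]?.bind fun r =>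
      if reindex C.args C.args r.1 = r.1 ∧ s₁.arr n (listCode (reindex C.args vs r.1)) = i + 1 then
        some (reindex C.args vs r.1, (D.project C vs).ann C.rel (reindex C.args vs r.1)) else none,
      getElem?_zipIdx_map _ _ _ hj, ?_, fun i hi s hs hsi => ?_⟩
    · simp only [if_true]
      simp only [factRows, hL', if_true, List.length_map]
      rw [← List.filterMap_eq_map, List.filterMap_filterMap]
      refine List.filterMap_congr fun i hi => ?_
      have hi' := List.mem_range.1 hi
      rw [List.getElem?_eq_getElem hi', List.getElem?_eq_getElem (by simpa using hi')]
      simp only [Option.bind_some, List.getElem_map]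
      split_ifs <;> simp
    · have hHs := hin.holds hj hfr hs
      obtain ⟨d1, d2⟩ := hcodeok i hi s hHs hsi
      obtain ⟨c1, c2⟩ := consistent_ok hin hC hHs hsi hi
      have hm' := hm (listCode (reindex C.args vs (factRows D L C.rel)[i].1))
      have harr : s.arr n = s₁.arr n := hs.arr n (by omega)
      have hkarr : s.karr n = s₁.karr n := hs.karr n (by omega)
      have hload : (Ex.load n code).eval s =
          s₁.arr n (listCode (reindex C.args vs (factRows D L C.rel)[i].1)) := by
        simp only [Ex.eval, d2, harr]
      have hok : (Ex.load n code).Ok W s := by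
        refine ⟨d1, ?_⟩
        rw [d2, harr]
        rcases hm'.2 with ⟨h1, -⟩ | ⟨i', hi', -, -, h1⟩ <;> rw [h1] <;> omega
      rw [hspec]
      simp only [if_true]
      have htest : (Ex.op .mul (consistent n j C.args)
          (.op .eq (.load n code) (.op .add (.reg n) (.cst 1)))).Ok W s ∧
          (Ex.op .mul (consistent n j C.args)
          (.op .eq (.load n code) (.op .add (.reg n) (.cst 1)))).eval s =
          if reindex C.args C.args (factRows D L C.rel)[i].1 = (factRows D L C.rel)[i].1 ∧
            s₁.arr n (listCode (reindex C.args vs (factRows D L C.rel)[i].1)) = i + 1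
          then 1 else 0 := by
        have hev : (Ex.op .mul (consistent n j C.args)
          (.op .eq (.load n code) (.op .add (.reg n) (.cst 1)))).eval s =
          if reindex C.args C.args (factRows D L C.rel)[i].1 = (factRows D L C.rel)[i].1 ∧
            s₁.arr n (listCode (reindex C.args vs (factRows D L C.rel)[i].1)) = i + 1
          then 1 else 0 := by
          rw [Ex.eval, c2, Ex.eval, hload]
          simp only [Ex.eval, hsi, WordOp.eval]
          exact indicator_and _ _
        have h1W : 1 < W := by omega
        refine ⟨⟨c1, ⟨hok, ⟨?_, h1W, ?_⟩, ?_⟩, ?_⟩, hev⟩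
        · change s.reg n < W
          omega
        · simp only [Ex.eval, WordOp.eval, hsi]; omega
        · simp only [WordOp.eval]; split <;> omega
        · change (Ex.op .mul (consistent n j C.args)
            (.op .eq (.load n code) (.op .add (.reg n) (.cst 1)))).eval s < W
          rw [hev]; split <;> omega
      simp only [List.getElem?_eq_getElem hi, Option.bind_some]
      refine ⟨htest.1, fun hnone => ?_, fun row hrow => ?_⟩
      · simp only [htest.2]
        split_ifs at hnone with h0
        rw [if_neg h0]
      · split_ifs at hrow with h0
        rw [Option.some_inj] at hrow
        subst hrow
        refine ⟨?_, reindexFields_ok hin hC hHs hsi hi hvs', d1, ?_⟩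
        · simp only [htest.2, if_pos h0]
          exact one_ne_zero
        · simp only [KEx.eval, d2, hkarr, hm'.1, KDatabase.project, if_true]
          refine Finset.sum_congr (Finset.filter_congr fun t ht => ?_) fun _ _ => rfl
          refine and_congr_right fun _ => ⟨fun h => listCode_inj ?_ h, fun h => by rw [h]⟩
          rw [length_reindex, length_reindex]
  · simp only [if_neg hCA]
    refine ⟨fun i => (factRows D L C.rel)[i]?.bind fun r => some (r.1,
      D.ann C.rel ((factRows D L C.rel).getD i ([], 0)).1),
      getElem?_zipIdx_map _ _ _ hj, ?_, fun i hi s hs hsi => ?_⟩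
    · refine factRows_copy (by simp [hL', hCA]) _ fun i hi => ?_
      simp only [KDatabase.project, if_neg hCA, List.getD_eq_getElem _ _ hi]
    · have hHs := hin.holds hj hfr hs
      rw [hspec]
      simp only [if_neg hCA]
      have hval : (KEx.load j (.reg n)).eval s =
          D.ann C.rel ((factRows D L C.rel).getD i ([], 0)).1 := by
        rw [KEx.row_val hHs hsi hi, List.getD_eq_getElem _ _ hi, factRows_getElem_fst hi]
      rw [← hval]
      refine copySpec_yields hin hj rfl hHs hsi hi ?_
      change s.reg n < W
      omega

end ProjectReduction

/-! ## Extending the facts by existential variables -/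

/-- The atom contains a variable from `S`. -/
def QAtom.Hits (S : Finset ℕ) (C : QAtom) : Prop := ∃ x ∈ C.args, x ∈ S

instance (S : Finset ℕ) (C : QAtom) : Decidable (C.Hits S) :=
  inferInstanceAs (Decidable (∃ x ∈ C.args, x ∈ S))

/-- Keep the variables in `F` only. -/
def QAtom.only (F : Finset ℕ) (C : QAtom) : QAtom := ⟨C.rel, C.args.filter (· ∈ F)⟩

/-- `Q'` is `Q` without its existential variables; `S` is closed under adding the existential
variables of atoms that contain an element of `S`, and the free variables of such atoms occur in
`T`; moreover, `S` is connected, and it consists of the existential variables that are reached in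
this way from the atom `A`. -/
structure Expansion (Q Q' : CQStar) (S : Finset ℕ) (A T : QAtom) : Prop where
  selfJoinFree : Q.SelfJoinFree
  body : Q'.body = Q.body.map (QAtom.only Q.free)
  pre : Q'.pre = Q.pre
  post : Q'.post = Q.post
  mem : A ∈ Q.body
  mem_top : T ∈ Q.body
  disj : ∀ x ∈ S, x ∉ Q.free
  closed : ∀ C ∈ Q.body, C.Hits S → ∀ x ∈ C.args, x ∉ Q.free → x ∈ S
  top : ∀ C ∈ Q.body, C.Hits S → ∀ x ∈ C.args, x ∈ Q.free → x ∈ T.args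
  conn : ∀ h : ℕ → ℕ, (∀ C ∈ Q.body, ∀ x ∈ C.args, ∀ y ∈ C.args, x ∈ S → y ∈ S → h x = h y) →
    ∀ x ∈ S, ∀ y ∈ S, h x = h y
  source : (A.Hits S ∧ T.Hits S) ∨ (∀ C ∈ Q.body, ¬ C.Hits S) ∧ A = T

section Expand

variable {K : Type*} [CommSemiring K]

/-- The atom whose facts are extended to facts of `C`. -/
def sourceAtom (S : Finset ℕ) (T C : QAtom) : QAtom := if C.Hits S then T else C

/-- Extend a tuple `t` of values of `vs` with number `i`. -/
def extendRow (F S : Finset ℕ) (C : QAtom) (vs : List ℕ) (i : ℕ) (t : List ℕ) :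
    Option (List ℕ) :=
  if reindex vs vs t = t then some (C.args.map fun x => if x ∈ F then t.getD (vs.idxOf x) 0
    else if C.Hits S then i else 0) else none

def extendRows (F S : Finset ℕ) (C : QAtom) (vs : List ℕ) (l : List (List ℕ)) :
    List (List ℕ) :=
  (List.range l.length).filterMap fun i => l[i]?.bind (extendRow F S C vs i)

theorem mem_extendRows {F S : Finset ℕ} {C : QAtom} {vs : List ℕ} {l : List (List ℕ)}
    {u : List ℕ} : u ∈ extendRows F S C vs l ↔ ∃ i, ∃ hi : i < l.length,
      extendRow F S C vs i l[i] = some u := by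
  simp only [extendRows, List.mem_filterMap, List.mem_range]
  constructor
  · rintro ⟨i, hi, h⟩
    rw [List.getElem?_eq_getElem hi] at h
    exact ⟨i, hi, h⟩
  · rintro ⟨i, hi, h⟩
    exact ⟨i, hi, by rw [List.getElem?_eq_getElem hi]; exact h⟩

theorem extendRow_eq_some {F S : Finset ℕ} {C : QAtom} {vs : List ℕ} {i : ℕ} {t u : List ℕ} :
    extendRow F S C vs i t = some u ↔ reindex vs vs t = t ∧
      (C.args.map fun x => if x ∈ F then t.getD (vs.idxOf x) 0
        else if C.Hits S then i else 0) = u := by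
  simp [extendRow]

def CQStar.atomOf (Q : CQStar) (r : ℕ) : QAtom := (Q.body.find? (·.rel = r)).getD ⟨r, []⟩

theorem CQStar.SelfJoinFree.atomOf_rel {Q : CQStar} (hQ : Q.SelfJoinFree) {C : QAtom}
    (hC : C ∈ Q.body) : Q.atomOf C.rel = C := by
  unfold CQStar.atomOf
  cases h : Q.body.find? (·.rel = C.rel) with
  | none => exact absurd (List.find?_eq_none.1 h C hC) (by simp)
  | some B =>
    have h1 := List.find?_some h
    exact hQ.eq_of_rel (List.mem_of_find?_eq_some h) hC (by simpa using h1)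

/-- The list of the extended facts. -/
def expandList (Q : CQStar) (S : Finset ℕ) (T : QAtom) (L : ℕ → List (List ℕ)) (r : ℕ) :
    List (List ℕ) :=
  extendRows Q.free S (Q.atomOf r) ((sourceAtom S T (Q.atomOf r)).only Q.free).args
    (L (sourceAtom S T (Q.atomOf r)).rel)

namespace KDatabase

/-- The database of the extended facts; those of `A` are annotated. -/
def expand (D : KDatabase K) (Q : CQStar) (S : Finset ℕ) (A T : QAtom) (L : ℕ → List (List ℕ)) :
    KDatabase K where
  rel r := (expandList Q S T L r).toFinset
  ann r u := if r = A.rel then ∑ i ∈ (Finset.range (L T.rel).length).filter (fun i =>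
    extendRow Q.free S A (T.only Q.free).args i ((L T.rel).getD i []) = some u),
      D.ann T.rel ((L T.rel).getD i []) else 1

variable {D : KDatabase K} {Q Q' : CQStar} {S : Finset ℕ} {A T : QAtom} {L : ℕ → List (List ℕ)}

theorem mem_expand (hQ : Q.SelfJoinFree) {C : QAtom} (hC : C ∈ Q.body) {u : List ℕ} :
    u ∈ (D.expand Q S A T L).rel C.rel ↔ ∃ i, ∃ hi : i < (L (sourceAtom S T C).rel).length,
      extendRow Q.free S C ((sourceAtom S T C).only Q.free).args i (L (sourceAtom S T C).rel)[i] =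
        some u := by
  simp only [expand, expandList, hQ.atomOf_rel hC, List.mem_toFinset, mem_extendRows]

theorem sourceAtom_mem (hE : Expansion Q Q' S A T) {C : QAtom} (hC : C ∈ Q.body) :
    sourceAtom S T C ∈ Q.body := by
  unfold sourceAtom
  split_ifs
  · exact hE.mem_top
  · exact hC

theorem sourceAtom_mem' (hE : Expansion Q Q' S A T) {C : QAtom} (hC : C ∈ Q.body) :
    (sourceAtom S T C).only Q.free ∈ Q'.body := by
  rw [hE.body]
  exact List.mem_map_of_mem (sourceAtom_mem hE hC)

theorem sourceAtom_self (hE : Expansion Q Q' S A T) : sourceAtom S T A = T := by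
  unfold sourceAtom
  rcases hE.source with ⟨h, -⟩ | ⟨h, rfl⟩
  · rw [if_pos h]
  · rw [if_neg (h _ hE.mem)]

/-- If `C` meets `S`, the number of the row stands at a variable from `S`. Otherwise `C` is its own
source, and the whole source row can be read off from the free variables. -/
theorem extendRow_inj (hE : Expansion Q Q' S A T) (hL : Enumerates D Q' L) {C : QAtom}
    (hC : C ∈ Q.body) {u : List ℕ} {i j : ℕ} (hi : i < (L (sourceAtom S T C).rel).length)
    (hj : j < (L (sourceAtom S T C).rel).length)
    (h1 : extendRow Q.free S C ((sourceAtom S T C).only Q.free).args i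
      (L (sourceAtom S T C).rel)[i] = some u)
    (h2 : extendRow Q.free S C ((sourceAtom S T C).only Q.free).args j
      (L (sourceAtom S T C).rel)[j] = some u) : i = j := by
  rw [extendRow_eq_some] at h1 h2
  have h3 := List.map_inj_left.1 (h1.2.trans h2.2.symm)
  by_cases hh : C.Hits S
  · obtain ⟨x, hx, hxS⟩ := hh
    simpa [hE.disj x hxS, show C.Hits S from ⟨x, hx, hxS⟩] using h3 x hx
  · have hs : sourceAtom S T C = C := if_neg hh
    simp only [hs] at hi hj h1 h2 h3
    have hnd := (hL C.rel (CQStar.rel_mem_symbols (A := C.only Q.free)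
      (by rw [hE.body]; exact List.mem_map_of_mem hC))).1
    refine (hnd.getElem_inj_iff (hi := hi) (hj := hj)).1 ?_
    rw [← h1.1, ← h2.1]
    refine List.map_congr_left fun x hx => ?_
    have hx' := List.mem_filter.1 hx
    simpa [show x ∈ Q.free by simpa using hx'.2] using h3 x hx'.1

theorem expand_over (hE : Expansion Q Q' S A T) : (D.expand Q S A T L).Over Q := by
  intro C hC u hu
  obtain ⟨i, hi, h⟩ := (mem_expand hE.selfJoinFree hC).1 hu
  rw [extendRow_eq_some] at h
  rw [← h.2, List.length_map]

theorem expand_locallyAnnotated : (D.expand Q S A T L).LocallyAnnotated Q A.rel :=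
  fun _ _ hne _ _ => if_neg hne

theorem expand_constants (hE : Expansion Q Q' S A T) (hL : Enumerates D Q' L)
    {x : ℕ} (hx : x ∈ (D.expand Q S A T L).constants Q) :
    x ∈ D.constants Q' ∨ x ≤ D.size Q' := by
  obtain ⟨C, hC, u, hu, hxu⟩ := mem_constants.1 hx
  obtain ⟨i, hi, h⟩ := (mem_expand hE.selfJoinFree hC).1 hu
  rw [extendRow_eq_some] at h
  rw [← h.2, List.mem_map] at hxu
  obtain ⟨y, hy, rfl⟩ := hxu
  have hB' := sourceAtom_mem' hE hC
  obtain ⟨B, hB⟩ : ∃ B, B = sourceAtom S T C := ⟨_, rfl⟩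
  have hmem := ((hL _ (CQStar.rel_mem_symbols hB')).2 _).1 (List.getElem_mem hi)
  split_ifs with h1 h2
  · by_cases hlt : ((sourceAtom S T C).only Q.free).args.idxOf y <
        (L (sourceAtom S T C).rel)[i].length
    · rw [List.getD_eq_getElem _ _ hlt]
      exact Or.inl (mem_constants_of_mem hB' hmem (List.getElem_mem _))
    · rw [List.getD_eq_default _ _ (by omega)]
      exact Or.inr (Nat.zero_le _)
  · refine Or.inr (hi.le.trans ?_)
    have := hL.card (CQStar.rel_mem_symbols hB')
    rw [show (L (sourceAtom S T C).rel).length = _ from this]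
    exact D.card_le_size (CQStar.rel_mem_symbols hB')
  · exact Or.inr (Nat.zero_le _)

theorem expand_enumerates (hE : Expansion Q Q' S A T) (hL : Enumerates D Q' L) :
    Enumerates (D.expand Q S A T L) Q (expandList Q S T L) := by
  intro R hR
  obtain ⟨C, hC, rfl⟩ := CQStar.mem_symbols.1 hR
  refine ⟨?_, fun t => by simp [expand]⟩
  simp only [expandList, hE.selfJoinFree.atomOf_rel hC, extendRows]
  refine List.Nodup.filterMap (fun i j u h1 h2 => ?_) List.nodup_range
  rw [Option.mem_def, Option.bind_eq_some_iff] at h1 h2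
  obtain ⟨t1, h1, h1'⟩ := h1
  obtain ⟨t2, h2, h2'⟩ := h2
  obtain ⟨hi, rfl⟩ := List.getElem?_eq_some_iff.1 h1
  obtain ⟨hj, rfl⟩ := List.getElem?_eq_some_iff.1 h2
  exact extendRow_inj hE hL hC hi hj h1' h2'

/-- How a homomorphism acts on an atom. -/
theorem expand_hom (hE : Expansion Q Q' S A T) {h : ℕ → ℕ} {C : QAtom} (hC : C ∈ Q.body) :
    C.args.map h ∈ (D.expand Q S A T L).rel C.rel ↔
      ∃ i, ∃ hi : i < (L (sourceAtom S T C).rel).length,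
        reindex ((sourceAtom S T C).only Q.free).args ((sourceAtom S T C).only Q.free).args
          (L (sourceAtom S T C).rel)[i] = (L (sourceAtom S T C).rel)[i] ∧
        ∀ x ∈ C.args, h x = if x ∈ Q.free then
          (L (sourceAtom S T C).rel)[i].getD (((sourceAtom S T C).only Q.free).args.idxOf x) 0
          else if C.Hits S then i else 0 := by
  rw [mem_expand hE.selfJoinFree hC]
  refine exists_congr fun i => exists_congr fun hi => ?_
  rw [extendRow_eq_some]
  refine and_congr_right fun _ => ?_
  rw [List.map_inj_left]
  exact forall_congr' fun x => forall_congr' fun _ => eq_comm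

theorem vars_eq_free (hE : Expansion Q Q' S A T) : Q'.vars = Q.free := by
  ext x
  rw [CQStar.mem_vars, hE.body]
  constructor
  · rintro ⟨C, hC, hx⟩
    obtain ⟨C, -, rfl⟩ := List.mem_map.1 hC
    simpa using (List.mem_filter.1 hx).2
  · intro hx
    obtain ⟨C, hC, hxC⟩ := Q.head_occurs x (by simpa [CQStar.free] using hx)
    exact ⟨_, List.mem_map_of_mem hC, List.mem_filter.2 ⟨hxC, by simpa using hx⟩⟩

end KDatabase

end Expand

namespace KDatabase

variable {K : Type*} [CommSemiring K] {D : KDatabase K} {Q Q' : CQStar} {S : Finset ℕ}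
  {A T : QAtom} {L : ℕ → List (List ℕ)}

theorem expand_hom_of_eq (hE : Expansion Q Q' S A T) {h : ℕ → ℕ} {B C : QAtom} (hC : C ∈ Q.body)
    (hB : sourceAtom S T C = B) : C.args.map h ∈ (D.expand Q S A T L).rel C.rel ↔
      ∃ i, ∃ hi : i < (L B.rel).length,
        reindex (B.only Q.free).args (B.only Q.free).args (L B.rel)[i] = (L B.rel)[i] ∧
        ∀ x ∈ C.args, h x = if x ∈ Q.free then
          (L B.rel)[i].getD ((B.only Q.free).args.idxOf x) 0 else if C.Hits S then i else 0 := by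
  subst hB
  exact expand_hom hE hC

theorem only_map_eq {B : QAtom} {F : Finset ℕ} {h : ℕ → ℕ} {t : List ℕ}
    (h1 : reindex (B.only F).args (B.only F).args t = t)
    (h2 : ∀ x ∈ B.args, x ∈ F → h x = t.getD ((B.only F).args.idxOf x) 0) :
    t = (B.only F).args.map h := by
  refine h1.symm.trans (List.map_congr_left fun x hx => ?_)
  have hx' := List.mem_filter.1 hx
  rw [h2 x hx'.1 (by simpa using hx'.2)]

/-- Connectedness of `S` forces all its variables to have the same value, namely the number `i` of
the fact of `T` in use. If no atom meets `S`, then `A = T` and there is nothing to transport. -/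
theorem expand_hom_row (hE : Expansion Q Q' S A T) {h : ℕ → ℕ}
    (hh : ∀ C ∈ Q.body, C.args.map h ∈ (D.expand Q S A T L).rel C.rel) :
    ∃ i, ∃ hi : i < (L T.rel).length, (L T.rel)[i] = (T.only Q.free).args.map h ∧
      extendRow Q.free S A (T.only Q.free).args i (L T.rel)[i] = some (A.args.map h) ∧
      ∀ x ∈ Q.vars, x ∉ Q.free → h x = if x ∈ S then i else 0 := by
  have hTT : sourceAtom S T T = T := ite_self _
  obtain ⟨i, hi, h1, h2⟩ := (expand_hom_of_eq hE hE.mem_top hTT).1 (hh T hE.mem_top)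
  have hrow := only_map_eq (h := h) h1 fun x hx hxF => by rw [h2 x hx, if_pos hxF]
  have hconst : ∀ C ∈ Q.body, ∀ x ∈ C.args, ∀ y ∈ C.args, x ∈ S → y ∈ S → h x = h y := by
    intro C hC x hx y hy hxS hyS
    obtain ⟨j, hj, -, h4⟩ := (expand_hom hE hC).1 (hh C hC)
    rw [h4 x hx, h4 y hy, if_neg (hE.disj x hxS), if_neg (hE.disj y hyS)]
  have hconn := hE.conn h hconst
  have hS : T.Hits S → ∀ x ∈ S, h x = i := by
    rintro ⟨y, hy, hyS⟩ x hx
    rw [hconn x hx y hyS, h2 y hy, if_neg (hE.disj y hyS), if_pos ⟨y, hy, hyS⟩]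
  refine ⟨i, hi, hrow, extendRow_eq_some.2 ⟨h1, ?_⟩, fun x hx hxF => ?_⟩
  · refine List.map_congr_left fun x hx => ?_
    obtain ⟨j, hj, h3, h4⟩ := (expand_hom_of_eq hE hE.mem (sourceAtom_self hE)).1 (hh A hE.mem)
    have hji : j = i ∨ A = T := by
      rcases hE.source with ⟨⟨y, hy, hyS⟩, hT⟩ | ⟨-, h⟩
      · left
        rw [← hS hT y hyS, h4 y hy, if_neg (hE.disj y hyS), if_pos ⟨y, hy, hyS⟩]
      · exact Or.inr h
    rcases hji with rfl | rfl
    · rw [h4 x hx]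
    · rw [h2 x hx]
  · obtain ⟨C, hC, hxC⟩ := CQStar.mem_vars.1 hx
    obtain ⟨j, hj, -, h4⟩ := (expand_hom hE hC).1 (hh C hC)
    by_cases hxS : x ∈ S
    · rw [if_pos hxS]
      refine hS ?_ x hxS
      rcases hE.source with ⟨-, h⟩ | ⟨h, -⟩
      · exact h
      · exact absurd ⟨x, hxC, hxS⟩ (h C hC)
    · rw [if_neg hxS, h4 x hxC, if_neg hxF, if_neg fun hh => hxS (hE.closed C hC hh x hxC hxF)]

/-- Restriction to the free variables is a bijection of homomorphisms: the free values give the fact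
of `T`, whose number fixes the variables in `S`, and the other existential variables are `0`. On
both sides the product is the annotation of this one fact, kept at `T` for `Q'` and at `A` for `Q`.
-/
theorem expand_nthAnswer [LinearOrder K] (hE : Expansion Q Q' S A T) (hL : Enumerates D Q' L)
    (hann : D.LocallyAnnotated Q' T.rel)
    (hc : ∀ C ∈ Q.body, C.Hits S → C.rel ≠ T.rel → Contained D (C.only Q.free) (T.only Q.free))
    (i : ℕ) : (D.expand Q S A T L).nthAnswer Q i = D.nthAnswer Q' i := by
  classical
  have hQ := hE.selfJoinFree
  have hF : Q'.vars = Q.free := vars_eq_free hE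
  have hmem : ∀ C ∈ Q.body, C.only Q.free ∈ Q'.body := fun C hC => by
    rw [hE.body]; exact List.mem_map_of_mem hC
  have hrel : ∀ C ∈ Q.body, (L C.rel).Nodup ∧ ∀ t, t ∈ L C.rel ↔ t ∈ D.rel C.rel := fun C hC =>
    hL (C.only Q.free).rel (CQStar.rel_mem_symbols (hmem C hC))
  have hTT : sourceAtom S T T = T := ite_self _
  have hFv : ∀ x ∈ Q.free, x ∈ Q.vars := fun x hx => by
    obtain ⟨C, hC, hxC⟩ := Q.head_occurs x (by simpa [CQStar.free] using hx)
    exact CQStar.mem_vars.2 ⟨C, hC, hxC⟩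
  have hQ' : Q'.SelfJoinFree := by
    unfold CQStar.SelfJoinFree
    rw [hE.body, List.map_map]
    exact hQ
  have hval : ∀ (h : ℕ →₀ ℕ) (C : QAtom), (C.only Q.free).args.map (assignOn Q'.vars h) =
      (C.only Q.free).args.map h := fun h C => List.map_congr_left fun x hx => by
    rw [hF]
    exact assignOn_of_mem _ (by simpa using (List.mem_filter.1 hx).2)
  have hinj : ∀ h ∈ (D.expand Q S A T L).homs Q, ∀ h' ∈ (D.expand Q S A T L).homs Q,
      assignOn Q'.vars h = assignOn Q'.vars h' → h = h' := by
    intro h hh h' hh' he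
    rw [mem_homs] at hh hh'
    obtain ⟨j, hj, h1, -, h3⟩ := expand_hom_row hE hh.2
    obtain ⟨j', hj', h1', -, h3'⟩ := expand_hom_row hE hh'.2
    have hjj : j = j' := by
      refine ((hrel T hE.mem_top).1.getElem_inj_iff (hi := hj) (hj := hj')).1 ?_
      rw [h1, h1', ← hval h, ← hval h', he]
    subst hjj
    ext x
    by_cases hx : x ∈ Q.vars
    · by_cases hxF : x ∈ Q.free
      · have := DFunLike.congr_fun he x
        rw [hF] at this
        rwa [assignOn_of_mem _ hxF, assignOn_of_mem _ hxF] at this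
      · rw [h3 x hx hxF, h3' x hx hxF]
    · rw [hh.1 x hx, hh'.1 x hx]
  have hsurj : ∀ h₂ ∈ D.homs Q', ∃ h ∈ (D.expand Q S A T L).homs Q,
      assignOn Q'.vars h = h₂ := by
    intro h₂ hh₂
    rw [mem_homs] at hh₂
    have hidx : ∀ C ∈ Q.body, ∃ j, ∃ hj : j < (L C.rel).length,
        (L C.rel)[j] = (C.only Q.free).args.map h₂ := fun C hC =>
      List.mem_iff_getElem.1 (((hrel C hC).2 _).2 (hh₂.2 _ (hmem C hC)))
    obtain ⟨j, hj, hrow⟩ := hidx T hE.mem_top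
    have hget : ∀ (B : QAtom) (x : ℕ), x ∈ B.args → x ∈ Q.free →
        ((B.only Q.free).args.map h₂).getD ((B.only Q.free).args.idxOf x) 0 = h₂ x := by
      intro B x hx hxF
      have := List.map_inj_left.1 (reindex_map (List.Subset.refl _) h₂ :
        reindex (B.only Q.free).args (B.only Q.free).args ((B.only Q.free).args.map h₂) = _)
      exact this x (List.mem_filter.2 ⟨hx, by simpa using hxF⟩)
    obtain ⟨h, hh⟩ : ∃ h, h = assignOn Q.vars fun x => if x ∈ Q.free then h₂ x else
      if x ∈ S then j else 0 := ⟨_, rfl⟩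
    have hhx : ∀ C ∈ Q.body, ∀ x ∈ C.args, h x = if x ∈ Q.free then h₂ x else
        if x ∈ S then j else 0 := fun C hC x hx => by
      rw [hh, assignOn_of_mem _ (CQStar.mem_vars.2 ⟨C, hC, hx⟩)]
    refine ⟨h, (mem_homs _ _ _).2 ⟨fun x hx => by rw [hh, assignOn_apply, if_neg hx],
      fun C hC => ?_⟩, ?_⟩
    · by_cases hCS : C.Hits S
      · refine (expand_hom_of_eq hE hC (if_pos hCS)).2 ⟨j, hj, ?_, fun x hx => ?_⟩
        · rw [hrow, reindex_map (List.Subset.refl _)]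
        · rw [hhx C hC x hx, hrow]
          by_cases hxF : x ∈ Q.free
          · rw [if_pos hxF, if_pos hxF, hget T x (hE.top C hC hCS x hx hxF) hxF]
          · rw [if_neg hxF, if_neg hxF, if_pos hCS, if_pos (hE.closed C hC hCS x hx hxF)]
      · obtain ⟨j', hj', hrow'⟩ := hidx C hC
        refine (expand_hom_of_eq hE hC (if_neg hCS)).2 ⟨j', hj', ?_, fun x hx => ?_⟩
        · rw [hrow', reindex_map (List.Subset.refl _)]
        · rw [hhx C hC x hx, hrow']
          by_cases hxF : x ∈ Q.free
          · rw [if_pos hxF, if_pos hxF, hget C x hx hxF]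
          · rw [if_neg hxF, if_neg hxF, if_neg hCS, if_neg fun hxS => hCS ⟨x, hx, hxS⟩]
    · ext x
      rw [assignOn_apply]
      split_ifs with hx
      · rw [hh, assignOn_of_mem _ (hFv x (hF ▸ hx)), if_pos (hF ▸ hx)]
      · exact (hh₂.1 x hx).symm
  refine (nthAnswer_congr (D₁ := D.expand Q S A T L) (D₂ := D) hE.pre hE.post
    (fun h => assignOn Q'.vars h) (fun h hh => ?_) hsurj (fun h hh x hx => ?_)
    (fun h₂ hh₂ => ?_) i).symm
  · rw [mem_homs] at hh ⊢
    refine ⟨fun x hx => by rw [assignOn_apply, if_neg hx], fun C' hC' => ?_⟩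
    rw [hE.body, List.mem_map] at hC'
    obtain ⟨C, hC, rfl⟩ := hC'
    rw [hval]
    change _ ∈ D.rel C.rel
    by_cases hs : sourceAtom S T C = C
    · obtain ⟨j, hj, h1, h2⟩ := (expand_hom_of_eq hE hC hs).1 (hh.2 C hC)
      rw [← only_map_eq h1 fun x hx hxF => by rw [h2 x hx, if_pos hxF]]
      exact ((hrel C hC).2 _).1 (List.getElem_mem _)
    -- The facts of `C` were made from those of `T` without regard to the relation of `C`. It is
    -- containment that gives back a fact of `D`.
    · have hCS : C.Hits S := by
        by_contra hn
        exact hs (if_neg hn)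
      obtain ⟨j, hj, h1, h2⟩ := (expand_hom_of_eq hE hC (if_pos hCS)).1 (hh.2 C hC)
      have := hc C hC hCS (fun he => hs (by rw [hQ.eq_of_rel hC hE.mem_top he, hTT]))
        _ (((hrel T hE.mem_top).2 _).1 (List.getElem_mem hj))
      rw [show (C.only Q.free).args.map h = _ from List.map_congr_left fun x hx => ?_]
      · exact this
      have hx' := List.mem_filter.1 hx
      rw [h2 x hx'.1, if_pos (by simpa using hx'.2)]
  · exact assignOn_of_mem _ (hF ▸ hx)
  · obtain ⟨h, hh, hπ⟩ := hsurj h₂ hh₂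
    rw [Finset.sum_eq_single h]
    · rw [mem_homs] at hh
      obtain ⟨j, hj, h1, h2, -⟩ := expand_hom_row hE hh.2
      rw [homProd_cons hE.mem hQ, homProd_cons (hmem T hE.mem_top) hQ', List.prod_eq_one,
        List.prod_eq_one, mul_one, mul_one]
      · simp only [expand, if_true]
        rw [Finset.sum_eq_single j]
        · rw [List.getD_eq_getElem _ _ hj, h1, ← hval h, hπ]
          rfl
        · intro j' hj' hne
          rw [Finset.mem_filter, Finset.mem_range] at hj'
          rw [List.getD_eq_getElem _ _ hj'.1] at hj'
          have hinj := extendRow_inj (i := j') (j := j) hE hL hE.mem (u := A.args.map h)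
          rw [sourceAtom_self hE] at hinj
          exact absurd (hinj hj'.1 hj hj'.2 h2) hne
        · intro hn
          exact absurd (Finset.mem_filter.2 ⟨Finset.mem_range.2 hj, by
            rwa [List.getD_eq_getElem _ _ hj]⟩) hn
      · intro a ha
        obtain ⟨C, hC, rfl⟩ := List.mem_map.1 ha
        have hC' := List.mem_filter.1 hC
        exact if_neg (by simpa using hC'.2)
      · intro a ha
        obtain ⟨C, hC, rfl⟩ := List.mem_map.1 ha
        have hC' := List.mem_filter.1 hC
        exact hann _ (CQStar.rel_mem_symbols hC'.1) (of_decide_eq_true hC'.2) _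
          (((mem_homs _ _ _).1 hh₂).2 C hC'.1)
    · intro h' hh' hne
      rw [Finset.mem_filter] at hh'
      exact absurd (hinj h' hh'.1 h hh (hh'.2.trans hπ.symm)) hne
    · intro hn
      exact absurd (Finset.mem_filter.2 ⟨hh, hπ⟩) hn

end KDatabase

/-! ### Expansion as a reduction -/

section ExpandReduction

variable {K : Type*} [CommSemiring K] [LinearOrder K]

/-- The reduction that extends the facts. -/
theorem Reduces.expand {κ : ℕ → ℕ} (hκ : ∀ n, 1 ≤ κ n) {Q Q' : CQStar} {S : Finset ℕ}
    {A T : QAtom} (hE : Expansion Q Q' S A T) :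
    Reduces κ Q' (fun D : KDatabase K => D.LocallyAnnotated Q' T.rel ∧
      ∀ C ∈ Q.body, C.Hits S → C.rel ≠ T.rel → Contained D (C.only Q.free) (T.only Q.free))
      Q (fun D => D.LocallyAnnotated Q A.rel) := by
  have hQ := hE.selfJoinFree
  have hQ' : Q'.SelfJoinFree := by
    unfold CQStar.SelfJoinFree
    rw [hE.body, List.map_map]
    exact hQ
  obtain ⟨n, hn⟩ : ∃ n, n = Q'.body.length := ⟨_, rfl⟩
  have hn' : n = Q.body.length := by rw [hn, hE.body, List.length_map]
  obtain ⟨t, ht⟩ := List.mem_iff_getElem?.1 hE.mem_top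
  have htn : t < n := hn' ▸ (List.getElem?_eq_some_iff.1 ht).1
  obtain ⟨src, hsrc⟩ : ∃ src : QAtom × ℕ → ℕ, src = fun q => if q.1.Hits S then t else q.2 :=
    ⟨_, rfl⟩
  obtain ⟨vs, hvs⟩ : ∃ vs : QAtom → List ℕ, vs = fun C => ((sourceAtom S T C).only Q.free).args :=
    ⟨_, rfl⟩
  obtain ⟨val, hval⟩ : ∃ val : QAtom → ℕ → Ex, val = fun C b => if C.Hits S then .reg n else .cst 0 :=
    ⟨_, rfl⟩
  obtain ⟨spec, hspec⟩ : ∃ spec : QAtom × ℕ → RowSpec, spec = fun q => ⟨src q,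
    consistent n (src q) (vs q.1), q.1.args.map fun x => if x ∈ Q.free then
      .field (src q) (vs q.1).length n ((vs q.1).idxOf x) else if q.1.Hits S then .reg n else .cst 0,
    if q.1.rel = A.rel then .load (src q) (.reg n) else .one⟩ := ⟨_, rfl⟩
  -- No marking phase is needed, because each new fact is computed from a single old fact and its
  -- number.
  refine Reduces.of_specs hκ hQ' hQ hn .skip (Q.body.zipIdx.map spec) (by simp) (fun ρ hρ => ?_) ?_
  · obtain ⟨⟨C, j⟩, hq, rfl⟩ := List.mem_map.1 hρ
    have hj := (List.getElem?_eq_some_iff.1 (List.mem_zipIdx_iff_getElem?.1 hq)).1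
    simp only [hspec, hsrc]
    split_ifs <;> omega
  intro k
  refine ⟨k + Q'.maxArity + 3, 1, ?_⟩
  intro D hD hD𝒟 L hL κ M W hκ1 hM hsz hc hW
  have hin : InputRows Q' D L n W := hn ▸ InputRows.of_le hQ' hD hL hM hsz hc le_rfl hW
  refine ⟨D.expand Q S A T L, expandList Q S T L, KDatabase.expand_over hE,
    KDatabase.expand_locallyAnnotated, fun x hx => KDatabase.expand_constants hE hL hx,
    KDatabase.expand_enumerates hE hL, KDatabase.expand_nthAnswer hE hL hD𝒟.1 hD𝒟.2,
    (Sp.skip ⟨fun _ _ _ => rfl, rfl, fun _ _ => rfl, fun _ _ => rfl⟩).mono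
      (by nlinarith [Nat.zero_le (D.size Q')]), fun j C hj => ?_⟩
  have hC := List.mem_of_getElem? hj
  obtain ⟨B, hB⟩ : ∃ B, B = sourceAtom S T C := ⟨_, rfl⟩
  have hB' : B.only Q.free ∈ Q'.body := hB ▸ KDatabase.sourceAtom_mem' hE hC
  have hBj : Q'.body[src (C, j)]? = some (B.only Q.free) := by
    rw [hE.body, List.getElem?_map, hB, hsrc]
    unfold sourceAtom
    simp only
    split_ifs
    · rw [ht]; rfl
    · rw [hj]; rfl
  have hBH := inputState_holds (D := D) (L := L) hQ' hBj
  have hlt := hin.length_lt hB'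
  have hfst : ∀ i (hi : i < (factRows D L (B.only Q.free).rel).length),
      (factRows D L (B.only Q.free).rel)[i].1 = (L B.rel)[i]'(by simpa [factRows, QAtom.only] using hi) :=
    fun i hi => by simp [factRows, QAtom.only]
  have hvsB : vs C = (B.only Q.free).args := by rw [hvs, hB]
  refine ⟨spec (C, j), fun i => (L B.rel)[i]?.bind fun u =>
    (extendRow Q.free S C (B.only Q.free).args i u).map fun w => (w, (D.expand Q S A T L).ann C.rel w),
    getElem?_zipIdx_map _ _ _ hj, ?_, fun i hi s hs hsi => ?_⟩
  · have hr : (inputState D Q' L).reg (spec (C, j)).src = (L B.rel).length := by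
      simp only [hspec, hBH.reg, factRows, List.length_map]; rfl
    rw [hr]
    simp only [factRows, expandList, hQ.atomOf_rel hC, ← hB, extendRows]
    rw [← List.filterMap_eq_map, List.filterMap_filterMap]
    refine List.filterMap_congr fun i hi => ?_
    rw [List.getElem?_eq_getElem (List.mem_range.1 hi)]
    simp [Option.map_eq_bind]
  · have hi' : i < (factRows D L (B.only Q.free).rel).length := by
      simpa only [hspec, hBH.reg] using hi
    have hiL : i < (L B.rel).length := by simpa [factRows, QAtom.only] using hi'
    have hHs := hin.holds hBj ⟨fun _ _ _ => rfl, rfl, fun _ _ => rfl, fun _ _ => rfl⟩ hs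
    obtain ⟨c1, c2⟩ := consistent_ok hin hB' hHs hsi hi'
    rw [hfst i hi'] at c2
    rw [hspec]
    simp only [hvsB, List.getElem?_eq_getElem hiL, Option.bind_some]
    refine ⟨c1, fun hnone => ?_, fun row hrow => ?_⟩
    · simp only [c2]
      refine if_neg fun hcon => ?_
      simp [extendRow, hcon] at hnone
    · obtain ⟨w, hw, rfl⟩ := Option.map_eq_some_iff.1 hrow
      obtain ⟨hcon, hw'⟩ := extendRow_eq_some.1 hw
      refine ⟨?_, (fun h1 (h2 : _ ∧ _) => ⟨h1, h2.1, h2.2⟩) ?_ ?_⟩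
      · simp only [c2, if_pos hcon]
        exact one_ne_zero
      · simp only [← hw', List.forall₂_map_left_iff, List.forall₂_map_right_iff,
          List.forall₂_same]
        intro x hx
        by_cases hxF : x ∈ Q.free
        · have hxB : x ∈ B.args := by
            rw [hB]
            unfold sourceAtom
            split_ifs with hh
            · exact hE.top C hC hh x hx hxF
            · exact hx
          have := reindexFields_ok hin hB' hHs hsi hi' (as := [x]) (List.cons_subset.2
            ⟨List.mem_filter.2 ⟨hxB, by simpa using hxF⟩, List.nil_subset _⟩)
          rw [hfst i hi'] at this
          simpa [reindexFields, reindex, hxF] using this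
        · simp only [if_neg hxF]
          split_ifs
          · refine ⟨?_, hsi⟩
            change s.reg n < W
            omega
          · exact ⟨by change 0 < W; omega, rfl⟩
      · by_cases hCA : C.rel = A.rel
        · obtain rfl := hQ.eq_of_rel hC hE.mem hCA
          have hBT : B = T := hB.trans (KDatabase.sourceAtom_self hE)
          subst hBT
          simp only [if_true]
          refine ⟨by change s.reg n < W; omega, ?_⟩
          rw [KEx.row_val hHs hsi hi', factRows_getElem_fst hi', hfst i hi']
          simp only [KDatabase.expand, if_true]
          rw [Finset.sum_eq_single i]
          · rw [List.getD_eq_getElem _ _ hiL]; rfl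
          · intro j' hj' hne
            rw [Finset.mem_filter, Finset.mem_range] at hj'
            rw [List.getD_eq_getElem _ _ hj'.1] at hj'
            have hinj := KDatabase.extendRow_inj (i := j') (j := i) hE hL hC (u := w)
            rw [← hB] at hinj
            exact absurd (hinj hj'.1 hiL hj'.2 hw) hne
          · intro hn
            exact absurd (Finset.mem_filter.2 ⟨Finset.mem_range.2 hiL, by
              rwa [List.getD_eq_getElem _ _ hiL]⟩) hn
        · simp only [if_neg hCA]
          exact ⟨trivial, (if_neg hCA).symm⟩

end ExpandReduction

/-! ## Eliminating the existential variables -/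

/-- The atoms can be removed one after the other, such that the variables which an atom shares with
`F` and the later atoms all belong to `F` or to one of the later atoms. -/
def Elim (F : Finset ℕ) : List QAtom → Prop
  | [] => True
  | A :: l => Elim F l ∧ ((∀ x ∈ A.args, (∃ C ∈ l, x ∈ C.args) → x ∈ F) ∨
      ∃ B ∈ l, ∀ x ∈ A.args, (x ∈ F ∨ ∃ C ∈ l, x ∈ C.args) → x ∈ B.args)

theorem CQStar.exists_projects {Q : CQStar} (hQ : Q.SelfJoinFree) {A : QAtom} (hA : A ∈ Q.body)
    {V : Finset ℕ} (hV : Q.free ⊆ V) : ∃ Q₂, Projects Q Q₂ A V := by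
  refine ⟨⟨Q.body.map fun C => if C.rel = A.rel then ⟨C.rel, C.args.filter (· ∈ V)⟩ else C,
    Q.pre, Q.post, fun x hx => ?_, ?_⟩, hQ, hA, rfl, rfl, rfl⟩
  · obtain ⟨C, hC, hxC⟩ := Q.head_occurs x hx
    refine ⟨_, List.mem_map_of_mem hC, ?_⟩
    split_ifs
    · exact List.mem_filter.2 ⟨hxC, by simpa using hV (by simpa [CQStar.free] using hx)⟩
    · exact hxC
  · simp only [List.forall_mem_map]
    intro C hC B hB hr
    have : C = B := hQ.eq_of_rel hC hB (by split_ifs at hr <;> exact hr)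
    rw [this]

theorem CQStar.ext' {Q₁ Q₂ : CQStar} (h1 : Q₁.body = Q₂.body) (h2 : Q₁.pre = Q₂.pre)
    (h3 : Q₁.post = Q₂.post) : Q₁ = Q₂ := by
  cases Q₁; cases Q₂; simp_all

/-- Drop all existential variables. -/
structure IsFullPart (Q Q' : CQStar) : Prop where
  body : Q'.body = Q.body.map (QAtom.only Q.free)
  pre : Q'.pre = Q.pre
  post : Q'.post = Q.post

/-- Existential variables dropped on the way would be dropped in the end anyway, so the elimination
aims at the same `Q'` throughout. -/
theorem Projects.isFullPart {Q₁ Q₂ Q' : CQStar} {A : QAtom} {V : Finset ℕ}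
    (hP : Projects Q₁ Q₂ A V) (hV : Q₁.free ⊆ V) (h : IsFullPart Q₁ Q') : IsFullPart Q₂ Q' := by
  refine ⟨?_, h.pre.trans hP.pre.symm, h.post.trans hP.post.symm⟩
  rw [h.body, hP.free_eq, hP.body, List.map_map]
  refine List.map_congr_left fun C hC => ?_
  simp only [Function.comp_apply]
  split_ifs
  · simp only [QAtom.only, List.filter_filter, QAtom.mk.injEq, true_and]
    refine List.filter_congr fun x hx => ?_
    by_cases hx : x ∈ Q₁.free
    · simp [hx, hV hx]
    · simp [hx]
  · rfl

theorem Projects.perm {Q₁ Q₂ : CQStar} {A : QAtom} {V : Finset ℕ} (hP : Projects Q₁ Q₂ A V)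
    {l₁ l₂ : List QAtom} (h : Q₁.body.Perm (l₁ ++ A :: l₂)) :
    Q₂.body.Perm (l₁ ++ ⟨A.rel, A.args.filter (· ∈ V)⟩ :: l₂) := by
  rw [hP.body]
  refine (h.map _).trans ?_
  have hnd := (h.map QAtom.rel).nodup_iff.1 hP.selfJoinFree
  rw [List.map_append, List.map_cons, List.nodup_append, List.nodup_cons] at hnd
  rw [List.map_append, List.map_cons, if_pos rfl]
  have h1 : ∀ C ∈ l₁, C.rel ≠ A.rel := fun C hC =>
    hnd.2.2 _ (List.mem_map_of_mem hC) _ List.mem_cons_self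
  have h2 : ∀ C ∈ l₂, C.rel ≠ A.rel := fun C hC he =>
    hnd.2.1.1 (he ▸ List.mem_map_of_mem hC)
  rw [(List.map_congr_left fun C hC => if_neg (h1 C hC)).trans (List.map_id' l₁),
    (List.map_congr_left fun C hC => if_neg (h2 C hC)).trans (List.map_id' l₂)]

section Eliminate

variable {K : Type*} [CommSemiring K] [LinearOrder K]

theorem RelaxedAccess.mono {κ : ℕ → ℕ} {Q : CQStar} {𝒟 𝒟' : KDatabase K → Prop}
    (h : RelaxedAccess κ Q 𝒟) (h' : ∀ D, 𝒟' D → 𝒟 D) : RelaxedAccess κ Q 𝒟' := by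
  intro k
  obtain ⟨P, A, k', C, H⟩ := h k
  exact ⟨P, A, k', C, fun D hD hD' => H D hD (h' D hD')⟩

/-- The class of `R`-annotated databases. -/
abbrev locally (K : Type*) [CommSemiring K] (Q : CQStar) (R : ℕ) : KDatabase K → Prop :=
  fun D => D.LocallyAnnotated Q R

theorem RelaxedAccess.project_private (hidem : ∀ a : K, a + a = a) {κ : ℕ → ℕ}
    (hκ : LogarithmicTime κ) {Q₁ Q₂ : CQStar} {A : QAtom} {V : Finset ℕ} (hP : Projects Q₁ Q₂ A V)
    (hpriv : ∀ x ∈ A.args, x ∉ V → ∀ C ∈ Q₁.body, C.rel ≠ A.rel → x ∉ C.args) {R : ℕ}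
    (h : RelaxedAccess κ Q₂ (locally K Q₂ R)) : RelaxedAccess κ Q₁ (locally K Q₁ R) :=
  .of_reduces hκ (Reduces.project hκ.one_le hP
    (fun _ _ h => KDatabase.project_locallyAnnotated hidem hP h)
    fun _ _ _ i => KDatabase.project_nthAnswer_of_private hP hpriv i) h

theorem RelaxedAccess.absorb {κ : ℕ → ℕ} (hκ : LogarithmicTime κ) {Q : CQStar}
    (hQ : Q.SelfJoinFree) {A B : QAtom} (hA : A ∈ Q.body) (hB : B ∈ Q.body) (hne : A.rel ≠ B.rel)
    (hAB : A.args ⊆ B.args) {R : ℕ} (h : RelaxedAccess κ Q fun D : KDatabase K =>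
      D.LocallyAnnotated Q (if R = A.rel then B.rel else R) ∧ Contained D A B) :
    RelaxedAccess κ Q (locally K Q R) :=
  .of_reduces hκ (Reduces.absorb hκ.one_le hQ hA hB hne hAB fun D _ h =>
    ⟨KDatabase.absorb_locallyAnnotated h hA, KDatabase.absorb_contained hne⟩) h

/-- Here `A` is implied by `B` and, because of `R ≠ A.rel`, carries only `1`. So even variables that
it shares with other atoms may be dropped. -/
theorem RelaxedAccess.project_contained (hidem : ∀ a : K, a + a = a) {κ : ℕ → ℕ}
    (hκ : LogarithmicTime κ) {Q₁ Q₂ : CQStar} {A B : QAtom} {V : Finset ℕ}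
    (hP : Projects Q₁ Q₂ A V) (hB : B ∈ Q₁.body) (hne : B.rel ≠ A.rel) (hAB : A.args ⊆ B.args)
    {R : ℕ} (hR : R ≠ A.rel) (h : RelaxedAccess κ Q₂ (locally K Q₂ R)) :
    RelaxedAccess κ Q₁ fun D : KDatabase K => D.LocallyAnnotated Q₁ R ∧ Contained D A B :=
  .of_reduces hκ (Reduces.project hκ.one_le hP
    (fun _ _ h => KDatabase.project_locallyAnnotated hidem hP h.1)
    fun _ _ h i => KDatabase.project_nthAnswer_of_contained hidem hP hB hne hAB h.2
      (fun t ht => h.1 _ (CQStar.rel_mem_symbols hP.mem) hR.symm t ht) i) h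

/-- All existential variables are eliminated; the annotated relation moves from an atom to atoms
that share an existential variable with it. -/
theorem RelaxedAccess.eliminate (hidem : ∀ a : K, a + a = a) {κ : ℕ → ℕ} (hκ : LogarithmicTime κ)
    {F : Finset ℕ} (G : ℕ → Prop) {Q' : CQStar} : ∀ (l : List QAtom) {Q : CQStar} {l₁ : List QAtom}
    {R : ℕ}, Q.SelfJoinFree → Q.free = F → IsFullPart Q Q' → Elim F l → Q.body.Perm (l₁ ++ l) →
    (∀ C ∈ l₁, ∀ x ∈ C.args, x ∈ F) →
    (∀ C ∈ l, ∀ B ∈ l, G C.rel → ∀ x ∈ C.args, x ∈ B.args → x ∉ F → G B.rel) → G R →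
    R ∈ Q.symbols →
    ∃ R', G R' ∧ R' ∈ Q'.symbols ∧
      (RelaxedAccess κ Q' (locally K Q' R') → RelaxedAccess κ Q (locally K Q R))
  | [], Q, l₁, R, hQ, hF, hQ', _, hp, h1, _, hR, hRs => by
    have hall : ∀ C ∈ Q.body, ∀ x ∈ C.args, x ∈ Q.free := fun C hC =>
      hF ▸ h1 C (by simpa using hp.mem_iff.1 hC)
    obtain rfl : Q' = Q := CQStar.ext' (by
      rw [hQ'.body]
      refine (List.map_congr_left fun C hC => ?_).trans (List.map_id _)
      have : C.args.filter (· ∈ Q.free) = C.args :=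
        List.filter_eq_self.2 fun x hx => by simpa using hall C hC x hx
      simp only [QAtom.only, this, id]) hQ'.pre hQ'.post
    exact ⟨R, hR, hRs, id⟩
  | A :: l, Q, l₁, R, hQ, hF, hQ', hl, hp, h1, hG, hR, hRs => by
    -- The treated atoms in `l₁` have free variables only, so a variable of `A` outside `V` occurs
    -- in no other atom.
    obtain ⟨V, hV⟩ : ∃ V, V = F ∪ (l.flatMap QAtom.args).toFinset := ⟨_, rfl⟩
    have hVm : ∀ x, x ∈ V ↔ x ∈ F ∨ ∃ C ∈ l, x ∈ C.args := fun x => by simp [hV]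
    have hFV : Q.free ⊆ V := fun x hx => (hVm x).2 (Or.inl (hF ▸ hx))
    have hA : A ∈ Q.body := hp.mem_iff.2 (by simp)
    obtain ⟨Q₂, hP⟩ := CQStar.exists_projects hQ hA hFV
    have hpriv : ∀ x ∈ A.args, x ∉ V → ∀ C ∈ Q.body, C.rel ≠ A.rel → x ∉ C.args := by
      intro x _ hxV C hC hne hxC
      rw [hVm] at hxV
      push Not at hxV
      rcases List.mem_append.1 (hp.mem_iff.1 hC) with h | h
      · exact hxV.1 (h1 C h x hxC)
      · rcases List.mem_cons.1 h with rfl | h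
        · exact hne rfl
        · exact hxV.2 C h hxC
    have hp₂ := hP.perm hp
    obtain ⟨A₁, hA₁⟩ : ∃ A₁ : QAtom, A₁ = ⟨A.rel, A.args.filter (· ∈ V)⟩ := ⟨_, rfl⟩
    have hA₁x : ∀ x ∈ A₁.args, x ∈ A.args ∧ (x ∈ F ∨ ∃ C ∈ l, x ∈ C.args) := fun x hx => by
      rw [hA₁] at hx
      have := List.mem_filter.1 hx
      exact ⟨this.1, (hVm x).1 (by simpa using this.2)⟩
    rw [← hA₁] at hp₂
    have hQ₂ := hP.selfJoinFree_right
    have hF₂ : Q₂.free = F := hP.free_eq.trans hF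
    have hfull := hP.isFullPart hFV hQ'
    have hGl : ∀ C ∈ l, ∀ B ∈ l, G C.rel → ∀ x ∈ C.args, x ∈ B.args → x ∉ F → G B.rel :=
      fun C hC B hB => hG C (List.mem_cons_of_mem _ hC) B (List.mem_cons_of_mem _ hB)
    -- Either no existential variable is left in `A₁`, or one is shared with a later atom; in that
    -- case the elimination order provides an atom `B` that contains all of `A₁`.
    by_cases hfree : ∀ x ∈ A₁.args, x ∈ F
    · obtain ⟨R', hR', hs', hstep⟩ := RelaxedAccess.eliminate hidem hκ G l (l₁ := l₁ ++ [A₁])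
        (R := R) hQ₂ hF₂ hfull hl.1 (by simpa using hp₂) (fun C hC => by
          rcases List.mem_append.1 hC with h | h
          · exact h1 C h
          · rw [List.mem_singleton.1 h]; exact hfree) hGl hR (hP.symbols_eq ▸ hRs)
      exact ⟨R', hR', hs', fun h => RelaxedAccess.project_private hidem hκ hP hpriv (hstep h)⟩
    · push Not at hfree
      obtain ⟨x, hx, hxF⟩ := hfree
      obtain ⟨hxA, hxl⟩ := hA₁x x hx
      obtain ⟨B, hB, hAB⟩ : ∃ B ∈ l, ∀ x ∈ A.args, (x ∈ F ∨ ∃ C ∈ l, x ∈ C.args) → x ∈ B.args := by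
        rcases hl.2 with h | h
        · exact absurd (h x hxA (hxl.resolve_left hxF)) hxF
        · exact h
      have hA₁B : A₁.args ⊆ B.args := fun y hy => hAB y (hA₁x y hy).1 (hA₁x y hy).2
      have hA₂ : A₁ ∈ Q₂.body := hp₂.mem_iff.2 (by simp)
      have hB₂ : B ∈ Q₂.body := hp₂.mem_iff.2 (by simp [hB])
      have hne : A₁.rel ≠ B.rel := by
        have hnd := (hp₂.map QAtom.rel).nodup_iff.1 hQ₂
        rw [List.map_append, List.map_cons, List.nodup_append, List.nodup_cons] at hnd
        exact fun he => hnd.2.1.1 (he ▸ List.mem_map_of_mem hB)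
      have hrel : A₁.rel = A.rel := by rw [hA₁]
      obtain ⟨Q₃, hP₃⟩ := CQStar.exists_projects hQ₂ hA₂ (V := F) hF₂.le
      have hp₃ := hP₃.perm hp₂
      -- If `A` is annotated, its annotation passes to `B`, which inherits `G` through the shared
      -- variable `x`. In either case `A` is free of annotations afterwards.
      obtain ⟨R₁, hR₁⟩ : ∃ R₁, R₁ = if R = A₁.rel then B.rel else R := ⟨_, rfl⟩
      have hGR : G R₁ := by
        rw [hR₁]
        split_ifs with he
        · exact hG A (by simp) B (by simp [hB]) (hrel ▸ he ▸ hR) x hxA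
            (hA₁B hx) hxF
        · exact hR
      have hR₁A : R₁ ≠ A₁.rel := by
        rw [hR₁]
        split_ifs with he
        · exact hne.symm
        · exact he
      have hR₁s : R₁ ∈ Q₃.symbols := by
        rw [hP₃.symbols_eq, hR₁]
        split_ifs
        · exact CQStar.rel_mem_symbols hB₂
        · exact hP.symbols_eq ▸ hRs
      obtain ⟨R', hR', hs', hstep⟩ := RelaxedAccess.eliminate hidem hκ G l
        (l₁ := l₁ ++ [⟨A₁.rel, A₁.args.filter (· ∈ F)⟩]) (R := R₁) hP₃.selfJoinFree_right
        (hP₃.free_eq.trans hF₂) (hP₃.isFullPart hF₂.le hfull) hl.1 (by simpa using hp₃)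
        (fun C hC => by
          rcases List.mem_append.1 hC with h | h
          · exact h1 C h
          · rw [List.mem_singleton.1 h]
            intro y hy
            simpa using (List.mem_filter.1 hy).2) hGl hGR hR₁s
      refine ⟨R', hR', hs', fun h => RelaxedAccess.project_private hidem hκ hP hpriv
        (RelaxedAccess.absorb hκ hQ₂ hA₂ hB₂ hne hA₁B ?_)⟩
      rw [← hR₁]
      exact RelaxedAccess.project_contained hidem hκ hP₃ hB₂ hne.symm hA₁B hR₁A (hstep h)

/-- Absorb several atoms into the same atom. -/
theorem RelaxedAccess.absorb_all {κ : ℕ → ℕ} (hκ : LogarithmicTime κ) {Q : CQStar}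
    (hQ : Q.SelfJoinFree) {T : QAtom} (hT : T ∈ Q.body) : ∀ l l₁ : List QAtom,
    (∀ C ∈ l, C ∈ Q.body ∧ (C.rel ≠ T.rel → C.args ⊆ T.args)) →
    RelaxedAccess κ Q (fun D : KDatabase K => D.LocallyAnnotated Q T.rel ∧
      ∀ C ∈ l ++ l₁, C.rel ≠ T.rel → Contained D C T) →
    RelaxedAccess κ Q (fun D : KDatabase K => D.LocallyAnnotated Q T.rel ∧
      ∀ C ∈ l₁, C.rel ≠ T.rel → Contained D C T)
  | [], _, _, h => h
  | A :: l, l₁, hl, h => by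
    have hA := hl A (by simp)
    have hl' : ∀ C ∈ l, C ∈ Q.body ∧ (C.rel ≠ T.rel → C.args ⊆ T.args) := fun C hC =>
      hl C (List.mem_cons_of_mem _ hC)
    by_cases hAT : A.rel = T.rel
    · refine RelaxedAccess.absorb_all hκ hQ hT l l₁ hl' ?_
      refine h.mono fun D hD => ⟨hD.1, fun C hC => ?_⟩
      rcases List.mem_cons.1 hC with rfl | hC
      · exact fun hn => absurd hAT hn
      · exact hD.2 C hC
    · refine .of_reduces hκ (Reduces.absorb hκ.one_le hQ hA.1 hT hAT (hA.2 hAT) (𝒟₂ :=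
        fun D : KDatabase K => D.LocallyAnnotated Q T.rel ∧
          ∀ C ∈ A :: l₁, C.rel ≠ T.rel → Contained D C T) fun D _ hD => ⟨?_, fun C hC hne => ?_⟩)
        (RelaxedAccess.absorb_all hκ hQ hT l (A :: l₁) hl' ?_)
      · have := KDatabase.absorb_locallyAnnotated (B := T) hD.1 hA.1
        rwa [if_neg (Ne.symm hAT)] at this
      · rcases List.mem_cons.1 hC with rfl | hC
        · exact KDatabase.absorb_contained hne
        · exact KDatabase.absorb_contained_of hne (hD.2 C hC hne)
      · refine h.mono fun D hD => ⟨hD.1, fun C hC => hD.2 C ?_⟩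
        simp only [List.mem_append, List.mem_cons, List.cons_append] at hC ⊢
        tauto

end Eliminate

/-! ## Join trees -/

namespace SimpleGraph

/-- Parents and depths in a rooted tree. -/
theorem IsAcyclic.exists_parent {V : Type*} {T : SimpleGraph V} (hT : T.IsAcyclic)
    (hc : T.Preconnected) (ρ : V) : ∃ (d : V → ℕ) (par : V → V), d ρ = 0 ∧
      (∀ v, v ≠ ρ → d v = d (par v) + 1) ∧
      ∀ a b, T.Adj a b → b = par a ∧ d a = d b + 1 ∨ a = par b ∧ d b = d a + 1 := by
  -- Shortest paths from the root: the depth is the distance, the parent the last vertex but one.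
  choose p hp hd using fun v => (hc ρ v).exists_path_of_dist
  have key : ∀ a b, T.Adj a b → b ∈ (p a).support →
      b = (p a).penultimate ∧ T.dist ρ a = T.dist ρ b + 1 := fun a b hab hb =>
    ⟨hT.eq_penultimate_of_adj_end (hp a) hab hb, by
      rw [← hd, ← hd, hT.path_concat (hp b) (hp a) hab.symm hb, Walk.length_concat]⟩
  refine ⟨T.dist ρ, fun v => (p v).penultimate, dist_self, fun v hv => ?_, fun a b hab => ?_⟩
  · refine (key v _ ((p v).adj_penultimate ?_).symm (Walk.getVert_mem_support _ _)).2
    exact Walk.not_nil_of_ne hv.symm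
  · by_cases hb : b ∈ (p a).support
    · exact Or.inl (key a b hab hb)
    · exact Or.inr (key b a hab.symm
        (hT.mem_support_of_ne_mem_support_of_adj_of_isPath (hp b) (hp a) hab.symm hb))

/-- Every edge remains a bridge: a walk in the image that avoids it is pulled back along a left
inverse of `ι` to a walk that avoids the original edge. -/
theorem IsAcyclic.map {V V' : Type*} [Nonempty V] {T : SimpleGraph V} (hT : T.IsAcyclic)
    (ι : V ↪ V') : (T.map ι).IsAcyclic := by
  rw [isAcyclic_iff_forall_adj_isBridge] at hT ⊢
  rintro _ _ ⟨-, a, b, hab, rfl, rfl⟩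
  have := hT hab
  rw [isBridge_iff] at this ⊢
  refine fun hr => this ?_
  have hinv := Function.leftInverse_invFun ι.injective
  have hmap := fun h => hr.map (G' := T \ fromEdgeSet {s(a, b)}) ⟨Function.invFun ι, h⟩
  have hmap' := hmap ?_
  · change (T \ fromEdgeSet {s(a, b)}).Reachable (Function.invFun ι (ι a)) (Function.invFun ι (ι b))
      at hmap'
    rwa [hinv, hinv] at hmap'
  · rintro _ _ ⟨⟨-, c, d, hcd, rfl, rfl⟩, hn⟩
    rw [hinv, hinv]
    refine ⟨hcd, fun h => hn ?_⟩
    simp only [fromEdgeSet_adj, Set.mem_singleton_iff] at h ⊢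
    refine ⟨?_, fun h' => h.2 (ι.injective h')⟩
    rw [← Sym2.map_mk, ← Sym2.map_mk, h.1]

end SimpleGraph

/-- Root a join tree at `r`. The hyperedges that contain `x` form a subtree, and if the parent of
`e` is not among them, they all lie below `e`. So a hyperedge that contains `x`, differs from `e`
and is not deeper than `e` can only be reached through the parent. -/
theorem HypergraphAcyclic.exists_parent {E : Finset (Finset ℕ)} (h : HypergraphAcyclic E)
    {r : Finset ℕ} (hr : r ∈ E) : ∃ (d : Finset ℕ → ℕ) (par : Finset ℕ → Finset ℕ), d r = 0 ∧
      ∀ e ∈ E, e ≠ r → par e ∈ E ∧ d (par e) < d e ∧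
        ∀ f ∈ E, f ≠ e → d f ≤ d e → ∀ x ∈ e, x ∈ f → x ∈ par e := by
  obtain ⟨T, hc, hT, hv⟩ := h
  obtain ⟨d, par, h0, h1, h2⟩ := hT.exists_parent hc ⟨r, hr⟩
  refine ⟨fun e => if he : e ∈ E then d ⟨e, he⟩ else 0,
    fun e => if he : e ∈ E then par ⟨e, he⟩ else e, by simp [hr, h0], fun e he hne => ?_⟩
  simp only [dif_pos he]
  refine ⟨(par ⟨e, he⟩).2, ?_, fun f hf hfe hdf x hxe hxf => ?_⟩
  · have := h1 ⟨e, he⟩ (fun h => hne (congrArg Subtype.val h))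
    rw [dif_pos (par ⟨e, he⟩).2]
    simp only [Subtype.coe_eta]
    omega
  · rw [dif_pos hf] at hdf
    by_contra hx
    have hr := hv x ⟨⟨e, he⟩, hxe⟩ ⟨⟨f, hf⟩, hxf⟩
    rw [SimpleGraph.reachable_iff_reflTransGen] at hr
    -- While `x` is missing from the parent of `e`, a walk inside the subtree of `x` never gets
    -- above `e`: each vertex it visits has `e` as its `n`-th ancestor.
    have key : ∀ w : {u : {e // e ∈ E} // u ∈ {u : {e // e ∈ E} | x ∈ u.1}},
        Relation.ReflTransGen (T.induce {u : {e // e ∈ E} | x ∈ u.1}).Adj ⟨⟨e, he⟩, hxe⟩ w →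
        ∃ n, par^[n] w.1 = ⟨e, he⟩ ∧ d w.1 = d ⟨e, he⟩ + n := by
      intro w hw
      induction hw with
      | refl => exact ⟨0, rfl, rfl⟩
      | @tail b c _ hbc ih =>
        obtain ⟨n, hn, hd⟩ := ih
        rcases h2 b.1 c.1 hbc with ⟨h3, h4⟩ | ⟨h3, h4⟩
        · cases n with
          | zero =>
            refine absurd ?_ hx
            rw [← show b.1 = ⟨e, he⟩ from hn, ← h3]
            exact c.2
          | succ n =>
            refine ⟨n, ?_, ?_⟩
            · rw [h3]; exact hn
            · omega
        · exact ⟨n + 1, by rw [Function.iterate_succ_apply, ← h3, hn], by omega⟩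
    obtain ⟨n, hn, hd⟩ := key _ hr
    simp only at hn hd
    cases n with
    | zero => exact hfe (congrArg Subtype.val hn)
    | succ n => omega

theorem List.exists_perm_pairwise {α : Type*} (d : α → ℕ) (l : List α) :
    ∃ l' : List α, l'.Perm l ∧ l'.Pairwise fun a b => d b ≤ d a :=
  ⟨l.mergeSort fun a b => d b ≤ d a, List.mergeSort_perm _ _, by
    have := List.pairwise_mergeSort (le := fun a b => decide (d b ≤ d a))
      (fun a b c h1 h2 => by simp only [decide_eq_true_eq] at *; omega)
      (fun a b => by simp only [Bool.or_eq_true, decide_eq_true_eq]; omega) l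
    simpa using this⟩

/-- A free-connex query has an elimination order of its atoms. -/
theorem CQStar.exists_elim {Q : CQStar} (h : HypergraphAcyclic (insert Q.free Q.edges)) :
    ∃ l, l.Perm Q.body ∧ Elim Q.free l := by
  -- The join tree is rooted at the set of the free variables, and the atoms are removed from the
  -- bottom up.
  obtain ⟨d, par, h0, hpar⟩ := h.exists_parent (Finset.mem_insert_self _ _)
  obtain ⟨l, hl, hs⟩ := Q.body.exists_perm_pairwise fun A => d A.args.toFinset
  refine ⟨l, hl, ?_⟩
  suffices H : ∀ l₂ l₁ : List QAtom, l = l₁ ++ l₂ → Elim Q.free l₂ from H l [] rfl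
  intro l₂
  induction l₂ with
  | nil => exact fun _ _ => trivial
  | cons A l₂ ih =>
    intro l₁ hl₁
    refine ⟨ih (l₁ ++ [A]) (by simpa using hl₁), ?_⟩
    rw [hl₁, List.pairwise_append, List.pairwise_cons] at hs
    have hmem : ∀ C, C ∈ Q.body ↔ C ∈ l₁ ++ A :: l₂ := fun C => by rw [← hl₁, hl.mem_iff]
    have hedge : ∀ C ∈ l₂, C.args.toFinset ∈ insert Q.free Q.edges := fun C hC =>
      Finset.mem_insert_of_mem (List.mem_toFinset.2 (List.mem_map_of_mem ((hmem C).2 (by simp [hC]))))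
    -- Atoms with the same variables share a node of the tree; each of them but the last is covered
    -- by a later one.
    by_cases hB : ∃ B ∈ l₂, B.args.toFinset = A.args.toFinset
    · obtain ⟨B, hB, he⟩ := hB
      exact Or.inr ⟨B, hB, fun x hx _ => by rwa [← List.mem_toFinset, he, List.mem_toFinset]⟩
    push Not at hB
    by_cases hF : A.args.toFinset = Q.free
    · exact Or.inl fun x hx _ => hF ▸ List.mem_toFinset.2 hx
    obtain ⟨p1, p2, p3⟩ := hpar _ (Finset.mem_insert_of_mem (List.mem_toFinset.2
      (List.mem_map_of_mem ((hmem A).2 (by simp))))) hF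
    have hsep : ∀ x ∈ A.args, (∃ C ∈ l₂, x ∈ C.args) → x ∈ par A.args.toFinset := by
      rintro x hx ⟨C, hC, hxC⟩
      exact p3 _ (hedge C hC) (hB C hC) (hs.2.1.1 C hC) x (List.mem_toFinset.2 hx)
        (List.mem_toFinset.2 hxC)
    -- If the parent is the root, all variables shared with later atoms are free. Otherwise it comes
    -- from an atom, which is later because it is less deep, and which also contains the free
    -- variables of `A`, as the root has depth `0`.
    rcases Finset.mem_insert.1 p1 with hp | hp
    · exact Or.inl fun x hx hC => hp ▸ hsep x hx hC
    · right
      obtain ⟨P, hP, he⟩ := List.mem_map.1 (List.mem_toFinset.1 hp)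
      refine ⟨P, ?_, fun x hx hC => ?_⟩
      · rcases List.mem_append.1 ((hmem P).1 hP) with h | h
        · have := hs.2.2 P h A (by simp)
          rw [he] at this
          omega
        · rcases List.mem_cons.1 h with rfl | h
          · rw [← he] at p2; omega
          · exact h
      · rw [← List.mem_toFinset, he]
        rcases hC with hxF | hC
        · exact p3 _ (Finset.mem_insert_self _ _) (Ne.symm hF) (by omega) x (List.mem_toFinset.2 hx)
            hxF
        · exact hsep x hx hC

/-- A new hyperedge may be attached as a leaf. -/
theorem HypergraphAcyclic.insert {E : Finset (Finset ℕ)} (h : HypergraphAcyclic E)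
    {e p : Finset ℕ} (he : e ∉ E) (hp : p ∈ E) (hx : ∀ x ∈ e, ∀ f ∈ E, x ∈ f → x ∈ p) :
    HypergraphAcyclic (insert e E) := by
  obtain ⟨T, hc, hT, hv⟩ := h
  have : Nonempty {e // e ∈ E} := ⟨⟨p, hp⟩⟩
  obtain ⟨ι, hι⟩ : ∃ ι : {f // f ∈ E} ↪ {f // f ∈ Insert.insert e E},
      ∀ f, (ι f).1 = f.1 :=
    ⟨⟨fun f => ⟨f.1, Finset.mem_insert_of_mem f.2⟩, fun f g h => Subtype.ext (congrArg Subtype.val h :)⟩,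
      fun _ => rfl⟩
  obtain ⟨e', he'⟩ : ∃ e' : {f // f ∈ Insert.insert e E}, e' = ⟨e, Finset.mem_insert_self _ _⟩ :=
    ⟨_, rfl⟩
  have hne : ∀ f, ι f ≠ e' := fun f h => he (by
    have := congrArg Subtype.val h
    rw [hι, he'] at this
    have hf := f.2
    rwa [this] at hf)
  have hcases : ∀ z, z = e' ∨ ∃ f, z = ι f := by
    rintro ⟨z, hz⟩
    rcases Finset.mem_insert.1 hz with rfl | hz'
    · exact Or.inl he'.symm
    · exact Or.inr ⟨⟨z, hz'⟩, Subtype.ext (hι ⟨z, hz'⟩).symm⟩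
  obtain ⟨T', hT'⟩ : ∃ T', T' = T.map ι ⊔ SimpleGraph.edge e' (ι ⟨p, hp⟩) := ⟨_, rfl⟩
  have hold : ∀ a b, T.Adj a b → T'.Adj (ι a) (ι b) := fun a b hab => by
    rw [hT']
    exact Or.inl ((SimpleGraph.map_adj_apply).2 hab)
  have hnew : T'.Adj e' (ι ⟨p, hp⟩) := by
    rw [hT']
    exact Or.inr ((SimpleGraph.edge_adj _ _ _ _).2 ⟨Or.inl ⟨rfl, rfl⟩, (hne _).symm⟩)
  -- With `P` always true this is connectedness of the tree, and with `P` saying that `v` is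
  -- contained it is connectedness of the subtree of `v`.
  have key : ∀ P : Finset ℕ → Prop, (P e → ∀ f ∈ E, P f → P p) →
      (T.induce {f | P f.1}).Preconnected → (T'.induce {f : {f // f ∈ Insert.insert e E} | P f.1}).Preconnected := by
    intro P hP hcP
    have hh : ∀ a b (ha : P (ι a).1) (hb : P (ι b).1),
        (T'.induce {f : {f // f ∈ Insert.insert e E} | P f.1}).Reachable ⟨ι a, ha⟩ ⟨ι b, hb⟩ := by
      intro a b ha hb
      rw [hι] at ha hb
      exact (hcP ⟨a, ha⟩ ⟨b, hb⟩).map (G' := T'.induce {f : {f // f ∈ Insert.insert e E} | P f.1})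
        ⟨fun f => ⟨ι f.1, by have := f.2; rwa [Set.mem_ofPred_eq, hι]⟩, fun {a b} hab => hold _ _ hab⟩
    have h1 : ∀ b (ha : P e'.1) (hb : P (ι b).1),
        (T'.induce {f : {f // f ∈ Insert.insert e E} | P f.1}).Reachable ⟨e', ha⟩ ⟨ι b, hb⟩ := by
      intro b ha hb
      have hpp : P (ι ⟨p, hp⟩).1 := by
        rw [hι]
        exact hP (by rw [he'] at ha; exact ha) b.1 b.2 (by rwa [hι] at hb)
      have : (T'.induce {f : {f // f ∈ Insert.insert e E} | P f.1}).Adj ⟨e', ha⟩ ⟨ι ⟨p, hp⟩, hpp⟩ := hnew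
      exact this.reachable.trans (hh _ _ hpp hb)
    rintro ⟨a, ha⟩ ⟨b, hb⟩
    rcases hcases a with rfl | ⟨a, rfl⟩ <;> rcases hcases b with hb' | ⟨b, rfl⟩
    · subst hb'; exact .refl _
    · exact h1 b ha hb
    · subst hb'; exact (h1 a hb ha).symm
    · exact hh a b ha hb
  refine ⟨T', ?_, ?_, fun v => key (v ∈ ·) (fun h1 f hf h2 => hx v h1 f hf h2) (hv v)⟩
  · have := key (fun _ => True) (fun _ _ _ _ => trivial) fun a b => (hc a.1 b.1).map
      (G' := T.induce {f | True}) ⟨fun f => ⟨f, trivial⟩, fun {a b} hab => hab⟩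
    exact fun a b => (this ⟨a, trivial⟩ ⟨b, trivial⟩).map (G' := T')
      ⟨fun f => f.1, fun {a b} hab => hab⟩
  · rw [hT']
    -- In the image of the old tree `e'` is isolated, so the new edge closes no cycle.
    refine (hT.map ι).sup_edge_of_not_reachable fun hr => ?_
    obtain ⟨w⟩ := hr
    cases w with
    | nil => exact hne _ rfl
    | cons hadj _ =>
      obtain ⟨-, a, b, -, h1, -⟩ := hadj
      exact hne a h1

theorem HypergraphAcyclic.of_subsingleton {E : Finset (Finset ℕ)} (h : E.card ≤ 1) :
    HypergraphAcyclic E := by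
  have hs : ∀ a b : {e // e ∈ E}, a = b := fun a b =>
    Subtype.ext (Finset.card_le_one.1 h _ a.2 _ b.2)
  have : Subsingleton {e // e ∈ E} := ⟨hs⟩
  refine ⟨⊥, fun a b => ?_, SimpleGraph.IsAcyclic.of_subsingleton, fun v a b => ?_⟩
  · rw [hs a b]
  · rw [Subtype.ext (hs a.1 b.1)]

/-- The traces of the hyperedges on a set of vertices. -/
theorem HypergraphAcyclic.image_inter {E : Finset (Finset ℕ)} (h : HypergraphAcyclic E)
    (F : Finset ℕ) : HypergraphAcyclic (E.image (· ∩ F)) := by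
  rcases E.eq_empty_or_nonempty with rfl | ⟨r, hr⟩
  · exact of_subsingleton (by simp)
  obtain ⟨d, par, h0, hpar⟩ := h.exists_parent hr
  obtain ⟨l, hl, hs⟩ := E.toList.exists_perm_pairwise d
  have hnd : l.Nodup := hl.nodup_iff.2 E.nodup_toList
  have hE : ∀ e, e ∈ l ↔ e ∈ E := fun e => by rw [hl.mem_iff, Finset.mem_toList]
  -- The hyperedges enter from the root downwards. A trace is either present already, or becomes a
  -- leaf at the trace of the parent, which contains everything that the new trace shares with the
  -- earlier ones.
  suffices H : ∀ l₂ l₁ : List (Finset ℕ), l = l₁ ++ l₂ →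
      HypergraphAcyclic ((l₂.map (· ∩ F)).toFinset) by
    convert H l [] rfl using 1
    ext e
    simp [hE]
  intro l₂
  induction l₂ with
  | nil => exact fun _ _ => of_subsingleton (by simp)
  | cons e l₂ ih =>
    intro l₁ hl₁
    have ih := ih (l₁ ++ [e]) (by simpa using hl₁)
    rw [hl₁, List.pairwise_append, List.pairwise_cons] at hs
    rw [hl₁, List.nodup_append, List.nodup_cons] at hnd
    rw [List.map_cons, List.toFinset_cons]
    have hmem : ∀ f ∈ l₂, f ∈ E := fun f hf => (hE f).1 (hl₁ ▸ by simp [hf])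
    by_cases hnew : e ∩ F ∈ (l₂.map (· ∩ F)).toFinset
    · rwa [Finset.insert_eq_of_mem hnew]
    rcases l₂.eq_nil_or_concat with h2 | ⟨_, f₀, h2⟩
    · subst h2
      exact of_subsingleton (by simp)
    have hf₀ : f₀ ∈ l₂ := by rw [h2]; simp
    have heE : e ∈ E := (hE e).1 (hl₁ ▸ by simp)
    have her : e ≠ r := by
      rintro rfl
      have h3 := hs.2.1.1 f₀ hf₀
      have h4 := (hpar f₀ (hmem f₀ hf₀) (fun h => hnd.2.1.1 (h ▸ hf₀))).2.1
      omega
    obtain ⟨p1, p2, p3⟩ := hpar e heE her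
    have hp : par e ∈ l₂ := by
      rcases List.mem_append.1 (hl₁ ▸ (hE _).2 p1) with h | h
      · have := hs.2.2 _ h e (by simp)
        omega
      · rcases List.mem_cons.1 h with h | h
        · rw [h] at p2; omega
        · exact h
    refine ih.insert hnew (List.mem_toFinset.2 (List.mem_map_of_mem hp)) fun x hx f hf' hxf => ?_
    obtain ⟨f, hf, rfl⟩ := List.mem_map.1 (List.mem_toFinset.1 hf')
    rw [Finset.mem_inter] at hx hxf ⊢
    exact ⟨p3 f (hmem f hf) (fun h => hnd.2.1.1 (h ▸ hf)) (hs.2.1.1 f hf) x hx.1 hxf.1, hx.2⟩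

/-! ## The transformation of the query -/

/-- Add the variables outside `F` of an atom that contains an element of `S`. -/
def QAtom.grow (F S : Finset ℕ) (C : QAtom) : Finset ℕ :=
  if C.Hits S then S ∪ C.args.toFinset.filter (· ∉ F) else S

/-- Prefer an atom that contains an element of `S` and all elements of `F` in `T`. -/
def QAtom.above (F S : Finset ℕ) (T C : QAtom) : QAtom :=
  if C.Hits S ∧ ∀ x ∈ T.args, x ∈ F → x ∈ C.args then C else T

namespace CQStar

/-- The existential variables of the atom with the relation symbol `R`. -/
def seed (Q : CQStar) (R : ℕ) : Finset ℕ :=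
  ((Q.body.filter (·.rel = R)).flatMap QAtom.args).toFinset.filter (· ∉ Q.free)

def growAll (Q : CQStar) (S : Finset ℕ) : Finset ℕ := Q.body.foldl (QAtom.grow Q.free) S

/-- The existential variables that are connected to the atom with the relation symbol `R`. -/
def reach (Q : CQStar) (R : ℕ) : Finset ℕ := Q.growAll^[(encodeQuery Q R).length] (Q.seed R)

/-- The atoms of the component need not be comparable, but for a free-connex query one of them
contains all free variables of the component. From then on the fold holds an atom with all of these
variables. -/
def top (Q : CQStar) (R : ℕ) : QAtom :=
  Q.body.foldl (QAtom.above Q.free (Q.reach R)) (Q.atomOf R)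

def fullPart (Q : CQStar) (hQ : Q.SelfJoinFree) : CQStar where
  body := Q.body.map (QAtom.only Q.free)
  pre := Q.pre
  post := Q.post
  head_occurs x hx := by
    obtain ⟨C, hC, hxC⟩ := Q.head_occurs x hx
    exact ⟨_, List.mem_map_of_mem hC, List.mem_filter.2 ⟨hxC, by simpa [free] using hx⟩⟩
  arity_eq := by
    simp only [List.forall_mem_map]
    intro A hA B hB hr
    rw [hQ.eq_of_rel hA hB hr]

open Classical in
noncomputable def transform (Q : CQStar) (R : ℕ) : CQStar × ℕ :=
  if h : Q.SelfJoinFree then (Q.fullPart h, (Q.top R).rel) else (Q, R)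

variable {Q : CQStar} {R : ℕ}

theorem mem_seed {x : ℕ} : x ∈ Q.seed R ↔ x ∉ Q.free ∧ ∃ C ∈ Q.body, C.rel = R ∧ x ∈ C.args := by
  rw [seed, Finset.mem_filter, List.mem_toFinset, List.mem_flatMap, and_comm]
  simp [and_assoc]

theorem subset_growAll (Q : CQStar) (S : Finset ℕ) : S ⊆ Q.growAll S := by
  unfold growAll
  generalize Q.body = l
  induction l generalizing S with
  | nil => exact Finset.Subset.refl _
  | cons C l ih =>
    refine Finset.Subset.trans ?_ (ih (C.grow Q.free S))
    unfold QAtom.grow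
    split_ifs
    · exact Finset.subset_union_left
    · exact Finset.Subset.refl _

theorem growAll_subset (hS : S ⊆ Q.vars) : Q.growAll S ⊆ Q.vars := by
  unfold growAll
  have : ∀ l : List QAtom, (∀ C ∈ l, C ∈ Q.body) → ∀ S, S ⊆ Q.vars →
      l.foldl (QAtom.grow Q.free) S ⊆ Q.vars := by
    intro l
    induction l with
    | nil => exact fun _ _ h => h
    | cons C l ih =>
      refine fun hl S hS => ih (fun D hD => hl D (by simp [hD])) _ ?_
      unfold QAtom.grow
      split_ifs
      · refine Finset.union_subset hS fun x hx => mem_vars.2 ⟨C, hl C (by simp), ?_⟩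
        simpa using (Finset.mem_filter.1 hx).1
      · exact hS
  exact this Q.body (fun _ h => h) S hS

/-- A set that does not grow is closed. -/
theorem closed_of_growAll_eq {S : Finset ℕ} (h : Q.growAll S = S) {C : QAtom} (hC : C ∈ Q.body)
    (hS : C.Hits S) {x : ℕ} (hx : x ∈ C.args) (hxF : x ∉ Q.free) : x ∈ S := by
  obtain ⟨l₁, l₂, hl⟩ := List.append_of_mem hC
  have hmono : ∀ (l : List QAtom) (S : Finset ℕ), S ⊆ l.foldl (QAtom.grow Q.free) S := by
    intro l
    induction l with
    | nil => exact fun S => Finset.Subset.refl _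
    | cons C l ih =>
      refine fun S => Finset.Subset.trans ?_ (ih (C.grow Q.free S))
      unfold QAtom.grow
      split_ifs
      · exact Finset.subset_union_left
      · exact Finset.Subset.refl _
  unfold growAll at h
  rw [hl, List.foldl_append, List.foldl_cons] at h
  obtain ⟨y, hy, hyS⟩ := hS
  have h1 : C.Hits (l₁.foldl (QAtom.grow Q.free) S) := ⟨y, hy, hmono l₁ S hyS⟩
  rw [← h]
  refine hmono l₂ _ ?_
  rw [QAtom.grow, if_pos h1]
  exact Finset.mem_union_right _ (by simp [hx, hxF])

/-- Thus the number of rounds in the definition of `reach` exceeds the number of variables. -/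
theorem length_encodeQuery (Q : CQStar) (R : ℕ) : Q.vars.card < (encodeQuery Q R).length := by
  have h1 : Q.vars.card ≤ (Q.body.flatMap QAtom.args).length := List.toFinset_card_le _
  have h2 : (Q.body.flatMap QAtom.args).length ≤
      (Q.body.flatMap fun A => A.rel :: A.args.length :: A.args).length := by
    simp only [List.length_flatMap, List.length_cons]
    exact List.sum_le_sum fun A _ => by omega
  simp only [encodeQuery, List.length_cons, List.length_append]
  omega

/-- Every round before the set becomes stable adds a variable, and there are more rounds than
variables. -/
theorem growAll_reach : Q.growAll (Q.reach R) = Q.reach R := by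
  have hsub : ∀ n, Q.growAll^[n] (Q.seed R) ⊆ Q.vars := fun n => by
    induction n with
    | zero =>
      intro x hx
      obtain ⟨-, C, hC, -, hxC⟩ := mem_seed.1 hx
      exact mem_vars.2 ⟨C, hC, hxC⟩
    | succ n ih => rw [Function.iterate_succ_apply']; exact growAll_subset ih
  have key : ∀ n, Q.growAll (Q.growAll^[n] (Q.seed R)) = Q.growAll^[n] (Q.seed R) ∨
      n ≤ (Q.growAll^[n] (Q.seed R)).card := fun n => by
    induction n with
    | zero => exact Or.inr (Nat.zero_le _)
    | succ n ih =>
      rw [Function.iterate_succ_apply']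
      rcases eq_or_ne (Q.growAll (Q.growAll^[n] (Q.seed R))) (Q.growAll^[n] (Q.seed R)) with h | h
      · exact Or.inl (by rw [h, h])
      · refine Or.inr ?_
        have := Finset.card_lt_card ((subset_growAll Q _).ssubset_of_ne (Ne.symm h))
        have := ih.resolve_left h
        omega
  refine (key (encodeQuery Q R).length).resolve_right fun h => ?_
  have := Finset.card_le_card (hsub (encodeQuery Q R).length)
  have := length_encodeQuery Q R
  omega

theorem reach_closed {C : QAtom} (hC : C ∈ Q.body) (hS : C.Hits (Q.reach R)) {x : ℕ}
    (hx : x ∈ C.args) (hxF : x ∉ Q.free) : x ∈ Q.reach R :=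
  closed_of_growAll_eq growAll_reach hC hS hx hxF

theorem seed_subset_reach : Q.seed R ⊆ Q.reach R := by
  unfold reach
  generalize (encodeQuery Q R).length = n
  induction n with
  | zero => exact Finset.Subset.refl _
  | succ n ih =>
    rw [Function.iterate_succ_apply']
    exact Finset.Subset.trans ih (subset_growAll Q _)

/-- A round adds variables atom by atom, using those added earlier in the same round; so the
induction goes over the rounds and, within a round, over the atoms. -/
theorem reach_induction {P : ℕ → Prop} (h0 : ∀ x ∈ Q.seed R, P x)
    (h1 : ∀ C ∈ Q.body, ∀ y ∈ C.args, y ∈ Q.reach R → P y → ∀ x ∈ C.args, x ∉ Q.free → P x) :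
    ∀ x ∈ Q.reach R, P x := by
  suffices H : ∀ n, Q.growAll^[n] (Q.seed R) ⊆ Q.reach R →
      ∀ x ∈ Q.growAll^[n] (Q.seed R), P x from H _ (Finset.Subset.refl _)
  intro n
  induction n with
  | zero => exact fun _ => h0
  | succ n ih =>
    rw [Function.iterate_succ_apply']
    intro hsub
    have hP := ih (Finset.Subset.trans (subset_growAll Q _) hsub)
    revert hP hsub
    generalize Q.growAll^[n] (Q.seed R) = S
    unfold growAll
    have : ∀ l : List QAtom, (∀ C ∈ l, C ∈ Q.body) → ∀ S : Finset ℕ, S ⊆ Q.reach R →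
        (∀ x ∈ S, P x) → ∀ x ∈ l.foldl (QAtom.grow Q.free) S, P x := by
      intro l
      induction l with
      | nil => exact fun _ _ _ h => h
      | cons C l ih =>
        intro hl S hS hP
        have hC := hl C (by simp)
        refine ih (fun D hD => hl D (by simp [hD])) _ ?_ ?_
        all_goals
          intro x hx
          unfold QAtom.grow at hx
          split_ifs at hx with hh
          · rcases Finset.mem_union.1 hx with hx | hx
            · first | exact hS hx | exact hP x hx
            · rw [Finset.mem_filter, List.mem_toFinset] at hx
              obtain ⟨y, hy, hyS⟩ := hh
              first
              | exact reach_closed hC ⟨y, hy, hS hyS⟩ hx.1 hx.2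
              | exact h1 C hC y hy (hS hyS) (hP y hyS) x hx.1 hx.2
          · first | exact hS hx | exact hP x hx
    intro hsub hP
    refine this Q.body (fun _ h => h) S ?_ hP
    exact Finset.Subset.trans (subset_growAll Q S) hsub

theorem reach_disj {x : ℕ} (hx : x ∈ Q.reach R) : x ∉ Q.free :=
  reach_induction (P := (· ∉ Q.free)) (fun _ h => (mem_seed.1 h).1) (fun _ _ _ _ _ _ _ _ h => h) x hx

end CQStar

/-- A connected set of atoms that is closed under sharing variables outside `F` has an atom that
contains all variables from `F`. -/
theorem Elim.exists_top {F : Finset ℕ} : ∀ {l : List QAtom} (G : QAtom → Prop), Elim F l →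
    (∀ C ∈ l, ∀ B ∈ l, G C → ∀ x ∈ C.args, x ∈ B.args → x ∉ F → G B) →
    -- Connectedness of `G`, put in terms of predicates: what is invariant under sharing a variable
    -- outside `F` is constant on `G`.
    (∀ p : QAtom → Prop, (∀ C ∈ l, ∀ B ∈ l, G C → ∀ x ∈ C.args, x ∈ B.args → x ∉ F → (p C ↔ p B)) →
      ∀ C ∈ l, ∀ B ∈ l, G C → G B → (p C ↔ p B)) → (∃ C ∈ l, G C) →
    ∃ T ∈ l, G T ∧ ∀ C ∈ l, G C → ∀ x ∈ C.args, x ∈ F → x ∈ T.args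
  | [], _, _, _, _, ⟨_, h, _⟩ => absurd h (by simp)
  | A :: l, G, hl, hG, hc, hne => by
    have hG' : ∀ C ∈ l, ∀ B ∈ l, G C → ∀ x ∈ C.args, x ∈ B.args → x ∉ F → G B :=
      fun C hC B hB => hG C (by simp [hC]) B (by simp [hB])
    by_cases hA : G A
    · by_cases hex : ∃ x ∈ A.args, x ∉ F ∧ ∃ C ∈ l, x ∈ C.args
      · obtain ⟨x, hx, hxF, hxl⟩ := hex
        obtain ⟨B, hB, hAB⟩ : ∃ B ∈ l, ∀ x ∈ A.args, (x ∈ F ∨ ∃ C ∈ l, x ∈ C.args) → x ∈ B.args := by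
          rcases hl.2 with h | h
          · exact absurd (h x hx hxl) hxF
          · exact h
        have hGB : G B := hG A (by simp) B (by simp [hB]) hA x hx (hAB x hx (Or.inr hxl)) hxF
        obtain ⟨T, hT, hGT, htop⟩ := Elim.exists_top G hl.1 hG' (fun p hp C hC C' hC' hGC hGC' => by
          classical
          -- `B` stands for `A` among the remaining atoms: `p` is extended to `A` by its value at
          -- `B`, unless `A` occurs once more in `l` and has a value already.
          have := hc (fun D => if D = A ∧ A ∉ l then p B else p D)
            (fun C hC D hD hGC y hy hyD hyF => ?_) C (by simp [hC]) C' (by simp [hC']) hGC hGC'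
          · have h1 : ∀ D ∈ l, ¬ (D = A ∧ A ∉ l) := fun D hD h => h.2 (h.1 ▸ hD)
            simpa only [if_neg (h1 C hC), if_neg (h1 C' hC')] using this
          · have hcase : ∀ D ∈ A :: l, G D → y ∈ D.args → (∃ C ∈ l, y ∈ C.args) →
                ∃ D' ∈ l, G D' ∧ y ∈ D'.args ∧
                  ((if D = A ∧ A ∉ l then p B else p D) ↔ p D') := by
              intro D hD hGD hyD hyl
              by_cases hDA : D = A ∧ A ∉ l
              · exact ⟨B, hB, hGB, hAB y (hDA.1 ▸ hyD) (Or.inr hyl), by rw [if_pos hDA]⟩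
              · refine ⟨D, ?_, hGD, hyD, by rw [if_neg hDA]⟩
                rcases List.mem_cons.1 hD with rfl | h
                · by_contra hn
                  exact hDA ⟨rfl, hn⟩
                · exact h
            by_cases hyl : ∃ C ∈ l, y ∈ C.args
            · obtain ⟨C₁, h1, h2, h3, h4⟩ := hcase C hC hGC hy hyl
              obtain ⟨D₁, h5, h6, h7, h8⟩ := hcase D hD (hG C hC D hD hGC y hy hyD hyF) hyD hyl
              rw [h4, h8]
              exact hp C₁ h1 D₁ h5 h2 y h3 h7 hyF
            · have hCA : C = A := (List.mem_cons.1 hC).resolve_right fun h => hyl ⟨C, h, hy⟩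
              have hDA : D = A := (List.mem_cons.1 hD).resolve_right fun h => hyl ⟨D, h, hyD⟩
              rw [hCA, hDA]) ⟨B, hB, hGB⟩
        refine ⟨T, by simp [hT], hGT, fun C hC hGC y hy hyF => ?_⟩
        rcases List.mem_cons.1 hC with rfl | hC
        · exact htop B hB hGB y (hAB y hy (Or.inl hyF)) hyF
        · exact htop C hC hGC y hy hyF
      · refine ⟨A, by simp, hA, fun C hC hGC => ?_⟩
        -- `A` shares no variable outside `F` with the rest, so equality with `A` is an invariant
        -- predicate; by connectedness `A` is the only member of `G`.
        have hCA := (hc (· = A) (fun C hC D hD _ y hy hyD hyF => ?_) A (by simp) C hC hA hGC).1 rfl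
        · rw [hCA]; exact fun _ h _ => h
        · simp only [not_exists, not_and] at hex
          constructor
          · rintro rfl
            exact (List.mem_cons.1 hD).resolve_right fun h => hex y hy hyF D h hyD
          · rintro rfl
            exact (List.mem_cons.1 hC).resolve_right fun h => hex y hyD hyF C h hy
    · obtain ⟨T, hT, h⟩ := Elim.exists_top G hl.1 hG' (fun p hp C hC B hB hGC hGB => by
        refine hc p (fun C hC B hB hGC x hx hxB hxF => ?_) C (by simp [hC]) B (by simp [hB]) hGC hGB
        have hGB := hG C hC B hB hGC x hx hxB hxF
        refine hp C ?_ B ?_ hGC x hx hxB hxF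
        · exact (List.mem_cons.1 hC).resolve_left fun h => hA (h ▸ hGC)
        · exact (List.mem_cons.1 hB).resolve_left fun h => hA (h ▸ hGB)) (by
        obtain ⟨C, hC, hGC⟩ := hne
        exact ⟨C, (List.mem_cons.1 hC).resolve_left fun h => hA (h ▸ hGC), hGC⟩)
      refine ⟨T, by simp [hT], h.1, fun C hC hGC => h.2 C ?_ hGC⟩
      exact (List.mem_cons.1 hC).resolve_left fun h => hA (h ▸ hGC)

namespace CQStar

variable {Q : CQStar} {R : ℕ}

theorem atomOf_mem (hQ : Q.SelfJoinFree) (hR : R ∈ Q.symbols) :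
    Q.atomOf R ∈ Q.body ∧ (Q.atomOf R).rel = R := by
  obtain ⟨C, hC, rfl⟩ := mem_symbols.1 hR
  rw [hQ.atomOf_rel hC]
  exact ⟨hC, rfl⟩

theorem top_mem (hQ : Q.SelfJoinFree) (hR : R ∈ Q.symbols) :
    Q.top R ∈ Q.body ∧ (Q.top R = Q.atomOf R ∨ (Q.top R).Hits (Q.reach R)) := by
  unfold top
  refine List.foldlRecOn (motive := fun T => T ∈ Q.body ∧ (T = Q.atomOf R ∨ T.Hits (Q.reach R)))
    Q.body _ ⟨(atomOf_mem hQ hR).1, Or.inl rfl⟩ fun T hT C hC => ?_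
  unfold QAtom.above
  split_ifs with h
  · exact ⟨hC, Or.inr h.1⟩
  · exact hT

theorem reach_closed_symbols {C B : QAtom} (hC : C ∈ Q.body)
    (hG : C.rel = R ∨ C.Hits (Q.reach R)) {x : ℕ}
    (hx : x ∈ C.args) (hxB : x ∈ B.args) (hxF : x ∉ Q.free) : B.Hits (Q.reach R) := by
  refine ⟨x, hxB, ?_⟩
  rcases hG with h | h
  · exact seed_subset_reach (mem_seed.2 ⟨hxF, C, hC, h, hx⟩)
  · exact reach_closed hC h hx hxF

/-- Along the way in which a variable `x` is reached, the value of `p` is passed from the atom of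
`R` to every atom that contains `x`. -/
theorem reach_connected (hQ : Q.SelfJoinFree) (hR : R ∈ Q.symbols) {p : QAtom → Prop}
    (hp : ∀ C ∈ Q.body, ∀ B ∈ Q.body, (C.rel = R ∨ C.Hits (Q.reach R)) →
      ∀ x ∈ C.args, x ∈ B.args → x ∉ Q.free → (p C ↔ p B)) {C : QAtom} (hC : C ∈ Q.body)
    (hG : C.rel = R ∨ C.Hits (Q.reach R)) : p C ↔ p (Q.atomOf R) := by
  obtain ⟨hA, hAR⟩ := atomOf_mem hQ hR
  rcases hG with h | ⟨x, hx, hxS⟩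
  · rw [hQ.eq_of_rel hC hA (h.trans hAR.symm)]
  · refine reach_induction (P := fun x => ∀ C ∈ Q.body, x ∈ C.args → (p C ↔ p (Q.atomOf R)))
      (fun x hx C hC hxC => ?_) (fun C hC y hy hyS ih x hx hxF B hB hxB => ?_) x hxS C hC hx
    · obtain ⟨hxF, B, hB, rfl, hxB⟩ := mem_seed.1 hx
      rw [hQ.atomOf_rel hB]
      exact (hp B hB C hC (Or.inl rfl) x hxB hxC hxF).symm
    · rw [← ih C hC hy]
      exact (hp C hC B hB (Or.inr ⟨y, hy, hyS⟩) x hx hxB hxF).symm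

/-- Let `T` be the atom supplied by `Elim.exists_top`. All candidates of the fold belong to the
component, so when `T` is met it replaces the current candidate; a later replacement never loses a
free variable. If `T` has no reached variable, it is the atom with which the fold starts. -/
theorem top_spec (hQ : Q.SelfJoinFree) (hR : R ∈ Q.symbols)
    (hc : HypergraphAcyclic (insert Q.free Q.edges)) {C : QAtom} (hC : C ∈ Q.body)
    (hG : C.rel = R ∨ C.Hits (Q.reach R)) {x : ℕ} (hx : x ∈ C.args) (hxF : x ∈ Q.free) :
    x ∈ (Q.top R).args := by
  obtain ⟨l, hl, helim⟩ := exists_elim hc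
  obtain ⟨hA, hAR⟩ := atomOf_mem hQ hR
  have hm : ∀ C, C ∈ l ↔ C ∈ Q.body := fun C => hl.mem_iff
  obtain ⟨T, hT, hGT, htop⟩ := helim.exists_top (fun C => C.rel = R ∨ C.Hits (Q.reach R))
    (fun C hC B hB hG x hx hxB hxF => Or.inr
      (reach_closed_symbols ((hm C).1 hC) hG hx hxB hxF))
    (fun p hp C hC B hB hGC hGB => by
      have hp' : ∀ C ∈ Q.body, ∀ B ∈ Q.body, (C.rel = R ∨ C.Hits (Q.reach R)) →
          ∀ x ∈ C.args, x ∈ B.args → x ∉ Q.free → (p C ↔ p B) := fun C hC B hB =>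
        hp C ((hm C).2 hC) B ((hm B).2 hB)
      rw [reach_connected hQ hR hp' ((hm C).1 hC) hGC,
        reach_connected hQ hR hp' ((hm B).1 hB) hGB])
    ⟨_, (hm _).2 hA, Or.inl hAR⟩
  suffices H : ∀ y ∈ T.args, y ∈ Q.free → y ∈ (Q.top R).args from
    H x (htop C ((hm C).2 hC) hG x hx hxF) hxF
  have hTb := (hm T).1 hT
  have hstep : ∀ (l : List QAtom) (B : QAtom), (∀ C ∈ l, C ∈ Q.body) →
      (∀ y ∈ T.args, y ∈ Q.free → y ∈ B.args) → ∀ y ∈ T.args, y ∈ Q.free →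
        y ∈ (l.foldl (QAtom.above Q.free (Q.reach R)) B).args := by
    intro l
    induction l with
    | nil => exact fun _ _ h => h
    | cons C l ih =>
      refine fun B hl hB => ih _ (fun D hD => hl D (by simp [hD])) fun y hy hyF => ?_
      unfold QAtom.above
      split_ifs with h
      · exact h.2 y (hB y hy hyF) hyF
      · exact hB y hy hyF
  unfold top
  by_cases hTh : T.Hits (Q.reach R)
  · obtain ⟨l₁, l₂, hl⟩ := List.append_of_mem hTb
    have hsub : ∀ C ∈ l₁ ++ T :: l₂, C ∈ Q.body := fun C hC => hl ▸ hC
    rw [hl, List.foldl_append, List.foldl_cons]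
    refine hstep l₂ _ (fun C hC => hsub C (by simp [hC])) fun y hy hyF => ?_
    unfold QAtom.above
    rw [if_pos]
    · exact hy
    refine ⟨hTh, fun z hz hzF => ?_⟩
    refine List.foldlRecOn (motive := fun B => (B.rel = R ∨ B.Hits (Q.reach R)) ∧ B ∈ Q.body →
      ∀ z ∈ B.args, z ∈ Q.free → z ∈ T.args) l₁ (QAtom.above Q.free (Q.reach R)) ?_ ?_ ?_ z hz hzF
    · exact fun h z hz => htop _ ((hm _).2 hA) (Or.inl hAR) z hz
    · intro B _ C hC h z hz
      exact htop _ ((hm _).2 h.2) h.1 z hz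
    · refine List.foldlRecOn (motive := fun B => (B.rel = R ∨ B.Hits (Q.reach R)) ∧ B ∈ Q.body)
        l₁ (QAtom.above Q.free (Q.reach R)) ⟨Or.inl hAR, hA⟩ fun B hB C hC => ?_
      unfold QAtom.above
      split_ifs with h
      · exact ⟨Or.inr h.1, hsub C (by simp [hC])⟩
      · exact hB
  · have hTA : T = Q.atomOf R :=
      hQ.eq_of_rel hTb hA ((hGT.resolve_right hTh).trans hAR.symm)
    exact hstep Q.body _ (fun _ h => h) fun y hy _ => hTA ▸ hy

theorem expansion (hQ : Q.SelfJoinFree) (hR : R ∈ Q.symbols)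
    (hc : HypergraphAcyclic (insert Q.free Q.edges)) :
    Expansion Q (Q.fullPart hQ) (Q.reach R) (Q.atomOf R) (Q.top R) where
  selfJoinFree := hQ
  body := rfl
  pre := rfl
  post := rfl
  mem := (atomOf_mem hQ hR).1
  mem_top := (top_mem hQ hR).1
  disj _ hx := reach_disj hx
  closed _ hC hS _ hx hxF := reach_closed hC hS hx hxF
  top _ hC hS _ hx hxF := top_spec hQ hR hc hC (Or.inr hS) hx hxF
  conn h hh := by
    obtain ⟨hA, hAR⟩ := atomOf_mem hQ hR
    -- All variables of the seed occur in the one atom with symbol `R`, so `h` is constant on them,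
    -- and growing passes this value on.
    have key : ∀ y ∈ Q.seed R, ∀ x ∈ Q.reach R, h x = h y := by
      intro y hy
      obtain ⟨hyF, B, hB, hBR, hyB⟩ := mem_seed.1 hy
      refine reach_induction (fun x hx => ?_) (fun C hC z hz hzS ih x hx hxF => ?_)
      · obtain ⟨hxF, C, hC, hCR, hxC⟩ := mem_seed.1 hx
        obtain rfl := hQ.eq_of_rel hC hB (hCR.trans hBR.symm)
        exact hh C hC x hxC y hyB (seed_subset_reach hx) (seed_subset_reach hy)
      · rw [← ih]
        exact hh C hC x hx z hz (reach_closed hC ⟨z, hz, hzS⟩ hx hxF) hzS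
    intro x hx y hy
    by_contra hne
    obtain ⟨z, hz⟩ : (Q.seed R).Nonempty := by
      by_contra hn
      rw [Finset.not_nonempty_iff_eq_empty] at hn
      exact reach_induction (P := fun _ => False) (by simp [hn]) (fun _ _ _ _ _ h _ _ _ => h) x hx
    exact hne ((key z hz x hx).trans (key z hz y hy).symm)
  source := by
    obtain ⟨hA, hAR⟩ := atomOf_mem hQ hR
    by_cases hAS : (Q.atomOf R).Hits (Q.reach R)
    · refine Or.inl ⟨hAS, ?_⟩
      rcases (top_mem hQ hR).2 with h | h
      · rwa [h]
      · exact h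
    · have hno : ∀ x, x ∉ Q.reach R := fun x hx =>
        reach_induction (P := fun _ => False) (fun x hx => by
          obtain ⟨hxF, C, hC, hCR, hxC⟩ := mem_seed.1 hx
          obtain rfl := hQ.eq_of_rel hC hA (hCR.trans hAR.symm)
          exact hAS ⟨x, hxC, seed_subset_reach hx⟩) (fun _ _ _ _ _ h _ _ _ => h) x hx
      refine Or.inr ⟨fun C _ ⟨x, _, hx⟩ => hno x hx, ?_⟩
      rcases (top_mem hQ hR).2 with h | ⟨x, _, hx⟩
      · exact h.symm
      · exact absurd hx (hno x)

theorem fullPart_selfJoinFree (hQ : Q.SelfJoinFree) : (Q.fullPart hQ).SelfJoinFree := by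
  unfold SelfJoinFree
  simp only [fullPart, List.map_map]
  exact hQ

/-- The hyperedges of the full part are the traces of the hyperedges of `Q` on the free variables.
-/
theorem fullPart_acyclic (hQ : Q.SelfJoinFree) (h : Q.IsAcyclic) : (Q.fullPart hQ).IsAcyclic := by
  have := h.image_inter Q.free
  unfold IsAcyclic
  convert this using 1
  ext e
  simp only [edges, fullPart, List.map_map, List.mem_toFinset, List.mem_map, Finset.mem_image,
    Function.comp_apply, exists_exists_and_eq_and]
  refine exists_congr fun C => and_congr_right fun _ => Eq.congr_left ?_
  ext x
  simp [QAtom.only]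

end CQStar

/-! ### The equivalence for relaxed and for ordinary direct access -/

section Equivalence

variable {K : Type*} [CommSemiring K] [LinearOrder K]

theorem relaxedAccess_fullPart_iff (hidem : ∀ a : K, a + a = a) {κ : ℕ → ℕ}
    (hκ : LogarithmicTime κ) {Q : CQStar} {R : ℕ} (hQ : Q.SelfJoinFree) (hR : R ∈ Q.symbols)
    (hc : HypergraphAcyclic (insert Q.free Q.edges)) :
    RelaxedAccess κ Q (locally K Q R) ↔
      RelaxedAccess κ (Q.fullPart hQ) (locally K (Q.fullPart hQ) (Q.top R).rel) := by
  have hQ' := CQStar.fullPart_selfJoinFree hQ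
  have hE := CQStar.expansion hQ hR hc
  obtain ⟨hA, hAR⟩ := CQStar.atomOf_mem hQ hR
  have hmem : ∀ C ∈ Q.body, C.only Q.free ∈ (Q.fullPart hQ).body := fun C hC =>
    List.mem_map_of_mem hC
  have hsub : ∀ C ∈ Q.body, (C.rel = R ∨ C.Hits (Q.reach R)) →
      (C.only Q.free).args ⊆ ((Q.top R).only Q.free).args := fun C hC hG x hx => by
    have hx' := List.mem_filter.1 hx
    exact List.mem_filter.2 ⟨CQStar.top_spec hQ hR hc hC hG hx'.1 (by simpa using hx'.2), hx'.2⟩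
  constructor
  · intro h
    -- The expansion presupposes that the facts of the top atom determine facts of the other atoms
    -- it replaces. Absorbing these atoms into the top atom achieves this, and leaves the annotation
    -- where it is.
    have hred := RelaxedAccess.of_reduces hκ (Reduces.expand (K := K) hκ.one_le hE)
      (by rw [hAR]; exact h)
    refine (RelaxedAccess.absorb_all hκ hQ' (hmem _ hE.mem_top)
      ((Q.body.filter (·.Hits (Q.reach R))).map (QAtom.only Q.free)) [] ?_ ?_).mono
      fun D hD => ⟨hD, fun _ h => absurd h (by simp)⟩
    · simp only [List.forall_mem_map, List.mem_filter, decide_eq_true_eq]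
      exact fun C hC => ⟨hmem C hC.1, fun _ => hsub C hC.1 (Or.inr hC.2)⟩
    · refine hred.mono fun D hD => ⟨hD.1, fun C hC hCS hne => hD.2 _ ?_ hne⟩
      simp only [List.append_nil]
      exact List.mem_map_of_mem (List.mem_filter.2 ⟨hC, by simpa using hCS⟩)
  · intro h
    obtain ⟨l, hl, helim⟩ := CQStar.exists_elim hc
    have hm : ∀ C, C ∈ l ↔ C ∈ Q.body := fun C => hl.mem_iff
    obtain ⟨R', ⟨C, hC, hCR, hG⟩, -, hstep⟩ := RelaxedAccess.eliminate hidem hκ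
      (fun r => ∃ C ∈ Q.body, C.rel = r ∧ (C.rel = R ∨ C.Hits (Q.reach R))) l (l₁ := []) hQ rfl
      ⟨rfl, rfl, rfl⟩ helim hl.symm (by simp)
      (fun C hC B hB ⟨C', hC', hr, hG⟩ x hx hxB hxF => by
        obtain rfl := hQ.eq_of_rel hC' ((hm C).1 hC) hr
        exact ⟨B, (hm B).1 hB, rfl, Or.inr (CQStar.reach_closed_symbols hC' hG hx
          hxB hxF)⟩) ⟨_, hA, hAR, Or.inl hAR⟩ hR (Q' := Q.fullPart hQ)
    refine hstep ?_
    -- After the elimination the annotation sits at some atom `C` of the component. Its free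
    -- variables all occur in the top atom, so one more absorption suffices.
    by_cases hne : C.rel = (Q.top R).rel
    · rw [← hCR, hne]; exact h
    · refine RelaxedAccess.absorb hκ hQ' (hmem C hC) (hmem _ hE.mem_top) hne (hsub C hC hG) ?_
      rw [if_pos (show R' = (C.only Q.free).rel from hCR.symm)]
      exact h.mono fun D hD => hD.1

theorem efficientDirectAccess_iff {κ : ℕ → ℕ} (hκ : LogarithmicTime κ) {Q : CQStar} {R : ℕ}
    (hQ : Q.SelfJoinFree) : EfficientDirectAccess K κ Q R ↔ RelaxedAccess κ Q (locally K Q R) :=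
  ⟨RelaxedAccess.of_directAccessIn hκ hQ, RelaxedAccess.directAccessIn⟩

end Equivalence

/-! ## Polynomial-time programs -/

/-- No multiplications. -/
def Ex.Tame : Ex → Prop
  | .op o x y => o ≠ .mul ∧ x.Tame ∧ y.Tame
  | .load _ x => x.Tame
  | _ => True

def Ex.mass : Ex → ℕ
  | .reg _ => 0
  | .cst c => c
  | .op _ x y => x.mass + y.mass + 1
  | .load _ x => x.mass

namespace Stmt

/-- No multiplications and no semiring operations; register `0` is not assigned, and its value is the
number of rounds of each loop. -/
def Tame : Stmt → Prop
  | skip => True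
  | set r e => r ≠ 0 ∧ e.Tame
  | store _ i e => i.Tame ∧ e.Tame
  | seq p q => p.Tame ∧ q.Tame
  | cond e p q => e.Tame ∧ p.Tame ∧ q.Tame
  | loop r e p => r ≠ 0 ∧ e = .reg 0 ∧ p.Tame
  | _ => False

/-- A bound for the time and for the number of doublings of words. -/
def mass (N : ℕ) : Stmt → ℕ
  | set _ e => e.mass + 1
  | store _ i e => i.mass + e.mass + 1
  | seq p q => p.mass N + q.mass N
  | cond e p q => 1 + e.mass + p.mass N + q.mass N
  | loop _ _ p => 1 + N * (1 + p.mass N)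
  | _ => 1

end Stmt

/-- All words are below `B`. -/
structure RamState.Lt (s : RamState Unit) (B : ℕ) : Prop where
  reg : ∀ r, s.reg r < B
  arr : ∀ A i, s.arr A i < B

/-- Without products a value is at most the sum of its parts, which doubles the bound at worst; a
constant `c` is covered by `c < 2 ^ c`. -/
theorem Ex.Tame.spec {s : RamState Unit} {B W : ℕ} (hs : s.Lt B) : ∀ {e : Ex}, e.Tame →
    B * 2 ^ e.mass ≤ W → e.Ok W s ∧ e.eval s < B * 2 ^ e.mass
  | .reg r, _, hW => by
    have := hs.reg r
    simp only [mass, pow_zero, mul_one] at hW ⊢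
    exact ⟨this.trans_le hW, this⟩
  | .cst c, _, hW => by
    have h1 : c < B * 2 ^ c := Nat.lt_two_pow_self.trans_le
      (Nat.le_mul_of_pos_left _ (by have := hs.reg 0; omega))
    exact ⟨h1.trans_le hW, h1⟩
  | .load A x, h, hW => by
    have h1 := Ex.Tame.spec hs (e := x) h hW
    have h2 : s.arr A (x.eval s) < B * 2 ^ x.mass :=
      (hs.arr A _).trans_le (Nat.le_mul_of_pos_right _ (by positivity))
    exact ⟨⟨h1.1, h2.trans_le hW⟩, h2⟩
  | .op o x y, ⟨ho, hx, hy⟩, hW => by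
    have hB : 0 < B := by have := hs.reg 0; omega
    obtain ⟨a, ha⟩ : ∃ a, a = 2 ^ x.mass := ⟨_, rfl⟩
    obtain ⟨b, hb⟩ : ∃ b, b = 2 ^ y.mass := ⟨_, rfl⟩
    have ha1 : 0 < a := ha ▸ by positivity
    have hb1 : 0 < b := hb ▸ by positivity
    have he : B * 2 ^ (Ex.op o x y).mass = B * (a * b * 2) := by
      rw [ha, hb]; simp only [mass, pow_add, pow_one]
    have h3 : B * a ≤ B * (a * b) := Nat.mul_le_mul_left _ (Nat.le_mul_of_pos_right _ hb1)
    have h4 : B * b ≤ B * (a * b) := Nat.mul_le_mul_left _ (Nat.le_mul_of_pos_left _ ha1)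
    have h5 : 1 ≤ B * (a * b) := Nat.mul_pos hB (Nat.mul_pos ha1 hb1)
    rw [he] at hW ⊢
    have h6 : B * (a * b * 2) = B * (a * b) + B * (a * b) := by ring
    obtain ⟨x1, x2⟩ := Ex.Tame.spec hs hx (W := W) (by rw [← ha]; omega)
    obtain ⟨y1, y2⟩ := Ex.Tame.spec hs hy (W := W) (by rw [← hb]; omega)
    rw [← ha] at x2
    rw [← hb] at y2
    have h7 : o.eval (x.eval s) (y.eval s) < B * (a * b * 2) := by
      have hd := Nat.div_le_self (x.eval s) (y.eval s)
      have hm := Nat.mod_le (x.eval s) (y.eval s)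
      cases o <;> simp only [WordOp.eval] at ho ⊢ <;> first | omega | (split <;> omega) | skip
      exact absurd rfl ho
    exact ⟨⟨x1, y1, h7.trans_le hW⟩, h7⟩

namespace Stmt

/-- The bound on words is multiplied by `2 ^ mass`, so masses add up under composition, just as
times do. Fixing register `0` keeps the number of rounds equal to `N` everywhere. -/
theorem Tame.spec {N : ℕ} : ∀ {p : Stmt}, p.Tame → ∀ {s : RamState Unit} {B W : ℕ}, s.reg 0 = N →
    s.Lt B → B * 2 ^ p.mass N ≤ W → p.Ok W s ∧ p.cost 1 s ≤ p.mass N ∧ (p.run s).reg 0 = N ∧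
      (p.run s).Lt (B * 2 ^ p.mass N)
  | skip, _, s, B, W, h0, hs, hW => by
    have hB : B ≤ B * 2 ^ skip.mass N := Nat.le_mul_of_pos_right _ (by positivity)
    exact ⟨trivial, le_rfl, h0, fun r => (hs.reg r).trans_le hB, fun A i => (hs.arr A i).trans_le hB⟩
  | set r e, h, s, B, W, h0, hs, hW => by
    have hle : B * 2 ^ e.mass ≤ B * 2 ^ (set r e).mass N :=
      Nat.mul_le_mul_left _ (Nat.pow_le_pow_right (by omega) (Nat.le_succ _))
    have hB : B ≤ B * 2 ^ (set r e).mass N := Nat.le_mul_of_pos_right _ (by positivity)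
    obtain ⟨h1, h2⟩ := Ex.Tame.spec hs h.2 (hle.trans hW)
    refine ⟨h1, Nat.le_add_left 1 _, ?_, fun r' => ?_, fun A i => (hs.arr A i).trans_le hB⟩
    · simpa [run, setReg, Function.update_of_ne h.1.symm] using h0
    · simp only [run, setReg, Function.update_apply]
      split_ifs
      · exact h2.trans_le hle
      · exact (hs.reg r').trans_le hB
  | store A i e, h, s, B, W, h0, hs, hW => by
    have hle : ∀ k ≤ i.mass + e.mass, B * 2 ^ k ≤ B * 2 ^ (store A i e).mass N := fun k hk =>
      Nat.mul_le_mul_left _ (Nat.pow_le_pow_right (by omega) (by simp only [mass]; omega))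
    have hB := hle 0 (Nat.zero_le _)
    rw [pow_zero, mul_one] at hB
    obtain ⟨h1, -⟩ := Ex.Tame.spec hs h.1 ((hle _ (Nat.le_add_right _ _)).trans hW)
    obtain ⟨h2, h3⟩ := Ex.Tame.spec hs h.2 ((hle _ (Nat.le_add_left _ _)).trans hW)
    refine ⟨⟨h1, h2⟩, Nat.le_add_left 1 _, h0, fun r => (hs.reg r).trans_le hB, fun A' j => ?_⟩
    simp only [run, setArr, Function.update_apply]
    split_ifs with hA
    · rw [Function.update_apply]
      split_ifs
      · exact h3.trans_le (hle _ (Nat.le_add_left _ _))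
      · exact (hs.arr A j).trans_le hB
    · exact (hs.arr A' j).trans_le hB
  | seq p q, h, s, B, W, h0, hs, hW => by
    have he : B * 2 ^ (seq p q).mass N = B * 2 ^ p.mass N * 2 ^ q.mass N := by
      simp only [mass, pow_add, mul_assoc]
    rw [he] at hW ⊢
    obtain ⟨a1, a2, a3, a4⟩ := Tame.spec h.1 h0 hs
      ((Nat.le_mul_of_pos_right _ (by positivity)).trans hW)
    obtain ⟨b1, b2, b3, b4⟩ := Tame.spec h.2 a3 a4 hW
    exact ⟨⟨a1, b1⟩, Nat.add_le_add a2 b2, b3, b4⟩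
  | cond e p q, h, s, B, W, h0, hs, hW => by
    have hle : ∀ k ≤ (cond e p q).mass N, B * 2 ^ k ≤ B * 2 ^ (cond e p q).mass N := fun k hk =>
      Nat.mul_le_mul_left _ (Nat.pow_le_pow_right (by omega) hk)
    have hpm : p.mass N ≤ (cond e p q).mass N := by simp only [mass]; omega
    have hqm : q.mass N ≤ (cond e p q).mass N := by simp only [mass]; omega
    obtain ⟨a1, a2, a3, a4⟩ := Tame.spec h.2.1 h0 hs ((hle _ hpm).trans hW)
    obtain ⟨b1, b2, b3, b4⟩ := Tame.spec h.2.2 h0 hs ((hle _ hqm).trans hW)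
    obtain ⟨e1, -⟩ := Ex.Tame.spec hs h.1
      ((hle _ (by simp only [mass]; omega)).trans hW)
    simp only [Ok, cost, run, mass]
    split_ifs
    · exact ⟨⟨e1, a1⟩, by omega, a3, fun r => (a4.reg r).trans_le (hle _ hpm),
        fun A i => (a4.arr A i).trans_le (hle _ hpm)⟩
    · exact ⟨⟨e1, b1⟩, by omega, b3, fun r => (b4.reg r).trans_le (hle _ hqm),
        fun A i => (b4.arr A i).trans_le (hle _ hqm)⟩
  | loop r e p, ⟨hr, he, hp⟩, s, B, W, h0, hs, hW => by
    subst he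
    have hle : ∀ k ≤ (loop r (.reg 0) p).mass N,
        B * 2 ^ k ≤ B * 2 ^ (loop r (.reg 0) p).mass N := fun k hk =>
      Nat.mul_le_mul_left _ (Nat.pow_le_pow_right (by omega) hk)
    have hm : ∀ i < N, i * p.mass N + p.mass N ≤ (loop r (.reg 0) p).mass N := fun i hi => by
      simp only [mass]; nlinarith
    have hset : ∀ {s : RamState Unit} {B i : ℕ}, s.reg 0 = N → s.Lt B → i < N →
        (s.setReg r i).reg 0 = N ∧ (s.setReg r i).Lt B := fun {s B i} h0 hs hi => by
      refine ⟨by simpa [setReg, Function.update_of_ne hr.symm] using h0, fun r' => ?_, hs.arr⟩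
      simp only [setReg, Function.update_apply]
      split_ifs
      · exact (hi.trans_eq h0.symm).trans (hs.reg 0)
      · exact hs.reg r'
    obtain ⟨f, hf⟩ : ∃ f, f = fun i (s : RamState Unit) => p.run (s.setReg r i) := ⟨_, rfl⟩
    have key : ∀ i ≤ N, (iterSteps f i s).reg 0 = N ∧
        (iterSteps f i s).Lt (B * 2 ^ (i * p.mass N)) := by
      intro i
      induction i with
      | zero => exact fun _ => ⟨h0, by simpa [iterSteps] using hs⟩
      | succ i ih =>
        intro hi
        obtain ⟨a1, a2⟩ := ih (by omega)
        obtain ⟨b1, b2⟩ := hset a1 a2 hi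
        have heq : B * 2 ^ ((i + 1) * p.mass N) = B * 2 ^ (i * p.mass N) * 2 ^ p.mass N := by
          rw [mul_assoc, ← pow_add, Nat.succ_mul]
        obtain ⟨-, -, c3, c4⟩ := Tame.spec hp b1 b2 le_rfl
        rw [heq]
        simp only [iterSteps, hf] at c3 c4 ⊢
        exact ⟨c3, c4⟩
    have hstep : ∀ i < N, p.Ok W ((iterSteps f i s).setReg r i) ∧
        p.cost 1 ((iterSteps f i s).setReg r i) ≤ p.mass N := fun i hi => by
      obtain ⟨a1, a2⟩ := key i hi.le
      obtain ⟨b1, b2⟩ := hset a1 a2 hi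
      obtain ⟨c1, c2, -⟩ := Tame.spec hp b1 b2 (W := W) (by
        rw [mul_assoc, ← pow_add]; exact (hle _ (hm i hi)).trans hW)
      exact ⟨c1, c2⟩
    have hB : B ≤ B * 2 ^ (loop r (.reg 0) p).mass N := Nat.le_mul_of_pos_right _ (by positivity)
    simp only [Ok, cost, run, Ex.eval, Ex.Ok, h0, ← hf]
    refine ⟨⟨(h0 ▸ hs.reg 0).trans_le (hB.trans hW), fun i hi => (hstep i hi).1⟩, ?_,
      (key N le_rfl).1, ?_⟩
    · refine Nat.add_le_add_left ((Finset.sum_le_card_nsmul _ _ (1 + p.mass N) fun i hi => ?_).trans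
        (by simp)) _
      have := (hstep i (Finset.mem_range.1 hi)).2
      omega
    · have := (key N le_rfl).2
      have hk : N * p.mass N ≤ (loop r (.reg 0) p).mass N := by simp only [mass]; nlinarith
      exact ⟨fun r => (this.reg r).trans_le (hle _ hk), fun A i => (this.arr A i).trans_le (hle _ hk)⟩

/-- Each nesting of loops contributes one factor `N`, so the mass of a fixed program is polynomial
in `N`. -/
theorem mass_le (p : Stmt) : ∃ c, ∀ N, p.mass N ≤ (N + 2) ^ c := by
  have hcst : ∀ k : ℕ, ∃ c, ∀ N : ℕ, k ≤ (N + 2) ^ c := fun k => ⟨k, fun N =>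
    Nat.lt_two_pow_self.le.trans (Nat.pow_le_pow_left (by omega) _)⟩
  have hadd : ∀ {f g : ℕ → ℕ}, (∃ c, ∀ N, f N ≤ (N + 2) ^ c) → (∃ c, ∀ N, g N ≤ (N + 2) ^ c) →
      ∃ c, ∀ N, f N + g N ≤ (N + 2) ^ c := by
    rintro f g ⟨a, ha⟩ ⟨b, hb⟩
    refine ⟨a + b + 1, fun N => ?_⟩
    have h1 : (N + 2) ^ a ≤ (N + 2) ^ (a + b) := Nat.pow_le_pow_right (by omega) (by omega)
    have h2 : (N + 2) ^ b ≤ (N + 2) ^ (a + b) := Nat.pow_le_pow_right (by omega) (by omega)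
    have := ha N
    have := hb N
    calc _ ≤ (N + 2) ^ (a + b) * 2 := by omega
      _ ≤ (N + 2) ^ (a + b) * (N + 2) := Nat.mul_le_mul_left _ (by omega)
      _ = _ := (pow_succ _ _).symm
  have hmul : ∀ {f g : ℕ → ℕ}, (∃ c, ∀ N, f N ≤ (N + 2) ^ c) → (∃ c, ∀ N, g N ≤ (N + 2) ^ c) →
      ∃ c, ∀ N, f N * g N ≤ (N + 2) ^ c := fun {f g} ⟨a, ha⟩ ⟨b, hb⟩ =>
    ⟨a + b, fun N => (Nat.mul_le_mul (ha N) (hb N)).trans_eq (pow_add _ _ _).symm⟩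
  induction p with
  | set r e => exact hcst _
  | store A i e => exact hcst _
  | seq p q hp hq => exact hadd hp hq
  | cond e p q hp hq => exact hadd (hadd (hadd (hcst 1) (hcst _)) hp) hq
  | loop r e p hp => exact hadd (hcst 1) (hmul ⟨1, fun N => by simp⟩ (hadd (hcst 1) hp))
  | _ => exact hcst 1

end Stmt

theorem length_le_bitLength (l : List ℕ) : l.length ≤ bitLength l := by
  rw [bitLength, ← List.length_map (f := fun x => Nat.size x + 1)]
  exact List.length_le_sum_of_one_le _ (by simp)

theorem lt_of_mem_bitLength {l : List ℕ} {x : ℕ} (hx : x ∈ l) : x < 2 ^ bitLength l :=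
  Nat.size_le.1 ((Nat.le_succ _).trans
    (List.single_le_sum (fun _ _ => Nat.zero_le _) _ (List.mem_map_of_mem hx)))

/-- Input words are below `2 ^ n`. Polynomially many doublings leave them with polynomially many
bits. -/
theorem PolyTimeOn.of_tame {dom : CQStar → ℕ → Prop} {f : CQStar → ℕ → CQStar × ℕ} (p : Stmt)
    (hp : p.Tame) (r : ℕ) (h : ∀ Q R, dom Q R →
      HoldsList (((p.run (listState (encodeQuery Q R)))).setReg 0
        ((p.run (listState (encodeQuery Q R))).reg r)) (encodeQuery (f Q R).1 (f Q R).2)) :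
    PolyTimeOn dom f := by
  obtain ⟨c, hc⟩ := p.mass_le
  -- Register `0` bounds all loops, so the length of the output can be moved there only at the end.
  obtain ⟨p', hp'⟩ : ∃ p', p' = p.seq (.set 0 (.reg r)) := ⟨_, rfl⟩
  obtain ⟨k, hk⟩ : ∃ k, k = 2 * c + p'.len + 3 := ⟨_, rfl⟩
  refine ⟨p'.compile p'.bound, k, fun Q R hQ n hn => ?_⟩
  obtain ⟨l, hl⟩ : ∃ l, l = encodeQuery Q R := ⟨_, rfl⟩
  have hdom := h Q R hQ
  rw [← hl] at hn hdom ⊢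
  have hlen : 2 ≤ l.length := by
    rw [hl]
    simp only [encodeQuery, List.length_append, List.length_cons]
    omega
  have hln : l.length ≤ n := hn ▸ length_le_bitLength l
  have hn2 : 2 ≤ n := by omega
  have hpow : ∀ {a b : ℕ}, a ≤ b → n ^ a ≤ n ^ b := fun h => Nat.pow_le_pow_right (by omega) h
  have hmass : p.mass l.length ≤ n ^ (2 * c) := by
    refine (hc _).trans ?_
    rw [pow_mul]
    exact Nat.pow_le_pow_left (by nlinarith) c
  have hLt : (listState l).Lt (2 ^ n) := by
    constructor
    · intro r
      simp only [listState]
      split_ifs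
      · exact Nat.lt_two_pow_self.trans_le (Nat.pow_le_pow_right (by omega) hln)
      · positivity
    · intro A i
      simp only [listState]
      split_ifs
      · rw [List.getD_eq_getElem?_getD]
        cases hi : l[i]? with
        | none => simp
        | some x => exact hn ▸ lt_of_mem_bitLength (List.mem_of_getElem? hi)
      · positivity
  have hW : 2 ^ n * 2 ^ p.mass l.length ≤ 2 ^ n ^ k := by
    rw [← pow_add]
    refine Nat.pow_le_pow_right (by omega) ?_
    have h1 : n ≤ n ^ (2 * c + 1) := by simpa using hpow (show 1 ≤ 2 * c + 1 by omega)
    have h2 : n ^ (2 * c) ≤ n ^ (2 * c + 1) := hpow (by omega)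
    calc n + p.mass l.length ≤ n ^ (2 * c + 1) * 2 := by omega
      _ ≤ n ^ (2 * c + 1) * n := Nat.mul_le_mul_left _ hn2
      _ = n ^ (2 * c + 2) := (pow_succ _ _).symm
      _ ≤ n ^ k := hpow (by omega)
  obtain ⟨a1, a2, a3, a4⟩ := hp.spec (N := l.length) (s := listState l) rfl hLt hW
  have hok : p'.Ok (2 ^ n ^ k) (listState l) := by
    rw [hp']
    exact ⟨a1, (a4.reg r).trans_le hW⟩
  have hW2 : 2 < 2 ^ n ^ k := by
    calc 2 < 2 ^ 2 := by norm_num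
      _ ≤ 2 ^ n ^ k := Nat.pow_le_pow_right (by omega) (by
        calc 2 ≤ n ^ 1 := by simpa using hn2
          _ ≤ n ^ k := hpow (by omega))
  obtain ⟨s', t, hex, ht, hA, -⟩ := Stmt.compile_exec (b := p'.bound) (κ := 1) le_rfl hW2 p' le_rfl
    le_rfl ⟨fun _ _ => rfl, fun _ _ => rfl, rfl, rfl⟩ hok
  have hb : 0 < p'.bound := by rw [hp']; simp [Stmt.bound]
  refine ⟨s', t, hex, ht.trans ?_, ?_⟩
  · have hcost : p'.cost 1 (listState l) ≤ n ^ (2 * c + 1) := by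
      rw [hp']
      simp only [Stmt.cost]
      calc _ ≤ n ^ (2 * c) + n ^ (2 * c) := by
            have : 1 ≤ n ^ (2 * c) := Nat.one_le_pow _ _ (by omega)
            omega
        _ = n ^ (2 * c) * 2 := by ring
        _ ≤ n ^ (2 * c) * n := Nat.mul_le_mul_left _ hn2
        _ = _ := (pow_succ _ _).symm
    calc _ ≤ n ^ p'.len * n ^ (2 * c + 1) := Nat.mul_le_mul
          (Nat.lt_two_pow_self.le.trans (Nat.pow_le_pow_left hn2 _)) hcost
      _ = n ^ (p'.len + (2 * c + 1)) := (pow_add _ _ _).symm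
      _ ≤ n ^ k := hpow (by omega)
  · rw [hp'] at hA
    exact ⟨(hA.reg 0 (hp' ▸ hb)).trans hdom.1, fun i x hx => by rw [hA.arr]; exact hdom.2 i x hx⟩

/-! ## The program for the transformation -/

/-- `f` takes the values `l` from the position `p` on. -/
def Reads (f : ℕ → ℕ) (p : ℕ) (l : List ℕ) : Prop := ∀ i x, l[i]? = some x → f (p + i) = x

theorem reads_append {f : ℕ → ℕ} : ∀ {l l' : List ℕ} {p : ℕ},
    Reads f p (l ++ l') ↔ Reads f p l ∧ Reads f (p + l.length) l' := by
  intro l l' p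
  constructor
  · intro h
    refine ⟨fun i x hi => h i x ?_, fun i x hi => ?_⟩
    · rw [List.getElem?_append_left (List.getElem?_eq_some_iff.1 hi).1, hi]
    · rw [add_assoc]
      refine h _ x ?_
      rw [List.getElem?_append_right (by omega), Nat.add_sub_cancel_left, hi]
  · rintro ⟨h1, h2⟩ i x hi
    rcases lt_or_ge i l.length with h | h
    · exact h1 i x (by rwa [List.getElem?_append_left h] at hi)
    · rw [List.getElem?_append_right h] at hi
      rw [← h2 _ x hi]
      congr 1
      omega

theorem reads_singleton {f : ℕ → ℕ} {p x : ℕ} : Reads f p [x] ↔ f p = x := by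
  refine ⟨fun h => h 0 x rfl, fun h i y hi => ?_⟩
  cases i <;> simp_all

theorem reads_cons {f : ℕ → ℕ} {p x : ℕ} {l : List ℕ} :
    Reads f p (x :: l) ↔ f p = x ∧ Reads f (p + 1) l := by
  rw [← List.singleton_append, reads_append, reads_singleton, List.length_singleton]

theorem Reads.congr {f g : ℕ → ℕ} {p : ℕ} {l : List ℕ} (h : Reads f p l)
    (hg : ∀ j, p ≤ j → j < p + l.length → g j = f j) : Reads g p l := fun i x hi => by
  rw [hg _ (by omega) (by have := (List.getElem?_eq_some_iff.1 hi).1; omega), h i x hi]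

def encodeAtoms (l : List QAtom) : List ℕ := l.flatMap fun A => A.rel :: A.args.length :: A.args

namespace Stmt

/-- The registers that are assigned. -/
def regs : Stmt → List ℕ
  | set r _ => [r]
  | size r _ => [r]
  | seq p q => p.regs ++ q.regs
  | cond _ p q => p.regs ++ q.regs
  | loop r _ p => r :: p.regs
  | _ => []

/-- The arrays that are changed. -/
def arrs : Stmt → List ℕ
  | store A _ _ => [A]
  | seq p q => p.arrs ++ q.arrs
  | cond _ p q => p.arrs ++ q.arrs
  | loop _ _ p => p.arrs
  | _ => []

theorem run_frame (p : Stmt) : ∀ s : RamState Unit,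
    (∀ r ∉ p.regs, (p.run s).reg r = s.reg r) ∧ ∀ A ∉ p.arrs, (p.run s).arr A = s.arr A := by
  induction p with
  | set r e => exact fun s => ⟨fun r' h => by simp_all [regs, run], fun _ _ => rfl⟩
  | size r e => exact fun s => ⟨fun r' h => by simp_all [regs, run], fun _ _ => rfl⟩
  | store A i e =>
    exact fun s => ⟨fun _ _ => rfl, fun A' h => by
      have : A' ≠ A := by simpa [arrs] using h
      simp [run, setArr, this]⟩
  | seq p q hp hq =>
    intro s
    simp only [regs, arrs, List.mem_append, not_or]
    exact ⟨fun r h => ((hq _).1 r h.2).trans ((hp s).1 r h.1),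
      fun A h => ((hq _).2 A h.2).trans ((hp s).2 A h.1)⟩
  | cond e p q hp hq =>
    intro s
    simp only [regs, arrs, List.mem_append, not_or, run]
    split_ifs
    · exact ⟨fun r h => (hp s).1 r h.1, fun A h => (hp s).2 A h.1⟩
    · exact ⟨fun r h => (hq s).1 r h.2, fun A h => (hq s).2 A h.2⟩
  | loop r e p hp =>
    intro s
    simp only [regs, arrs, List.mem_cons, not_or, run]
    generalize e.eval s = n
    induction n with
    | zero => exact ⟨fun _ _ => rfl, fun _ _ => rfl⟩
    | succ n ih =>
      exact ⟨fun r' h => ((hp _).1 r' h.2).trans (by simp [h.1, ih.1 r' h]),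
        fun A h => ((hp _).2 A h).trans (ih.2 A h)⟩
  | _ => exact fun s => ⟨fun _ _ => rfl, fun _ _ => rfl⟩

theorem run_loop {N r : ℕ} {p : Stmt} {s : RamState Unit} (J : ℕ → RamState Unit → Prop)
    (h0 : s.reg 0 = N) (hJ : J 0 s)
    (hs : ∀ i < N, ∀ s, J i s → J (i + 1) (p.run (s.setReg r i))) :
    J N ((loop r (.reg 0) p).run s) := by
  simp only [run, Ex.eval, h0]
  have : ∀ i ≤ N, J i (iterSteps (fun i s => p.run (s.setReg r i)) i s) := by
    intro i
    induction i with
    | zero => exact fun _ => hJ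
    | succ i ih => exact fun hi => hs i hi _ (ih (by omega))
  exact this N le_rfl

/-- Let register `7` run through the list whose length and entries are found in array `0` from
position `reg b + c` on. -/
def scan (b c : ℕ) (p : Stmt) : Stmt :=
  .loop 2 (.reg 0) (.cond (.op .lt (.reg 2) (.load 0 (.op .add (.reg b) (.cst c))))
    (.seq (.set 7 (.load 0 (.op .add (.op .add (.reg b) (.cst (c + 1))) (.reg 2)))) p) .skip)

/-- The loop makes `N` rounds, and those beyond the length of the list are idle. The invariant `I`
refers to the entries treated so far, and must not depend on the registers `2` and `7` of the scan.
-/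
theorem scan_run {N b c : ℕ} {xs : List ℕ} {p : Stmt} {s : RamState Unit}
    (I : List ℕ → RamState Unit → Prop) (hb : b ≠ 2 ∧ b ≠ 7)
    (hp : 0 ∉ p.arrs ∧ 0 ∉ p.regs ∧ 2 ∉ p.regs ∧ b ∉ p.regs) (h0 : s.reg 0 = N)
    (hxs : Reads (s.arr 0) (s.reg b + c) (xs.length :: xs)) (hle : xs.length ≤ N)
    (hset : ∀ l s r v, r = 2 ∨ r = 7 → I l s → I l (s.setReg r v)) (hI : I [] s)
    (hstep : ∀ l x s', I l s' → s'.reg 7 = x → (∀ r ∉ 2 :: 7 :: p.regs, s'.reg r = s.reg r) →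
      (∀ A ∉ p.arrs, s'.arr A = s.arr A) → I (l ++ [x]) (p.run s')) :
    I xs ((scan b c p).run s) := by
  have := run_loop (r := 2) (p := .cond (.op .lt (.reg 2) (.load 0 (.op .add (.reg b) (.cst c))))
    (.seq (.set 7 (.load 0 (.op .add (.op .add (.reg b) (.cst (c + 1))) (.reg 2)))) p) .skip)
    (fun i s' => I (xs.take i) s' ∧ (∀ r ∉ 2 :: 7 :: p.regs, s'.reg r = s.reg r) ∧
      ∀ A ∉ p.arrs, s'.arr A = s.arr A) h0 ⟨by simpa using hI, fun _ _ => rfl, fun _ _ => rfl⟩ ?_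
  · rw [List.take_of_length_le hle] at this
    exact this.1
  · rintro i - s' ⟨h1, h2, h3⟩
    obtain ⟨h4, h5⟩ := reads_cons.1 hxs
    have hb' : s'.reg b = s.reg b := h2 b (by simp [hb.1, hb.2, hp.2.2.2])
    simp only [run, Ex.eval, WordOp.eval, setReg_reg, setReg_arr, if_true, if_neg hb.1, hb',
      h3 0 hp.1, h4]
    by_cases hi : i < xs.length
    · rw [if_pos hi, if_pos one_ne_zero, ← List.take_concat_get' xs i hi]
      refine ⟨hstep _ _ _ (hset _ _ _ _ (Or.inr rfl) (hset _ _ _ _ (Or.inl rfl) h1)) ?_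
        (fun r hr => ?_) h3, fun r hr => ?_, fun A hA => ?_⟩
      · rw [setReg_reg, if_pos rfl, ← add_assoc]
        exact h5 i _ (List.getElem?_eq_getElem hi)
      · simp only [List.mem_cons, not_or] at hr
        simp only [setReg_reg, if_neg hr.1, if_neg hr.2.1]
        exact h2 r (by simp [hr])
      · rw [(run_frame p _).1 r (fun h => hr (by simp [h]))]
        simp only [List.mem_cons, not_or] at hr
        simp only [setReg_reg, if_neg hr.1, if_neg hr.2.1]
        exact h2 r (by simp [hr])
      · rw [(run_frame p _).2 A hA]
        exact h3 A hA
    · rw [if_neg hi, if_neg (by simp), List.take_of_length_le (by omega)]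
      rw [List.take_of_length_le (by omega)] at h1
      refine ⟨hset _ _ _ _ (Or.inl rfl) h1, fun r hr => ?_, h3⟩
      rw [setReg_reg, if_neg fun h => hr (by simp [h]), h2 r hr]

end Stmt

/-- Register `b` points to the atom `C` in array `0`. -/
structure PointsTo (N b : ℕ) (C : QAtom) (s : RamState Unit) : Prop where
  len : s.reg 0 = N
  rel : s.arr 0 (s.reg b) = C.rel
  args : Reads (s.arr 0) (s.reg b + 1) (C.args.length :: C.args)
  le : C.args.length ≤ N

theorem PointsTo.congr {N b b' : ℕ} {C : QAtom} {s s' : RamState Unit} (h : PointsTo N b C s)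
    (h0 : s'.reg 0 = s.reg 0) (h1 : s'.arr 0 = s.arr 0) (h2 : s'.reg b' = s.reg b) :
    PointsTo N b' C s' :=
  ⟨h0.trans h.len, by rw [h1, h2, h.rel], by rw [h1, h2]; exact h.args, h.le⟩

theorem PointsTo.run {N b : ℕ} {C : QAtom} {s : RamState Unit} (h : PointsTo N b C s) (p : Stmt)
    (hp : 0 ∉ p.regs ∧ b ∉ p.regs ∧ 0 ∉ p.arrs) : PointsTo N b C (p.run s) :=
  h.congr ((p.run_frame s).1 _ hp.1) ((p.run_frame s).2 _ hp.2.2) ((p.run_frame s).1 _ hp.2.1)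

namespace Stmt

/-- Let register `3` run through the positions of the atoms. -/
def pass (p : Stmt) : Stmt :=
  .seq (.set 3 (.cst 2)) (.loop 1 (.reg 0) (.cond (.op .lt (.reg 1) (.load 0 (.cst 1)))
    (.seq p (.set 3 (.op .add (.reg 3) (.op .add (.cst 2) (.load 0 (.op .add (.reg 3) (.cst 1)))))))
    .skip))

/-- Array `0` holds the sequence of the atoms. -/
structure HoldsAtoms (N : ℕ) (as : List QAtom) (s : RamState Unit) : Prop where
  len : s.reg 0 = N
  reads : Reads (s.arr 0) 1 (as.length :: encodeAtoms as)
  length_le : as.length ≤ N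
  le : ∀ C ∈ as, C.args.length ≤ N

/-- The pointer in register `3` is advanced by two plus the arity that is found in array `0`. At the
end it is the position behind the atoms, where the head begins. -/
theorem pass_run {N : ℕ} {as : List QAtom} {p : Stmt} {s : RamState Unit}
    (I : List QAtom → RamState Unit → Prop) (h : HoldsAtoms N as s)
    (hp : 0 ∉ p.arrs ∧ 0 ∉ p.regs ∧ 1 ∉ p.regs ∧ 3 ∉ p.regs)
    (hset : ∀ l s r v, r = 1 ∨ r = 3 → I l s → I l (s.setReg r v)) (hI : I [] s)
    (hstep : ∀ l, ∀ C ∈ as, ∀ s', I l s' → PointsTo N 3 C s' →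
      (∀ r ∉ 1 :: 3 :: p.regs, s'.reg r = s.reg r) →
      (∀ A ∉ p.arrs, s'.arr A = s.arr A) → I (l ++ [C]) (p.run s')) :
    I as ((pass p).run s) ∧ ((pass p).run s).reg 3 = 2 + (encodeAtoms as).length := by
  have := run_loop (r := 1) (p := .cond (.op .lt (.reg 1) (.load 0 (.cst 1)))
    (.seq p (.set 3 (.op .add (.reg 3) (.op .add (.cst 2) (.load 0 (.op .add (.reg 3) (.cst 1)))))))
    .skip) (s := s.setReg 3 2)
    (fun i s' => (I (as.take i) s' ∧ s'.reg 3 = 2 + (encodeAtoms (as.take i)).length) ∧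
      (∀ r ∉ 1 :: 3 :: p.regs, s'.reg r = s.reg r) ∧ ∀ A ∉ p.arrs, s'.arr A = s.arr A)
    (show _ = N by simpa using h.len)
    ⟨⟨by simpa using hset _ _ _ _ (Or.inr rfl) hI, rfl⟩,
      fun r hr => by
        simp only [List.mem_cons, not_or] at hr
        rw [setReg_reg, if_neg hr.2.1], fun _ _ => rfl⟩ ?_
  · rw [List.take_of_length_le h.length_le] at this
    exact this.1
  · rintro i - s' ⟨⟨h1, h1'⟩, h2, h3⟩
    obtain ⟨h4, h5⟩ := reads_cons.1 h.reads
    simp only [run, Ex.eval, WordOp.eval, setReg_reg, setReg_arr, if_true, h3 0 hp.1, h4]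
    have hI' := hset _ _ _ i (Or.inl rfl) h1
    have hr1 : ∀ r ∉ 1 :: 3 :: p.regs, (s'.setReg 1 i).reg r = s.reg r := fun r hr => by
      rw [setReg_reg, if_neg fun h => hr (by simp [h]), h2 r hr]
    by_cases hi : i < as.length
    · rw [if_pos hi, if_pos one_ne_zero, ← List.take_concat_get' as i hi]
      have hP : PointsTo N 3 as[i] (s'.setReg 1 i) := by
        have h6 : encodeAtoms as = encodeAtoms (as.take i) ++ (as[i].rel :: as[i].args.length ::
            as[i].args) ++ encodeAtoms (as.drop (i + 1)) := by
          refine (congrArg encodeAtoms ((List.take_append_drop i as).symm.trans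
            (by rw [List.drop_eq_getElem_cons hi]))).trans ?_
          simp only [encodeAtoms, List.flatMap_append, List.flatMap_cons, List.append_assoc,
            List.cons_append]
        rw [h6, reads_append, reads_append, reads_cons, show 1 + 1 = 2 from rfl, ← h1'] at h5
        refine ⟨?_, ?_, ?_, h.le _ (List.getElem_mem _)⟩
        · rw [hr1 0 (by simp [hp.2.1]), h.len]
        · simpa [h3 0 hp.1] using h5.1.2.1
        · simpa [h3 0 hp.1] using h5.1.2.2
      have hP' := hP.run p ⟨hp.2.1, hp.2.2.2, hp.1⟩
      refine ⟨⟨hset _ _ _ _ (Or.inr rfl) (hstep _ _ (List.getElem_mem _) _ hI' hP hr1 h3), ?_⟩,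
        fun r hr => ?_, fun A hA => ((run_frame p _).2 A hA).trans (h3 A hA)⟩
      · rw [(reads_cons.1 hP'.args).1, (run_frame p _).1 3 hp.2.2.2]
        simp only [setReg_reg, if_true, if_neg (show ¬ 3 = 1 by decide), h1', encodeAtoms,
          List.flatMap_append, List.length_append, List.flatMap_cons, List.flatMap_nil,
          List.length_cons, List.length_nil]
        omega
      · rw [setReg_reg, if_neg fun h => hr (by simp [h]), (run_frame p _).1 r fun h => hr (by simp [h]), hr1 r hr]
    · rw [if_neg hi, if_neg (by simp), List.take_of_length_le (by omega)]
      rw [List.take_of_length_le (by omega)] at hI' h1'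
      exact ⟨⟨hI', h1'⟩, hr1, h3⟩

end Stmt

/-- The entries of the array `A` at the elements of `P` are not zero. -/
def Marks (A : ℕ) (P : ℕ → Prop) (s : RamState Unit) : Prop := ∀ v, s.arr A v ≠ 0 ↔ P v

theorem Marks.run {A : ℕ} {P : ℕ → Prop} {s : RamState Unit} (h : Marks A P s) (p : Stmt)
    (hp : A ∉ p.arrs) : Marks A P (p.run s) := fun v => by
  rw [(p.run_frame s).2 A hp]; exact h v

theorem Marks.store {A : ℕ} {P : ℕ → Prop} {s : RamState Unit} (h : Marks A P s) (x : ℕ) :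
    Marks A (fun v => P v ∨ v = x) (s.setArr A x 1) := fun v => by
  rw [setArr_arr]
  by_cases hv : v = x <;> simp [hv, h v]

theorem Marks.congr {A : ℕ} {P P' : ℕ → Prop} {s : RamState Unit} (h : Marks A P s)
    (hP : ∀ v, P v ↔ P' v) : Marks A P' s := fun v => (h v).trans (hP v)

namespace Stmt

/-- Use of the work space: array `0` is the input, array `1` marks the free variables, `2` the
reached ones, `3` those of the current atom, and `4` receives the output. Register `3` points to the
current atom and `6` to the best one so far, `4` and `5` hold outcomes of tests, `7` is the current
entry and `8` the length of the output; `5` also counts the arguments that are output. -/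
def mark (b c A : ℕ) : Stmt := scan b c (.store A (.reg 7) (.cst 1))

def spread : Stmt := scan 3 1 (.cond (.load 1 (.reg 7)) .skip (.store 2 (.reg 7) (.cst 1)))

def hits : Stmt := .seq (.set 4 (.cst 0))
  (scan 3 1 (.cond (.load 2 (.reg 7)) (.set 4 (.cst 1)) .skip))

def growStep : Stmt := .seq hits (.cond (.reg 4) spread .skip)

def check : Stmt := .seq (.set 5 (.cst 1))
  (scan 6 1 (.cond (.load 1 (.reg 7)) (.cond (.load 3 (.reg 7)) .skip (.set 5 (.cst 0))) .skip))

/-- Array `3` has to be empty again before the next atom is examined. -/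
def unmark : Stmt := scan 3 1 (.store 3 (.reg 7) (.cst 0))

def aboveStep : Stmt := .seq hits (.seq (mark 3 1 3) (.seq check (.seq unmark
  (.cond (.reg 4) (.cond (.reg 5) (.set 6 (.reg 3)) .skip) .skip))))

def emitArgs : Stmt := scan 3 1 (.cond (.load 1 (.reg 7))
  (.seq (.store 4 (.op .add (.reg 8) (.op .add (.cst 2) (.reg 5))) (.reg 7))
    (.set 5 (.op .add (.reg 5) (.cst 1)))) .skip)

def emit : Stmt := .seq (.store 4 (.reg 8) (.load 0 (.reg 3))) (.seq (.set 5 (.cst 0))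
  (.seq emitArgs (.seq (.store 4 (.op .add (.reg 8) (.cst 1)) (.reg 5))
    (.set 8 (.op .add (.reg 8) (.op .add (.cst 2) (.reg 5)))))))

variable {N : ℕ} {C T : QAtom} {F S : Finset ℕ} {s : RamState Unit}

theorem mark_run {b c A : ℕ} {P : ℕ → Prop} {xs : List ℕ} (hb : b ≠ 2 ∧ b ≠ 7) (hA : A ≠ 0)
    (h0 : s.reg 0 = N) (hxs : Reads (s.arr 0) (s.reg b + c) (xs.length :: xs))
    (hle : xs.length ≤ N) (h : Marks A P s) :
    Marks A (fun v => P v ∨ v ∈ xs) ((mark b c A).run s) := by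
  refine scan_run (fun l => Marks A (fun v => P v ∨ v ∈ l)) hb (by simp [arrs, regs, hA.symm]) h0 hxs
    hle (fun _ _ _ _ _ h => h) (h.congr (by simp)) fun l x s' hI hx _ _ => ?_
  simp only [run, Ex.eval, hx]
  exact (hI.store x).congr fun v => by simp [or_assoc]

theorem spread_run (h : PointsTo N 3 C s) (hF : Marks 1 (· ∈ F) s) {P : ℕ → Prop}
    (hS : Marks 2 P s) : Marks 2 (fun v => P v ∨ v ∈ C.args ∧ v ∉ F) (spread.run s) := by
  refine scan_run (fun l => Marks 2 (fun v => P v ∨ v ∈ l ∧ v ∉ F)) (by decide) (by decide) h.len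
    h.args h.le (fun _ _ _ _ _ h => h) (hS.congr (by simp)) fun l x s' hI hx _ hA => ?_
  simp only [run, Ex.eval, hx, hA 1 (by decide)]
  split_ifs with h1
  · refine hI.congr fun v => ?_
    have := (hF x).1 h1
    by_cases hv : v = x <;> simp [hv, this]
  · refine (hI.store x).congr fun v => ?_
    have := mt (hF x).2 h1
    by_cases hv : v = x <;> simp [hv, this]

theorem hits_run (h : PointsTo N 3 C s) (hS : Marks 2 (· ∈ S) s) :
    (hits.run s).reg 4 ≠ 0 ↔ C.Hits S := by
  have h' := h.run (.set 4 (.cst 0)) (by decide)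
  refine scan_run (fun l s' => s'.reg 4 ≠ 0 ↔ ∃ x ∈ l, x ∈ S) (by decide) (by decide) h'.len
    h'.args h'.le (fun l s' r v hr h => ?_) (by simp [run, Ex.eval]) fun l x s' hI hx _ hA => ?_
  · rcases hr with rfl | rfl <;> simpa using h
  · have := hS x
    simp only [run, Ex.eval, hx, hA 2 (by decide), setReg_arr]
    split_ifs with h1
    · simp [this.1 h1, or_and_right, exists_or]
    · simp [hI, mt this.2 h1, or_and_right, exists_or]

theorem growStep_run (h : PointsTo N 3 C s) (hF : Marks 1 (· ∈ F) s) (hS : Marks 2 (· ∈ S) s) :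
    Marks 2 (· ∈ C.grow F S) (growStep.run s) := by
  have h1 := hits_run h hS
  have hS' := hS.run hits (by decide)
  have he : growStep.run s = if (hits.run s).reg 4 ≠ 0 then spread.run (hits.run s)
      else hits.run s := rfl
  rw [he, QAtom.grow]
  by_cases d : C.Hits S
  · rw [if_pos (h1.2 d), if_pos d]
    refine (spread_run (h.run hits (by decide)) (hF.run hits (by decide)) hS').congr fun v => ?_
    simp
  · rw [if_neg (mt h1.1 d), if_neg d]
    exact hS'

theorem check_run (h : PointsTo N 6 T s) (hF : Marks 1 (· ∈ F) s) {P : ℕ → Prop}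
    (hP : Marks 3 P s) : (check.run s).reg 5 ≠ 0 ↔ ∀ x ∈ T.args, x ∈ F → P x := by
  have h' := h.run (.set 5 (.cst 1)) (by decide)
  refine scan_run (fun l s' => s'.reg 5 ≠ 0 ↔ ∀ x ∈ l, x ∈ F → P x) (by decide) (by decide) h'.len
    h'.args h'.le (fun l s' r v hr h => ?_) (by simp [run, Ex.eval]) fun l x s' hI hx _ hA => ?_
  · rcases hr with rfl | rfl <;> simpa using h
  · have hFx := hF x
    have hPx := hP x
    simp only [run, Ex.eval, hx, hA 1 (by decide), hA 3 (by decide), setReg_arr]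
    simp only [List.mem_append, List.mem_singleton, or_imp, forall_and, forall_eq]
    split_ifs with h1 h2
    · rw [hI]; simp [hPx.1 h2]
    · simp [hFx.1 h1, mt hPx.2 h2]
    · rw [hI]; simp [mt hFx.2 h1]

theorem unmark_run {P : ℕ → Prop} (h : PointsTo N 3 C s) (hP : Marks 3 P s)
    (hPC : ∀ v, P v → v ∈ C.args) : Marks 3 (fun _ => False) (unmark.run s) := by
  have := scan_run (fun l => Marks 3 (fun v => P v ∧ v ∉ l)) (by decide) (by decide) h.len h.args
    h.le (p := .store 3 (.reg 7) (.cst 0)) (fun _ _ _ _ _ h => h) (hP.congr (by simp))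
    fun l x s' hI hx _ _ v => ?_
  · exact this.congr fun v => iff_of_false (fun hv => hv.2 (hPC v hv.1)) id
  · have := hI v
    simp only [run, Ex.eval, hx, setArr_arr]
    by_cases hv : v = x
    · simp [hv]
    · simpa [hv] using this

theorem aboveStep_run (h : PointsTo N 3 C s) (hT : PointsTo N 6 T s) (hF : Marks 1 (· ∈ F) s)
    (hS : Marks 2 (· ∈ S) s) (h3 : Marks 3 (fun _ => False) s) :
    PointsTo N 6 (T.above F S C) (aboveStep.run s) ∧
      Marks 3 (fun _ => False) (aboveStep.run s) := by
  have h4 := hits_run h hS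
  obtain ⟨s₁, hs₁⟩ : ∃ s₁, s₁ = hits.run s := ⟨_, rfl⟩
  have a1 : PointsTo N 3 C s₁ := hs₁ ▸ h.run hits (by decide)
  have a2 : PointsTo N 6 T s₁ := hs₁ ▸ hT.run hits (by decide)
  have m := mark_run (by decide) (by decide) a1.len a1.args a1.le
    (hs₁ ▸ h3.run hits (by decide) : Marks 3 (fun _ => False) s₁)
  have b1 := a1.run (mark 3 1 3) (by decide)
  have b2 := a2.run (mark 3 1 3) (by decide)
  have h5 := check_run b2 ((hs₁ ▸ hF.run hits (by decide) : Marks 1 (· ∈ F) s₁).run (mark 3 1 3)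
    (by decide)) m
  have u := unmark_run (b1.run check (by decide)) (m.run check (by decide))
    fun v hv => hv.resolve_left id
  have c1 := (b1.run check (by decide)).run unmark (by decide)
  have c2 := (b2.run check (by decide)).run unmark (by decide)
  rw [← (unmark.run_frame _).1 5 (by decide)] at h5
  rw [← hs₁, ← ((mark 3 1 3).run_frame _).1 4 (by decide), ← (check.run_frame _).1 4 (by decide),
    ← (unmark.run_frame _).1 4 (by decide)] at h4
  simp only [false_or] at h5
  simp only [aboveStep, run, ← hs₁, Ex.eval, QAtom.above]
  by_cases d4 : C.Hits S
  · rw [if_pos (h4.2 d4)]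
    by_cases d5 : ∀ x ∈ T.args, x ∈ F → x ∈ C.args
    · rw [if_pos (h5.2 d5), if_pos ⟨d4, d5⟩]
      exact ⟨c1.congr rfl rfl rfl, u⟩
    · rw [if_neg (mt h5.1 d5), if_neg fun h => d5 h.2]
      exact ⟨c2, u⟩
  · rw [if_neg (mt h4.1 d4), if_neg fun h => d4 h.1]
    exact ⟨c2, u⟩

theorem emit_run {out : List ℕ} (h : PointsTo N 3 C s) (hF : Marks 1 (· ∈ F) s)
    (ho : Reads (s.arr 4) 0 out) (h8 : s.reg 8 = out.length) :
    Reads ((emit.run s).arr 4) 0 (out ++ encodeAtoms [C.only F]) ∧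
      (emit.run s).reg 8 = (out ++ encodeAtoms [C.only F]).length := by
  obtain ⟨s₁, hs₁⟩ : ∃ s₁, s₁ = Stmt.run (.set 5 (.cst 0))
    (Stmt.run (.store 4 (.reg 8) (.load 0 (.reg 3))) s) := ⟨_, rfl⟩
  have hP : PointsTo N 3 C s₁ := hs₁ ▸ (h.run _ (by decide)).run _ (by decide)
  have hF₁ : Marks 1 (· ∈ F) s₁ := by
    rw [hs₁]; exact (hF.run _ (by decide)).run _ (by decide)
  have h8₁ : s₁.reg 8 = out.length := by simpa [hs₁, run] using h8
  have := scan_run (fun l s' => Reads (s'.arr 4) 0 out ∧ s'.arr 4 out.length = C.rel ∧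
    Reads (s'.arr 4) (out.length + 2) (l.filter (· ∈ F)) ∧
    s'.reg 5 = (l.filter (· ∈ F)).length) (by decide) (by decide) hP.len hP.args hP.le
    (fun l s' r v hr h => ?_) (p := .cond (.load 1 (.reg 7))
      (.seq (.store 4 (.op .add (.reg 8) (.op .add (.cst 2) (.reg 5))) (.reg 7))
        (.set 5 (.op .add (.reg 5) (.cst 1)))) .skip)
    (hI := ⟨ho.congr fun j _ hj => ?_, by simp [hs₁, run, Ex.eval, h8, h.rel],
      fun i x hi => by simp at hi, by simp [hs₁, run, Ex.eval]⟩)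
    (hstep := fun l x s' hI hx hr hA => ?_)
  · obtain ⟨i1, i2, i3, i4⟩ := this
    obtain ⟨s₂, hs₂⟩ : ∃ s₂, s₂ = emitArgs.run s₁ := ⟨_, rfl⟩
    rw [show (scan 3 1 _).run s₁ = s₂ from hs₂.symm] at i1 i2 i3 i4
    have h8₂ : s₂.reg 8 = out.length := by
      rw [hs₂, (emitArgs.run_frame s₁).1 8 (by decide), h8₁]
    have he : emit.run s = (s₂.setArr 4 (s₂.reg 8 + 1) (s₂.reg 5)).setReg 8
        (s₂.reg 8 + (2 + s₂.reg 5)) := by rw [hs₂, hs₁]; rfl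
    simp only [he, setReg_arr, setReg_reg, if_true, h8₂, i4]
    refine ⟨reads_append.2 ⟨i1.congr fun j _ hj => ?_, ?_⟩, ?_⟩
    · rw [setArr_arr, if_neg (by omega)]
    · simp only [encodeAtoms, List.flatMap_cons, List.flatMap_nil, List.append_nil, reads_cons,
        QAtom.only, zero_add]
      refine ⟨by rw [setArr_arr, if_neg (by omega), i2], by simp, i3.congr fun j hj _ => ?_⟩
      rw [setArr_arr, if_neg (by omega)]
    · simp [encodeAtoms, QAtom.only]
      omega
  · rcases hr with rfl | rfl <;> simpa using h
  · rw [hs₁]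
    simp only [run, setReg_arr, setArr_arr, Ex.eval]
    rw [if_neg (by omega)]
  · obtain ⟨i1, i2, i3, i4⟩ := hI
    simp only [run, Ex.eval, WordOp.eval, hx, hA 1 (by decide), hr 8 (by decide), h8₁, i4]
    split_ifs with h1
    · have hxF : x ∈ F := (hF₁ x).1 h1
      simp only [setReg_arr, setReg_reg, setArr_reg, if_true, i4, List.filter_append,
        List.filter_cons, List.filter_nil, hxF, decide_true, List.length_append, List.length_cons,
        List.length_nil, zero_add, and_true, reads_append, reads_singleton]
      refine ⟨i1.congr fun j _ hj => ?_, ?_, i3.congr fun j hj hj' => ?_, ?_⟩ <;> rw [setArr_arr]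
      · rw [if_neg (by omega)]
      · rw [if_neg (by omega), i2]
      · rw [if_neg (by omega)]
      · rw [if_pos ⟨rfl, by omega⟩]
    · have hxF : x ∉ F := mt (hF₁ x).2 h1
      simp [hxF, i1, i2, i3, i4]

/-- What follows the atoms in the encoding is the head, which the transformation leaves as it is. -/
def copyTail : Stmt := .loop 2 (.reg 0) (.cond (.op .lt (.op .add (.reg 2) (.reg 3)) (.reg 0))
  (.store 4 (.op .add (.reg 8) (.reg 2)) (.load 0 (.op .add (.reg 3) (.reg 2)))) .skip)

theorem copyTail_run {out tail : List ℕ} (h0 : s.reg 0 = N)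
    (ht : Reads (s.arr 0) (s.reg 3) tail) (hN : s.reg 3 + tail.length = N)
    (ho : Reads (s.arr 4) 0 out) (h8 : s.reg 8 = out.length) :
    Reads ((copyTail.run s).arr 4) 0 (out ++ tail) := by
  have := run_loop (r := 2) (p := .cond (.op .lt (.op .add (.reg 2) (.reg 3)) (.reg 0))
    (.store 4 (.op .add (.reg 8) (.reg 2)) (.load 0 (.op .add (.reg 3) (.reg 2)))) .skip)
    (fun i s' => Reads (s'.arr 4) 0 (out ++ tail.take i) ∧ s'.arr 0 = s.arr 0 ∧
      ∀ r, r ≠ 2 → s'.reg r = s.reg r) h0 ⟨by simpa using ho, rfl, fun _ _ => rfl⟩ ?_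
  · rw [List.take_of_length_le (by omega)] at this
    exact this.1
  · rintro i hi s' ⟨h1, h2, h3⟩
    simp only [run, Ex.eval, WordOp.eval, setReg_reg, setReg_arr, if_true, h2, h3 3 (by decide),
      h3 0 (by decide), h3 8 (by decide), h0, h8, if_neg (show ¬ 3 = 2 by decide),
      if_neg (show ¬ 0 = 2 by decide), if_neg (show ¬ 8 = 2 by decide)]
    have hr : ∀ r, r ≠ 2 → (s'.setReg 2 i).reg r = s.reg r := fun r hr => by
      rw [setReg_reg, if_neg hr, h3 r hr]
    by_cases hi' : i < tail.length
    · rw [if_pos (show i + s.reg 3 < N by omega), if_pos one_ne_zero, ← List.take_concat_get' tail i hi',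
        ← List.append_assoc, reads_append, reads_singleton]
      refine ⟨⟨h1.congr fun j _ hj => ?_, ?_⟩, funext fun v => ?_, hr⟩
      · have hl : (out ++ tail.take i).length ≤ out.length + i := by simp
        rw [setArr_arr, if_neg (by omega), setReg_arr]
      · rw [setArr_arr, if_pos ⟨rfl, by simp; omega⟩]
        exact ht i _ (List.getElem?_eq_getElem hi')
      · rw [setArr_arr, if_neg (by omega), setReg_arr, h2]
    · rw [if_neg (show ¬ i + s.reg 3 < N by omega), if_neg (by simp),
        List.take_of_length_le (by omega)]
      rw [List.take_of_length_le (by omega)] at h1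
      exact ⟨h1, h2, hr⟩

end Stmt

theorem encodeAtoms_append (l l' : List QAtom) :
    encodeAtoms (l ++ l') = encodeAtoms l ++ encodeAtoms l' := List.flatMap_append

/-- Array `0` holds the query `Q` with the relation symbol `R`. -/
structure HoldsQuery (Q : CQStar) (R : ℕ) (s : RamState Unit) : Prop where
  len : s.reg 0 = (encodeQuery Q R).length
  reads : Reads (s.arr 0) 0 (encodeQuery Q R)

namespace HoldsQuery

variable {Q : CQStar} {R : ℕ} {s : RamState Unit}

theorem run (h : HoldsQuery Q R s) (p : Stmt) (hp : 0 ∉ p.regs ∧ 0 ∉ p.arrs) : HoldsQuery Q R (p.run s) :=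
  ⟨((p.run_frame s).1 0 hp.1).trans h.len, by rw [(p.run_frame s).2 0 hp.2]; exact h.reads⟩

theorem spec (h : HoldsQuery Q R s) : s.arr 0 0 = R ∧ Stmt.HoldsAtoms (encodeQuery Q R).length Q.body s ∧
    Reads (s.arr 0) (2 + (encodeAtoms Q.body).length) (Q.pre.length :: Q.pre) ∧
    Reads (s.arr 0) (2 + (encodeAtoms Q.body).length + (1 + Q.pre.length))
      (Q.post.length :: Q.post) := by
  have h1 : encodeQuery Q R = R :: Q.body.length :: encodeAtoms Q.body ++
    (Q.pre.length :: Q.pre) ++ (Q.post.length :: Q.post) := rfl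
  have h2 := h.reads
  rw [h1, reads_append, reads_append, List.cons_append, reads_cons] at h2
  obtain ⟨⟨⟨h3, h4⟩, h5⟩, h6⟩ := h2
  have hl : ∀ l : List QAtom, l.length ≤ (encodeAtoms l).length ∧
      ∀ C ∈ l, C.args.length ≤ (encodeAtoms l).length := by
    intro l
    induction l with
    | nil => simp
    | cons C l ih =>
      simp only [encodeAtoms, List.flatMap_cons, List.length_append, List.length_cons,
        List.mem_cons, forall_eq_or_imp] at ih ⊢
      exact ⟨by omega, by omega, fun D hD => by have := ih.2 D hD; omega⟩
  have hN : (encodeAtoms Q.body).length ≤ (encodeQuery Q R).length := by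
    rw [h1]; simp only [List.length_append, List.length_cons]; omega
  refine ⟨h3, ⟨h.len, h4, (hl _).1.trans hN, fun C hC => ((hl _).2 C hC).trans hN⟩, ?_, ?_⟩
  · convert h5 using 1
    simp only [List.length_cons]; omega
  · convert h6 using 1
    simp only [List.length_cons, List.length_append]; omega

end HoldsQuery

namespace Stmt

/-- The idle pass over the atoms finds the position of the head. -/
def readFree : Stmt := .seq (pass .skip) (.seq (mark 3 0 1)
  (.seq (.set 3 (.op .add (.reg 3) (.op .add (.cst 1) (.load 0 (.reg 3))))) (mark 3 0 1)))

def readSeed : Stmt :=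
  pass (.cond (.op .eq (.load 0 (.reg 3)) (.load 0 (.cst 0))) spread .skip)

/-- The number of rounds is the length of the encoding, as in the definition of `reach`. -/
def rounds : Stmt := .loop 9 (.reg 0) (pass growStep)

def findAtom : Stmt :=
  pass (.cond (.op .eq (.load 0 (.reg 3)) (.load 0 (.cst 0))) (.set 6 (.reg 3)) .skip)

def header : Stmt := .seq (.store 4 (.cst 0) (.load 0 (.reg 6)))
  (.seq (.store 4 (.cst 1) (.load 0 (.cst 1))) (.set 8 (.cst 2)))

/-- The input in array `0` is read to the end, so the output is collected in array `4` and
transferred afterwards. -/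
def copyBack : Stmt := .loop 2 (.reg 0) (.store 0 (.reg 2) (.load 4 (.reg 2)))

/-- Compute `CQStar.transform`. -/
def transformProg : Stmt := .seq readFree (.seq readSeed (.seq rounds (.seq findAtom
  (.seq (pass aboveStep) (.seq header (.seq (pass emit) (.seq copyTail
    (.seq (.set 8 (.op .add (.reg 8) (.op .sub (.reg 0) (.reg 3)))) copyBack))))))))

variable {Q : CQStar} {R : ℕ} {s : RamState Unit}

theorem readFree_run (h : HoldsQuery Q R s) (h1 : Marks 1 (fun _ => False) s) :
    Marks 1 (· ∈ Q.free) (readFree.run s) := by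
  obtain ⟨-, h2, -, -⟩ := h.spec
  have h3 := (pass_run (p := .skip) (fun _ _ => True) h2 (by decide) (fun _ _ _ _ _ _ => trivial)
    trivial fun _ _ _ _ _ _ _ _ => trivial).2
  obtain ⟨s₁, hs₁⟩ : ∃ s₁, s₁ = (pass .skip).run s := ⟨_, rfl⟩
  have k1 : HoldsQuery Q R s₁ := hs₁ ▸ h.run _ (by decide)
  have m1 : Marks 1 (fun _ => False) s₁ := hs₁ ▸ h1.run _ (by decide)
  rw [← hs₁] at h3
  obtain ⟨s₂, hs₂⟩ : ∃ s₂, s₂ = (mark 3 0 1).run s₁ := ⟨_, rfl⟩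
  have hN : Q.pre.length ≤ (encodeQuery Q R).length ∧ Q.post.length ≤ (encodeQuery Q R).length := by
    simp only [encodeQuery, List.length_append, List.length_cons]; omega
  have m2 := mark_run (b := 3) (c := 0) (by decide) (by decide) k1.len
    (by rw [h3]; exact k1.spec.2.2.1) hN.1 m1
  have k2 := k1.run (mark 3 0 1) (by decide)
  have h4 := ((mark 3 0 1).run_frame s₁).1 3 (by decide)
  rw [← hs₂] at m2 k2 h4
  have m3 := mark_run (b := 3) (c := 0) (by decide) (by decide) (k2.run (.set 3 (.op .add (.reg 3) (.op .add (.cst 1)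
    (.load 0 (.reg 3))))) (by decide)).len (xs := Q.post) (by
      have := k2.spec.2.2.1
      simp only [run, Ex.eval, WordOp.eval, setReg_reg, if_true, setReg_arr, h4, h3, add_zero,
        (reads_cons.1 this).1]
      exact k2.spec.2.2.2) hN.2 (m2.run _ (by decide))
  rw [readFree, run, run, run, ← hs₁, ← hs₂]
  exact m3.congr fun v => by simp [CQStar.free]

theorem eq_eval (s : RamState Unit) :
    (Ex.op .eq (.load 0 (.reg 3)) (.load 0 (.cst 0))).eval s ≠ 0 ↔
      s.arr 0 (s.reg 3) = s.arr 0 0 := by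
  simp only [Ex.eval, WordOp.eval]
  split_ifs with h <;> simp [h]

theorem readSeed_run (h : HoldsQuery Q R s) (h1 : Marks 1 (· ∈ Q.free) s)
    (h2 : Marks 2 (fun _ => False) s) : Marks 2 (· ∈ Q.seed R) (readSeed.run s) := by
  obtain ⟨hR, h3, -, -⟩ := h.spec
  refine (pass_run (fun l => Marks 2 fun x => x ∉ Q.free ∧ ∃ C ∈ l, C.rel = R ∧ x ∈ C.args) h3
    (by decide) (fun _ _ _ _ _ h => h) (h2.congr (by simp)) fun l C hC s' hI hP _ hA => ?_).1.congr
      fun v => CQStar.mem_seed.symm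
  have hc := eq_eval s'
  rw [hA 0 (by decide), ← hA 0 (by decide), hP.rel, hA 0 (by decide), hR] at hc
  rw [run]
  split_ifs with d
  · have := hc.1 d
    refine (spread_run hP (fun v => by rw [hA 1 (by decide)]; exact h1 v) hI).congr fun v => ?_
    simp only [List.mem_append, List.mem_singleton, or_and_right, exists_or, exists_eq_left, this,
      true_and, and_or_left]
    exact or_congr Iff.rfl and_comm
  · have := mt hc.2 d
    exact hI.congr fun v => by simp [or_and_right, exists_or, this]

theorem rounds_run (h : HoldsQuery Q R s) (h1 : Marks 1 (· ∈ Q.free) s)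
    (h2 : Marks 2 (· ∈ Q.seed R) s) : Marks 2 (· ∈ Q.reach R) (rounds.run s) := by
  refine (run_loop (fun i s => HoldsQuery Q R s ∧ Marks 1 (· ∈ Q.free) s ∧
    Marks 2 (· ∈ Q.growAll^[i] (Q.seed R)) s) h.len ⟨h, h1, h2⟩ fun i _ s ⟨a1, a2, a3⟩ => ?_).2.2
  have b1 : HoldsQuery Q R (s.setReg 9 i) := ⟨by simpa using a1.len, a1.reads⟩
  refine ⟨b1.run (pass growStep) (by decide), (show Marks 1 (· ∈ Q.free) (s.setReg 9 i) from a2).run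
    (pass growStep) (by decide), ?_⟩
  rw [Function.iterate_succ_apply']
  exact (pass_run (fun l => Marks 2 (· ∈ l.foldl (QAtom.grow Q.free) (Q.growAll^[i] (Q.seed R))))
    b1.spec.2.1 (by decide) (fun _ _ _ _ _ h => h) a3 fun l C hC s' hI hP _ hA => by
      rw [List.foldl_append]
      exact growStep_run hP (fun v => by rw [hA 1 (by decide)]; exact a2 v) hI).1

/-- Without self-joins only one atom has the symbol `R`, so the pointer is not moved again once it
has been set. -/
theorem findAtom_run (h : HoldsQuery Q R s) (hQ : Q.SelfJoinFree) (hR : R ∈ Q.symbols) :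
    PointsTo (encodeQuery Q R).length 6 (Q.atomOf R) (findAtom.run s) := by
  obtain ⟨hR', h3, -, -⟩ := h.spec
  obtain ⟨hA, hAR⟩ := CQStar.atomOf_mem hQ hR
  refine (pass_run (fun l s => Q.atomOf R ∈ l → PointsTo (encodeQuery Q R).length 6 (Q.atomOf R) s)
    h3 (by decide) (fun l s r v hr h hl => ?_) (by simp) fun l C hC s' hI hP _ hA' => ?_).1 hA
  · refine (h hl).congr ?_ rfl ?_ <;> rcases hr with rfl | rfl <;> simp
  · have hc := eq_eval s'
    rw [hP.rel, hA' 0 (by decide), hR'] at hc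
    intro hl
    rw [run]
    split_ifs with d
    · obtain rfl : C = Q.atomOf R := hQ.eq_of_rel hC hA ((hc.1 d).trans hAR.symm)
      exact hP.congr rfl rfl rfl
    · refine hI ((List.mem_append.1 hl).resolve_right fun hm => d (hc.2 ?_))
      rw [← List.mem_singleton.1 hm, hAR]

theorem passAbove_run {T : QAtom} {S : Finset ℕ} (h : HoldsQuery Q R s)
    (h1 : Marks 1 (· ∈ Q.free) s) (h2 : Marks 2 (· ∈ S) s) (h3 : Marks 3 (fun _ => False) s)
    (hT : PointsTo (encodeQuery Q R).length 6 T s) :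
    PointsTo (encodeQuery Q R).length 6 (Q.body.foldl (QAtom.above Q.free S) T)
      ((pass aboveStep).run s) := by
  refine (pass_run (fun l s => PointsTo (encodeQuery Q R).length 6
    (l.foldl (QAtom.above Q.free S) T) s ∧ Marks 3 (fun _ => False) s) h.spec.2.1 (by decide)
    (fun l s r v hr h => ⟨?_, h.2⟩) ⟨hT, h3⟩ fun l C hC s' hI hP _ hA => ?_).1.1
  · refine h.1.congr ?_ rfl ?_ <;> rcases hr with rfl | rfl <;> simp
  · rw [List.foldl_append]
    exact aboveStep_run hP hI.1 (fun v => by rw [hA 1 (by decide)]; exact h1 v)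
      (fun v => by rw [hA 2 (by decide)]; exact h2 v) hI.2

theorem passEmit_run {out : List ℕ} (h : HoldsQuery Q R s) (h1 : Marks 1 (· ∈ Q.free) s)
    (ho : Reads (s.arr 4) 0 out) (h8 : s.reg 8 = out.length) :
    (Reads (((pass emit).run s).arr 4) 0 (out ++ encodeAtoms (Q.body.map (QAtom.only Q.free))) ∧
      ((pass emit).run s).reg 8 = (out ++ encodeAtoms (Q.body.map (QAtom.only Q.free))).length) ∧
      ((pass emit).run s).reg 3 = 2 + (encodeAtoms Q.body).length := by
  refine pass_run (fun l s => Reads (s.arr 4) 0 (out ++ encodeAtoms (l.map (QAtom.only Q.free))) ∧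
    s.reg 8 = (out ++ encodeAtoms (l.map (QAtom.only Q.free))).length) h.spec.2.1 (by decide)
    (fun l s r v hr h => ⟨h.1, ?_⟩) (by simpa [encodeAtoms] using ⟨ho, h8⟩)
    fun l C hC s' hI hP _ hA => ?_
  · rcases hr with rfl | rfl <;> simpa using h.2
  · rw [List.map_append, encodeAtoms_append, ← List.append_assoc]
    exact emit_run hP (fun v => by rw [hA 1 (by decide)]; exact h1 v) hI.1 hI.2

theorem copyBack_run {l : List ℕ} (hl : l.length ≤ s.reg 0) (h : Reads (s.arr 4) 0 l)
    (h8 : s.reg 8 = l.length) : HoldsList ((copyBack.run s).setReg 0 ((copyBack.run s).reg 8)) l := by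
  have := run_loop (r := 2) (p := .store 0 (.reg 2) (.load 4 (.reg 2))) (s := s) (fun i s' =>
    (∀ j < i, s'.arr 0 j = s.arr 4 j) ∧ s'.arr 4 = s.arr 4 ∧ s'.reg 8 = s.reg 8) rfl
    ⟨by simp, rfl, rfl⟩ fun i _ s' ⟨h1, h2, h3⟩ => ⟨fun j hj => ?_, funext fun j => ?_, ?_⟩
  · refine ⟨by rw [setReg_reg, if_pos rfl]; exact this.2.2.trans h8, fun i x hi => ?_⟩
    have hi' := (List.getElem?_eq_some_iff.1 hi).1
    rw [← h i x hi, zero_add]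
    exact this.1 i (by omega)
  · simp only [run, Ex.eval, setArr_arr, setReg_reg, setReg_arr, if_true, true_and, h2]
    split_ifs with hji
    · rw [hji]
    · exact h1 j (by omega)
  · simp [run, h2]
  · simpa [run] using h3

end Stmt

namespace CQStar

variable {Q : CQStar} {R : ℕ}

theorem encodeQuery_fullPart (hQ : Q.SelfJoinFree) (R' : ℕ) : encodeQuery (Q.fullPart hQ) R' =
    [R', Q.body.length] ++ encodeAtoms (Q.body.map (QAtom.only Q.free)) ++
      ((Q.pre.length :: Q.pre) ++ (Q.post.length :: Q.post)) := by
  simp [encodeQuery, fullPart, encodeAtoms]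

theorem transformProg_run (hQ : Q.SelfJoinFree) (hR : R ∈ Q.symbols) :
    HoldsList ((Stmt.transformProg.run (listState (encodeQuery Q R))).setReg 0
      ((Stmt.transformProg.run (listState (encodeQuery Q R))).reg 8))
      (encodeQuery (Q.fullPart hQ) (Q.top R).rel) := by
  have a0 : HoldsQuery Q R (listState (encodeQuery Q R)) :=
    ⟨rfl, fun i x hi => by simp [listState, List.getD_eq_getElem?_getD, hi]⟩
  have m0 : ∀ A, A ≠ 0 → Marks A (fun _ => False) (listState (encodeQuery Q R)) :=
    fun A hA v => by simp [listState, hA]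
  generalize listState (encodeQuery Q R) = s at a0 m0
  simp only [Stmt.transformProg, Stmt.run]
  have f1 := Stmt.readFree_run a0 (m0 1 one_ne_zero)
  have a1 := a0.run .readFree (by decide)
  have g1 := (m0 2 two_ne_zero).run .readFree (by decide)
  have t1 := (m0 3 three_ne_zero).run .readFree (by decide)
  generalize Stmt.readFree.run s = s₁ at f1 a1 g1 t1
  have g2 := Stmt.readSeed_run a1 f1 g1
  have f2 := f1.run .readSeed (by decide)
  have a2 := a1.run .readSeed (by decide)
  have t2 := t1.run .readSeed (by decide)
  generalize Stmt.readSeed.run s₁ = s₂ at f2 a2 g2 t2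
  have g3 := (Stmt.rounds_run a2 f2 g2).run .findAtom (by decide)
  have f3 := (f2.run .rounds (by decide)).run .findAtom (by decide)
  have a3 := a2.run .rounds (by decide)
  have p3 := Stmt.findAtom_run a3 hQ hR
  have a3 := a3.run .findAtom (by decide)
  have t3 := (t2.run .rounds (by decide)).run .findAtom (by decide)
  generalize Stmt.findAtom.run (Stmt.rounds.run s₂) = s₃ at f3 a3 g3 t3 p3
  have p4 := Stmt.passAbove_run a3 f3 g3 t3 p3
  have f4 := f3.run (.pass .aboveStep) (by decide)
  have a4 := a3.run (.pass .aboveStep) (by decide)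
  generalize (Stmt.pass .aboveStep).run s₃ = s₄ at f4 a4 p4
  have f5 := f4.run .header (by decide)
  have a5 := a4.run .header (by decide)
  obtain ⟨o5, e5⟩ : Reads ((Stmt.header.run s₄).arr 4) 0 [(Q.top R).rel, Q.body.length] ∧
      (Stmt.header.run s₄).reg 8 = 2 := by
    rw [reads_cons, reads_singleton]
    simp [Stmt.header, Stmt.run, Ex.eval, p4.rel, top, (reads_cons.1 a4.spec.2.1.reads).1]
  generalize Stmt.header.run s₄ = s₅ at f5 a5 o5 e5
  obtain ⟨⟨o6, e6⟩, q6⟩ := Stmt.passEmit_run a5 f5 o5 e5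
  have a6 := a5.run (.pass .emit) (by decide)
  generalize (Stmt.pass .emit).run s₅ = s₆ at a6 o6 e6 q6
  have htail := a6.spec.2.2
  have hlen : s₆.reg 3 + ((Q.pre.length :: Q.pre) ++ (Q.post.length :: Q.post)).length =
      (encodeQuery Q R).length := by
    rw [q6]
    simp only [encodeQuery, encodeAtoms, List.length_append, List.length_cons]
    omega
  have o7 := Stmt.copyTail_run a6.len (by
    rw [reads_append, q6]
    exact ⟨htail.1, by simpa [add_comm] using htail.2⟩) hlen o6 e6
  have e7 := (Stmt.copyTail.run_frame s₆).1 8 (by decide)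
  have q7 := (Stmt.copyTail.run_frame s₆).1 3 (by decide)
  have z7 := (a6.run .copyTail (by decide)).len
  generalize Stmt.copyTail.run s₆ = s₇ at o7 e7 q7 z7
  rw [← encodeQuery_fullPart hQ] at o7
  -- Arguments are only deleted, so the output is not longer than the input, and `copyBack` makes
  -- enough rounds.
  have hle : (encodeAtoms (Q.body.map (QAtom.only Q.free))).length ≤
      (encodeAtoms Q.body).length := by
    simp only [encodeAtoms, List.length_flatMap, List.map_map, List.length_cons]
    refine List.sum_le_sum fun A _ => ?_
    have := List.length_filter_le (· ∈ Q.free) A.args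
    simp only [Function.comp_apply, QAtom.only]
    omega
  have hl := congrArg List.length (encodeQuery_fullPart hQ (Q.top R).rel)
  rw [List.length_append, ← e6] at hl
  refine Stmt.copyBack_run ?_ o7 ?_
  · simp only [setReg_reg, if_neg (show ¬ 0 = 8 by decide), z7]
    rw [hl, e6, List.length_append, ← hlen, q6]
    simp only [List.length_cons, List.length_nil]
    omega
  · simp only [setReg_reg, if_true, Ex.eval, WordOp.eval, e7, q7, z7, hl]
    omega

theorem polyTimeOn_transform :
    PolyTimeOn (fun Q R => Q.FreeConnex ∧ Q.SelfJoinFree ∧ R ∈ Q.symbols) transform :=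
  .of_tame .transformProg (by
    simp [Stmt.transformProg, Stmt.readFree, Stmt.readSeed, Stmt.rounds, Stmt.findAtom, Stmt.header,
      Stmt.copyBack, Stmt.copyTail, Stmt.emit, Stmt.emitArgs, Stmt.aboveStep, Stmt.unmark,
      Stmt.check, Stmt.growStep, Stmt.hits, Stmt.spread, Stmt.mark, Stmt.scan, Stmt.pass, Stmt.Tame,
      Ex.Tame]) 8 fun Q R h => by
    rw [transform, dif_pos h.2.1]
    exact transformProg_run h.2.1 h.2.2

end CQStar

/-! ### The theorem, for the full part and its top atom -/

theorem mainTheorem10 {K : Type*} [CommSemiring K] [LinearOrder K]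
    (hidem : ∀ a : K, a + a = a) (κ : ℕ → ℕ) (hκ : LogarithmicTime κ) :
    ∃ f : CQStar → ℕ → CQStar × ℕ,
      PolyTimeOn (fun Q R => Q.FreeConnex ∧ Q.SelfJoinFree ∧ R ∈ Q.symbols) f ∧
      ∀ (Q : CQStar) (R : ℕ), Q.FreeConnex → Q.SelfJoinFree → R ∈ Q.symbols →
        ∀ (Q' : CQStar) (R' : ℕ), f Q R = (Q', R') →
          Q'.IsFull ∧ Q'.IsAcyclic ∧ Q'.SelfJoinFree ∧ R' ∈ Q'.symbols ∧
          Q'.pre = Q.pre ∧ Q'.post = Q.post ∧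
          (EfficientDirectAccess K κ Q R ↔ EfficientDirectAccess K κ Q' R') := by
  refine ⟨CQStar.transform, CQStar.polyTimeOn_transform, fun Q R hfc hQ hR Q' R' he => ?_⟩
  rw [CQStar.transform, dif_pos hQ, Prod.mk.injEq] at he
  obtain ⟨rfl, rfl⟩ := he
  have hE := CQStar.expansion hQ hR hfc.2
  have hQ' := CQStar.fullPart_selfJoinFree hQ
  exact ⟨KDatabase.vars_eq_free (Q := Q) hE, CQStar.fullPart_acyclic hQ hfc.1, hQ',
    CQStar.rel_mem_symbols (A := (Q.top R).only Q.free) (List.mem_map_of_mem hE.mem_top), rfl, rfl,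
    (efficientDirectAccess_iff hκ hQ).trans
      ((relaxedAccess_fullPart_iff hidem hκ hQ hR hfc.2).trans (efficientDirectAccess_iff hκ hQ').symm)⟩
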